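/- **Conventions.** 2-categories are strict and small (all in one fixed universe), functors of 2-categories are strict. The composite of morphisms $f:x\to y$, $g:y\to z$ of a 2-category is written $f\cdot g:x\to z$ (diagrammatic order); $\cdot$ also denotes horizontal composition of 2-morphisms, an identity 2-morphism of $f$ being written $f$; vertical composition of 2-morphisms $\varphi:f\Rightarrow g$, $\psi:g\Rightarrow h$ is written $\varphi;\psi$. A *weak transformation* $\tau:F\Rightarrow G$ has components $\tau_x:Fx\to Gx$ and, for $f:x\to y$, an invertible 2-morphism $\bar\tau_f:\tau_x\cdot Gf\Rightarrow Ff\cdot\tau_y$, such that $\bar\tau_{1}=1$, $\bar\tau_{f\cdot g}=(\bar\tau_f\cdot Gg);(Ff\cdot\bar\tau_g)$, and $\bar\tau$ is natural for 2-morphisms of the source. A *modification* $\Gamma:\tau\Rrightarrow\sigma$ between $\tau,\sigma:F\Rightarrow G$ has components $\Gamma_x:\tau_x\Rightarrow\sigma_x$ with $\bar\tau_f;(Ff\cdot\Gamma_y)=(\Gamma_x\cdot Gf);\bar\sigma_f$. All fibre products below are strict fibre products. **Category objects.** A category object $C=(C_0,C_1)$ in the switch 3-category $\mathsf{2CAT}_{nwk}$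 of 2-categories, strict functors, weak transformations and modifications consists of 2-categories $C_0,C_1$ and the following. - *1-data.* Strict functors $s,t:C_1\to C_0$, $I:C_0\to C_1$ and $M:C_1\times_{C_0}C_1\to C_1$ (fibre product of $t$ and $s$; write $xy=M(x,y)$ on objects, $f*g=M(f,g)$ on morphisms and 2-morphisms, and abbreviate $1_x*g$ to $x*g$, $f*1_y$ to $f*y$; likewise an object in an index of $\bar\alpha$ means its identity morphism), with $sI=tI=1$, $sM(x,y)=s(x)$, $tM(x,y)=t(y)$. In the formulas below $e$ denotes the identity 1-cell $I(p)$ at the only possible object $p$ of $C_0$. - *2-data.* Weak transformations with components $\lambda_x:ex\to x$, $\rho_x:xe\to x$, $\alpha_{x,y,z}:(xy)z\to x(yz)$, defined on $C_1$, $C_1$ and $C_1\times_{C_0}C_1\times_{C_0}C_1$. Their images under $s$ and $t$ are identity transformations. Each $\tau\in\{\lambda,\rho,\alpha\}$ is invertible: there are a weak transformation $\tau'$ in the opposite direction and invertible modifications $\eta:\tau\cdot\tau'\Rrightarrow 1$, $\varepsilon:\tau'\cdot\tau\Rrightarrow 1$ with $\eta\cdot\tau=\tau\cdot\varepsilon$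 and $\varepsilon\cdot\tau'=\tau'\cdot\eta$, and $s$, $t$ send $\tau',\eta,\varepsilon$ to identities. - *3-data.* Invertible modifications, sent to identities by $s$ and $t$, with components - $c_1(p):\lambda_{I(p)}\Rightarrow\rho_{I(p)}$ for $p\in C_0$, - $c_2(x,y):\lambda_x*y\Rightarrow\alpha_{e,x,y}\cdot\lambda_{xy}$, - $c_3(x,y):\alpha_{x,y,e}\cdot(x*\rho_y)\Rightarrow\rho_{xy}$, - $c_4(x,y):\rho_x*y\Rightarrow\alpha_{x,e,y}\cdot(x*\lambda_y)$, - $c_5(x,y,z,w):\alpha_{xy,z,w}\cdot\alpha_{x,y,zw}\Rightarrow(\alpha_{x,y,z}*w)\cdot\alpha_{x,yz,w}\cdot(x*\alpha_{y,z,w})$. - *Axioms.* For all composable objects $a,b,c,d,f$ of $C_1$: - (C4-1, for $1,1,a$) $(c_1(sa)*a)\cdot\lambda_a;\ c_4(e,a)\cdot\lambda_a\ =\ c_2(e,a)\cdot\lambda_a;\ \alpha_{e,e,a}\cdot\bar\lambda_{\lambda_a}$. - (C4-1, for $a,1,1$) $c_4(a,e)\cdot\rho_a;\ \alpha_{a,e,e}\cdot(a*c_1(ta))\cdot\rho_a;\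 c_3(a,e)\cdot\rho_a;\ \bar\rho_{\rho_a}\ =\ 1_{(\rho_a*e)\cdot\rho_a}$. - (C4-2, for $1,a,1$) $c_2(a,e)\cdot\rho_a;\ \alpha_{e,a,e}\cdot\bar\lambda_{\rho_a};\ c_3(e,a)\cdot\lambda_a;\ \bar\rho_{\lambda_a}\ =\ 1_{(\lambda_a*e)\cdot\rho_a}$. - (C4-3, for $1,a,b,c$) $\bar\alpha_{\lambda_a,b,c};\ (c_2(a,b)*c)\cdot\alpha_{a,b,c};\ (\alpha_{e,a,b}*c)\cdot c_2(ab,c)\cdot\alpha_{a,b,c};\ (\alpha_{e,a,b}*c)\cdot\alpha_{e,ab,c}\cdot\bar\lambda_{\alpha_{a,b,c}}\ =\ \alpha_{ea,b,c}\cdot c_2(a,bc);\ c_5(e,a,b,c)\cdot\lambda_{a(bc)}$. - (C4-3, for $a,b,c,1$) $c_5(a,b,c,e)\cdot(a*(b*\rho_c));\ (\alpha_{a,b,c}*e)\cdot\alpha_{a,bc,e}\cdot(a*c_3(b,c));\ (\alpha_{a,b,c}*e)\cdot c_3(a,bc)\ =\ \alpha_{ab,c,e}\cdot\bar\alpha_{a,b,\rho_c};\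 c_3(ab,c)\cdot\alpha_{a,b,c};\ \bar\rho_{\alpha_{a,b,c}}$. - (C4-4, for $a,1,b,c$) $\bar\alpha_{\rho_a,b,c};\ (c_4(a,b)*c)\cdot\alpha_{a,b,c};\ (\alpha_{a,e,b}*c)\cdot\bar\alpha_{a,\lambda_b,c}^{-1};\ (\alpha_{a,e,b}*c)\cdot\alpha_{a,eb,c}\cdot(a*c_2(b,c))\ =\ \alpha_{ae,b,c}\cdot c_4(a,bc);\ c_5(a,e,b,c)\cdot(a*\lambda_{bc})$. - (C4-4, for $a,b,1,c$) $(\alpha_{a,b,e}*c)\cdot\bar\alpha_{a,\rho_b,c};\ (c_3(a,b)*c)\cdot\alpha_{a,b,c};\ c_4(ab,c)\cdot\alpha_{a,b,c};\ \alpha_{ab,e,c}\cdot\bar\alpha_{a,b,\lambda_c}^{-1};\ c_5(a,b,e,c)\cdot(a*(b*\lambda_c))\ =\ (\alpha_{a,b,e}*c)\cdot\alpha_{a,be,c}\cdot(a*c_4(b,c))$. - (C4-5) $c_5(ab,c,d,f)\cdot\alpha_{a,b,c(df)};\ (\alpha_{ab,c,d}*f)\cdot\alpha_{ab,cd,f}\cdot\bar\alpha_{a,b,\alpha_{c,d,f}}^{-1};\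 (\alpha_{ab,c,d}*f)\cdot c_5(a,b,cd,f)\cdot(a*(b*\alpha_{c,d,f}));\ (c_5(a,b,c,d)*f)\cdot\alpha_{a,b(cd),f}\cdot(a*\alpha_{b,cd,f})\cdot(a*(b*\alpha_{c,d,f}));\ ((\alpha_{a,b,c}*d)*f)\cdot(\alpha_{a,bc,d}*f)\cdot\bar\alpha_{a,\alpha_{b,c,d},f}^{-1}\cdot(a*\alpha_{b,cd,f})\cdot(a*(b*\alpha_{c,d,f}))\ =\ \alpha_{(ab)c,d,f}\cdot c_5(a,b,c,df);\ \bar\alpha_{\alpha_{a,b,c},d,f}\cdot\alpha_{a,bc,df}\cdot(a*\alpha_{b,c,df});\ ((\alpha_{a,b,c}*d)*f)\cdot c_5(a,bc,d,f)\cdot(a*\alpha_{b,c,df});\ ((\alpha_{a,b,c}*d)*f)\cdot(\alpha_{a,bc,d}*f)\cdot\alpha_{a,(bc)d,f}\cdot(a*c_5(b,c,d,f))$. **Bicategory objects.** A not-necessarily-fibrant bicategory object $B$ in $\mathsf{CAT}$ consists of the following. - *0-data.* Categories $B_0,B_1,B_2$ and functors $s,t:B_1\to B_0$, $S,T:B_2\to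 B_1$ with $sT=sS$, $tT=tS$. A morphism of $B_2$ is *vertical* if $S$ and $T$ send it to identities; a *vertical isomorphism* of functors into $B_2$ is a natural isomorphism with vertical components. - *1-data.* Functors giving: identity 1-cells $e=i(p)$; horizontal composition $xy$ of 1-cells ($tx=sy$); identity 2-cells $1_x:x\to x$; vertical composition $u\cdot v$ of 2-cells ($Tu=Sv$), with $S(u\cdot v)=Su$, $T(u\cdot v)=Tv$; whiskers $u\lhd y:(Su)y\to(Tu)y$ and $x\rhd u:x(Su)\to x(Tu)$; 2-cells $\lambda_x:ex\to x$, $\rho_x:xe\to x$, $a_{x,y,z}:(xy)z\to x(yz)$, where $u:x\to y$ means $Su=x$, $Tu=y$ as functors. The expected equations $si=ti=1$, $s(xy)=sx$, $t(xy)=ty$ hold. Each $k\in\{\lambda,\rho,a\}$ is invertible: there are a functor $k'$ with $S,T$ exchanged and vertical isomorphisms $k\cdot k'\to 1$, $k'\cdot k\to1$ satisfying the two triangle identities (with respect to $b_1,b_2,b_3$). - *2-data.* Vertical isomorphisms of functors, for $u,v,w$ 2-cells and $x,y,z,w$ 1-cells: - $b_1(u):1_{Su}\cdot u\to u$, $b_2(u):u\cdot1_{Tu}\to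 u$, $b_3(u,v,w):(u\cdot v)\cdot w\to u\cdot(v\cdot w)$, - $b_4(x,y):1_x\lhd y\to1_{xy}$, $b_5(x,y):x\rhd1_y\to1_{xy}$, - $b_6(u,v,y):(u\cdot v)\lhd y\to(u\lhd y)\cdot(v\lhd y)$, $b_7(x,u,v):x\rhd(u\cdot v)\to(x\rhd u)\cdot(x\rhd v)$, - $b_8(u,v):(u\lhd Sv)\cdot(Tu\rhd v)\to(Su\rhd v)\cdot(u\lhd Tv)$, - $b_9(u,y,z):((u\lhd y)\lhd z)\cdot a_{Tu,y,z}\to a_{Su,y,z}\cdot(u\lhd(yz))$, - $b_{10}(x,y,u):((xy)\rhd u)\cdot a_{x,y,Tu}\to a_{x,y,Su}\cdot(x\rhd(y\rhd u))$, - $b_{11}(x,u,z):((x\rhd u)\lhd z)\cdot a_{x,Tu,z}\to a_{x,Su,z}\cdot(x\rhd(u\lhd z))$, - $b_{12}(x,y,z,w):a_{xy,z,w}\cdot a_{x,y,zw}\to((a_{x,y,z}\lhd w)\cdot a_{x,yz,w})\cdot(x\rhd a_{y,z,w})$, - $b_{13}(u):(e\rhd u)\cdot\lambda_{Tu}\to\lambda_{Su}\cdot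 u$, $b_{14}(u):(u\lhd e)\cdot\rho_{Tu}\to\rho_{Su}\cdot u$, - $b_{15}(p):\lambda_{i(p)}\to\rho_{i(p)}$, $b_{16}(x,y):\lambda_x\lhd y\to a_{e,x,y}\cdot\lambda_{xy}$, - $b_{17}(x,y):a_{x,y,e}\cdot(x\rhd\rho_y)\to\rho_{xy}$, $b_{18}(x,y):\rho_x\lhd y\to a_{x,e,y}\cdot(x\rhd\lambda_y)$. - *3-axioms.* Equations between two composites of vertical isomorphisms with the same starting point. Each step acts on the evident consecutive factors of the current vertical composite (it is whiskered vertically by the other factors), and a whisker or $\cdot$ applied to a step denotes the value of the corresponding functor on it and identities. The isomorphisms $b_3^{\pm1}$ that rebracket vertical composites are left implicit, except in (4). The variables are all composable 1-cells $x,y,z$ (and $w$ next to a 1-cell, and $v,w$ in (17)) and 2-cells $u,v,w,c$. (1) from $1_x\cdot 1_x$: $b_1(1_x) = b_2(1_x)$. (2) from $1_{Su}\cdot u\cdot v$: $b_1(u\cdot v) = b_1(u)$. (2') from $u\cdot v\cdot 1_{Tv}$: $b_2(u\cdot v) = b_2(v)$. (3) from $u\cdot 1_{Tu}\cdot v$: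 $b_2(u) = b_1(v)$. (4) from $((u\cdot v)\cdot w)\cdot c$ (here the $b_3$ are written out): $b_3(u\cdot v,w,c);\, b_3(u,v,w\cdot c) = b_3(u,v,w)\cdot c;\, b_3(u,v\cdot w,c);\, u\cdot b_3(v,w,c)$. (5a) from $(1_{Su}\cdot u)\lhd y$: $b_6(1_{Su},u,y);\, b_4(Su,y);\, b_1(u\lhd y) = b_1(u)\lhd y$. (5b) from $(u\cdot 1_{Tu})\lhd y$: $b_6(u,1_{Tu},y);\, b_4(Tu,y);\, b_2(u\lhd y) = b_2(u)\lhd y$. (5c) from $x\rhd (1_{Su}\cdot u)$: $b_7(x,1_{Su},u);\, b_5(x,Su);\, b_1(x\rhd u) = x\rhd b_1(u)$. (5d) from $x\rhd (u\cdot 1_{Tu})$: $b_7(x,u,1_{Tu});\, b_5(x,Tu);\, b_2(x\rhd u) = x\rhd b_2(u)$. (6) from $(1_x\lhd Sv)\cdot (x\rhd v)$: $b_4(x,Sv);\, b_1(x\rhd v) = b_8(1_x,v);\, b_4(x,Tv);\, b_2(x\rhd v)$. (6') from $(u\lhd y)\cdot (Tu\rhd 1_y)$: $b_5(Tu,y);\,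 b_2(u\lhd y) = b_8(u,1_y);\, b_5(Su,y);\, b_1(u\lhd y)$. (7) from $(u\cdot v\cdot w)\lhd y$: $b_6(u\cdot v,w,y);\, b_6(u,v,y) = b_6(u,v\cdot w,y);\, b_6(v,w,y)$. (7') from $x\rhd (u\cdot v\cdot w)$: $b_7(x,u\cdot v,w);\, b_7(x,u,v) = b_7(x,u,v\cdot w);\, b_7(x,v,w)$. (8) from $((u\cdot w)\lhd Sv)\cdot (Tw\rhd v)$: $b_6(u,w,Sv);\, b_8(w,v);\, b_8(u,v) = b_8(u\cdot w,v);\, b_6(u,w,Tv)$. (8') from $(u\lhd Sv)\cdot (Tu\rhd (v\cdot w))$: $b_7(Tu,v,w);\, b_8(u,v);\, b_8(u,w) = b_8(u,v\cdot w);\, b_7(Su,v,w)$. (9) from $((1_x\lhd y)\lhd z)\cdot a_{x,y,z}$: $b_4(x,y)\lhd z;\, b_4(xy,z);\, b_1(a_{x,y,z});\, b_2^{-1}(a_{x,y,z}) = b_9(1_x,y,z);\, b_4(x,yz)$. (9') from $((xy)\rhd 1_z)\cdot a_{x,y,z}$: $b_5(xy,z);\, b_1(a_{x,y,z});\, b_2^{-1}(a_{x,y,z})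 = b_{10}(x,y,1_z);\, x\rhd b_5(y,z);\, b_5(x,yz)$. (10) from $((x\rhd 1_y)\lhd z)\cdot a_{x,y,z}$: $b_5(x,y)\lhd z;\, b_4(xy,z);\, b_1(a_{x,y,z});\, b_2^{-1}(a_{x,y,z}) = b_{11}(x,1_y,z);\, x\rhd b_4(y,z);\, b_5(x,yz)$. (11) from $(((u\cdot v)\lhd y)\lhd z)\cdot a_{Tv,y,z}$: $b_6(u,v,y)\lhd z;\, b_6(u\lhd y,v\lhd y,z);\, b_9(v,y,z);\, b_9(u,y,z) = b_9(u\cdot v,y,z);\, b_6(u,v,yz)$. (11') from $((xy)\rhd (u\cdot v))\cdot a_{x,y,Tv}$: $b_7(xy,u,v);\, b_{10}(x,y,v);\, b_{10}(x,y,u) = b_{10}(x,y,u\cdot v);\, x\rhd b_7(y,u,v);\, b_7(x,y\rhd u,y\rhd v)$. (12) from $((x\rhd (u\cdot v))\lhd z)\cdot a_{x,Tv,z}$: $b_7(x,u,v)\lhd z;\, b_6(x\rhd u,x\rhd v,z);\, b_{11}(x,v,z);\, b_{11}(x,u,z) = b_{11}(x,u\cdot v,z);\, x\rhd b_6(u,v,z);\,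 b_7(x,u\lhd z,v\lhd z)$. (13) from $(((u\lhd Sv)\cdot (Tu\rhd v))\lhd z)\cdot a_{Tu,Tv,z}$: $b_8(u,v)\lhd z;\, b_6(Su\rhd v,u\lhd Tv,z);\, b_9(u,Tv,z);\, b_{11}(Su,v,z) = b_6(u\lhd Sv,Tu\rhd v,z);\, b_{11}(Tu,v,z);\, b_9(u,Sv,z);\, b_8(u,v\lhd z)$. (13') from $((x\rhd u)\lhd Sv)\cdot ((xTu)\rhd v)\cdot a_{x,Tu,Tv}$: $b_8(x\rhd u,v);\, b_{11}(x,u,Tv);\, b_{10}(x,Su,v) = b_{10}(x,Tu,v);\, b_{11}(x,u,Sv);\, b_7^{-1}(x,u\lhd Sv,Tu\rhd v);\, x\rhd b_8(u,v);\, b_7(x,Su\rhd v,u\lhd Tv)$. (14) from $((u\lhd y)\lhd Sv)\cdot ((Tuy)\rhd v)\cdot a_{Tu,y,Tv}$: $b_8(u\lhd y,v);\, b_9(u,y,Tv);\, b_{10}(Su,y,v) = b_{10}(Tu,y,v);\, b_9(u,y,Sv);\, b_8(u,y\rhd v)$. (15) from $(((u\lhd y)\lhd z)\lhd w)\cdot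 a_{Tuy,z,w}\cdot a_{Tu,y,zw}$: $b_9(u\lhd y,z,w);\, b_9(u,y,zw);\, b_{12}(Su,y,z,w) = b_{12}(Tu,y,z,w);\, b_6^{-1}((u\lhd y)\lhd z,a_{Tu,y,z},w);\, b_9(u,y,z)\lhd w;\, b_6(a_{Su,y,z},u\lhd (yz),w);\, b_9(u,yz,w);\, b_8(u,a_{y,z,w})$. (15') from $(((xy)z)\rhd u)\cdot a_{xy,z,Tu}\cdot a_{x,y,zTu}$: $b_{10}(xy,z,u);\, b_{10}(x,y,z\rhd u);\, b_{12}(x,y,z,Su) = b_{12}(x,y,z,Tu);\, b_8^{-1}(a_{x,y,z},u);\, b_{10}(x,yz,u);\, b_7^{-1}(x,(yz)\rhd u,a_{y,z,Tu});\, x\rhd b_{10}(y,z,u);\, b_7(x,a_{y,z,Su},y\rhd (z\rhd u))$. (16) from $(((x\rhd u)\lhd z)\lhd w)\cdot a_{xTu,z,w}\cdot a_{x,Tu,zw}$: $b_9(x\rhd u,z,w);\, b_{11}(x,u,zw);\, b_{12}(x,Su,z,w) = b_{12}(x,Tu,z,w);\, b_6^{-1}((x\rhd u)\lhd z,a_{x,Tu,z},w);\,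 b_{11}(x,u,z)\lhd w;\, b_6(a_{x,Su,z},x\rhd (u\lhd z),w);\, b_{11}(x,u\lhd z,w);\, b_7^{-1}(x,(u\lhd z)\lhd w,a_{Tu,z,w});\, x\rhd b_9(u,z,w);\, b_7(x,a_{Su,z,w},u\lhd (zw))$. (16') from $(((xy)\rhd u)\lhd w)\cdot a_{xy,Tu,w}\cdot a_{x,y,Tuw}$: $b_{11}(xy,u,w);\, b_{10}(x,y,u\lhd w);\, b_{12}(x,y,Su,w) = b_{12}(x,y,Tu,w);\, b_6^{-1}((xy)\rhd u,a_{x,y,Tu},w);\, b_{10}(x,y,u)\lhd w;\, b_6(a_{x,y,Su},x\rhd (y\rhd u),w);\, b_{11}(x,y\rhd u,w);\, b_7^{-1}(x,(y\rhd u)\lhd w,a_{y,Tu,w});\, x\rhd b_{11}(y,u,w);\, b_7(x,a_{y,Su,w},y\rhd (u\lhd w))$. (17) from $a_{(xy)z,v,w}\cdot a_{xy,z,vw}\cdot a_{x,y,z(vw)}$: $b_{12}(xy,z,v,w);\, b_{10}(x,y,a_{z,v,w});\, b_{12}(x,y,zv,w);\, b_6^{-1}(a_{xy,z,v},a_{x,y,zv},w);\,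 b_{12}(x,y,z,v)\lhd w;\, b_6((a_{x,y,z}\lhd v)\cdot a_{x,yz,v},x\rhd a_{y,z,v},w);\, b_6(a_{x,y,z}\lhd v,a_{x,yz,v},w);\, b_{11}(x,a_{y,z,v},w) = b_{12}(x,y,z,vw);\, b_9^{-1}(a_{x,y,z},v,w);\, b_{12}(x,yz,v,w);\, b_7^{-1}(x,a_{yz,v,w},a_{y,z,vw});\, x\rhd b_{12}(y,z,v,w);\, b_7(x,(a_{y,z,v}\lhd w)\cdot a_{y,zv,w},y\rhd a_{z,v,w});\, b_7(x,a_{y,z,v}\lhd w,a_{y,zv,w})$. (18) from $(e\rhd 1_x)\cdot \lambda_x$: $b_5(e,x);\, b_1(\lambda_x) = b_{13}(1_x);\, b_2(\lambda_x)$. (18') from $(1_x\lhd e)\cdot \rho_x$: $b_4(x,e);\, b_1(\rho_x) = b_{14}(1_x);\, b_2(\rho_x)$. (19) from $(e\rhd (u\cdot v))\cdot \lambda_{Tv}$: $b_7(e,u,v);\, b_{13}(v);\, b_{13}(u) = b_{13}(u\cdot v)$. (19') from $((u\cdot v)\lhd e)\cdot \rho_{Tv}$: $b_6(u,v,e);\,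 b_{14}(v);\, b_{14}(u) = b_{14}(u\cdot v)$. (20) from $((u\lhd e)\lhd y)\cdot (\rho_{Tu}\lhd y)$: $b_6^{-1}(u\lhd e,\rho_{Tu},y);\, b_{14}(u)\lhd y;\, b_6(\rho_{Su},u,y);\, b_{18}(Su,y) = b_{18}(Tu,y);\, b_9(u,e,y);\, b_8(u,\lambda_y)$. (20') from $((xe)\rhd u)\cdot (\rho_x\lhd Tu)$: $b_{18}(x,Tu);\, b_{10}(x,e,u);\, b_7^{-1}(x,e\rhd u,\lambda_{Tu});\, x\rhd b_{13}(u);\, b_7(x,\lambda_{Su},u) = b_8^{-1}(\rho_x,u);\, b_{18}(x,Su)$. (21) from $((u\lhd y)\lhd e)\cdot a_{Tu,y,e}\cdot (Tu\rhd \rho_y)$: $b_{17}(Tu,y);\, b_{14}(u\lhd y) = b_9(u,y,e);\, b_8(u,\rho_y);\, b_{17}(Su,y)$. (21') from $((ex)\rhd u)\cdot (\lambda_x\lhd Tu)$: $b_{16}(x,Tu);\, b_{10}(e,x,u);\, b_{13}(x\rhd u) = b_8^{-1}(\lambda_x,u);\, b_{16}(x,Su)$. (22) from $((e\rhd u)\lhd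 y)\cdot (\lambda_{Tu}\lhd y)$: $b_6^{-1}(e\rhd u,\lambda_{Tu},y);\, b_{13}(u)\lhd y;\, b_6(\lambda_{Su},u,y);\, b_{16}(Su,y) = b_{16}(Tu,y);\, b_{11}(e,u,y);\, b_{13}(u\lhd y)$. (22') from $((x\rhd u)\lhd e)\cdot a_{x,Tu,e}\cdot (x\rhd \rho_{Tu})$: $b_{17}(x,Tu);\, b_{14}(x\rhd u) = b_{11}(x,u,e);\, b_7^{-1}(x,u\lhd e,\rho_{Tu});\, x\rhd b_{14}(u);\, b_7(x,\rho_{Su},u);\, b_{17}(x,Su)$. (23) from $(\lambda_e\lhd x)\cdot \lambda_x$: $b_{15}(sx)\lhd x;\, b_{18}(e,x);\, b_{13}(\lambda_x) = b_{16}(e,x)$. (23') from $(\rho_x\lhd e)\cdot \rho_x$: $b_{14}(\rho_x) = b_{18}(x,e);\, x\rhd b_{15}(tx);\, b_{17}(x,e)$. (24) from $(\lambda_x\lhd e)\cdot \rho_x$: $b_{14}(\lambda_x) = b_{16}(x,e);\, b_{13}^{-1}(\rho_x);\, b_{17}(e,x)$. (25) from $((\lambda_x\lhd y)\lhd z)\cdot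 a_{x,y,z}$: $b_9(\lambda_x,y,z);\, b_{16}(x,yz);\, b_{12}(e,x,y,z);\, b_{13}(a_{x,y,z}) = b_{16}(x,y)\lhd z;\, b_6(a_{e,x,y},\lambda_{xy},z);\, b_{16}(xy,z)$. (25') from $a_{xy,z,e}\cdot a_{x,y,ze}\cdot (x\rhd (y\rhd \rho_z))$: $b_{12}(x,y,z,e);\, b_7^{-1}(x,a_{y,z,e},y\rhd \rho_z);\, x\rhd b_{17}(y,z);\, b_{17}(x,yz);\, b_{14}(a_{x,y,z}) = b_{10}^{-1}(x,y,\rho_z);\, b_{17}(xy,z)$. (26) from $((\rho_x\lhd y)\lhd z)\cdot a_{x,y,z}$: $b_9(\rho_x,y,z);\, b_{18}(x,yz);\, b_{12}(x,e,y,z) = b_{18}(x,y)\lhd z;\, b_6(a_{x,e,y},x\rhd \lambda_y,z);\, b_{11}(x,\lambda_y,z);\, x\rhd b_{16}(y,z);\, b_7(x,a_{e,y,z},\lambda_{yz})$. (26') from $((a_{x,y,e}\cdot (x\rhd \rho_y))\lhd z)\cdot a_{x,y,z}$: $b_{17}(x,y)\lhd z;\, b_{18}(xy,z);\, b_{10}(x,y,\lambda_z);\,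 b_{12}(x,y,e,z) = b_6(a_{x,y,e},x\rhd \rho_y,z);\, b_{11}(x,\rho_y,z);\, x\rhd b_{18}(y,z);\, b_7(x,a_{y,e,z},y\rhd \lambda_z)$. No fibrancy (groupoid or isofibration) condition is imposed on $B$. **Theorem.** Let $C=(C_0,C_1)$ be a category object in $\mathsf{2CAT}_{nwk}$. Let $B_0$ and $B_1$ be the underlying categories of $C_0$ and $C_1$ (objects and morphisms), with $s,t$ induced by those of $C$. Let $B_2$ be the category whose objects are triples $(p,u,q)$ with $u$ a morphism of $C_1$, $p,q$ objects of $C_0$, $1_p=su$, $tu=1_q$, and whose morphisms $b\to b'$, for $b=(p,u,q)$, $b'=(p',u',q')$, are the triples $(\varphi,f,g)$ of morphisms $f,g$ of $C_1$ and a 2-morphism $\varphi:u\cdot g\Rightarrow f\cdot u'$ of $C_1$ such that $s(u\cdot g)=s(f\cdot u')$, $t(u\cdot g)=t(f\cdot u')$ and $s\varphi$, $t\varphi$ are identities; that is, the morphisms form the fibre product of the 2-morphisms $\varphi$ with the composable pairs $(u,g)$ and $(f,u')$. Identities are $(1_u,1,1)$, and the composite of $(\varphi,f,g)$ and $(\psi,f',g')$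 is $((\varphi\cdot g');(f\cdot\psi),\,f\cdot f',\,g\cdot g')$. Let $S$ send $(p,u,q)$ to the source of $u$ and $(\varphi,f,g)$ to $f$, and let $T$ send them to the target of $u$ and to $g$. Then $B_0,B_1,B_2,s,t,S,T$ are the 0-data of a not-necessarily-fibrant bicategory object $B$ in $\mathsf{CAT}$ whose further structure is read off from $C$ as follows. - $i$ is $I$, and horizontal composition is $M$, on objects and morphisms. - $1_x$ is given by the identity morphism of $x$, and by the identity 2-morphism $1_f$ on morphisms $f$. Vertical composition is given by $u\cdot v$ on objects, and sends $(\varphi,f,g):u\to u'$, $(\psi,g,h):v\to v'$ to $(u\cdot\psi);(\varphi\cdot v')$. - $u\lhd y$ is $u*1_y$ and $x\rhd u$ is $1_x*u$; on morphisms they are $\varphi*1_g$ and $1_f*\varphi$. - $\lambda,\rho,a$ are given on objects by the components $\lambda_x,\rho_x,\alpha_{x,y,z}$, and on morphisms by the naturality 2-morphisms $\bar\lambda_f,\bar\rho_f,\bar\alpha_{f,g,h}$. - $b_1,\dots,b_8$ are identities; $b_9(u,y,z)^{-1}$, $b_{10}(x,y,u)^{-1}$, $b_{11}(x,u,z)^{-1}$,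 $b_{13}(u)^{-1}$, $b_{14}(u)^{-1}$ are given by $\bar\alpha_{u,y,z}$, $\bar\alpha_{x,y,u}$, $\bar\alpha_{x,u,z}$, $\bar\lambda_u$, $\bar\rho_u$; and $b_{12},b_{15},b_{16},b_{17},b_{18}$ are given by $c_5,c_1,c_2,c_3,c_4$. -/

import Mathlib

universe u

/-- A (strict) 2-category, presented by its sets of objects, morphisms and 2-morphisms.  Composites
are written in diagrammatic order and take a proof of composability.  `vcomp` composes 2-morphisms
along a common 1-morphism, `hcomp` along a common object. -/
structure TwoCat where
  Ob : Type u
  Hom : Type u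
  Hom₂ : Type u
  src : Hom → Ob
  tgt : Hom → Ob
  src₂ : Hom₂ → Hom
  tgt₂ : Hom₂ → Hom
  one : Ob → Hom
  one₂ : Hom → Hom₂
  comp : (f g : Hom) → tgt f = src g → Hom
  vcomp : (φ ψ : Hom₂) → tgt₂ φ = src₂ ψ → Hom₂
  hcomp : (φ ψ : Hom₂) → tgt (src₂ φ) = src (src₂ ψ) → Hom₂
  src_tgt₂ : ∀ φ, src (tgt₂ φ) = src (src₂ φ)
  tgt_tgt₂ : ∀ φ, tgt (tgt₂ φ) = tgt (src₂ φ)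
  src_one : ∀ x, src (one x) = x
  tgt_one : ∀ x, tgt (one x) = x
  src_comp : ∀ f g h, src (comp f g h) = src f
  tgt_comp : ∀ f g h, tgt (comp f g h) = tgt g
  src₂_one₂ : ∀ f, src₂ (one₂ f) = f
  tgt₂_one₂ : ∀ f, tgt₂ (one₂ f) = f
  src₂_vcomp : ∀ φ ψ h, src₂ (vcomp φ ψ h) = src₂ φ
  tgt₂_vcomp : ∀ φ ψ h, tgt₂ (vcomp φ ψ h) = tgt₂ ψ
  src₂_hcomp : ∀ φ ψ h, src₂ (hcomp φ ψ h) = comp (src₂ φ) (src₂ ψ) h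
  tgt₂_hcomp : ∀ φ ψ h h', tgt₂ (hcomp φ ψ h) = comp (tgt₂ φ) (tgt₂ ψ) h'
  one_comp : ∀ f h, comp (one (src f)) f h = f
  comp_one : ∀ f h, comp f (one (tgt f)) h = f
  comp_assoc : ∀ f g k h₁ h₂ h₃ h₄, comp (comp f g h₁) k h₃ = comp f (comp g k h₂) h₄
  one₂_vcomp : ∀ φ h, vcomp (one₂ (src₂ φ)) φ h = φ
  vcomp_one₂ : ∀ φ h, vcomp φ (one₂ (tgt₂ φ)) h = φ
  vcomp_assoc : ∀ φ ψ χ h₁ h₂ h₃ h₄,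
    vcomp (vcomp φ ψ h₁) χ h₃ = vcomp φ (vcomp ψ χ h₂) h₄
  one_hcomp : ∀ φ h, hcomp (one₂ (one (src (src₂ φ)))) φ h = φ
  hcomp_one : ∀ φ h, hcomp φ (one₂ (one (tgt (src₂ φ)))) h = φ
  hcomp_assoc : ∀ φ ψ χ h₁ h₂ h₃ h₄,
    hcomp (hcomp φ ψ h₁) χ h₃ = hcomp φ (hcomp ψ χ h₂) h₄
  one₂_comp : ∀ f g h h', one₂ (comp f g h) = hcomp (one₂ f) (one₂ g) h'
  interchange : ∀ φ φ' ψ ψ' h₁ h₂ h₃ h₄ h₅ h₆,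
    hcomp (vcomp φ φ' h₁) (vcomp ψ ψ' h₂) h₃ = vcomp (hcomp φ ψ h₄) (hcomp φ' ψ' h₅) h₆

namespace TwoCat

attribute [simp] src_tgt₂ tgt_tgt₂ src_one tgt_one src_comp tgt_comp src₂_one₂ tgt₂_one₂
  src₂_vcomp tgt₂_vcomp src₂_hcomp tgt₂_hcomp

end TwoCat

/-- A strict functor of 2-categories. -/
@[ext]
structure StrictFunctor (A B : TwoCat.{u}) where
  ob : A.Ob → B.Ob
  hom : A.Hom → B.Hom
  hom₂ : A.Hom₂ → B.Hom₂
  src_hom : ∀ f, B.src (hom f) = ob (A.src f)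
  tgt_hom : ∀ f, B.tgt (hom f) = ob (A.tgt f)
  src₂_hom₂ : ∀ φ, B.src₂ (hom₂ φ) = hom (A.src₂ φ)
  tgt₂_hom₂ : ∀ φ, B.tgt₂ (hom₂ φ) = hom (A.tgt₂ φ)
  map_one : ∀ x, hom (A.one x) = B.one (ob x)
  map_one₂ : ∀ f, hom₂ (A.one₂ f) = B.one₂ (hom f)
  map_comp : ∀ f g h h', hom (A.comp f g h) = B.comp (hom f) (hom g) h'
  map_vcomp : ∀ φ ψ h h', hom₂ (A.vcomp φ ψ h) = B.vcomp (hom₂ φ) (hom₂ ψ) h'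
  map_hcomp : ∀ φ ψ h h', hom₂ (A.hcomp φ ψ h) = B.hcomp (hom₂ φ) (hom₂ ψ) h'

namespace StrictFunctor

attribute [simp] src_hom tgt_hom src₂_hom₂ tgt₂_hom₂ map_one map_one₂ map_comp map_vcomp map_hcomp

variable {A B C D : TwoCat.{u}}

/-- The identity functor. -/
@[simps] def id (A : TwoCat.{u}) : StrictFunctor A A where
  ob x := x
  hom f := f
  hom₂ φ := φ
  src_hom _ := (rfl)
  tgt_hom _ := (rfl)
  src₂_hom₂ _ := (rfl)
  tgt₂_hom₂ _ := (rfl)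
  map_one _ := (rfl)
  map_one₂ _ := (rfl)
  map_comp _ _ _ _ := (rfl)
  map_vcomp _ _ _ _ := (rfl)
  map_hcomp _ _ _ _ := (rfl)

/-- Composition of strict functors, in diagrammatic order. -/
@[simps] def comp (F : StrictFunctor A B) (G : StrictFunctor B C) : StrictFunctor A C where
  ob x := G.ob (F.ob x)
  hom f := G.hom (F.hom f)
  hom₂ φ := G.hom₂ (F.hom₂ φ)
  src_hom _ := by simp
  tgt_hom _ := by simp
  src₂_hom₂ _ := by simp
  tgt₂_hom₂ _ := by simp
  map_one _ := by simp
  map_one₂ _ := by simp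
  map_comp f g h _ := by
    rw [F.map_comp f g h (by simp [h]), G.map_comp]
  map_vcomp f g h _ := by
    rw [F.map_vcomp f g h (by simp [h]), G.map_vcomp]
  map_hcomp f g h _ := by
    rw [F.map_hcomp f g h (by simp [h]), G.map_hcomp]

end StrictFunctor

/-- The strict pullback of 2-categories: cells are pairs of cells with the same image. -/
abbrev TwoCat.pb {A B C : TwoCat.{u}} (F : StrictFunctor A C) (G : StrictFunctor B C) :
    TwoCat.{u} where
  Ob := {p : A.Ob × B.Ob // F.ob p.1 = G.ob p.2}
  Hom := {p : A.Hom × B.Hom // F.hom p.1 = G.hom p.2}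
  Hom₂ := {p : A.Hom₂ × B.Hom₂ // F.hom₂ p.1 = G.hom₂ p.2}
  src f := ⟨(A.src f.1.1, B.src f.1.2), by rw [← F.src_hom, ← G.src_hom, f.2]⟩
  tgt f := ⟨(A.tgt f.1.1, B.tgt f.1.2), by rw [← F.tgt_hom, ← G.tgt_hom, f.2]⟩
  src₂ f := ⟨(A.src₂ f.1.1, B.src₂ f.1.2), by rw [← F.src₂_hom₂, ← G.src₂_hom₂, f.2]⟩
  tgt₂ f := ⟨(A.tgt₂ f.1.1, B.tgt₂ f.1.2), by rw [← F.tgt₂_hom₂, ← G.tgt₂_hom₂, f.2]⟩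
  one x := ⟨(A.one x.1.1, B.one x.1.2), by simp [x.2]⟩
  one₂ x := ⟨(A.one₂ x.1.1, B.one₂ x.1.2), by simp [x.2]⟩
  comp f g h := ⟨(A.comp f.1.1 g.1.1 (congrArg (fun p => p.1.1) h),
      B.comp f.1.2 g.1.2 (congrArg (fun p => p.1.2) h)), by
    rw [F.map_comp _ _ _ (by simpa using congrArg (fun p => F.ob p.1.1) h),
      G.map_comp _ _ _ (by simpa using congrArg (fun p => G.ob p.1.2) h)]
    simp only [f.2, g.2]⟩
  vcomp f g h := ⟨(A.vcomp f.1.1 g.1.1 (congrArg (fun p => p.1.1) h),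
      B.vcomp f.1.2 g.1.2 (congrArg (fun p => p.1.2) h)), by
    rw [F.map_vcomp _ _ _ (by simpa using congrArg (fun p => F.hom p.1.1) h),
      G.map_vcomp _ _ _ (by simpa using congrArg (fun p => G.hom p.1.2) h)]
    simp only [f.2, g.2]⟩
  hcomp f g h := ⟨(A.hcomp f.1.1 g.1.1 (congrArg (fun p => p.1.1) h),
      B.hcomp f.1.2 g.1.2 (congrArg (fun p => p.1.2) h)), by
    rw [F.map_hcomp _ _ _ (by simpa using congrArg (fun p => F.ob p.1.1) h),
      G.map_hcomp _ _ _ (by simpa using congrArg (fun p => G.ob p.1.2) h)]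
    simp only [f.2, g.2]⟩
  src_tgt₂ φ := by simp
  tgt_tgt₂ φ := by simp
  src_one x := by simp
  tgt_one x := by simp
  src_comp f g h := by simp
  tgt_comp f g h := by simp
  src₂_one₂ f := by simp
  tgt₂_one₂ f := by simp
  src₂_vcomp φ ψ h := by simp
  tgt₂_vcomp φ ψ h := by simp
  src₂_hcomp φ ψ h := by simp
  tgt₂_hcomp φ ψ h h' := by
    have h₁ := congrArg (fun p => p.1.1) h'
    have h₂ := congrArg (fun p => p.1.2) h'
    exact Subtype.ext (Prod.ext (A.tgt₂_hcomp _ _ _ h₁) (B.tgt₂_hcomp _ _ _ h₂))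
  one_comp f h := Subtype.ext (Prod.ext (A.one_comp _ _) (B.one_comp _ _))
  comp_one f h := Subtype.ext (Prod.ext (A.comp_one _ _) (B.comp_one _ _))
  comp_assoc f g k h₁ h₂ h₃ h₄ := Subtype.ext (Prod.ext
    (A.comp_assoc _ _ _ _ (congrArg (fun p => p.1.1) h₂) _ _)
    (B.comp_assoc _ _ _ _ (congrArg (fun p => p.1.2) h₂) _ _))
  one₂_vcomp f h := Subtype.ext (Prod.ext (A.one₂_vcomp _ _) (B.one₂_vcomp _ _))
  vcomp_one₂ f h := Subtype.ext (Prod.ext (A.vcomp_one₂ _ _) (B.vcomp_one₂ _ _))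
  vcomp_assoc f g k h₁ h₂ h₃ h₄ := Subtype.ext (Prod.ext
    (A.vcomp_assoc _ _ _ _ (congrArg (fun p => p.1.1) h₂) _ _)
    (B.vcomp_assoc _ _ _ _ (congrArg (fun p => p.1.2) h₂) _ _))
  one_hcomp f h := Subtype.ext (Prod.ext (A.one_hcomp _ _) (B.one_hcomp _ _))
  hcomp_one f h := Subtype.ext (Prod.ext (A.hcomp_one _ _) (B.hcomp_one _ _))
  hcomp_assoc f g k h₁ h₂ h₃ h₄ := Subtype.ext (Prod.ext
    (A.hcomp_assoc _ _ _ _ (congrArg (fun p => p.1.1) h₂) _ _)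
    (B.hcomp_assoc _ _ _ _ (congrArg (fun p => p.1.2) h₂) _ _))
  one₂_comp f g h h' := Subtype.ext (Prod.ext
    (A.one₂_comp _ _ _ (congrArg (fun p => p.1.1) h'))
    (B.one₂_comp _ _ _ (congrArg (fun p => p.1.2) h')))
  interchange φ φ' ψ ψ' h₁ h₂ h₃ h₄ h₅ h₆ := Subtype.ext (Prod.ext
    (A.interchange _ _ _ _ (congrArg (fun p => p.1.1) h₁) (congrArg (fun p => p.1.1) h₂) _
      (congrArg (fun p => p.1.1) h₄) (congrArg (fun p => p.1.1) h₅) _)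
    (B.interchange _ _ _ _ (congrArg (fun p => p.1.2) h₁) (congrArg (fun p => p.1.2) h₂) _
      (congrArg (fun p => p.1.2) h₄) (congrArg (fun p => p.1.2) h₅) _))

namespace StrictFunctor

variable {A B C D E : TwoCat.{u}}

/-- The first projection of a strict pullback. -/
@[simps] def fst (F : StrictFunctor A C) (G : StrictFunctor B C) :
    StrictFunctor (TwoCat.pb F G) A where
  ob p := p.1.1
  hom p := p.1.1
  hom₂ p := p.1.1
  src_hom _ := (rfl)
  tgt_hom _ := (rfl)
  src₂_hom₂ _ := (rfl)
  tgt₂_hom₂ _ := (rfl)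
  map_one _ := (rfl)
  map_one₂ _ := (rfl)
  map_comp _ _ _ _ := (rfl)
  map_vcomp _ _ _ _ := (rfl)
  map_hcomp _ _ _ _ := (rfl)

/-- The second projection of a strict pullback. -/
@[simps] def snd (F : StrictFunctor A C) (G : StrictFunctor B C) :
    StrictFunctor (TwoCat.pb F G) B where
  ob p := p.1.2
  hom p := p.1.2
  hom₂ p := p.1.2
  src_hom _ := (rfl)
  tgt_hom _ := (rfl)
  src₂_hom₂ _ := (rfl)
  tgt₂_hom₂ _ := (rfl)
  map_one _ := (rfl)
  map_one₂ _ := (rfl)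
  map_comp _ _ _ _ := (rfl)
  map_vcomp _ _ _ _ := (rfl)
  map_hcomp _ _ _ _ := (rfl)

/-- The functor into a strict pullback induced by two functors with the same image. -/
@[simps] def lift {F : StrictFunctor A C} {G : StrictFunctor B C} (X : StrictFunctor D A)
    (Y : StrictFunctor D B) (h : X.comp F = Y.comp G) : StrictFunctor D (TwoCat.pb F G) where
  ob d := ⟨(X.ob d, Y.ob d), congrFun (congrArg ob h) d⟩
  hom d := ⟨(X.hom d, Y.hom d), congrFun (congrArg hom h) d⟩
  hom₂ d := ⟨(X.hom₂ d, Y.hom₂ d), congrFun (congrArg hom₂ h) d⟩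
  src_hom _ := Subtype.ext (Prod.ext (X.src_hom _) (Y.src_hom _))
  tgt_hom _ := Subtype.ext (Prod.ext (X.tgt_hom _) (Y.tgt_hom _))
  src₂_hom₂ _ := Subtype.ext (Prod.ext (X.src₂_hom₂ _) (Y.src₂_hom₂ _))
  tgt₂_hom₂ _ := Subtype.ext (Prod.ext (X.tgt₂_hom₂ _) (Y.tgt₂_hom₂ _))
  map_one _ := Subtype.ext (Prod.ext (X.map_one _) (Y.map_one _))
  map_one₂ _ := Subtype.ext (Prod.ext (X.map_one₂ _) (Y.map_one₂ _))
  map_comp _ _ _ h' := Subtype.ext (Prod.ext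
    (X.map_comp _ _ _ (congrArg (fun p => p.1.1) h'))
    (Y.map_comp _ _ _ (congrArg (fun p => p.1.2) h')))
  map_vcomp _ _ _ h' := Subtype.ext (Prod.ext
    (X.map_vcomp _ _ _ (congrArg (fun p => p.1.1) h'))
    (Y.map_vcomp _ _ _ (congrArg (fun p => p.1.2) h')))
  map_hcomp _ _ _ h' := Subtype.ext (Prod.ext
    (X.map_hcomp _ _ _ (congrArg (fun p => p.1.1) h'))
    (Y.map_hcomp _ _ _ (congrArg (fun p => p.1.2) h')))

theorem comp_assoc (F : StrictFunctor A B) (G : StrictFunctor B C) (H : StrictFunctor C D) :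
    (F.comp G).comp H = F.comp (G.comp H) := (rfl)

theorem fst_comp_eq (F : StrictFunctor A C) (G : StrictFunctor B C) :
    (fst F G).comp F = (snd F G).comp G := by
  ext p
  · exact p.2
  · exact p.2
  · exact p.2

end StrictFunctor

namespace StrictFunctor

variable {A B C D E : TwoCat.{u}}

attribute [simp] comp_assoc fst_comp_eq

@[simp] theorem id_comp (F : StrictFunctor A B) : (id A).comp F = F := (rfl)

@[simp] theorem comp_id (F : StrictFunctor A B) : F.comp (id B) = F := (rfl)

@[simp] theorem lift_fst {F : StrictFunctor A C} {G : StrictFunctor B C} (X : StrictFunctor D A)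
    (Y : StrictFunctor D B) (h : X.comp F = Y.comp G) : (lift X Y h).comp (fst F G) = X := (rfl)

@[simp] theorem lift_snd {F : StrictFunctor A C} {G : StrictFunctor B C} (X : StrictFunctor D A)
    (Y : StrictFunctor D B) (h : X.comp F = Y.comp G) : (lift X Y h).comp (snd F G) = Y := (rfl)

@[simp] theorem lift_fst_assoc {F : StrictFunctor A C} {G : StrictFunctor B C}
    (X : StrictFunctor D A) (Y : StrictFunctor D B) (h : X.comp F = Y.comp G)
    (H : StrictFunctor A E) : (lift X Y h).comp ((fst F G).comp H) = X.comp H := (rfl)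

@[simp] theorem lift_snd_assoc {F : StrictFunctor A C} {G : StrictFunctor B C}
    (X : StrictFunctor D A) (Y : StrictFunctor D B) (h : X.comp F = Y.comp G)
    (H : StrictFunctor B E) : (lift X Y h).comp ((snd F G).comp H) = Y.comp H := (rfl)

@[simp] theorem fst_comp_eq_assoc (F : StrictFunctor A C) (G : StrictFunctor B C)
    (H : StrictFunctor C D) : (fst F G).comp (F.comp H) = (snd F G).comp (G.comp H) := by
  rw [← comp_assoc, fst_comp_eq, comp_assoc]

@[simp] theorem lift_eta (F : StrictFunctor A C) (G : StrictFunctor B C)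
    (h : (fst F G).comp F = (snd F G).comp G) : lift (fst F G) (snd F G) h = id _ := (rfl)

@[simp] theorem comp_lift {F : StrictFunctor A C} {G : StrictFunctor B C} (K : StrictFunctor E D)
    (X : StrictFunctor D A) (Y : StrictFunctor D B) (h : X.comp F = Y.comp G) :
    K.comp (lift X Y h) = lift (K.comp X) (K.comp Y) (by simp [h]) := (rfl)

@[simp] theorem comp_lift_assoc {F : StrictFunctor A C} {G : StrictFunctor B C}
    {Z : TwoCat.{u}} (K : StrictFunctor E D)
    (X : StrictFunctor D A) (Y : StrictFunctor D B) (h : X.comp F = Y.comp G)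
    (H : StrictFunctor (TwoCat.pb F G) Z) :
    K.comp ((lift X Y h).comp H) = (lift (K.comp X) (K.comp Y) (by simp [h])).comp H := (rfl)

end StrictFunctor

/-- The data of a transformation between strict functors `dom` and `cod`: components
`app x : dom x ⟶ cod x`, and for each morphism `f : x ⟶ y` a naturality 2-morphism
`nat f : app x ≫ cod f ⟹ dom f ≫ app y` together with a candidate inverse `natInv f`.
The laws of a weak natural transformation are stated in `Transf.IsWeak`. -/
@[ext]
structure Transf (A B : TwoCat.{u}) where
  dom : StrictFunctor A B
  cod : StrictFunctor A B
  app : A.Ob → B.Hom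
  nat : A.Hom → B.Hom₂
  natInv : A.Hom → B.Hom₂
  src_app : ∀ x, B.src (app x) = dom.ob x
  tgt_app : ∀ x, B.tgt (app x) = cod.ob x
  src₂_nat : ∀ f h, B.src₂ (nat f) = B.comp (app (A.src f)) (cod.hom f) h
  tgt₂_nat : ∀ f h, B.tgt₂ (nat f) = B.comp (dom.hom f) (app (A.tgt f)) h
  src₂_natInv : ∀ f h, B.src₂ (natInv f) = B.comp (dom.hom f) (app (A.tgt f)) h
  tgt₂_natInv : ∀ f h, B.tgt₂ (natInv f) = B.comp (app (A.src f)) (cod.hom f) h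

namespace Transf

variable {A B C D : TwoCat.{u}}

attribute [simp] src_app tgt_app

@[simp] theorem src₂_nat' (α : Transf A B) (f : A.Hom) :
    B.src₂ (α.nat f) = B.comp (α.app (A.src f)) (α.cod.hom f) (by simp) := α.src₂_nat f _

@[simp] theorem tgt₂_nat' (α : Transf A B) (f : A.Hom) :
    B.tgt₂ (α.nat f) = B.comp (α.dom.hom f) (α.app (A.tgt f)) (by simp) := α.tgt₂_nat f _

@[simp] theorem src₂_natInv' (α : Transf A B) (f : A.Hom) :
    B.src₂ (α.natInv f) = B.comp (α.dom.hom f) (α.app (A.tgt f)) (by simp) := α.src₂_natInv f _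

@[simp] theorem tgt₂_natInv' (α : Transf A B) (f : A.Hom) :
    B.tgt₂ (α.natInv f) = B.comp (α.app (A.src f)) (α.cod.hom f) (by simp) := α.tgt₂_natInv f _

/-- The laws of a weak (pseudo-) natural transformation: the naturality 2-morphisms are invertible,
compatible with identities and composites of morphisms, and natural for 2-morphisms. -/
structure IsWeak (α : Transf A B) : Prop where
  nat_natInv : ∀ f h, B.vcomp (α.nat f) (α.natInv f) h = B.one₂ (B.src₂ (α.nat f))
  natInv_nat : ∀ f h, B.vcomp (α.natInv f) (α.nat f) h = B.one₂ (B.tgt₂ (α.nat f))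
  nat_one : ∀ x, α.nat (A.one x) = B.one₂ (α.app x)
  nat_comp : ∀ f g h h₁ h₂ h₃, α.nat (A.comp f g h) =
    B.vcomp (B.hcomp (α.nat f) (B.one₂ (α.cod.hom g)) h₁)
      (B.hcomp (B.one₂ (α.dom.hom f)) (α.nat g) h₂) h₃
  natural : ∀ φ h₁ h₂ h₃ h₄,
    B.vcomp (B.hcomp (B.one₂ (α.app (A.src (A.src₂ φ)))) (α.cod.hom₂ φ) h₁)
      (α.nat (A.tgt₂ φ)) h₂ =
    B.vcomp (α.nat (A.src₂ φ))
      (B.hcomp (α.dom.hom₂ φ) (B.one₂ (α.app (A.tgt (A.src₂ φ)))) h₃) h₄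

/-- The identity transformation of a functor. -/
@[simps] def id (F : StrictFunctor A B) : Transf A B where
  dom := F
  cod := F
  app x := B.one (F.ob x)
  nat f := B.one₂ (F.hom f)
  natInv f := B.one₂ (F.hom f)
  src_app := by simp
  tgt_app := by simp
  src₂_nat f h := by
    simp only [TwoCat.src₂_one₂, ← F.src_hom, B.one_comp]
  tgt₂_nat f h := by
    simp only [TwoCat.tgt₂_one₂, ← F.tgt_hom, B.comp_one]
  src₂_natInv f h := by
    simp only [TwoCat.src₂_one₂, ← F.tgt_hom, B.comp_one]
  tgt₂_natInv f h := by
    simp only [TwoCat.tgt₂_one₂, ← F.src_hom, B.one_comp]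

/-- Vertical composition of transformations, in diagrammatic order. -/
@[simps] def comp (α β : Transf A B) (e : α.cod = β.dom) : Transf A B where
  dom := α.dom
  cod := β.cod
  app x := B.comp (α.app x) (β.app x) (by simp [e])
  nat f := B.vcomp (B.hcomp (B.one₂ (α.app (A.src f))) (β.nat f) (by simp [e]))
    (B.hcomp (α.nat f) (B.one₂ (β.app (A.tgt f))) (by simp [e]))
    (by rw [B.tgt₂_hcomp _ _ _ (by simp [e]), B.src₂_hcomp]; simp [e, B.comp_assoc])
  natInv f := B.vcomp (B.hcomp (α.natInv f) (B.one₂ (β.app (A.tgt f))) (by simp [e]))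
    (B.hcomp (B.one₂ (α.app (A.src f))) (β.natInv f) (by simp [e]))
    (by rw [B.tgt₂_hcomp _ _ _ (by simp [e]), B.src₂_hcomp]; simp [e, B.comp_assoc])
  src_app := by simp
  tgt_app := by simp
  src₂_nat f h := by
    simp only [TwoCat.src₂_vcomp, TwoCat.src₂_hcomp, TwoCat.src₂_one₂, src₂_nat']
    exact (B.comp_assoc _ _ _ _ _ _ _).symm
  tgt₂_nat f h := by
    rw [B.tgt₂_vcomp, B.tgt₂_hcomp _ _ _ (by simp [e])]
    simp only [TwoCat.tgt₂_one₂, tgt₂_nat']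
    exact B.comp_assoc _ _ _ _ _ _ _
  src₂_natInv f h := by
    simp only [TwoCat.src₂_vcomp, TwoCat.src₂_hcomp, TwoCat.src₂_one₂, src₂_natInv']
    exact B.comp_assoc _ _ _ _ _ _ _
  tgt₂_natInv f h := by
    rw [B.tgt₂_vcomp, B.tgt₂_hcomp _ _ _ (by simp [e])]
    simp only [TwoCat.tgt₂_one₂, tgt₂_natInv']
    exact (B.comp_assoc _ _ _ _ _ _ _).symm

/-- Precomposition of a transformation with a functor. -/
@[simps] def pre (F : StrictFunctor C A) (α : Transf A B) : Transf C B where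
  dom := F.comp α.dom
  cod := F.comp α.cod
  app x := α.app (F.ob x)
  nat f := α.nat (F.hom f)
  natInv f := α.natInv (F.hom f)
  src_app := by simp
  tgt_app := by simp
  src₂_nat := by simp
  tgt₂_nat := by simp
  src₂_natInv := by simp
  tgt₂_natInv := by simp

/-- Postcomposition of a transformation with a strict functor. -/
@[simps] def post (α : Transf A B) (G : StrictFunctor B C) : Transf A C where
  dom := α.dom.comp G
  cod := α.cod.comp G
  app x := G.hom (α.app x)
  nat f := G.hom₂ (α.nat f)
  natInv f := G.hom₂ (α.natInv f)
  src_app := by simp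
  tgt_app := by simp
  src₂_nat f h := by simp [G.map_comp _ _ _ h]
  tgt₂_nat f h := by simp [G.map_comp _ _ _ h]
  src₂_natInv f h := by simp [G.map_comp _ _ _ h]
  tgt₂_natInv f h := by simp [G.map_comp _ _ _ h]

/-- The transformation into a strict pullback given by two transformations with the same image. -/
@[simps] def pair {F : StrictFunctor B D} {G : StrictFunctor C D} (α : Transf A B) (β : Transf A C)
    (e : α.post F = β.post G) : Transf A (TwoCat.pb F G) where
  dom := StrictFunctor.lift α.dom β.dom (congrArg dom e)
  cod := StrictFunctor.lift α.cod β.cod (congrArg cod e)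
  app x := ⟨(α.app x, β.app x), congrFun (congrArg app e) x⟩
  nat f := ⟨(α.nat f, β.nat f), congrFun (congrArg nat e) f⟩
  natInv f := ⟨(α.natInv f, β.natInv f), congrFun (congrArg natInv e) f⟩
  src_app x := Subtype.ext (Prod.ext (α.src_app x) (β.src_app x))
  tgt_app x := Subtype.ext (Prod.ext (α.tgt_app x) (β.tgt_app x))
  src₂_nat f _ := Subtype.ext (Prod.ext (α.src₂_nat f _) (β.src₂_nat f _))
  tgt₂_nat f _ := Subtype.ext (Prod.ext (α.tgt₂_nat f _) (β.tgt₂_nat f _))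
  src₂_natInv f _ := Subtype.ext (Prod.ext (α.src₂_natInv f _) (β.src₂_natInv f _))
  tgt₂_natInv f _ := Subtype.ext (Prod.ext (α.tgt₂_natInv f _) (β.tgt₂_natInv f _))

@[simp] theorem pre_post (F : StrictFunctor C A) (α : Transf A B) (G : StrictFunctor B D) :
    (pre F α).post G = pre F (α.post G) := (rfl)

@[simp] theorem post_post (α : Transf A B) (F : StrictFunctor B C) (G : StrictFunctor C D) :
    (α.post F).post G = α.post (F.comp G) := (rfl)

@[simp] theorem pre_id (F : StrictFunctor C A) (G : StrictFunctor A B) :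
    pre F (id G) = id (F.comp G) := (rfl)

@[simp] theorem id_post (F : StrictFunctor A B) (G : StrictFunctor B C) :
    (id F).post G = id (F.comp G) := by
  ext <;> simp [id, post]

@[simp] theorem pair_fst {F : StrictFunctor B D} {G : StrictFunctor C D} (α : Transf A B)
    (β : Transf A C) (e : α.post F = β.post G) : (pair α β e).post (.fst F G) = α := (rfl)

@[simp] theorem pair_snd {F : StrictFunctor B D} {G : StrictFunctor C D} (α : Transf A B)
    (β : Transf A C) (e : α.post F = β.post G) : (pair α β e).post (.snd F G) = β := (rfl)

end Transf

/-- A modification between transformations with the same source and target functors. -/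
structure Modif {A B : TwoCat.{u}} (α β : Transf A B) (hd : α.dom = β.dom)
    (hc : α.cod = β.cod) where
  app : A.Ob → B.Hom₂
  src₂_app : ∀ x, B.src₂ (app x) = α.app x
  tgt₂_app : ∀ x, B.tgt₂ (app x) = β.app x
  natural : ∀ f h₁ h₂ h₃ h₄,
    B.vcomp (α.nat f) (B.hcomp (B.one₂ (α.dom.hom f)) (app (A.tgt f)) h₁) h₂ =
    B.vcomp (B.hcomp (app (A.src f)) (B.one₂ (α.cod.hom f)) h₃) (β.nat f) h₄

attribute [simp] Modif.src₂_app Modif.tgt₂_app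

/-- A 2-morphism is invertible. -/
def TwoCat.IsInv (B : TwoCat.{u}) (φ : B.Hom₂) : Prop :=
  ∃ (ψ : B.Hom₂) (h : B.tgt₂ φ = B.src₂ ψ) (h' : B.tgt₂ ψ = B.src₂ φ),
    B.vcomp φ ψ h = B.one₂ (B.src₂ φ) ∧ B.vcomp ψ φ h' = B.one₂ (B.tgt₂ φ)

/-- Horizontal composites of lists of 2-morphisms. -/
inductive TwoCat.Row (B : TwoCat.{u}) : List B.Hom₂ → B.Hom₂ → Prop
  | single (φ : B.Hom₂) : Row B [φ] φ
  | cons (φ : B.Hom₂) (L : List B.Hom₂) (ψ : B.Hom₂) (h : B.tgt (B.src₂ φ) = B.src (B.src₂ ψ)) :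
      Row B L ψ → Row B (φ :: L) (B.hcomp φ ψ h)

/-- Composites of pasting diagrams: each row is composed horizontally, and the results are
composed vertically. -/
inductive TwoCat.Paste (B : TwoCat.{u}) : List (List B.Hom₂) → B.Hom₂ → Prop
  | single (r : List B.Hom₂) (φ : B.Hom₂) : B.Row r φ → Paste B [r] φ
  | cons (r : List B.Hom₂) (φ : B.Hom₂) (L : List (List B.Hom₂)) (ψ : B.Hom₂)
      (h : B.tgt₂ φ = B.src₂ ψ) :
      B.Row r φ → Paste B L ψ → Paste B (r :: L) (B.vcomp φ ψ h)

/-- Two pasting diagrams have a common composite. -/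
def TwoCat.Commutes (B : TwoCat.{u}) (L L' : List (List B.Hom₂)) : Prop :=
  ∃ φ, B.Paste L φ ∧ B.Paste L' φ

/-- The 0-data and 1-data of a category object in 2-categories: 2-categories `X₀` and `X₁` of
0-cells and of 1-cells, source and target functors `s`, `t`, identities `i` and composition `m`. -/
structure CatData₁ (X₀ X₁ : TwoCat.{u}) where
  s : StrictFunctor X₁ X₀
  t : StrictFunctor X₁ X₀
  i : StrictFunctor X₀ X₁
  m : StrictFunctor (TwoCat.pb t s) X₁
  i_s : i.comp s = .id X₀
  i_t : i.comp t = .id X₀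
  m_s : m.comp s = (StrictFunctor.fst t s).comp s
  m_t : m.comp t = (StrictFunctor.snd t s).comp t

namespace CatData₁

open StrictFunctor

variable {X₀ X₁ A B : TwoCat.{u}} (C : CatData₁ X₀ X₁)

attribute [simp] i_s i_t m_s m_t

@[simp] theorem i_s_assoc (F : StrictFunctor X₀ A) : C.i.comp (C.s.comp F) = F := by
  rw [← comp_assoc, i_s, id_comp]

@[simp] theorem i_t_assoc (F : StrictFunctor X₀ A) : C.i.comp (C.t.comp F) = F := by
  rw [← comp_assoc, i_t, id_comp]

@[simp] theorem m_s_assoc (F : StrictFunctor X₀ A) :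
    C.m.comp (C.s.comp F) = (fst C.t C.s).comp (C.s.comp F) := by
  rw [← comp_assoc, m_s, comp_assoc]

@[simp] theorem m_t_assoc (F : StrictFunctor X₀ A) :
    C.m.comp (C.t.comp F) = (snd C.t C.s).comp (C.t.comp F) := by
  rw [← comp_assoc, m_t, comp_assoc]

@[simp] theorem s_i_ob (x) : C.s.ob (C.i.ob x) = x := congrFun (congrArg ob C.i_s) x
@[simp] theorem s_i_hom (x) : C.s.hom (C.i.hom x) = x := congrFun (congrArg hom C.i_s) x
@[simp] theorem s_i_hom₂ (x) : C.s.hom₂ (C.i.hom₂ x) = x := congrFun (congrArg hom₂ C.i_s) x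
@[simp] theorem t_i_ob (x) : C.t.ob (C.i.ob x) = x := congrFun (congrArg ob C.i_t) x
@[simp] theorem t_i_hom (x) : C.t.hom (C.i.hom x) = x := congrFun (congrArg hom C.i_t) x
@[simp] theorem t_i_hom₂ (x) : C.t.hom₂ (C.i.hom₂ x) = x := congrFun (congrArg hom₂ C.i_t) x
@[simp] theorem s_m_ob (x) : C.s.ob (C.m.ob x) = C.s.ob x.1.1 := congrFun (congrArg ob C.m_s) x
@[simp] theorem s_m_hom (x) : C.s.hom (C.m.hom x) = C.s.hom x.1.1 :=
  congrFun (congrArg hom C.m_s) x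
@[simp] theorem s_m_hom₂ (x) : C.s.hom₂ (C.m.hom₂ x) = C.s.hom₂ x.1.1 :=
  congrFun (congrArg hom₂ C.m_s) x
@[simp] theorem t_m_ob (x) : C.t.ob (C.m.ob x) = C.t.ob x.1.2 := congrFun (congrArg ob C.m_t) x
@[simp] theorem t_m_hom (x) : C.t.hom (C.m.hom x) = C.t.hom x.1.2 :=
  congrFun (congrArg hom C.m_t) x
@[simp] theorem t_m_hom₂ (x) : C.t.hom₂ (C.m.hom₂ x) = C.t.hom₂ x.1.2 :=
  congrFun (congrArg hom₂ C.m_t) x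

/-- The 2-category of composable pairs of 1-cells. -/
abbrev X₂ : TwoCat.{u} := TwoCat.pb C.t C.s

/-- The 2-category of composable triples of 1-cells. -/
abbrev X₃ : TwoCat.{u} := TwoCat.pb ((snd C.t C.s).comp C.t) C.s

/-- The 2-category of composable quadruples of 1-cells. -/
abbrev X₄ : TwoCat.{u} := TwoCat.pb ((snd ((snd C.t C.s).comp C.t) C.s).comp C.t) C.s

/-- The composite of two functors into the 2-category of 1-cells. -/
abbrev mul (x y : StrictFunctor A X₁) (h : x.comp C.t = y.comp C.s := by simp [*]) :
    StrictFunctor A X₁ := (lift x y h).comp C.m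

/-- The functor to composable triples of 1-cells given by three functors. -/
abbrev triple (x y z : StrictFunctor A X₁) (h : x.comp C.t = y.comp C.s := by simp [*])
    (h' : y.comp C.t = z.comp C.s := by simp [*]) : StrictFunctor A C.X₃ :=
  lift (lift x y h) z (by simp [h'])

/-- The horizontal composite of two transformations into the 2-category of 1-cells. -/
abbrev mulT (α β : Transf A X₁) (h : α.post C.t = β.post C.s := by simp [*]) : Transf A X₁ :=
  (α.pair β h).post C.m

/-- The functors picking the entries of a composable pair, triple or quadruple. -/
abbrev p₁ : StrictFunctor C.X₂ X₁ := fst _ _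
abbrev p₂ : StrictFunctor C.X₂ X₁ := snd _ _
abbrev q₁ : StrictFunctor C.X₃ X₁ := (fst _ _).comp (fst _ _)
abbrev q₂ : StrictFunctor C.X₃ X₁ := (fst _ _).comp (snd _ _)
abbrev q₃ : StrictFunctor C.X₃ X₁ := snd _ _
abbrev r₁ : StrictFunctor C.X₄ X₁ := (fst _ _).comp ((fst _ _).comp (fst _ _))
abbrev r₂ : StrictFunctor C.X₄ X₁ := (fst _ _).comp ((fst _ _).comp (snd _ _))
abbrev r₃ : StrictFunctor C.X₄ X₁ := (fst _ _).comp (snd _ _)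
abbrev r₄ : StrictFunctor C.X₄ X₁ := snd _ _

end CatData₁

namespace CatData₁

variable {X₀ X₁ A B : TwoCat.{u}} (C : CatData₁ X₀ X₁)

/-- The modification `Γ` into the 2-category of 1-cells is invertible, and the source and target
functors send it to identities. -/
structure IsGood {α β : Transf A X₁} {hd hc} (Γ : Modif α β hd hc) : Prop where
  inv : ∀ x, X₁.IsInv (Γ.app x)
  s : ∀ x, C.s.hom₂ (Γ.app x) = X₀.one₂ (X₀.one (C.s.ob (α.dom.ob x)))
  t : ∀ x, C.t.hom₂ (Γ.app x) = X₀.one₂ (X₀.one (C.t.ob (α.dom.ob x)))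

/-- An inverse of a transformation `α` into the 2-category of 1-cells: a weak transformation in the
opposite direction and invertible modifications from the two composites to identities, satisfying
the triangle identities.  As for all the 2- and 3-morphisms in the structure of a category object,
the images of these data under the source and target functors are identities. -/
structure Inverse (α : Transf A X₁) where
  inv : Transf A X₁
  isWeak : inv.IsWeak
  dom_eq : inv.dom = α.cod
  cod_eq : inv.cod = α.dom
  η : Modif (α.comp inv dom_eq.symm) (.id α.dom) rfl cod_eq
  ε : Modif (inv.comp α cod_eq) (.id α.cod) dom_eq rfl
  η_isGood : C.IsGood η
  ε_isGood : C.IsGood ε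
  s_inv : inv.post C.s = .id (α.dom.comp C.s)
  t_inv : inv.post C.t = .id (α.dom.comp C.t)
  triangle : ∀ x h h', X₁.hcomp (η.app x) (X₁.one₂ (α.app x)) h =
    X₁.hcomp (X₁.one₂ (α.app x)) (ε.app x) h'
  triangle' : ∀ x h h', X₁.hcomp (ε.app x) (X₁.one₂ (inv.app x)) h =
    X₁.hcomp (X₁.one₂ (inv.app x)) (η.app x) h'

end CatData₁

/-- The 2-data of a category object in 2-categories: the left identity transformation
`lam : m (i s x, x) ⟶ x`, the right identity transformation `rho : m (x, i t x) ⟶ x` and the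
associator transformation `alp : m (m (x, y), z) ⟶ m (x, m (y, z))`.  They are weak natural
transformations, are sent to identities by the source and target functors, and are invertible. -/
structure CatData₂ {X₀ X₁ : TwoCat.{u}} (C : CatData₁ X₀ X₁) where
  lam : Transf X₁ X₁
  rho : Transf X₁ X₁
  alp : Transf C.X₃ X₁
  lam_dom : lam.dom = C.mul (C.s.comp C.i) (.id X₁)
  lam_cod : lam.cod = .id X₁
  rho_dom : rho.dom = C.mul (.id X₁) (C.t.comp C.i)
  rho_cod : rho.cod = .id X₁
  alp_dom : alp.dom = C.mul (C.mul C.q₁ C.q₂) C.q₃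
  alp_cod : alp.cod = C.mul C.q₁ (C.mul C.q₂ C.q₃)
  lam_isWeak : lam.IsWeak
  rho_isWeak : rho.IsWeak
  alp_isWeak : alp.IsWeak
  lam_s : lam.post C.s = .id C.s
  lam_t : lam.post C.t = .id C.t
  rho_s : rho.post C.s = .id C.s
  rho_t : rho.post C.t = .id C.t
  alp_s : alp.post C.s = .id (C.q₁.comp C.s)
  alp_t : alp.post C.t = .id (C.q₃.comp C.t)
  lam_inverse : Nonempty (C.Inverse lam)
  rho_inverse : Nonempty (C.Inverse rho)
  alp_inverse : Nonempty (C.Inverse alp)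

namespace CatData₂

open StrictFunctor

variable {X₀ X₁ A B : TwoCat.{u}} {C : CatData₁ X₀ X₁} (D : CatData₂ C)

attribute [simp] lam_dom lam_cod rho_dom rho_cod alp_dom alp_cod lam_s lam_t rho_s rho_t alp_s alp_t

@[simp] theorem s_lam_app (x) : C.s.hom (D.lam.app x) = X₀.one (C.s.ob x) :=
  congrFun (congrArg Transf.app D.lam_s) x
@[simp] theorem t_lam_app (x) : C.t.hom (D.lam.app x) = X₀.one (C.t.ob x) :=
  congrFun (congrArg Transf.app D.lam_t) x
@[simp] theorem s_rho_app (x) : C.s.hom (D.rho.app x) = X₀.one (C.s.ob x) :=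
  congrFun (congrArg Transf.app D.rho_s) x
@[simp] theorem t_rho_app (x) : C.t.hom (D.rho.app x) = X₀.one (C.t.ob x) :=
  congrFun (congrArg Transf.app D.rho_t) x
@[simp] theorem s_alp_app (x) : C.s.hom (D.alp.app x) = X₀.one (C.s.ob x.1.1.1.1) :=
  congrFun (congrArg Transf.app D.alp_s) x
@[simp] theorem t_alp_app (x) : C.t.hom (D.alp.app x) = X₀.one (C.t.ob x.1.2) :=
  congrFun (congrArg Transf.app D.alp_t) x

/-- The associator transformation at three functors into the 2-category of 1-cells. -/
abbrev assoc (x y z : StrictFunctor A X₁) (h : x.comp C.t = y.comp C.s := by simp [*])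
    (h' : y.comp C.t = z.comp C.s := by simp [*]) : Transf A X₁ :=
  Transf.pre (C.triple x y z h h') D.alp

/-- The left identity transformation at a functor into the 2-category of 1-cells. -/
abbrev lunit (x : StrictFunctor A X₁) : Transf A X₁ := Transf.pre x D.lam

/-- The right identity transformation at a functor into the 2-category of 1-cells. -/
abbrev runit (x : StrictFunctor A X₁) : Transf A X₁ := Transf.pre x D.rho

/-- The source of the second modification, `m (λ x, y)`. -/
def src₂ : Transf C.X₂ X₁ := C.mulT (D.lunit C.p₁) (.id C.p₂)

/-- The target of the second modification, `α (i s x, x, y) ≫ λ (m (x, y))`. -/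
def tgt₂ : Transf C.X₂ X₁ :=
  (D.assoc (C.p₁.comp (C.s.comp C.i)) C.p₁ C.p₂).comp (D.lunit C.m) (by simp)

/-- The source of the third modification, `α (x, y, i t y) ≫ m (x, ρ y)`. -/
def src₃ : Transf C.X₂ X₁ :=
  (D.assoc C.p₁ C.p₂ (C.p₂.comp (C.t.comp C.i))).comp
    (C.mulT (.id C.p₁) (D.runit C.p₂)) (by simp)

/-- The source of the fourth modification, `m (ρ x, y)`. -/
def src₄ : Transf C.X₂ X₁ := C.mulT (D.runit C.p₁) (.id C.p₂)

/-- The target of the fourth modification, `α (x, i t x, y) ≫ m (x, λ y)`. -/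
def tgt₄ : Transf C.X₂ X₁ :=
  (D.assoc C.p₁ (C.p₁.comp (C.t.comp C.i)) C.p₂).comp
    (C.mulT (.id C.p₁) (D.lunit C.p₂)) (by simp)

/-- The source of the fifth modification, `α (m (x, y), z, w) ≫ α (x, y, m (z, w))`. -/
def src₅ : Transf C.X₄ X₁ :=
  (D.assoc (C.mul C.r₁ C.r₂) C.r₃ C.r₄).comp (D.assoc C.r₁ C.r₂ (C.mul C.r₃ C.r₄)) (by simp)

/-- The first two factors `m (α (x, y, z), w) ≫ α (x, m (y, z), w)` of the target of the fifth
modification. -/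
def pre₅ : Transf C.X₄ X₁ :=
  (C.mulT (D.assoc C.r₁ C.r₂ C.r₃) (.id C.r₄)).comp
    (D.assoc C.r₁ (C.mul C.r₂ C.r₃) C.r₄) (by simp)

/-- The target of the fifth modification,
`(m (α (x, y, z), w) ≫ α (x, m (y, z), w)) ≫ m (x, α (y, z, w))`. -/
def tgt₅ : Transf C.X₄ X₁ :=
  D.pre₅.comp (C.mulT (.id C.r₁) (D.assoc C.r₂ C.r₃ C.r₄)) (by simp [pre₅])

theorem dom₁ : (D.lunit C.i).dom = (D.runit C.i).dom := by simp
theorem cod₁ : (D.lunit C.i).cod = (D.runit C.i).cod := by simp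
theorem dom₂ : D.src₂.dom = D.tgt₂.dom := by simp [src₂, tgt₂]
theorem cod₂ : D.src₂.cod = D.tgt₂.cod := by simp [src₂, tgt₂]
theorem dom₃ : D.src₃.dom = (D.runit C.m).dom := by simp [src₃]
theorem cod₃ : D.src₃.cod = (D.runit C.m).cod := by simp [src₃]
theorem dom₄ : D.src₄.dom = D.tgt₄.dom := by simp [src₄, tgt₄]
theorem cod₄ : D.src₄.cod = D.tgt₄.cod := by simp [src₄, tgt₄]
theorem dom₅ : D.src₅.dom = D.tgt₅.dom := by simp [src₅, pre₅, tgt₅]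
theorem cod₅ : D.src₅.cod = D.tgt₅.cod := by simp [src₅, tgt₅]

end CatData₂

/-- The 3-data of a category object in 2-categories: five invertible modifications, sent to
identities by the source and target functors. -/
structure CatData₃ {X₀ X₁ : TwoCat.{u}} {C : CatData₁ X₀ X₁} (D : CatData₂ C) where
  c₁ : Modif (D.lunit C.i) (D.runit C.i) D.dom₁ D.cod₁
  c₂ : Modif D.src₂ D.tgt₂ D.dom₂ D.cod₂
  c₃ : Modif D.src₃ (D.runit C.m) D.dom₃ D.cod₃
  c₄ : Modif D.src₄ D.tgt₄ D.dom₄ D.cod₄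
  c₅ : Modif D.src₅ D.tgt₅ D.dom₅ D.cod₅
  c₁_isGood : C.IsGood c₁
  c₂_isGood : C.IsGood c₂
  c₃_isGood : C.IsGood c₃
  c₄_isGood : C.IsGood c₄
  c₅_isGood : C.IsGood c₅

namespace CatData₁

variable {X₀ X₁ : TwoCat.{u}} (C : CatData₁ X₀ X₁)

/-- Horizontal composition of objects of the 2-category of 1-cells. -/
abbrev m₀ (x y : X₁.Ob) (h : C.t.ob x = C.s.ob y := by simp [*]) : X₁.Ob := C.m.ob ⟨(x, y), h⟩

/-- Horizontal composition of morphisms of the 2-category of 1-cells. -/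
abbrev m₁ (f g : X₁.Hom) (h : C.t.hom f = C.s.hom g := by simp [*]) : X₁.Hom :=
  C.m.hom ⟨(f, g), h⟩

/-- Horizontal composition of 2-morphisms of the 2-category of 1-cells. -/
abbrev m₂ (φ ψ : X₁.Hom₂) (h : C.t.hom₂ φ = C.s.hom₂ ψ := by simp [*]) : X₁.Hom₂ :=
  C.m.hom₂ ⟨(φ, ψ), h⟩

end CatData₁

namespace CatData₂

variable {X₀ X₁ : TwoCat.{u}} {C : CatData₁ X₀ X₁} (D : CatData₂ C)

/-- The component of the associator transformation at a composable triple of objects. -/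
abbrev A (x y z : X₁.Ob) (h : C.t.ob x = C.s.ob y := by simp [*])
    (h' : C.t.ob y = C.s.ob z := by simp [*]) : X₁.Hom := D.alp.app ⟨(⟨(x, y), h⟩, z), h'⟩

/-- The naturality 2-morphism of the associator transformation at a triple of morphisms. -/
abbrev An (f g k : X₁.Hom) (h : C.t.hom f = C.s.hom g := by simp [*])
    (h' : C.t.hom g = C.s.hom k := by simp [*]) : X₁.Hom₂ := D.alp.nat ⟨(⟨(f, g), h⟩, k), h'⟩

/-- The inverse naturality 2-morphism of the associator transformation at a triple of morphisms. -/
abbrev Ai (f g k : X₁.Hom) (h : C.t.hom f = C.s.hom g := by simp [*])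
    (h' : C.t.hom g = C.s.hom k := by simp [*]) : X₁.Hom₂ := D.alp.natInv ⟨(⟨(f, g), h⟩, k), h'⟩

end CatData₂

namespace CatData₃

variable {X₀ X₁ : TwoCat.{u}} {C : CatData₁ X₀ X₁} {D : CatData₂ C} (E : CatData₃ D)

/-- The component of the second modification at a composable pair. -/
abbrev b₂ (x y : X₁.Ob) (h : C.t.ob x = C.s.ob y := by simp [*]) : X₁.Hom₂ :=
  E.c₂.app ⟨(x, y), h⟩

/-- The component of the third modification at a composable pair. -/
abbrev b₃ (x y : X₁.Ob) (h : C.t.ob x = C.s.ob y := by simp [*]) : X₁.Hom₂ :=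
  E.c₃.app ⟨(x, y), h⟩

/-- The component of the fourth modification at a composable pair. -/
abbrev b₄ (x y : X₁.Ob) (h : C.t.ob x = C.s.ob y := by simp [*]) : X₁.Hom₂ :=
  E.c₄.app ⟨(x, y), h⟩

/-- The component of the fifth modification at a composable quadruple. -/
abbrev b₅ (x y z w : X₁.Ob) (h : C.t.ob x = C.s.ob y := by simp [*])
    (h' : C.t.ob y = C.s.ob z := by simp [*]) (h'' : C.t.ob z = C.s.ob w := by simp [*]) :
    X₁.Hom₂ :=
  E.c₅.app ⟨(⟨(⟨(x, y), h⟩, z), h'⟩, w), h''⟩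

@[simp] theorem s_c₁ (x) : C.s.hom₂ (E.c₁.app x) = X₀.one₂ (X₀.one x) := by
  simpa using E.c₁_isGood.s x
@[simp] theorem t_c₁ (x) : C.t.hom₂ (E.c₁.app x) = X₀.one₂ (X₀.one x) := by
  simpa using E.c₁_isGood.t x
@[simp] theorem s_c₂ (x) : C.s.hom₂ (E.c₂.app x) = X₀.one₂ (X₀.one (C.s.ob x.1.1)) := by
  simpa [CatData₂.src₂] using E.c₂_isGood.s x
@[simp] theorem t_c₂ (x) : C.t.hom₂ (E.c₂.app x) = X₀.one₂ (X₀.one (C.t.ob x.1.2)) := by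
  simpa [CatData₂.src₂] using E.c₂_isGood.t x
@[simp] theorem s_c₃ (x) : C.s.hom₂ (E.c₃.app x) = X₀.one₂ (X₀.one (C.s.ob x.1.1)) := by
  simpa [CatData₂.src₃] using E.c₃_isGood.s x
@[simp] theorem t_c₃ (x) : C.t.hom₂ (E.c₃.app x) = X₀.one₂ (X₀.one (C.t.ob x.1.2)) := by
  simpa [CatData₂.src₃] using E.c₃_isGood.t x
@[simp] theorem s_c₄ (x) : C.s.hom₂ (E.c₄.app x) = X₀.one₂ (X₀.one (C.s.ob x.1.1)) := by
  simpa [CatData₂.src₄] using E.c₄_isGood.s x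
@[simp] theorem t_c₄ (x) : C.t.hom₂ (E.c₄.app x) = X₀.one₂ (X₀.one (C.t.ob x.1.2)) := by
  simpa [CatData₂.src₄] using E.c₄_isGood.t x
@[simp] theorem s_c₅ (x) : C.s.hom₂ (E.c₅.app x) = X₀.one₂ (X₀.one (C.s.ob x.1.1.1.1.1.1)) := by
  simpa [CatData₂.src₅] using E.c₅_isGood.s x
@[simp] theorem t_c₅ (x) : C.t.hom₂ (E.c₅.app x) = X₀.one₂ (X₀.one (C.t.ob x.1.2)) := by
  simpa [CatData₂.src₅] using E.c₅_isGood.t x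

end CatData₃

/-- The identity 2-morphism on the identity morphism of an object. -/
abbrev TwoCat.o (B : TwoCat.{u}) (x : B.Ob) : B.Hom₂ := B.one₂ (B.one x)

namespace CatData₃

variable {X₀ X₁ : TwoCat.{u}} {C : CatData₁ X₀ X₁} {D : CatData₂ C} (E : CatData₃ D)

/-- First coherence axiom, for the triple `(1, 1, a)`. -/
def Ax₁ : Prop := ∀ a : X₁.Ob,
  X₁.Commutes
    [[C.m₂ (E.c₁.app (C.s.ob a)) (X₁.o a), X₁.one₂ (D.lam.app a)],
     [E.b₄ (C.i.ob (C.s.ob a)) a, X₁.one₂ (D.lam.app a)]]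
    [[E.b₂ (C.i.ob (C.s.ob a)) a, X₁.one₂ (D.lam.app a)],
     [X₁.one₂ (D.A (C.i.ob (C.s.ob a)) (C.i.ob (C.s.ob a)) a), D.lam.nat (D.lam.app a)]]

/-- First coherence axiom, variant for the triple `(a, 1, 1)`. -/
def Ax₁' : Prop := ∀ a : X₁.Ob,
  X₁.Commutes
    [[E.b₄ a (C.i.ob (C.t.ob a)), X₁.one₂ (D.rho.app a)],
     [X₁.one₂ (D.A a (C.i.ob (C.t.ob a)) (C.i.ob (C.t.ob a))),
      C.m₂ (X₁.o a) (E.c₁.app (C.t.ob a)), X₁.one₂ (D.rho.app a)],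
     [E.b₃ a (C.i.ob (C.t.ob a)), X₁.one₂ (D.rho.app a)],
     [D.rho.nat (D.rho.app a)]]
    [[X₁.one₂ (C.m₁ (D.rho.app a) (X₁.one (C.i.ob (C.t.ob a)))), X₁.one₂ (D.rho.app a)]]

/-- Second coherence axiom, for the triple `(1, a, 1)`. -/
def Ax₂ : Prop := ∀ a : X₁.Ob,
  X₁.Commutes
    [[E.b₂ a (C.i.ob (C.t.ob a)), X₁.one₂ (D.rho.app a)],
     [X₁.one₂ (D.A (C.i.ob (C.s.ob a)) a (C.i.ob (C.t.ob a))), D.lam.nat (D.rho.app a)],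
     [E.b₃ (C.i.ob (C.s.ob a)) a, X₁.one₂ (D.lam.app a)],
     [D.rho.nat (D.lam.app a)]]
    [[X₁.one₂ (C.m₁ (D.lam.app a) (X₁.one (C.i.ob (C.t.ob a)))), X₁.one₂ (D.rho.app a)]]

/-- Third coherence axiom, for the quadruple `(1, a, b, c)`. -/
def Ax₃ : Prop := ∀ (a b c : X₁.Ob) (hab : C.t.ob a = C.s.ob b) (hbc : C.t.ob b = C.s.ob c),
  X₁.Commutes
    [[D.An (D.lam.app a) (X₁.one b) (X₁.one c)],
     [C.m₂ (E.b₂ a b) (X₁.o c), X₁.one₂ (D.A a b c)],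
     [X₁.one₂ (C.m₁ (D.A (C.i.ob (C.s.ob a)) a b) (X₁.one c)),
      E.b₂ (C.m₀ a b) c, X₁.one₂ (D.A a b c)],
     [X₁.one₂ (C.m₁ (D.A (C.i.ob (C.s.ob a)) a b) (X₁.one c)),
      X₁.one₂ (D.A (C.i.ob (C.s.ob a)) (C.m₀ a b) c), D.lam.nat (D.A a b c)]]
    [[X₁.one₂ (D.A (C.m₀ (C.i.ob (C.s.ob a)) a) b c), E.b₂ a (C.m₀ b c)],
     [E.b₅ (C.i.ob (C.s.ob a)) a b c, X₁.one₂ (D.lam.app (C.m₀ a (C.m₀ b c)))]]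

/-- Third coherence axiom, variant for the quadruple `(a, b, c, 1)`. -/
def Ax₃' : Prop := ∀ (a b c : X₁.Ob) (hab : C.t.ob a = C.s.ob b) (hbc : C.t.ob b = C.s.ob c),
  X₁.Commutes
    [[E.b₅ a b c (C.i.ob (C.t.ob c)),
      X₁.one₂ (C.m₁ (X₁.one a) (C.m₁ (X₁.one b) (D.rho.app c)))],
     [X₁.one₂ (C.m₁ (D.A a b c) (X₁.one (C.i.ob (C.t.ob c)))),
      X₁.one₂ (D.A a (C.m₀ b c) (C.i.ob (C.t.ob c))),
      C.m₂ (X₁.o a) (E.b₃ b c)],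
     [X₁.one₂ (C.m₁ (D.A a b c) (X₁.one (C.i.ob (C.t.ob c)))),
      E.b₃ a (C.m₀ b c)]]
    [[X₁.one₂ (D.A (C.m₀ a b) c (C.i.ob (C.t.ob c))),
      D.An (X₁.one a) (X₁.one b) (D.rho.app c)],
     [E.b₃ (C.m₀ a b) c, X₁.one₂ (D.A a b c)],
     [D.rho.nat (D.A a b c)]]

/-- Fourth coherence axiom, for the quadruple `(a, 1, b, c)`. -/
def Ax₄ : Prop := ∀ (a b c : X₁.Ob) (hab : C.t.ob a = C.s.ob b) (hbc : C.t.ob b = C.s.ob c),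
  X₁.Commutes
    [[D.An (D.rho.app a) (X₁.one b) (X₁.one c)],
     [C.m₂ (E.b₄ a b) (X₁.o c), X₁.one₂ (D.A a b c)],
     [X₁.one₂ (C.m₁ (D.A a (C.i.ob (C.t.ob a)) b) (X₁.one c)),
      D.Ai (X₁.one a) (D.lam.app b) (X₁.one c)],
     [X₁.one₂ (C.m₁ (D.A a (C.i.ob (C.t.ob a)) b) (X₁.one c)),
      X₁.one₂ (D.A a (C.m₀ (C.i.ob (C.t.ob a)) b) c), C.m₂ (X₁.o a) (E.b₂ b c)]]
    [[X₁.one₂ (D.A (C.m₀ a (C.i.ob (C.t.ob a))) b c), E.b₄ a (C.m₀ b c)],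
     [E.b₅ a (C.i.ob (C.t.ob a)) b c,
      X₁.one₂ (C.m₁ (X₁.one a) (D.lam.app (C.m₀ b c)))]]

/-- Fourth coherence axiom, variant for the quadruple `(a, b, 1, c)`. -/
def Ax₄' : Prop := ∀ (a b c : X₁.Ob) (hab : C.t.ob a = C.s.ob b) (hbc : C.t.ob b = C.s.ob c),
  X₁.Commutes
    [[X₁.one₂ (C.m₁ (D.A a b (C.i.ob (C.t.ob b))) (X₁.one c)),
      D.An (X₁.one a) (D.rho.app b) (X₁.one c)],
     [C.m₂ (E.b₃ a b) (X₁.o c), X₁.one₂ (D.A a b c)],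
     [E.b₄ (C.m₀ a b) c, X₁.one₂ (D.A a b c)],
     [X₁.one₂ (D.A (C.m₀ a b) (C.i.ob (C.t.ob b)) c),
      D.Ai (X₁.one a) (X₁.one b) (D.lam.app c)],
     [E.b₅ a b (C.i.ob (C.t.ob b)) c,
      X₁.one₂ (C.m₁ (X₁.one a) (C.m₁ (X₁.one b) (D.lam.app c)))]]
    [[X₁.one₂ (C.m₁ (D.A a b (C.i.ob (C.t.ob b))) (X₁.one c)),
      X₁.one₂ (D.A a (C.m₀ b (C.i.ob (C.t.ob b))) c), C.m₂ (X₁.o a) (E.b₄ b c)]]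

/-- Fifth coherence axiom, for quintuples `(a, b, c, d, e)`. -/
def Ax₅ : Prop := ∀ (a b c d e : X₁.Ob) (hab : C.t.ob a = C.s.ob b) (hbc : C.t.ob b = C.s.ob c)
    (hcd : C.t.ob c = C.s.ob d) (hde : C.t.ob d = C.s.ob e),
  X₁.Commutes
    [[E.b₅ (C.m₀ a b) c d e, X₁.one₂ (D.A a b (C.m₀ c (C.m₀ d e)))],
     [X₁.one₂ (C.m₁ (D.A (C.m₀ a b) c d) (X₁.one e)),
      X₁.one₂ (D.A (C.m₀ a b) (C.m₀ c d) e),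
      D.Ai (X₁.one a) (X₁.one b) (D.A c d e)],
     [X₁.one₂ (C.m₁ (D.A (C.m₀ a b) c d) (X₁.one e)),
      E.b₅ a b (C.m₀ c d) e,
      X₁.one₂ (C.m₁ (X₁.one a) (C.m₁ (X₁.one b) (D.A c d e)))],
     [C.m₂ (E.b₅ a b c d) (X₁.o e), X₁.one₂ (D.A a (C.m₀ b (C.m₀ c d)) e),
      X₁.one₂ (C.m₁ (X₁.one a) (D.A b (C.m₀ c d) e)),
      X₁.one₂ (C.m₁ (X₁.one a) (C.m₁ (X₁.one b) (D.A c d e)))],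
     [X₁.one₂ (C.m₁ (C.m₁ (D.A a b c) (X₁.one d)) (X₁.one e)),
      X₁.one₂ (C.m₁ (D.A a (C.m₀ b c) d) (X₁.one e)),
      D.Ai (X₁.one a) (D.A b c d) (X₁.one e),
      X₁.one₂ (C.m₁ (X₁.one a) (D.A b (C.m₀ c d) e)),
      X₁.one₂ (C.m₁ (X₁.one a) (C.m₁ (X₁.one b) (D.A c d e)))]]
    [[X₁.one₂ (D.A (C.m₀ (C.m₀ a b) c) d e), E.b₅ a b c (C.m₀ d e)],
     [D.An (D.A a b c) (X₁.one d) (X₁.one e),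
      X₁.one₂ (D.A a (C.m₀ b c) (C.m₀ d e)),
      X₁.one₂ (C.m₁ (X₁.one a) (D.A b c (C.m₀ d e)))],
     [X₁.one₂ (C.m₁ (C.m₁ (D.A a b c) (X₁.one d)) (X₁.one e)),
      E.b₅ a (C.m₀ b c) d e,
      X₁.one₂ (C.m₁ (X₁.one a) (D.A b c (C.m₀ d e)))],
     [X₁.one₂ (C.m₁ (C.m₁ (D.A a b c) (X₁.one d)) (X₁.one e)),
      X₁.one₂ (C.m₁ (D.A a (C.m₀ b c) d) (X₁.one e)),
      X₁.one₂ (D.A a (C.m₀ (C.m₀ b c) d) e),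
      C.m₂ (X₁.o a) (E.b₅ b c d e)]]

end CatData₃

/-- A category object in the switch 3-category of 2-categories, strict functors, weak natural
transformations and modifications, with 2-category of 0-cells `X₀` and 2-category of 1-cells `X₁`.
-/
structure CatObj (X₀ X₁ : TwoCat.{u}) where
  data₁ : CatData₁ X₀ X₁
  data₂ : CatData₂ data₁
  data₃ : CatData₃ data₂
  ax₁ : data₃.Ax₁
  ax₁' : data₃.Ax₁'
  ax₂ : data₃.Ax₂
  ax₃ : data₃.Ax₃
  ax₃' : data₃.Ax₃'
  ax₄ : data₃.Ax₄
  ax₄' : data₃.Ax₄'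
  ax₅ : data₃.Ax₅

open CategoryTheory

/-- The strict pullback of categories: objects and morphisms are pairs with the same image. -/
structure Pb {A B C : Type u} [Category.{u} A] [Category.{u} B] [Category.{u} C]
    (F : A ⥤ C) (G : B ⥤ C) where
  fst : A
  snd : B
  w : F.obj fst = G.obj snd

namespace Pb

variable {A B C D E : Type u} [Category.{u} A] [Category.{u} B] [Category.{u} C] [Category.{u} D]
  [Category.{u} E]

instance (F : A ⥤ C) (G : B ⥤ C) : Category.{u} (Pb F G) where
  Hom (p q : Pb F G) := {f : (p.fst ⟶ q.fst) × (p.snd ⟶ q.snd) //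
    F.map f.1 ≫ eqToHom q.w = eqToHom p.w ≫ G.map f.2}
  id (p : Pb F G) := ⟨(𝟙 _, 𝟙 _), by simp⟩
  comp f g := ⟨(f.1.1 ≫ g.1.1, f.1.2 ≫ g.1.2), by
    have hf := f.2
    have hg := g.2
    simp only [Functor.map_comp, Category.assoc]
    rw [hg, ← Category.assoc, hf, Category.assoc]⟩

/-- The first projection. -/
def π₁ (F : A ⥤ C) (G : B ⥤ C) : Pb F G ⥤ A where
  obj p := p.fst
  map f := f.1.1

/-- The second projection. -/
def π₂ (F : A ⥤ C) (G : B ⥤ C) : Pb F G ⥤ B where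
  obj p := p.snd
  map f := f.1.2

/-- The functor into a strict pullback induced by two functors with the same image. -/
def lift {F : A ⥤ C} {G : B ⥤ C} (X : D ⥤ A) (Y : D ⥤ B) (h : X ⋙ F = Y ⋙ G) : D ⥤ Pb F G where
  obj d := ⟨X.obj d, Y.obj d, Functor.congr_obj h d⟩
  map f := ⟨(X.map f, Y.map f), by
    have := Functor.congr_hom h f
    simp only [Functor.comp_map] at this
    simp [this]⟩
  map_id d := Subtype.ext (Prod.ext (X.map_id d) (Y.map_id d))
  map_comp f g := Subtype.ext (Prod.ext (X.map_comp f g) (Y.map_comp f g))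

variable {F : A ⥤ C} {G : B ⥤ C}

@[simp] theorem π₁_obj (p : Pb F G) : (π₁ F G).obj p = p.fst := (rfl)
@[simp] theorem π₂_obj (p : Pb F G) : (π₂ F G).obj p = p.snd := (rfl)
@[simp] theorem π₁_map {p q : Pb F G} (f : p ⟶ q) : (π₁ F G).map f = f.1.1 := (rfl)
@[simp] theorem π₂_map {p q : Pb F G} (f : p ⟶ q) : (π₂ F G).map f = f.1.2 := (rfl)

@[simp] theorem functor_assoc (X : A ⥤ B) (Y : B ⥤ C) (Z : C ⥤ D) :
    (X ⋙ Y) ⋙ Z = X ⋙ (Y ⋙ Z) := (rfl)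

@[simp] theorem π₂_comp (F : A ⥤ C) (G : B ⥤ C) : π₂ F G ⋙ G = π₁ F G ⋙ F := by
  refine CategoryTheory.Functor.ext (fun p => p.w.symm) fun p q f => ?_
  have key : G.map f.1.2 = eqToHom p.w.symm ≫ F.map f.1.1 ≫ eqToHom q.w := by
    rw [f.2]
    simp
  exact key

@[simp] theorem π₂_comp_assoc (F : A ⥤ C) (G : B ⥤ C) (H : C ⥤ D) :
    π₂ F G ⋙ (G ⋙ H) = π₁ F G ⋙ (F ⋙ H) := by
  rw [← functor_assoc, π₂_comp, functor_assoc]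

@[simp] theorem lift_π₁ (X : D ⥤ A) (Y : D ⥤ B) (h : X ⋙ F = Y ⋙ G) :
    lift X Y h ⋙ π₁ F G = X := (rfl)

@[simp] theorem lift_π₂ (X : D ⥤ A) (Y : D ⥤ B) (h : X ⋙ F = Y ⋙ G) :
    lift X Y h ⋙ π₂ F G = Y := (rfl)

@[simp] theorem lift_π₁_assoc (X : D ⥤ A) (Y : D ⥤ B) (h : X ⋙ F = Y ⋙ G) (H : A ⥤ E) :
    lift X Y h ⋙ (π₁ F G ⋙ H) = X ⋙ H := (rfl)

@[simp] theorem lift_π₂_assoc (X : D ⥤ A) (Y : D ⥤ B) (h : X ⋙ F = Y ⋙ G) (H : B ⥤ E) :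
    lift X Y h ⋙ (π₂ F G ⋙ H) = Y ⋙ H := (rfl)

@[simp] theorem functor_comp_id (X : A ⥤ B) : X ⋙ 𝟭 B = X := (rfl)

@[simp] theorem functor_id_comp (X : A ⥤ B) : 𝟭 A ⋙ X = X := (rfl)

@[simp] theorem lift_eta (F : A ⥤ C) (G : B ⥤ C) (h : π₁ F G ⋙ F = π₂ F G ⋙ G) :
    lift (π₁ F G) (π₂ F G) h = 𝟭 _ := (rfl)

@[simp] theorem comp_lift (K : E ⥤ D) (X : D ⥤ A) (Y : D ⥤ B) (h : X ⋙ F = Y ⋙ G) :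
    K ⋙ lift X Y h = lift (K ⋙ X) (K ⋙ Y) (by simp [h]) := (rfl)

@[simp] theorem comp_lift_assoc {Z : Type u} [Category.{u} Z] (K : E ⥤ D) (X : D ⥤ A) (Y : D ⥤ B)
    (h : X ⋙ F = Y ⋙ G) (H : Pb F G ⥤ Z) :
    K ⋙ (lift X Y h ⋙ H) = lift (K ⋙ X) (K ⋙ Y) (by simp [h]) ⋙ H := (rfl)

end Pb

/-- A morphism is an identity, up to equality of its source and target. -/
def IsEqHom {A : Type u} [Category.{u} A] {x y : A} (f : x ⟶ y) : Prop :=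
  ∃ h : x = y, f = eqToHom h

namespace IsEqHom

variable {A B C : Type u} [Category.{u} A] [Category.{u} B] [Category.{u} C]

theorem id (x : A) : IsEqHom (𝟙 x) := ⟨rfl, rfl⟩

theorem map (F : A ⥤ B) {x y : A} {f : x ⟶ y} (h : IsEqHom f) : IsEqHom (F.map f) := by
  obtain ⟨rfl, rfl⟩ := h
  exact ⟨rfl, by simp⟩

theorem congr {F G : A ⥤ B} (e : F = G) {x y : A} {f : x ⟶ y} (h : IsEqHom (G.map f)) :
    IsEqHom (F.map f) := by
  subst e
  exact h

theorem inv {x y : A} (f : x ≅ y) (h : IsEqHom f.hom) : IsEqHom f.inv := by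
  obtain ⟨rfl, h⟩ := h
  refine ⟨rfl, ?_⟩
  rw [← cancel_epi f.hom, f.hom_inv_id, h]
  simp

theorem pair {F : A ⥤ C} {G : B ⥤ C} {p q : Pb F G} {f : p ⟶ q} (h₁ : IsEqHom f.1.1)
    (h₂ : IsEqHom f.1.2) : IsEqHom f := by
  obtain ⟨x, y, w⟩ := p
  obtain ⟨x', y', w'⟩ := q
  obtain ⟨⟨f₁, f₂⟩, hf⟩ := f
  obtain ⟨e₁, h₁⟩ := h₁
  obtain ⟨e₂, h₂⟩ := h₂
  dsimp only at e₁ e₂ h₁ h₂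
  subst e₁ e₂ h₁ h₂
  exact ⟨rfl, rfl⟩

theorem square {x y : A} {F : A ⥤ C} {G : B ⥤ C} {f : x ⟶ y} {z : B} (h : IsEqHom (F.map f))
    (w : F.obj x = G.obj z) (w' : F.obj y = G.obj z) :
    F.map f ≫ eqToHom w' = eqToHom w ≫ G.map (𝟙 z) := by
  obtain ⟨e, h⟩ := h
  rw [h]
  simp

theorem square' {x y : B} {F : A ⥤ C} {G : B ⥤ C} {f : x ⟶ y} {z : A} (h : IsEqHom (G.map f))
    (w : F.obj z = G.obj x) (w' : F.obj z = G.obj y) :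
    F.map (𝟙 z) ≫ eqToHom w' = eqToHom w ≫ G.map f := by
  obtain ⟨e, h⟩ := h
  rw [h]
  simp

end IsEqHom

/-- The 0-data of a bicategory object in categories: categories of 0-, 1- and 2-cells, source and
target functors `s`, `t` of 1-cells and `S`, `T` of 2-cells. -/
structure Cells where
  C₀ : Type u
  C₁ : Type u
  C₂ : Type u
  [cat₀ : Category.{u} C₀]
  [cat₁ : Category.{u} C₁]
  [cat₂ : Category.{u} C₂]
  s : C₁ ⥤ C₀
  t : C₁ ⥤ C₀
  S : C₂ ⥤ C₁
  T : C₂ ⥤ C₁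
  T_s : T ⋙ s = S ⋙ s
  T_t : T ⋙ t = S ⋙ t

attribute [instance] Cells.cat₀ Cells.cat₁ Cells.cat₂

namespace Cells

variable (K : Cells.{u})

attribute [simp] T_s T_t

@[simp] theorem T_s_assoc {X : Type u} [Category.{u} X] (F : K.C₀ ⥤ X) :
    K.T ⋙ (K.s ⋙ F) = K.S ⋙ (K.s ⋙ F) := by
  rw [← Pb.functor_assoc, T_s, Pb.functor_assoc]

@[simp] theorem T_t_assoc {X : Type u} [Category.{u} X] (F : K.C₀ ⥤ X) :
    K.T ⋙ (K.t ⋙ F) = K.S ⋙ (K.t ⋙ F) := by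
  rw [← Pb.functor_assoc, T_t, Pb.functor_assoc]

@[simp] theorem s_T_obj (u : K.C₂) : K.s.obj (K.T.obj u) = K.s.obj (K.S.obj u) :=
  Functor.congr_obj K.T_s u

@[simp] theorem t_T_obj (u : K.C₂) : K.t.obj (K.T.obj u) = K.t.obj (K.S.obj u) :=
  Functor.congr_obj K.T_t u

/-- A morphism of 2-cells is vertical if both the source and the target functor send it to an
identity. -/
def IsVert {u v : K.C₂} (f : u ⟶ v) : Prop := IsEqHom (K.S.map f) ∧ IsEqHom (K.T.map f)

/-- A natural isomorphism of functors to the category of 2-cells which the source and target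
functors send to an identity. -/
structure VIso {X : Type u} [Category.{u} X] (F G : X ⥤ K.C₂) where
  iso : F ≅ G
  isVert : ∀ x, K.IsVert (iso.hom.app x)

/-- A vertical morphism of 2-cells. -/
structure VArr where
  src : K.C₂
  tgt : K.C₂
  hom : src ⟶ tgt
  isVert : K.IsVert hom

/-- Composites of lists of vertical morphisms. -/
inductive Chain : List K.VArr → Arrow K.C₂ → Prop
  | single (e : K.VArr) : Chain [e] (Arrow.mk e.hom)
  | cons (e : K.VArr) (L : List K.VArr) (f : Arrow K.C₂) (h : e.tgt = f.left) :
      Chain L f → Chain (e :: L) (Arrow.mk (e.hom ≫ eqToHom h ≫ f.hom))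

/-- Two lists of vertical morphisms have a common composite. -/
def Commutes (L L' : List K.VArr) : Prop := ∃ f, K.Chain L f ∧ K.Chain L' f

variable {K}

theorem IsVert.inv {u v : K.C₂} (f : u ≅ v) (h : K.IsVert f.hom) : K.IsVert f.inv :=
  ⟨IsEqHom.inv (K.S.mapIso f) h.1, IsEqHom.inv (K.T.mapIso f) h.2⟩

/-- The inverse of a vertical isomorphism. -/
def VIso.symm {X : Type u} [Category.{u} X] {F G : X ⥤ K.C₂} (e : K.VIso F G) : K.VIso G F where
  iso := e.iso.symm
  isVert x := IsVert.inv (e.iso.app x) (e.isVert x)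

end Cells

/-- The 1-data of a bicategory object in categories: 1-cell identity `i`, horizontal composition
`m`, 2-cell identity `iv`, vertical composition `mv`, right and left whiskers `wr` and `wl`, left and
right 2-cell identities `il : m (i s x, x) ⟶ x` and `ir : m (x, i t x) ⟶ x`, and the associator
2-cell `a : m (m (x, y), z) ⟶ m (x, m (y, z))`, all compatible with sources and targets. -/
structure Data₁ (K : Cells.{u}) where
  i : K.C₀ ⥤ K.C₁
  m : Pb K.t K.s ⥤ K.C₁
  iv : K.C₁ ⥤ K.C₂
  mv : Pb K.T K.S ⥤ K.C₂
  wr : Pb (K.S ⋙ K.t) K.s ⥤ K.C₂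
  wl : Pb K.t (K.S ⋙ K.s) ⥤ K.C₂
  il : K.C₁ ⥤ K.C₂
  ir : K.C₁ ⥤ K.C₂
  a : Pb (Pb.π₂ K.t K.s ⋙ K.t) K.s ⥤ K.C₂
  i_s : i ⋙ K.s = 𝟭 K.C₀
  i_t : i ⋙ K.t = 𝟭 K.C₀
  m_s : m ⋙ K.s = Pb.π₁ K.t K.s ⋙ K.s
  m_t : m ⋙ K.t = Pb.π₂ K.t K.s ⋙ K.t
  iv_S : iv ⋙ K.S = 𝟭 K.C₁
  iv_T : iv ⋙ K.T = 𝟭 K.C₁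
  mv_S : mv ⋙ K.S = Pb.π₁ K.T K.S ⋙ K.S
  mv_T : mv ⋙ K.T = Pb.π₂ K.T K.S ⋙ K.T
  wr_S : wr ⋙ K.S =
    Pb.lift (Pb.π₁ (K.S ⋙ K.t) K.s ⋙ K.S) (Pb.π₂ (K.S ⋙ K.t) K.s) (by simp) ⋙ m
  wr_T : wr ⋙ K.T =
    Pb.lift (Pb.π₁ (K.S ⋙ K.t) K.s ⋙ K.T) (Pb.π₂ (K.S ⋙ K.t) K.s) (by simp) ⋙ m
  wl_S : wl ⋙ K.S =
    Pb.lift (Pb.π₁ K.t (K.S ⋙ K.s)) (Pb.π₂ K.t (K.S ⋙ K.s) ⋙ K.S) (by simp) ⋙ m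
  wl_T : wl ⋙ K.T =
    Pb.lift (Pb.π₁ K.t (K.S ⋙ K.s)) (Pb.π₂ K.t (K.S ⋙ K.s) ⋙ K.T) (by simp) ⋙ m
  il_S : il ⋙ K.S = Pb.lift (K.s ⋙ i) (𝟭 K.C₁) (by simp [i_t]) ⋙ m
  il_T : il ⋙ K.T = 𝟭 K.C₁
  ir_S : ir ⋙ K.S = Pb.lift (𝟭 K.C₁) (K.t ⋙ i) (by simp [i_s]) ⋙ m
  ir_T : ir ⋙ K.T = 𝟭 K.C₁
  a_S : a ⋙ K.S = Pb.lift (Pb.π₁ _ K.s ⋙ m) (Pb.π₂ _ K.s) (by simp [m_t]) ⋙ m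
  a_T : a ⋙ K.T = Pb.lift (Pb.π₁ _ K.s ⋙ Pb.π₁ K.t K.s)
    (Pb.lift (Pb.π₁ _ K.s ⋙ Pb.π₂ K.t K.s) (Pb.π₂ _ K.s) (by simp) ⋙ m)
    (by simp [m_s]) ⋙ m

namespace Data₁

variable {K : Cells.{u}} (P : Data₁ K) {X : Type u} [Category.{u} X]

attribute [simp] i_s i_t m_s m_t iv_S iv_T mv_S mv_T wr_S wr_T wl_S wl_T il_S il_T ir_S ir_T a_S a_T

section assoc

variable {Y : Type u} [Category.{u} Y]

@[simp] theorem i_s_assoc (F : K.C₀ ⥤ Y) : P.i ⋙ (K.s ⋙ F) = F := by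
  rw [← Pb.functor_assoc, i_s, Pb.functor_id_comp]

@[simp] theorem i_t_assoc (F : K.C₀ ⥤ Y) : P.i ⋙ (K.t ⋙ F) = F := by
  rw [← Pb.functor_assoc, i_t, Pb.functor_id_comp]

@[simp] theorem iv_S_assoc (F : K.C₁ ⥤ Y) : P.iv ⋙ (K.S ⋙ F) = F := by
  rw [← Pb.functor_assoc, iv_S, Pb.functor_id_comp]

@[simp] theorem iv_T_assoc (F : K.C₁ ⥤ Y) : P.iv ⋙ (K.T ⋙ F) = F := by
  rw [← Pb.functor_assoc, iv_T, Pb.functor_id_comp]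

@[simp] theorem m_s_assoc (F : K.C₀ ⥤ Y) :
    P.m ⋙ (K.s ⋙ F) = Pb.π₁ K.t K.s ⋙ K.s ⋙ F := by
  rw [← Pb.functor_assoc, m_s, Pb.functor_assoc]

@[simp] theorem m_t_assoc (F : K.C₀ ⥤ Y) :
    P.m ⋙ (K.t ⋙ F) = Pb.π₂ K.t K.s ⋙ K.t ⋙ F := by
  rw [← Pb.functor_assoc, m_t, Pb.functor_assoc]

@[simp] theorem mv_S_assoc (F : K.C₁ ⥤ Y) :
    P.mv ⋙ (K.S ⋙ F) = Pb.π₁ K.T K.S ⋙ K.S ⋙ F := by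
  rw [← Pb.functor_assoc, mv_S, Pb.functor_assoc]

@[simp] theorem mv_T_assoc (F : K.C₁ ⥤ Y) :
    P.mv ⋙ (K.T ⋙ F) = Pb.π₂ K.T K.S ⋙ K.T ⋙ F := by
  rw [← Pb.functor_assoc, mv_T, Pb.functor_assoc]

@[simp] theorem wr_S_assoc (F : K.C₁ ⥤ Y) : P.wr ⋙ (K.S ⋙ F) =
    Pb.lift (Pb.π₁ (K.S ⋙ K.t) K.s ⋙ K.S) (Pb.π₂ (K.S ⋙ K.t) K.s) (by simp) ⋙ P.m ⋙ F := by
  rw [← Pb.functor_assoc, wr_S, Pb.functor_assoc]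

@[simp] theorem wr_T_assoc (F : K.C₁ ⥤ Y) : P.wr ⋙ (K.T ⋙ F) =
    Pb.lift (Pb.π₁ (K.S ⋙ K.t) K.s ⋙ K.T) (Pb.π₂ (K.S ⋙ K.t) K.s) (by simp) ⋙ P.m ⋙ F := by
  rw [← Pb.functor_assoc, wr_T, Pb.functor_assoc]

@[simp] theorem wl_S_assoc (F : K.C₁ ⥤ Y) : P.wl ⋙ (K.S ⋙ F) =
    Pb.lift (Pb.π₁ K.t (K.S ⋙ K.s)) (Pb.π₂ K.t (K.S ⋙ K.s) ⋙ K.S) (by simp) ⋙ P.m ⋙ F := by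
  rw [← Pb.functor_assoc, wl_S, Pb.functor_assoc]

@[simp] theorem wl_T_assoc (F : K.C₁ ⥤ Y) : P.wl ⋙ (K.T ⋙ F) =
    Pb.lift (Pb.π₁ K.t (K.S ⋙ K.s)) (Pb.π₂ K.t (K.S ⋙ K.s) ⋙ K.T) (by simp) ⋙ P.m ⋙ F := by
  rw [← Pb.functor_assoc, wl_T, Pb.functor_assoc]

@[simp] theorem il_S_assoc (F : K.C₁ ⥤ Y) : P.il ⋙ (K.S ⋙ F) =
    Pb.lift (K.s ⋙ P.i) (𝟭 K.C₁) (by simp) ⋙ P.m ⋙ F := by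
  rw [← Pb.functor_assoc, il_S, Pb.functor_assoc]

@[simp] theorem il_T_assoc (F : K.C₁ ⥤ Y) : P.il ⋙ (K.T ⋙ F) = F := by
  rw [← Pb.functor_assoc, il_T, Pb.functor_id_comp]

@[simp] theorem ir_S_assoc (F : K.C₁ ⥤ Y) : P.ir ⋙ (K.S ⋙ F) =
    Pb.lift (𝟭 K.C₁) (K.t ⋙ P.i) (by simp) ⋙ P.m ⋙ F := by
  rw [← Pb.functor_assoc, ir_S, Pb.functor_assoc]

@[simp] theorem ir_T_assoc (F : K.C₁ ⥤ Y) : P.ir ⋙ (K.T ⋙ F) = F := by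
  rw [← Pb.functor_assoc, ir_T, Pb.functor_id_comp]

@[simp] theorem a_S_assoc (F : K.C₁ ⥤ Y) : P.a ⋙ (K.S ⋙ F) =
    Pb.lift (Pb.π₁ _ K.s ⋙ P.m) (Pb.π₂ _ K.s) (by simp) ⋙ P.m ⋙ F := by
  rw [← Pb.functor_assoc, a_S, Pb.functor_assoc]

@[simp] theorem a_T_assoc (F : K.C₁ ⥤ Y) : P.a ⋙ (K.T ⋙ F) =
    Pb.lift (Pb.π₁ _ K.s ⋙ Pb.π₁ K.t K.s)
      (Pb.lift (Pb.π₁ _ K.s ⋙ Pb.π₂ K.t K.s) (Pb.π₂ _ K.s) (by simp) ⋙ P.m)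
      (by simp) ⋙ P.m ⋙ F := by
  rw [← Pb.functor_assoc, a_T, Pb.functor_assoc]

end assoc

/-- Horizontal composition of functors to the category of 1-cells. -/
abbrev fm (x y : X ⥤ K.C₁) (h : x ⋙ K.t = y ⋙ K.s := by simp) : X ⥤ K.C₁ :=
  Pb.lift x y h ⋙ P.m

/-- Vertical composition of functors to the category of 2-cells. -/
abbrev fV (u v : X ⥤ K.C₂) (h : u ⋙ K.T = v ⋙ K.S := by simp) : X ⥤ K.C₂ :=
  Pb.lift u v h ⋙ P.mv

/-- Right whisker of functors. -/
abbrev fr (u : X ⥤ K.C₂) (y : X ⥤ K.C₁) (h : u ⋙ (K.S ⋙ K.t) = y ⋙ K.s := by simp) :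
    X ⥤ K.C₂ := Pb.lift u y h ⋙ P.wr

/-- Left whisker of functors. -/
abbrev fl (x : X ⥤ K.C₁) (u : X ⥤ K.C₂) (h : x ⋙ K.t = u ⋙ (K.S ⋙ K.s) := by simp) :
    X ⥤ K.C₂ := Pb.lift x u h ⋙ P.wl

/-- The associator 2-cell of functors to the category of 1-cells. -/
abbrev fa (x y z : X ⥤ K.C₁) (h : x ⋙ K.t = y ⋙ K.s := by simp)
    (h' : y ⋙ K.t = z ⋙ K.s := by simp) : X ⥤ K.C₂ :=
  Pb.lift (Pb.lift x y h) z (by simp [h']) ⋙ P.a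

end Data₁

namespace Cells

variable (K : Cells.{u})

/-- The category of composable pairs of 1-cells, with its projections. -/
abbrev D11 : Type u := Pb K.t K.s
abbrev d11₁ : K.D11 ⥤ K.C₁ := Pb.π₁ K.t K.s
abbrev d11₂ : K.D11 ⥤ K.C₁ := Pb.π₂ K.t K.s

/-- The category of composable triples of 1-cells, with its projections. -/
abbrev D111 : Type u := Pb (K.d11₂ ⋙ K.t) K.s
abbrev d111₁ : K.D111 ⥤ K.C₁ := Pb.π₁ (K.d11₂ ⋙ K.t) K.s ⋙ K.d11₁
abbrev d111₂ : K.D111 ⥤ K.C₁ := Pb.π₁ (K.d11₂ ⋙ K.t) K.s ⋙ K.d11₂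
abbrev d111₃ : K.D111 ⥤ K.C₁ := Pb.π₂ (K.d11₂ ⋙ K.t) K.s

/-- The category of composable quadruples of 1-cells, with its projections. -/
abbrev D1111 : Type u := Pb (K.d111₃ ⋙ K.t) K.s
abbrev d1111₁ : K.D1111 ⥤ K.C₁ := Pb.π₁ (K.d111₃ ⋙ K.t) K.s ⋙ K.d111₁
abbrev d1111₂ : K.D1111 ⥤ K.C₁ := Pb.π₁ (K.d111₃ ⋙ K.t) K.s ⋙ K.d111₂
abbrev d1111₃ : K.D1111 ⥤ K.C₁ := Pb.π₁ (K.d111₃ ⋙ K.t) K.s ⋙ K.d111₃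
abbrev d1111₄ : K.D1111 ⥤ K.C₁ := Pb.π₂ (K.d111₃ ⋙ K.t) K.s

/-- The category of vertically composable pairs of 2-cells, with its projections. -/
abbrev DV : Type u := Pb K.T K.S
abbrev dv₁ : K.DV ⥤ K.C₂ := Pb.π₁ K.T K.S
abbrev dv₂ : K.DV ⥤ K.C₂ := Pb.π₂ K.T K.S

/-- The category of vertically composable triples of 2-cells, with its projections. -/
abbrev DVV : Type u := Pb (K.dv₂ ⋙ K.T) K.S
abbrev dvv₁ : K.DVV ⥤ K.C₂ := Pb.π₁ (K.dv₂ ⋙ K.T) K.S ⋙ K.dv₁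
abbrev dvv₂ : K.DVV ⥤ K.C₂ := Pb.π₁ (K.dv₂ ⋙ K.T) K.S ⋙ K.dv₂
abbrev dvv₃ : K.DVV ⥤ K.C₂ := Pb.π₂ (K.dv₂ ⋙ K.T) K.S

/-- The category of vertically composable pairs of 2-cells followed by a 1-cell, with its projections. -/
abbrev DV1 : Type u := Pb (K.dv₁ ⋙ (K.S ⋙ K.t)) K.s
abbrev dv1₁ : K.DV1 ⥤ K.C₂ := Pb.π₁ (K.dv₁ ⋙ (K.S ⋙ K.t)) K.s ⋙ K.dv₁
abbrev dv1₂ : K.DV1 ⥤ K.C₂ := Pb.π₁ (K.dv₁ ⋙ (K.S ⋙ K.t)) K.s ⋙ K.dv₂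
abbrev dv1₃ : K.DV1 ⥤ K.C₁ := Pb.π₂ (K.dv₁ ⋙ (K.S ⋙ K.t)) K.s

/-- The category of vertically composable pairs of 2-cells preceded by a 1-cell, with its projections. -/
abbrev D1V : Type u := Pb K.t (K.dv₁ ⋙ (K.S ⋙ K.s))
abbrev d1v₁ : K.D1V ⥤ K.C₁ := Pb.π₁ K.t (K.dv₁ ⋙ (K.S ⋙ K.s))
abbrev d1v₂ : K.D1V ⥤ K.C₂ := Pb.π₂ K.t (K.dv₁ ⋙ (K.S ⋙ K.s)) ⋙ K.dv₁
abbrev d1v₃ : K.D1V ⥤ K.C₂ := Pb.π₂ K.t (K.dv₁ ⋙ (K.S ⋙ K.s)) ⋙ K.dv₂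

/-- The category of horizontally composable pairs of 2-cells, with its projections. -/
abbrev D22 : Type u := Pb (K.S ⋙ K.t) (K.S ⋙ K.s)
abbrev d22₁ : K.D22 ⥤ K.C₂ := Pb.π₁ (K.S ⋙ K.t) (K.S ⋙ K.s)
abbrev d22₂ : K.D22 ⥤ K.C₂ := Pb.π₂ (K.S ⋙ K.t) (K.S ⋙ K.s)

/-- The category of 2-cells followed by a 1-cell, with its projections. -/
abbrev D21 : Type u := Pb (K.S ⋙ K.t) K.s
abbrev d21₁ : K.D21 ⥤ K.C₂ := Pb.π₁ (K.S ⋙ K.t) K.s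
abbrev d21₂ : K.D21 ⥤ K.C₁ := Pb.π₂ (K.S ⋙ K.t) K.s

/-- The category of 2-cells preceded by a 1-cell, with its projections. -/
abbrev D12 : Type u := Pb K.t (K.S ⋙ K.s)
abbrev d12₁ : K.D12 ⥤ K.C₁ := Pb.π₁ K.t (K.S ⋙ K.s)
abbrev d12₂ : K.D12 ⥤ K.C₂ := Pb.π₂ K.t (K.S ⋙ K.s)

/-- The category of 2-cells followed by two 1-cells, with its projections. -/
abbrev D211 : Type u := Pb (K.d21₂ ⋙ K.t) K.s
abbrev d211₁ : K.D211 ⥤ K.C₂ := Pb.π₁ (K.d21₂ ⋙ K.t) K.s ⋙ K.d21₁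
abbrev d211₂ : K.D211 ⥤ K.C₁ := Pb.π₁ (K.d21₂ ⋙ K.t) K.s ⋙ K.d21₂
abbrev d211₃ : K.D211 ⥤ K.C₁ := Pb.π₂ (K.d21₂ ⋙ K.t) K.s

/-- The category of 2-cells preceded by two 1-cells, with its projections. -/
abbrev D112 : Type u := Pb (K.d11₂ ⋙ K.t) (K.S ⋙ K.s)
abbrev d112₁ : K.D112 ⥤ K.C₁ := Pb.π₁ (K.d11₂ ⋙ K.t) (K.S ⋙ K.s) ⋙ K.d11₁
abbrev d112₂ : K.D112 ⥤ K.C₁ := Pb.π₁ (K.d11₂ ⋙ K.t) (K.S ⋙ K.s) ⋙ K.d11₂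
abbrev d112₃ : K.D112 ⥤ K.C₂ := Pb.π₂ (K.d11₂ ⋙ K.t) (K.S ⋙ K.s)

/-- The category of 2-cells between two 1-cells, with its projections. -/
abbrev D121 : Type u := Pb (K.d12₂ ⋙ (K.S ⋙ K.t)) K.s
abbrev d121₁ : K.D121 ⥤ K.C₁ := Pb.π₁ (K.d12₂ ⋙ (K.S ⋙ K.t)) K.s ⋙ K.d12₁
abbrev d121₂ : K.D121 ⥤ K.C₂ := Pb.π₁ (K.d12₂ ⋙ (K.S ⋙ K.t)) K.s ⋙ K.d12₂
abbrev d121₃ : K.D121 ⥤ K.C₁ := Pb.π₂ (K.d12₂ ⋙ (K.S ⋙ K.t)) K.s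

end Cells

namespace Data₁

variable {K : Cells.{u}} (P : Data₁ K)

/-- The source of the 2-datum `b₁`. -/
def src₁ : K.C₂ ⥤ K.C₂ := P.fV (K.S ⋙ P.iv) (𝟭 K.C₂)

/-- The source of the 2-datum `b₂`. -/
def src₂ : K.C₂ ⥤ K.C₂ := P.fV (𝟭 K.C₂) (K.T ⋙ P.iv)

/-- The source and target of the 2-datum `b₃`. -/
def src₃ : K.DVV ⥤ K.C₂ := P.fV (P.fV K.dvv₁ K.dvv₂) K.dvv₃
def tgt₃ : K.DVV ⥤ K.C₂ := P.fV K.dvv₁ (P.fV K.dvv₂ K.dvv₃)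

/-- The source and target of the 2-datum `b₄`. -/
def src₄ : K.D11 ⥤ K.C₂ := P.fr (K.d11₁ ⋙ P.iv) K.d11₂
def tgt₄ : K.D11 ⥤ K.C₂ := P.m ⋙ P.iv

/-- The source and target of the 2-datum `b₅`. -/
def src₅ : K.D11 ⥤ K.C₂ := P.fl K.d11₁ (K.d11₂ ⋙ P.iv)
def tgt₅ : K.D11 ⥤ K.C₂ := P.m ⋙ P.iv

/-- The source and target of the 2-datum `b₆`. -/
def src₆ : K.DV1 ⥤ K.C₂ := P.fr (P.fV K.dv1₁ K.dv1₂) K.dv1₃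
def tgt₆ : K.DV1 ⥤ K.C₂ := P.fV (P.fr K.dv1₁ K.dv1₃) (P.fr K.dv1₂ K.dv1₃)

/-- The source and target of the 2-datum `b₇`. -/
def src₇ : K.D1V ⥤ K.C₂ := P.fl K.d1v₁ (P.fV K.d1v₂ K.d1v₃)
def tgt₇ : K.D1V ⥤ K.C₂ := P.fV (P.fl K.d1v₁ K.d1v₂) (P.fl K.d1v₁ K.d1v₃)

/-- The source and target of the 2-datum `b₈`. -/
def src₈ : K.D22 ⥤ K.C₂ := P.fV (P.fr K.d22₁ (K.d22₂ ⋙ K.S)) (P.fl (K.d22₁ ⋙ K.T) K.d22₂)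
def tgt₈ : K.D22 ⥤ K.C₂ := P.fV (P.fl (K.d22₁ ⋙ K.S) K.d22₂) (P.fr K.d22₁ (K.d22₂ ⋙ K.T))

/-- The source and target of the 2-datum `b₉`. -/
def src₉ : K.D211 ⥤ K.C₂ := P.fV (P.fr (P.fr K.d211₁ K.d211₂) K.d211₃) (P.fa (K.d211₁ ⋙ K.T)
  K.d211₂ K.d211₃)
def tgt₉ : K.D211 ⥤ K.C₂ := P.fV (P.fa (K.d211₁ ⋙ K.S) K.d211₂ K.d211₃) (P.fr K.d211₁ (P.fm
  K.d211₂ K.d211₃))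

/-- The source and target of the 2-datum `b₁₀`. -/
def src₁₀ : K.D112 ⥤ K.C₂ := P.fV (P.fl (P.fm K.d112₁ K.d112₂) K.d112₃) (P.fa K.d112₁ K.d112₂
  (K.d112₃ ⋙ K.T))
def tgt₁₀ : K.D112 ⥤ K.C₂ := P.fV (P.fa K.d112₁ K.d112₂ (K.d112₃ ⋙ K.S)) (P.fl K.d112₁ (P.fl
  K.d112₂ K.d112₃))

/-- The source and target of the 2-datum `b₁₁`. -/
def src₁₁ : K.D121 ⥤ K.C₂ := P.fV (P.fr (P.fl K.d121₁ K.d121₂) K.d121₃) (P.fa K.d121₁ (K.d121₂ ⋙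
  K.T) K.d121₃)
def tgt₁₁ : K.D121 ⥤ K.C₂ := P.fV (P.fa K.d121₁ (K.d121₂ ⋙ K.S) K.d121₃) (P.fl K.d121₁ (P.fr
  K.d121₂ K.d121₃))

/-- The source and target of the 2-datum `b₁₂`. -/
def src₁₂ : K.D1111 ⥤ K.C₂ := P.fV (P.fa (P.fm K.d1111₁ K.d1111₂) K.d1111₃ K.d1111₄) (P.fa
  K.d1111₁ K.d1111₂ (P.fm K.d1111₃ K.d1111₄))
def tgt₁₂ : K.D1111 ⥤ K.C₂ := P.fV (P.fV (P.fr (P.fa K.d1111₁ K.d1111₂ K.d1111₃) K.d1111₄) (P.fa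
  K.d1111₁ (P.fm K.d1111₂ K.d1111₃) K.d1111₄)) (P.fl K.d1111₁ (P.fa K.d1111₂ K.d1111₃ K.d1111₄))

/-- The source and target of the 2-datum `b₁₃`. -/
def src₁₃ : K.C₂ ⥤ K.C₂ := P.fV (P.fl (K.S ⋙ K.s ⋙ P.i) (𝟭 K.C₂)) (K.T ⋙ P.il)
def tgt₁₃ : K.C₂ ⥤ K.C₂ := P.fV (K.S ⋙ P.il) (𝟭 K.C₂)

/-- The source and target of the 2-datum `b₁₄`. -/
def src₁₄ : K.C₂ ⥤ K.C₂ := P.fV (P.fr (𝟭 K.C₂) (K.S ⋙ K.t ⋙ P.i)) (K.T ⋙ P.ir)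
def tgt₁₄ : K.C₂ ⥤ K.C₂ := P.fV (K.S ⋙ P.ir) (𝟭 K.C₂)

/-- The source and target of the 2-datum `b₁₅`. -/
def src₁₅ : K.C₀ ⥤ K.C₂ := P.i ⋙ P.il
def tgt₁₅ : K.C₀ ⥤ K.C₂ := P.i ⋙ P.ir

/-- The source and target of the 2-datum `b₁₆`. -/
def src₁₆ : K.D11 ⥤ K.C₂ := P.fr (K.d11₁ ⋙ P.il) K.d11₂
def tgt₁₆ : K.D11 ⥤ K.C₂ := P.fV (P.fa (K.d11₁ ⋙ K.s ⋙ P.i) K.d11₁ K.d11₂) (P.m ⋙ P.il)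

/-- The source and target of the 2-datum `b₁₇`. -/
def src₁₇ : K.D11 ⥤ K.C₂ := P.fV (P.fa K.d11₁ K.d11₂ (K.d11₂ ⋙ K.t ⋙ P.i)) (P.fl K.d11₁ (K.d11₂ ⋙
  P.ir))
def tgt₁₇ : K.D11 ⥤ K.C₂ := P.m ⋙ P.ir

/-- The source and target of the 2-datum `b₁₈`. -/
def src₁₈ : K.D11 ⥤ K.C₂ := P.fr (K.d11₁ ⋙ P.ir) K.d11₂
def tgt₁₈ : K.D11 ⥤ K.C₂ := P.fV (P.fa K.d11₁ (K.d11₁ ⋙ K.t ⋙ P.i) K.d11₂) (P.fl K.d11₁ (K.d11₂ ⋙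
  P.il))

end Data₁

/-- The 2-data of a bicategory object in categories: vertical natural isomorphisms. -/
structure Data₂ {K : Cells.{u}} (P : Data₁ K) where
  b₁ : K.VIso P.src₁ (𝟭 K.C₂)
  b₂ : K.VIso P.src₂ (𝟭 K.C₂)
  b₃ : K.VIso P.src₃ P.tgt₃
  b₄ : K.VIso P.src₄ P.tgt₄
  b₅ : K.VIso P.src₅ P.tgt₅
  b₆ : K.VIso P.src₆ P.tgt₆
  b₇ : K.VIso P.src₇ P.tgt₇
  b₈ : K.VIso P.src₈ P.tgt₈
  b₉ : K.VIso P.src₉ P.tgt₉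
  b₁₀ : K.VIso P.src₁₀ P.tgt₁₀
  b₁₁ : K.VIso P.src₁₁ P.tgt₁₁
  b₁₂ : K.VIso P.src₁₂ P.tgt₁₂
  b₁₃ : K.VIso P.src₁₃ P.tgt₁₃
  b₁₄ : K.VIso P.src₁₄ P.tgt₁₄
  b₁₅ : K.VIso P.src₁₅ P.tgt₁₅
  b₁₆ : K.VIso P.src₁₆ P.tgt₁₆
  b₁₇ : K.VIso P.src₁₇ P.tgt₁₇
  b₁₈ : K.VIso P.src₁₈ P.tgt₁₈

namespace Data₁

variable {K : Cells.{u}} (P : Data₁ K)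

@[simp] theorem s_i_obj (x) : K.s.obj (P.i.obj x) = x := Functor.congr_obj P.i_s x
@[simp] theorem t_i_obj (x) : K.t.obj (P.i.obj x) = x := Functor.congr_obj P.i_t x
@[simp] theorem s_m_obj (p) : K.s.obj (P.m.obj p) = K.s.obj p.fst := Functor.congr_obj P.m_s p
@[simp] theorem t_m_obj (p) : K.t.obj (P.m.obj p) = K.t.obj p.snd := Functor.congr_obj P.m_t p
@[simp] theorem S_iv_obj (x) : K.S.obj (P.iv.obj x) = x := Functor.congr_obj P.iv_S x
@[simp] theorem T_iv_obj (x) : K.T.obj (P.iv.obj x) = x := Functor.congr_obj P.iv_T x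
@[simp] theorem S_mv_obj (p) : K.S.obj (P.mv.obj p) = K.S.obj p.fst := Functor.congr_obj P.mv_S p
@[simp] theorem T_mv_obj (p) : K.T.obj (P.mv.obj p) = K.T.obj p.snd := Functor.congr_obj P.mv_T p
@[simp] theorem S_wr_obj (p) :
    K.S.obj (P.wr.obj p) = P.m.obj ⟨K.S.obj p.fst, p.snd, p.w⟩ := Functor.congr_obj P.wr_S p
@[simp] theorem T_wr_obj (p) :
    K.T.obj (P.wr.obj p) = P.m.obj ⟨K.T.obj p.fst, p.snd, (K.t_T_obj _).trans p.w⟩ :=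
  Functor.congr_obj P.wr_T p
@[simp] theorem S_wl_obj (p) :
    K.S.obj (P.wl.obj p) = P.m.obj ⟨p.fst, K.S.obj p.snd, p.w⟩ := Functor.congr_obj P.wl_S p
@[simp] theorem T_wl_obj (p) :
    K.T.obj (P.wl.obj p) = P.m.obj ⟨p.fst, K.T.obj p.snd, p.w.trans (K.s_T_obj _).symm⟩ :=
  Functor.congr_obj P.wl_T p
@[simp] theorem S_il_obj (x) :
    K.S.obj (P.il.obj x) = P.m.obj ⟨P.i.obj (K.s.obj x), x, P.t_i_obj _⟩ :=
  Functor.congr_obj P.il_S x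
@[simp] theorem T_il_obj (x) : K.T.obj (P.il.obj x) = x := Functor.congr_obj P.il_T x
@[simp] theorem S_ir_obj (x) :
    K.S.obj (P.ir.obj x) = P.m.obj ⟨x, P.i.obj (K.t.obj x), (P.s_i_obj _).symm⟩ :=
  Functor.congr_obj P.ir_S x
@[simp] theorem T_ir_obj (x) : K.T.obj (P.ir.obj x) = x := Functor.congr_obj P.ir_T x
@[simp] theorem S_a_obj (p) : K.S.obj (P.a.obj p) =
    P.m.obj ⟨P.m.obj p.fst, p.snd, (P.t_m_obj _).trans p.w⟩ := Functor.congr_obj P.a_S p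
@[simp] theorem T_a_obj (p) : K.T.obj (P.a.obj p) =
    P.m.obj ⟨p.fst.fst, P.m.obj ⟨p.fst.snd, p.snd, p.w⟩, p.fst.w.trans (P.s_m_obj ⟨p.fst.snd, p.snd, p.w⟩).symm⟩ :=
  Functor.congr_obj P.a_T p

/-- Horizontal composition of 1-cells. -/
abbrev om (x y : K.C₁) (h : K.t.obj x = K.s.obj y := by simp [*]) : K.C₁ := P.m.obj ⟨x, y, h⟩

/-- Vertical composition of 2-cells. -/
abbrev V (u v : K.C₂) (h : K.T.obj u = K.S.obj v := by simp [*]) : K.C₂ := P.mv.obj ⟨u, v, h⟩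

/-- Right whisker of a 2-cell by a 1-cell. -/
abbrev r (u : K.C₂) (y : K.C₁) (h : K.t.obj (K.S.obj u) = K.s.obj y := by simp [*]) : K.C₂ :=
  P.wr.obj ⟨u, y, h⟩

/-- Left whisker of a 2-cell by a 1-cell. -/
abbrev l (x : K.C₁) (u : K.C₂) (h : K.t.obj x = K.s.obj (K.S.obj u) := by simp [*]) : K.C₂ :=
  P.wl.obj ⟨x, u, h⟩

/-- The associator 2-cell. -/
abbrev A (x y z : K.C₁) (h : K.t.obj x = K.s.obj y := by simp [*])
    (h' : K.t.obj y = K.s.obj z := by simp [*]) : K.C₂ := P.a.obj ⟨⟨x, y, h⟩, z, h'⟩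

/-- Vertical composition of a vertical morphism with (the identity of) a 2-cell below. -/
abbrev eV (e : K.VArr) (v : K.C₂) (h : K.T.obj e.src = K.S.obj v := by simp [*]) : K.VArr where
  src := P.V e.src v h
  tgt := P.V e.tgt v (e.isVert.2.choose.symm.trans h)
  hom := P.mv.map ⟨(e.hom, 𝟙 v), e.isVert.2.square _ _⟩
  isVert := ⟨IsEqHom.congr P.mv_S e.isVert.1, IsEqHom.congr P.mv_T ((IsEqHom.id v).map K.T)⟩

/-- Vertical composition of a vertical morphism with (the identity of) a 2-cell above. -/
abbrev Ve (v : K.C₂) (e : K.VArr) (h : K.T.obj v = K.S.obj e.src := by simp [*]) : K.VArr where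
  src := P.V v e.src h
  tgt := P.V v e.tgt (h.trans e.isVert.1.choose)
  hom := P.mv.map ⟨(𝟙 v, e.hom), e.isVert.1.square' _ _⟩
  isVert := ⟨IsEqHom.congr P.mv_S ((IsEqHom.id v).map K.S), IsEqHom.congr P.mv_T e.isVert.2⟩

/-- Right whisker of a vertical morphism by a 1-cell. -/
abbrev er (e : K.VArr) (y : K.C₁) (h : K.t.obj (K.S.obj e.src) = K.s.obj y := by simp [*]) :
    K.VArr where
  src := P.r e.src y h
  tgt := P.r e.tgt y ((congrArg K.t.obj e.isVert.1.choose.symm).trans h)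
  hom := P.wr.map ⟨(e.hom, 𝟙 y), (e.isVert.1.map K.t).square (F := K.S ⋙ K.t) _ _⟩
  isVert := ⟨IsEqHom.congr P.wr_S (.map P.m (.pair e.isVert.1 (.id y))),
    IsEqHom.congr P.wr_T (.map P.m (.pair e.isVert.2 (.id y)))⟩

/-- Left whisker of a vertical morphism by a 1-cell. -/
abbrev le (x : K.C₁) (e : K.VArr) (h : K.t.obj x = K.s.obj (K.S.obj e.src) := by simp [*]) :
    K.VArr where
  src := P.l x e.src h
  tgt := P.l x e.tgt (h.trans (congrArg K.s.obj e.isVert.1.choose))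
  hom := P.wl.map ⟨(𝟙 x, e.hom), (e.isVert.1.map K.s).square' (G := K.S ⋙ K.s) _ _⟩
  isVert := ⟨IsEqHom.congr P.wl_S (.map P.m (.pair (.id x) e.isVert.1)),
    IsEqHom.congr P.wl_T (.map P.m (.pair (.id x) e.isVert.2))⟩

end Data₁

namespace Data₂

variable {K : Cells.{u}} {P : Data₁ K} (B : Data₂ P)

/-- Component of `b₁`. -/
abbrev e₁ (u : K.C₂) :
    K.VArr where
  src := P.V (P.iv.obj (K.S.obj u)) u
  tgt := u
  hom := B.b₁.iso.hom.app u
  isVert := B.b₁.isVert _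

/-- Component of `b₂`. -/
abbrev e₂ (u : K.C₂) :
    K.VArr where
  src := P.V u (P.iv.obj (K.T.obj u))
  tgt := u
  hom := B.b₂.iso.hom.app u
  isVert := B.b₂.isVert _

/-- Component of the inverse of `b₂`. -/
abbrev e₂i (u : K.C₂) :
    K.VArr where
  src := u
  tgt := P.V u (P.iv.obj (K.T.obj u))
  hom := B.b₂.iso.inv.app u
  isVert := B.b₂.symm.isVert _

/-- Component of `b₃`. -/
abbrev e₃ (u v w : K.C₂) (h : K.S.obj v = K.T.obj u := by simp [*]) (h' : K.S.obj w = K.T.obj v := by simp [*]) :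
    K.VArr where
  src := P.V (P.V u v) w
  tgt := P.V u (P.V v w)
  hom := B.b₃.iso.hom.app ⟨⟨u, v, h.symm⟩, w, h'.symm⟩
  isVert := B.b₃.isVert _

/-- Component of the inverse of `b₃`. -/
abbrev e₃i (u v w : K.C₂) (h : K.S.obj v = K.T.obj u := by simp [*]) (h' : K.S.obj w = K.T.obj v := by simp [*]) :
    K.VArr where
  src := P.V u (P.V v w)
  tgt := P.V (P.V u v) w
  hom := B.b₃.iso.inv.app ⟨⟨u, v, h.symm⟩, w, h'.symm⟩
  isVert := B.b₃.symm.isVert _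

/-- Component of `b₄`. -/
abbrev e₄ (x y : K.C₁) (h : K.s.obj y = K.t.obj x := by simp [*]) :
    K.VArr where
  src := P.r (P.iv.obj x) y
  tgt := P.iv.obj (P.om x y)
  hom := B.b₄.iso.hom.app ⟨x, y, h.symm⟩
  isVert := B.b₄.isVert _

/-- Component of `b₅`. -/
abbrev e₅ (x y : K.C₁) (h : K.s.obj y = K.t.obj x := by simp [*]) :
    K.VArr where
  src := P.l x (P.iv.obj y)
  tgt := P.iv.obj (P.om x y)
  hom := B.b₅.iso.hom.app ⟨x, y, h.symm⟩
  isVert := B.b₅.isVert _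

/-- Component of `b₆`. -/
abbrev e₆ (u v : K.C₂) (y : K.C₁) (h : K.S.obj v = K.T.obj u := by simp [*]) (h' : K.s.obj y = K.t.obj (K.S.obj u) := by simp [*]) :
    K.VArr where
  src := P.r (P.V u v) y
  tgt := P.V (P.r u y) (P.r v y)
  hom := B.b₆.iso.hom.app ⟨⟨u, v, h.symm⟩, y, h'.symm⟩
  isVert := B.b₆.isVert _

/-- Component of the inverse of `b₆`. -/
abbrev e₆i (u v : K.C₂) (y : K.C₁) (h : K.S.obj v = K.T.obj u := by simp [*]) (h' : K.s.obj y = K.t.obj (K.S.obj u) := by simp [*]) :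
    K.VArr where
  src := P.V (P.r u y) (P.r v y)
  tgt := P.r (P.V u v) y
  hom := B.b₆.iso.inv.app ⟨⟨u, v, h.symm⟩, y, h'.symm⟩
  isVert := B.b₆.symm.isVert _

/-- Component of `b₇`. -/
abbrev e₇ (x : K.C₁) (u v : K.C₂) (h : K.s.obj (K.S.obj u) = K.t.obj x := by simp [*]) (h' : K.S.obj v = K.T.obj u := by simp [*]) :
    K.VArr where
  src := P.l x (P.V u v)
  tgt := P.V (P.l x u) (P.l x v)
  hom := B.b₇.iso.hom.app ⟨x, ⟨u, v, h'.symm⟩, h.symm⟩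
  isVert := B.b₇.isVert _

/-- Component of the inverse of `b₇`. -/
abbrev e₇i (x : K.C₁) (u v : K.C₂) (h : K.s.obj (K.S.obj u) = K.t.obj x := by simp [*]) (h' : K.S.obj v = K.T.obj u := by simp [*]) :
    K.VArr where
  src := P.V (P.l x u) (P.l x v)
  tgt := P.l x (P.V u v)
  hom := B.b₇.iso.inv.app ⟨x, ⟨u, v, h'.symm⟩, h.symm⟩
  isVert := B.b₇.symm.isVert _

/-- Component of `b₈`. -/
abbrev e₈ (u v : K.C₂) (h : K.s.obj (K.S.obj v) = K.t.obj (K.S.obj u) := by simp [*]) :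
    K.VArr where
  src := P.V (P.r u (K.S.obj v)) (P.l (K.T.obj u) v)
  tgt := P.V (P.l (K.S.obj u) v) (P.r u (K.T.obj v))
  hom := B.b₈.iso.hom.app ⟨u, v, h.symm⟩
  isVert := B.b₈.isVert _

/-- Component of the inverse of `b₈`. -/
abbrev e₈i (u v : K.C₂) (h : K.s.obj (K.S.obj v) = K.t.obj (K.S.obj u) := by simp [*]) :
    K.VArr where
  src := P.V (P.l (K.S.obj u) v) (P.r u (K.T.obj v))
  tgt := P.V (P.r u (K.S.obj v)) (P.l (K.T.obj u) v)
  hom := B.b₈.iso.inv.app ⟨u, v, h.symm⟩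
  isVert := B.b₈.symm.isVert _

/-- Component of `b₉`. -/
abbrev e₉ (u : K.C₂) (y z : K.C₁) (h : K.s.obj y = K.t.obj (K.S.obj u) := by simp [*]) (h' : K.s.obj z = K.t.obj y := by simp [*]) :
    K.VArr where
  src := P.V (P.r (P.r u y) z) (P.A (K.T.obj u) y z)
  tgt := P.V (P.A (K.S.obj u) y z) (P.r u (P.om y z))
  hom := B.b₉.iso.hom.app ⟨⟨u, y, h.symm⟩, z, h'.symm⟩
  isVert := B.b₉.isVert _

/-- Component of the inverse of `b₉`. -/
abbrev e₉i (u : K.C₂) (y z : K.C₁) (h : K.s.obj y = K.t.obj (K.S.obj u) := by simp [*]) (h' : K.s.obj z = K.t.obj y := by simp [*]) :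
    K.VArr where
  src := P.V (P.A (K.S.obj u) y z) (P.r u (P.om y z))
  tgt := P.V (P.r (P.r u y) z) (P.A (K.T.obj u) y z)
  hom := B.b₉.iso.inv.app ⟨⟨u, y, h.symm⟩, z, h'.symm⟩
  isVert := B.b₉.symm.isVert _

/-- Component of `b₁₀`. -/
abbrev e₁₀ (x y : K.C₁) (u : K.C₂) (h : K.s.obj y = K.t.obj x := by simp [*]) (h' : K.s.obj (K.S.obj u) = K.t.obj y := by simp [*]) :
    K.VArr where
  src := P.V (P.l (P.om x y) u) (P.A x y (K.T.obj u))
  tgt := P.V (P.A x y (K.S.obj u)) (P.l x (P.l y u))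
  hom := B.b₁₀.iso.hom.app ⟨⟨x, y, h.symm⟩, u, h'.symm⟩
  isVert := B.b₁₀.isVert _

/-- Component of the inverse of `b₁₀`. -/
abbrev e₁₀i (x y : K.C₁) (u : K.C₂) (h : K.s.obj y = K.t.obj x := by simp [*]) (h' : K.s.obj (K.S.obj u) = K.t.obj y := by simp [*]) :
    K.VArr where
  src := P.V (P.A x y (K.S.obj u)) (P.l x (P.l y u))
  tgt := P.V (P.l (P.om x y) u) (P.A x y (K.T.obj u))
  hom := B.b₁₀.iso.inv.app ⟨⟨x, y, h.symm⟩, u, h'.symm⟩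
  isVert := B.b₁₀.symm.isVert _

/-- Component of `b₁₁`. -/
abbrev e₁₁ (x : K.C₁) (u : K.C₂) (z : K.C₁) (h : K.s.obj (K.S.obj u) = K.t.obj x := by simp [*]) (h' : K.s.obj z = K.t.obj (K.S.obj u) := by simp [*]) :
    K.VArr where
  src := P.V (P.r (P.l x u) z) (P.A x (K.T.obj u) z)
  tgt := P.V (P.A x (K.S.obj u) z) (P.l x (P.r u z))
  hom := B.b₁₁.iso.hom.app ⟨⟨x, u, h.symm⟩, z, h'.symm⟩
  isVert := B.b₁₁.isVert _

/-- Component of `b₁₂`. -/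
abbrev e₁₂ (x y z w : K.C₁) (h : K.s.obj y = K.t.obj x := by simp [*]) (h' : K.s.obj z = K.t.obj y := by simp [*]) (h'' : K.s.obj w = K.t.obj z := by simp [*]) :
    K.VArr where
  src := P.V (P.A (P.om x y) z w) (P.A x y (P.om z w))
  tgt := P.V (P.V (P.r (P.A x y z) w) (P.A x (P.om y z) w)) (P.l x (P.A y z w))
  hom := B.b₁₂.iso.hom.app ⟨⟨⟨x, y, h.symm⟩, z, h'.symm⟩, w, h''.symm⟩
  isVert := B.b₁₂.isVert _

/-- Component of `b₁₃`. -/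
abbrev e₁₃ (u : K.C₂) :
    K.VArr where
  src := P.V (P.l (P.i.obj (K.s.obj (K.S.obj u))) u) (P.il.obj (K.T.obj u))
  tgt := P.V (P.il.obj (K.S.obj u)) u
  hom := B.b₁₃.iso.hom.app u
  isVert := B.b₁₃.isVert _

/-- Component of the inverse of `b₁₃`. -/
abbrev e₁₃i (u : K.C₂) :
    K.VArr where
  src := P.V (P.il.obj (K.S.obj u)) u
  tgt := P.V (P.l (P.i.obj (K.s.obj (K.S.obj u))) u) (P.il.obj (K.T.obj u))
  hom := B.b₁₃.iso.inv.app u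
  isVert := B.b₁₃.symm.isVert _

/-- Component of `b₁₄`. -/
abbrev e₁₄ (u : K.C₂) :
    K.VArr where
  src := P.V (P.r u (P.i.obj (K.t.obj (K.S.obj u)))) (P.ir.obj (K.T.obj u))
  tgt := P.V (P.ir.obj (K.S.obj u)) u
  hom := B.b₁₄.iso.hom.app u
  isVert := B.b₁₄.isVert _

/-- Component of `b₁₅`. -/
abbrev e₁₅ (p : K.C₀) :
    K.VArr where
  src := P.il.obj (P.i.obj p)
  tgt := P.ir.obj (P.i.obj p)
  hom := B.b₁₅.iso.hom.app p
  isVert := B.b₁₅.isVert _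

/-- Component of `b₁₆`. -/
abbrev e₁₆ (x y : K.C₁) (h : K.s.obj y = K.t.obj x := by simp [*]) :
    K.VArr where
  src := P.r (P.il.obj x) y
  tgt := P.V (P.A (P.i.obj (K.s.obj x)) x y) (P.il.obj (P.om x y))
  hom := B.b₁₆.iso.hom.app ⟨x, y, h.symm⟩
  isVert := B.b₁₆.isVert _

/-- Component of `b₁₇`. -/
abbrev e₁₇ (x y : K.C₁) (h : K.s.obj y = K.t.obj x := by simp [*]) :
    K.VArr where
  src := P.V (P.A x y (P.i.obj (K.t.obj y))) (P.l x (P.ir.obj y))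
  tgt := P.ir.obj (P.om x y)
  hom := B.b₁₇.iso.hom.app ⟨x, y, h.symm⟩
  isVert := B.b₁₇.isVert _

/-- Component of `b₁₈`. -/
abbrev e₁₈ (x y : K.C₁) (h : K.s.obj y = K.t.obj x := by simp [*]) :
    K.VArr where
  src := P.r (P.ir.obj x) y
  tgt := P.V (P.A x (P.i.obj (K.t.obj x)) y) (P.l x (P.il.obj y))
  hom := B.b₁₈.iso.hom.app ⟨x, y, h.symm⟩
  isVert := B.b₁₈.isVert _

end Data₂

namespace Data₂

variable {K : Cells.{u}} {P : Data₁ K} (B : Data₂ P)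

/-- The two unit 2-data of vertical composition agree on 2-cell identities. -/
def Ax₁ : Prop := ∀ (x : K.C₁),
  K.Commutes
    [B.e₁ (P.iv.obj x)]
    [B.e₂ (P.iv.obj x)]

/-- Unit coherence of vertical composition, left. -/
def Ax₂ : Prop := ∀ (u v : K.C₂) (h : K.S.obj v = K.T.obj u),
  K.Commutes
    [B.e₃ (P.iv.obj (K.S.obj u)) u v, B.e₁ (P.V u v)]
    [P.eV (B.e₁ u) v]

/-- Unit coherence of vertical composition, right. -/
def Ax₂' : Prop := ∀ (u v : K.C₂) (h : K.S.obj v = K.T.obj u),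
  K.Commutes
    [B.e₂ (P.V u v)]
    [B.e₃ u v (P.iv.obj (K.T.obj v)), P.Ve u (B.e₂ v)]

/-- Unit coherence of vertical composition, middle. -/
def Ax₃ : Prop := ∀ (u v : K.C₂) (h : K.S.obj v = K.T.obj u),
  K.Commutes
    [P.eV (B.e₂ u) v]
    [B.e₃ u (P.iv.obj (K.T.obj u)) v, P.Ve u (B.e₁ v)]

/-- Pentagon for vertical composition. -/
def Ax₄ : Prop := ∀ (u v w c : K.C₂) (h : K.S.obj v = K.T.obj u) (h' : K.S.obj w = K.T.obj v) (h'' :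
    K.S.obj c = K.T.obj w),
  K.Commutes
    [B.e₃ (P.V u v) w c, B.e₃ u v (P.V w c)]
    [P.eV (B.e₃ u v w) c, B.e₃ u (P.V v w) c, P.Ve u (B.e₃ v w c)]

/-- Right whiskers and left units. -/
def Ax₅a : Prop := ∀ (u : K.C₂) (y : K.C₁) (h : K.s.obj y = K.t.obj (K.S.obj u)),
  K.Commutes
    [B.e₆ (P.iv.obj (K.S.obj u)) u y, P.eV (B.e₄ (K.S.obj u) y) (P.r u y), B.e₁ (P.r u y)]
    [P.er (B.e₁ u) y]

/-- Right whiskers and right units. -/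
def Ax₅b : Prop := ∀ (u : K.C₂) (y : K.C₁) (h : K.s.obj y = K.t.obj (K.S.obj u)),
  K.Commutes
    [B.e₆ u (P.iv.obj (K.T.obj u)) y, P.Ve (P.r u y) (B.e₄ (K.T.obj u) y), B.e₂ (P.r u y)]
    [P.er (B.e₂ u) y]

/-- Left whiskers and left units. -/
def Ax₅c : Prop := ∀ (x : K.C₁) (u : K.C₂) (h : K.s.obj (K.S.obj u) = K.t.obj x),
  K.Commutes
    [B.e₇ x (P.iv.obj (K.S.obj u)) u, P.eV (B.e₅ x (K.S.obj u)) (P.l x u), B.e₁ (P.l x u)]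
    [P.le x (B.e₁ u)]

/-- Left whiskers and right units. -/
def Ax₅d : Prop := ∀ (x : K.C₁) (u : K.C₂) (h : K.s.obj (K.S.obj u) = K.t.obj x),
  K.Commutes
    [B.e₇ x u (P.iv.obj (K.T.obj u)), P.Ve (P.l x u) (B.e₅ x (K.T.obj u)), B.e₂ (P.l x u)]
    [P.le x (B.e₂ u)]

/-- Interchange and identities, for `(1, v)`. -/
def Ax₆ : Prop := ∀ (x : K.C₁) (v : K.C₂) (h : K.s.obj (K.S.obj v) = K.t.obj x),
  K.Commutes
    [P.eV (B.e₄ x (K.S.obj v)) (P.l x v), B.e₁ (P.l x v)]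
    [B.e₈ (P.iv.obj x) v, P.Ve (P.l x v) (B.e₄ x (K.T.obj v)), B.e₂ (P.l x v)]

/-- Interchange and identities, for `(u, 1)`. -/
def Ax₆' : Prop := ∀ (u : K.C₂) (y : K.C₁) (h : K.s.obj y = K.t.obj (K.S.obj u)),
  K.Commutes
    [P.Ve (P.r u y) (B.e₅ (K.T.obj u) y), B.e₂ (P.r u y)]
    [B.e₈ u (P.iv.obj y), P.eV (B.e₅ (K.S.obj u) y) (P.r u y), B.e₁ (P.r u y)]

/-- Right whiskers and associativity. -/
def Ax₇ : Prop := ∀ (u v w : K.C₂) (y : K.C₁) (h : K.S.obj v = K.T.obj u) (h' : K.S.obj w = K.T.obj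
    v) (h'' : K.s.obj y = K.t.obj (K.S.obj u)),
  K.Commutes
    [B.e₆ (P.V u v) w y, P.eV (B.e₆ u v y) (P.r w y), B.e₃ (P.r u y) (P.r v y) (P.r w y)]
    [P.er (B.e₃ u v w) y, B.e₆ u (P.V v w) y, P.Ve (P.r u y) (B.e₆ v w y)]

/-- Left whiskers and associativity. -/
def Ax₇' : Prop := ∀ (x : K.C₁) (u v w : K.C₂) (h : K.s.obj (K.S.obj u) = K.t.obj x) (h' : K.S.obj v
    = K.T.obj u) (h'' : K.S.obj w = K.T.obj v),
  K.Commutes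
    [B.e₇ x (P.V u v) w, P.eV (B.e₇ x u v) (P.l x w), B.e₃ (P.l x u) (P.l x v) (P.l x w)]
    [P.le x (B.e₃ u v w), B.e₇ x u (P.V v w), P.Ve (P.l x u) (B.e₇ x v w)]

/-- Interchange and vertical composition, for `(V(u, w), v)`. -/
def Ax₈ : Prop := ∀ (u w v : K.C₂) (h : K.S.obj w = K.T.obj u) (h' : K.s.obj (K.S.obj v) = K.t.obj
    (K.S.obj u)),
  K.Commutes
    [P.eV (B.e₆ u w (K.S.obj v)) (P.l (K.T.obj w) v), B.e₃ (P.r u (K.S.obj v)) (P.r w (K.S.obj v))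
     (P.l (K.T.obj w) v), P.Ve (P.r u (K.S.obj v)) (B.e₈ w v), B.e₃i (P.r u (K.S.obj v)) (P.l
     (K.T.obj u) v) (P.r w (K.T.obj v)), P.eV (B.e₈ u v) (P.r w (K.T.obj v)), B.e₃ (P.l (K.S.obj u)
     v) (P.r u (K.T.obj v)) (P.r w (K.T.obj v))]
    [B.e₈ (P.V u w) v, P.Ve (P.l (K.S.obj u) v) (B.e₆ u w (K.T.obj v))]

/-- Interchange and vertical composition, for `(u, V(v, w))`. -/
def Ax₈' : Prop := ∀ (u v w : K.C₂) (h : K.s.obj (K.S.obj v) = K.t.obj (K.S.obj u)) (h' : K.S.obj w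
    = K.T.obj v),
  K.Commutes
    [P.Ve (P.r u (K.S.obj v)) (B.e₇ (K.T.obj u) v w), B.e₃i (P.r u (K.S.obj v)) (P.l (K.T.obj u) v)
     (P.l (K.T.obj u) w), P.eV (B.e₈ u v) (P.l (K.T.obj u) w), B.e₃ (P.l (K.S.obj u) v) (P.r u
     (K.T.obj v)) (P.l (K.T.obj u) w), P.Ve (P.l (K.S.obj u) v) (B.e₈ u w), B.e₃i (P.l (K.S.obj u)
     v) (P.l (K.S.obj u) w) (P.r u (K.T.obj w))]
    [B.e₈ u (P.V v w), P.eV (B.e₇ (K.S.obj u) v w) (P.r u (K.T.obj w))]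

/-- Associators and identities, for `(1, y, z)`. -/
def Ax₉ : Prop := ∀ (x y z : K.C₁) (h : K.s.obj y = K.t.obj x) (h' : K.s.obj z = K.t.obj y),
  K.Commutes
    [P.eV (P.er (B.e₄ x y) z) (P.A x y z), P.eV (B.e₄ (P.om x y) z) (P.A x y z), B.e₁ (P.A x y z),
     B.e₂i (P.A x y z)]
    [B.e₉ (P.iv.obj x) y z, P.Ve (P.A x y z) (B.e₄ x (P.om y z))]

/-- Associators and identities, for `(x, y, 1)`. -/
def Ax₉' : Prop := ∀ (x y z : K.C₁) (h : K.s.obj y = K.t.obj x) (h' : K.s.obj z = K.t.obj y),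
  K.Commutes
    [P.eV (B.e₅ (P.om x y) z) (P.A x y z), B.e₁ (P.A x y z), B.e₂i (P.A x y z)]
    [B.e₁₀ x y (P.iv.obj z), P.Ve (P.A x y z) (P.le x (B.e₅ y z)), P.Ve (P.A x y z) (B.e₅ x (P.om y
     z))]

/-- Associators and identities, for `(x, 1, z)`. -/
def Ax₁₀ : Prop := ∀ (x y z : K.C₁) (h : K.s.obj y = K.t.obj x) (h' : K.s.obj z = K.t.obj y),
  K.Commutes
    [P.eV (P.er (B.e₅ x y) z) (P.A x y z), P.eV (B.e₄ (P.om x y) z) (P.A x y z), B.e₁ (P.A x y z),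
     B.e₂i (P.A x y z)]
    [B.e₁₁ x (P.iv.obj y) z, P.Ve (P.A x y z) (P.le x (B.e₄ y z)), P.Ve (P.A x y z) (B.e₅ x (P.om y
     z))]

/-- Associators and vertical composition, for `(V(u, v), y, z)`. -/
def Ax₁₁ : Prop := ∀ (u v : K.C₂) (y z : K.C₁) (h : K.S.obj v = K.T.obj u) (h' : K.s.obj y = K.t.obj
    (K.S.obj u)) (h'' : K.s.obj z = K.t.obj y),
  K.Commutes
    [P.eV (P.er (B.e₆ u v y) z) (P.A (K.T.obj v) y z), P.eV (B.e₆ (P.r u y) (P.r v y) z) (P.A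
     (K.T.obj v) y z), B.e₃ (P.r (P.r u y) z) (P.r (P.r v y) z) (P.A (K.T.obj v) y z), P.Ve (P.r
     (P.r u y) z) (B.e₉ v y z), B.e₃i (P.r (P.r u y) z) (P.A (K.T.obj u) y z) (P.r v (P.om y z)),
     P.eV (B.e₉ u y z) (P.r v (P.om y z)), B.e₃ (P.A (K.S.obj u) y z) (P.r u (P.om y z)) (P.r v
     (P.om y z))]
    [B.e₉ (P.V u v) y z, P.Ve (P.A (K.S.obj u) y z) (B.e₆ u v (P.om y z))]

/-- Associators and vertical composition, for `(x, y, V(u, v))`. -/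
def Ax₁₁' : Prop := ∀ (x y : K.C₁) (u v : K.C₂) (h : K.s.obj y = K.t.obj x) (h' : K.s.obj (K.S.obj
    u) = K.t.obj y) (h'' : K.S.obj v = K.T.obj u),
  K.Commutes
    [P.eV (B.e₇ (P.om x y) u v) (P.A x y (K.T.obj v)), B.e₃ (P.l (P.om x y) u) (P.l (P.om x y) v)
     (P.A x y (K.T.obj v)), P.Ve (P.l (P.om x y) u) (B.e₁₀ x y v), B.e₃i (P.l (P.om x y) u) (P.A x y
     (K.T.obj u)) (P.l x (P.l y v)), P.eV (B.e₁₀ x y u) (P.l x (P.l y v)), B.e₃ (P.A x y (K.S.obj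
     u)) (P.l x (P.l y u)) (P.l x (P.l y v))]
    [B.e₁₀ x y (P.V u v), P.Ve (P.A x y (K.S.obj u)) (P.le x (B.e₇ y u v)), P.Ve (P.A x y (K.S.obj
     u)) (B.e₇ x (P.l y u) (P.l y v))]

/-- Associators and vertical composition, for `(x, V(u, v), z)`. -/
def Ax₁₂ : Prop := ∀ (x : K.C₁) (u v : K.C₂) (z : K.C₁) (h : K.s.obj (K.S.obj u) = K.t.obj x) (h' :
    K.s.obj z = K.t.obj (K.S.obj u)) (h'' : K.S.obj v = K.T.obj u),
  K.Commutes
    [P.eV (P.er (B.e₇ x u v) z) (P.A x (K.T.obj v) z), P.eV (B.e₆ (P.l x u) (P.l x v) z) (P.A x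
     (K.T.obj v) z), B.e₃ (P.r (P.l x u) z) (P.r (P.l x v) z) (P.A x (K.T.obj v) z), P.Ve (P.r (P.l
     x u) z) (B.e₁₁ x v z), B.e₃i (P.r (P.l x u) z) (P.A x (K.T.obj u) z) (P.l x (P.r v z)), P.eV
     (B.e₁₁ x u z) (P.l x (P.r v z)), B.e₃ (P.A x (K.S.obj u) z) (P.l x (P.r u z)) (P.l x (P.r v
     z))]
    [B.e₁₁ x (P.V u v) z, P.Ve (P.A x (K.S.obj u) z) (P.le x (B.e₆ u v z)), P.Ve (P.A x (K.S.obj u)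
     z) (B.e₇ x (P.r u z) (P.r v z))]

/-- Associators and interchange, for `(u, v, z)`. -/
def Ax₁₃ : Prop := ∀ (u v : K.C₂) (z : K.C₁) (h : K.s.obj (K.S.obj v) = K.t.obj (K.S.obj u)) (h' :
    K.s.obj z = K.t.obj (K.S.obj v)),
  K.Commutes
    [P.eV (P.er (B.e₈ u v) z) (P.A (K.T.obj u) (K.T.obj v) z), P.eV (B.e₆ (P.l (K.S.obj u) v) (P.r u
     (K.T.obj v)) z) (P.A (K.T.obj u) (K.T.obj v) z), B.e₃ (P.r (P.l (K.S.obj u) v) z) (P.r (P.r u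
     (K.T.obj v)) z) (P.A (K.T.obj u) (K.T.obj v) z), P.Ve (P.r (P.l (K.S.obj u) v) z) (B.e₉ u
     (K.T.obj v) z), B.e₃i (P.r (P.l (K.S.obj u) v) z) (P.A (K.S.obj u) (K.T.obj v) z) (P.r u (P.om
     (K.T.obj v) z)), P.eV (B.e₁₁ (K.S.obj u) v z) (P.r u (P.om (K.T.obj v) z)), B.e₃ (P.A (K.S.obj
     u) (K.S.obj v) z) (P.l (K.S.obj u) (P.r v z)) (P.r u (P.om (K.T.obj v) z))]
    [P.eV (B.e₆ (P.r u (K.S.obj v)) (P.l (K.T.obj u) v) z) (P.A (K.T.obj u) (K.T.obj v) z), B.e₃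
     (P.r (P.r u (K.S.obj v)) z) (P.r (P.l (K.T.obj u) v) z) (P.A (K.T.obj u) (K.T.obj v) z), P.Ve
     (P.r (P.r u (K.S.obj v)) z) (B.e₁₁ (K.T.obj u) v z), B.e₃i (P.r (P.r u (K.S.obj v)) z) (P.A
     (K.T.obj u) (K.S.obj v) z) (P.l (K.T.obj u) (P.r v z)), P.eV (B.e₉ u (K.S.obj v) z) (P.l
     (K.T.obj u) (P.r v z)), B.e₃ (P.A (K.S.obj u) (K.S.obj v) z) (P.r u (P.om (K.S.obj v) z)) (P.l
     (K.T.obj u) (P.r v z)), P.Ve (P.A (K.S.obj u) (K.S.obj v) z) (B.e₈ u (P.r v z))]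

/-- Associators and interchange, for `(x, u, v)`. -/
def Ax₁₃' : Prop := ∀ (x : K.C₁) (u v : K.C₂) (h : K.s.obj (K.S.obj u) = K.t.obj x) (h' : K.s.obj
    (K.S.obj v) = K.t.obj (K.S.obj u)),
  K.Commutes
    [P.eV (B.e₈ (P.l x u) v) (P.A x (K.T.obj u) (K.T.obj v)), B.e₃ (P.l (P.om x (K.S.obj u)) v) (P.r
     (P.l x u) (K.T.obj v)) (P.A x (K.T.obj u) (K.T.obj v)), P.Ve (P.l (P.om x (K.S.obj u)) v)
     (B.e₁₁ x u (K.T.obj v)), B.e₃i (P.l (P.om x (K.S.obj u)) v) (P.A x (K.S.obj u) (K.T.obj v))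
     (P.l x (P.r u (K.T.obj v))), P.eV (B.e₁₀ x (K.S.obj u) v) (P.l x (P.r u (K.T.obj v))), B.e₃
     (P.A x (K.S.obj u) (K.S.obj v)) (P.l x (P.l (K.S.obj u) v)) (P.l x (P.r u (K.T.obj v)))]
    [B.e₃ (P.r (P.l x u) (K.S.obj v)) (P.l (P.om x (K.T.obj u)) v) (P.A x (K.T.obj u) (K.T.obj v)),
     P.Ve (P.r (P.l x u) (K.S.obj v)) (B.e₁₀ x (K.T.obj u) v), B.e₃i (P.r (P.l x u) (K.S.obj v))
     (P.A x (K.T.obj u) (K.S.obj v)) (P.l x (P.l (K.T.obj u) v)), P.eV (B.e₁₁ x u (K.S.obj v)) (P.l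
     x (P.l (K.T.obj u) v)), B.e₃ (P.A x (K.S.obj u) (K.S.obj v)) (P.l x (P.r u (K.S.obj v))) (P.l x
     (P.l (K.T.obj u) v)), P.Ve (P.A x (K.S.obj u) (K.S.obj v)) (B.e₇i x (P.r u (K.S.obj v)) (P.l
     (K.T.obj u) v)), P.Ve (P.A x (K.S.obj u) (K.S.obj v)) (P.le x (B.e₈ u v)), P.Ve (P.A x (K.S.obj
     u) (K.S.obj v)) (B.e₇ x (P.l (K.S.obj u) v) (P.r u (K.T.obj v)))]

/-- Associators and interchange, for `(u, y, v)`. -/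
def Ax₁₄ : Prop := ∀ (u : K.C₂) (y : K.C₁) (v : K.C₂) (h : K.s.obj y = K.t.obj (K.S.obj u)) (h' :
    K.s.obj (K.S.obj v) = K.t.obj y),
  K.Commutes
    [P.eV (B.e₈ (P.r u y) v) (P.A (K.T.obj u) y (K.T.obj v)), B.e₃ (P.l (P.om (K.S.obj u) y) v) (P.r
     (P.r u y) (K.T.obj v)) (P.A (K.T.obj u) y (K.T.obj v)), P.Ve (P.l (P.om (K.S.obj u) y) v) (B.e₉
     u y (K.T.obj v)), B.e₃i (P.l (P.om (K.S.obj u) y) v) (P.A (K.S.obj u) y (K.T.obj v)) (P.r u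
     (P.om y (K.T.obj v))), P.eV (B.e₁₀ (K.S.obj u) y v) (P.r u (P.om y (K.T.obj v))), B.e₃ (P.A
     (K.S.obj u) y (K.S.obj v)) (P.l (K.S.obj u) (P.l y v)) (P.r u (P.om y (K.T.obj v)))]
    [B.e₃ (P.r (P.r u y) (K.S.obj v)) (P.l (P.om (K.T.obj u) y) v) (P.A (K.T.obj u) y (K.T.obj v)),
     P.Ve (P.r (P.r u y) (K.S.obj v)) (B.e₁₀ (K.T.obj u) y v), B.e₃i (P.r (P.r u y) (K.S.obj v))
     (P.A (K.T.obj u) y (K.S.obj v)) (P.l (K.T.obj u) (P.l y v)), P.eV (B.e₉ u y (K.S.obj v)) (P.l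
     (K.T.obj u) (P.l y v)), B.e₃ (P.A (K.S.obj u) y (K.S.obj v)) (P.r u (P.om y (K.S.obj v))) (P.l
     (K.T.obj u) (P.l y v)), P.Ve (P.A (K.S.obj u) y (K.S.obj v)) (B.e₈ u (P.l y v))]

/-- Compatibility of `b₁₂` with a 2-cell in the first place. -/
def Ax₁₅ : Prop := ∀ (u : K.C₂) (y z w : K.C₁) (h : K.s.obj y = K.t.obj (K.S.obj u)) (h' : K.s.obj z
    = K.t.obj y) (h'' : K.s.obj w = K.t.obj z),
  K.Commutes
    [P.eV (B.e₉ (P.r u y) z w) (P.A (K.T.obj u) y (P.om z w)), B.e₃ (P.A (P.om (K.S.obj u) y) z w)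
     (P.r (P.r u y) (P.om z w)) (P.A (K.T.obj u) y (P.om z w)), P.Ve (P.A (P.om (K.S.obj u) y) z w)
     (B.e₉ u y (P.om z w)), B.e₃i (P.A (P.om (K.S.obj u) y) z w) (P.A (K.S.obj u) y (P.om z w)) (P.r
     u (P.om y (P.om z w))), P.eV (B.e₁₂ (K.S.obj u) y z w) (P.r u (P.om y (P.om z w)))]
    [B.e₃ (P.r (P.r (P.r u y) z) w) (P.A (P.om (K.T.obj u) y) z w) (P.A (K.T.obj u) y (P.om z w)),
     P.Ve (P.r (P.r (P.r u y) z) w) (B.e₁₂ (K.T.obj u) y z w), B.e₃i (P.r (P.r (P.r u y) z) w) (P.V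
     (P.r (P.A (K.T.obj u) y z) w) (P.A (K.T.obj u) (P.om y z) w)) (P.l (K.T.obj u) (P.A y z w)),
     P.eV (B.e₃i (P.r (P.r (P.r u y) z) w) (P.r (P.A (K.T.obj u) y z) w) (P.A (K.T.obj u) (P.om y z)
     w)) (P.l (K.T.obj u) (P.A y z w)), P.eV (P.eV (B.e₆i (P.r (P.r u y) z) (P.A (K.T.obj u) y z) w)
     (P.A (K.T.obj u) (P.om y z) w)) (P.l (K.T.obj u) (P.A y z w)), P.eV (P.eV (P.er (B.e₉ u y z) w)
     (P.A (K.T.obj u) (P.om y z) w)) (P.l (K.T.obj u) (P.A y z w)), P.eV (P.eV (B.e₆ (P.A (K.S.obj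
     u) y z) (P.r u (P.om y z)) w) (P.A (K.T.obj u) (P.om y z) w)) (P.l (K.T.obj u) (P.A y z w)),
     P.eV (B.e₃ (P.r (P.A (K.S.obj u) y z) w) (P.r (P.r u (P.om y z)) w) (P.A (K.T.obj u) (P.om y z)
     w)) (P.l (K.T.obj u) (P.A y z w)), P.eV (P.Ve (P.r (P.A (K.S.obj u) y z) w) (B.e₉ u (P.om y z)
     w)) (P.l (K.T.obj u) (P.A y z w)), P.eV (B.e₃i (P.r (P.A (K.S.obj u) y z) w) (P.A (K.S.obj u)
     (P.om y z) w) (P.r u (P.om (P.om y z) w))) (P.l (K.T.obj u) (P.A y z w)), B.e₃ (P.V (P.r (P.A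
     (K.S.obj u) y z) w) (P.A (K.S.obj u) (P.om y z) w)) (P.r u (P.om (P.om y z) w)) (P.l (K.T.obj
     u) (P.A y z w)), P.Ve (P.V (P.r (P.A (K.S.obj u) y z) w) (P.A (K.S.obj u) (P.om y z) w)) (B.e₈
     u (P.A y z w)), B.e₃i (P.V (P.r (P.A (K.S.obj u) y z) w) (P.A (K.S.obj u) (P.om y z) w)) (P.l
     (K.S.obj u) (P.A y z w)) (P.r u (P.om y (P.om z w)))]

/-- Compatibility of `b₁₂` with a 2-cell in the fourth place. -/
def Ax₁₅' : Prop := ∀ (x y z : K.C₁) (u : K.C₂) (h : K.s.obj y = K.t.obj x) (h' : K.s.obj z =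
    K.t.obj y) (h'' : K.s.obj (K.S.obj u) = K.t.obj z),
  K.Commutes
    [P.eV (B.e₁₀ (P.om x y) z u) (P.A x y (P.om z (K.T.obj u))), B.e₃ (P.A (P.om x y) z (K.S.obj u))
     (P.l (P.om x y) (P.l z u)) (P.A x y (P.om z (K.T.obj u))), P.Ve (P.A (P.om x y) z (K.S.obj u))
     (B.e₁₀ x y (P.l z u)), B.e₃i (P.A (P.om x y) z (K.S.obj u)) (P.A x y (P.om z (K.S.obj u))) (P.l
     x (P.l y (P.l z u))), P.eV (B.e₁₂ x y z (K.S.obj u)) (P.l x (P.l y (P.l z u)))]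
    [B.e₃ (P.l (P.om (P.om x y) z) u) (P.A (P.om x y) z (K.T.obj u)) (P.A x y (P.om z (K.T.obj u))),
     P.Ve (P.l (P.om (P.om x y) z) u) (B.e₁₂ x y z (K.T.obj u)), B.e₃i (P.l (P.om (P.om x y) z) u)
     (P.V (P.r (P.A x y z) (K.T.obj u)) (P.A x (P.om y z) (K.T.obj u))) (P.l x (P.A y z (K.T.obj
     u))), P.eV (B.e₃i (P.l (P.om (P.om x y) z) u) (P.r (P.A x y z) (K.T.obj u)) (P.A x (P.om y z)
     (K.T.obj u))) (P.l x (P.A y z (K.T.obj u))), P.eV (P.eV (B.e₈i (P.A x y z) u) (P.A x (P.om y z)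
     (K.T.obj u))) (P.l x (P.A y z (K.T.obj u))), P.eV (B.e₃ (P.r (P.A x y z) (K.S.obj u)) (P.l
     (P.om x (P.om y z)) u) (P.A x (P.om y z) (K.T.obj u))) (P.l x (P.A y z (K.T.obj u))), P.eV
     (P.Ve (P.r (P.A x y z) (K.S.obj u)) (B.e₁₀ x (P.om y z) u)) (P.l x (P.A y z (K.T.obj u))), P.eV
     (B.e₃i (P.r (P.A x y z) (K.S.obj u)) (P.A x (P.om y z) (K.S.obj u)) (P.l x (P.l (P.om y z) u)))
     (P.l x (P.A y z (K.T.obj u))), B.e₃ (P.V (P.r (P.A x y z) (K.S.obj u)) (P.A x (P.om y z)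
     (K.S.obj u))) (P.l x (P.l (P.om y z) u)) (P.l x (P.A y z (K.T.obj u))), P.Ve (P.V (P.r (P.A x y
     z) (K.S.obj u)) (P.A x (P.om y z) (K.S.obj u))) (B.e₇i x (P.l (P.om y z) u) (P.A y z (K.T.obj
     u))), P.Ve (P.V (P.r (P.A x y z) (K.S.obj u)) (P.A x (P.om y z) (K.S.obj u))) (P.le x (B.e₁₀ y
     z u)), P.Ve (P.V (P.r (P.A x y z) (K.S.obj u)) (P.A x (P.om y z) (K.S.obj u))) (B.e₇ x (P.A y z
     (K.S.obj u)) (P.l y (P.l z u))), B.e₃i (P.V (P.r (P.A x y z) (K.S.obj u)) (P.A x (P.om y z)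
     (K.S.obj u))) (P.l x (P.A y z (K.S.obj u))) (P.l x (P.l y (P.l z u)))]

/-- Compatibility of `b₁₂` with a 2-cell in the second place. -/
def Ax₁₆ : Prop := ∀ (x : K.C₁) (u : K.C₂) (z w : K.C₁) (h : K.s.obj (K.S.obj u) = K.t.obj x) (h' :
    K.s.obj z = K.t.obj (K.S.obj u)) (h'' : K.s.obj w = K.t.obj z),
  K.Commutes
    [P.eV (B.e₉ (P.l x u) z w) (P.A x (K.T.obj u) (P.om z w)), B.e₃ (P.A (P.om x (K.S.obj u)) z w)
     (P.r (P.l x u) (P.om z w)) (P.A x (K.T.obj u) (P.om z w)), P.Ve (P.A (P.om x (K.S.obj u)) z w)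
     (B.e₁₁ x u (P.om z w)), B.e₃i (P.A (P.om x (K.S.obj u)) z w) (P.A x (K.S.obj u) (P.om z w))
     (P.l x (P.r u (P.om z w))), P.eV (B.e₁₂ x (K.S.obj u) z w) (P.l x (P.r u (P.om z w)))]
    [B.e₃ (P.r (P.r (P.l x u) z) w) (P.A (P.om x (K.T.obj u)) z w) (P.A x (K.T.obj u) (P.om z w)),
     P.Ve (P.r (P.r (P.l x u) z) w) (B.e₁₂ x (K.T.obj u) z w), B.e₃i (P.r (P.r (P.l x u) z) w) (P.V
     (P.r (P.A x (K.T.obj u) z) w) (P.A x (P.om (K.T.obj u) z) w)) (P.l x (P.A (K.T.obj u) z w)),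
     P.eV (B.e₃i (P.r (P.r (P.l x u) z) w) (P.r (P.A x (K.T.obj u) z) w) (P.A x (P.om (K.T.obj u) z)
     w)) (P.l x (P.A (K.T.obj u) z w)), P.eV (P.eV (B.e₆i (P.r (P.l x u) z) (P.A x (K.T.obj u) z) w)
     (P.A x (P.om (K.T.obj u) z) w)) (P.l x (P.A (K.T.obj u) z w)), P.eV (P.eV (P.er (B.e₁₁ x u z)
     w) (P.A x (P.om (K.T.obj u) z) w)) (P.l x (P.A (K.T.obj u) z w)), P.eV (P.eV (B.e₆ (P.A x
     (K.S.obj u) z) (P.l x (P.r u z)) w) (P.A x (P.om (K.T.obj u) z) w)) (P.l x (P.A (K.T.obj u) z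
     w)), P.eV (B.e₃ (P.r (P.A x (K.S.obj u) z) w) (P.r (P.l x (P.r u z)) w) (P.A x (P.om (K.T.obj
     u) z) w)) (P.l x (P.A (K.T.obj u) z w)), P.eV (P.Ve (P.r (P.A x (K.S.obj u) z) w) (B.e₁₁ x (P.r
     u z) w)) (P.l x (P.A (K.T.obj u) z w)), P.eV (B.e₃i (P.r (P.A x (K.S.obj u) z) w) (P.A x (P.om
     (K.S.obj u) z) w) (P.l x (P.r (P.r u z) w))) (P.l x (P.A (K.T.obj u) z w)), B.e₃ (P.V (P.r (P.A
     x (K.S.obj u) z) w) (P.A x (P.om (K.S.obj u) z) w)) (P.l x (P.r (P.r u z) w)) (P.l x (P.A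
     (K.T.obj u) z w)), P.Ve (P.V (P.r (P.A x (K.S.obj u) z) w) (P.A x (P.om (K.S.obj u) z) w))
     (B.e₇i x (P.r (P.r u z) w) (P.A (K.T.obj u) z w)), P.Ve (P.V (P.r (P.A x (K.S.obj u) z) w) (P.A
     x (P.om (K.S.obj u) z) w)) (P.le x (B.e₉ u z w)), P.Ve (P.V (P.r (P.A x (K.S.obj u) z) w) (P.A
     x (P.om (K.S.obj u) z) w)) (B.e₇ x (P.A (K.S.obj u) z w) (P.r u (P.om z w))), B.e₃i (P.V (P.r
     (P.A x (K.S.obj u) z) w) (P.A x (P.om (K.S.obj u) z) w)) (P.l x (P.A (K.S.obj u) z w)) (P.l x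
     (P.r u (P.om z w)))]

/-- Compatibility of `b₁₂` with a 2-cell in the third place. -/
def Ax₁₆' : Prop := ∀ (x y : K.C₁) (u : K.C₂) (w : K.C₁) (h : K.s.obj y = K.t.obj x) (h' : K.s.obj
    (K.S.obj u) = K.t.obj y) (h'' : K.s.obj w = K.t.obj (K.S.obj u)),
  K.Commutes
    [P.eV (B.e₁₁ (P.om x y) u w) (P.A x y (P.om (K.T.obj u) w)), B.e₃ (P.A (P.om x y) (K.S.obj u) w)
     (P.l (P.om x y) (P.r u w)) (P.A x y (P.om (K.T.obj u) w)), P.Ve (P.A (P.om x y) (K.S.obj u) w)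
     (B.e₁₀ x y (P.r u w)), B.e₃i (P.A (P.om x y) (K.S.obj u) w) (P.A x y (P.om (K.S.obj u) w)) (P.l
     x (P.l y (P.r u w))), P.eV (B.e₁₂ x y (K.S.obj u) w) (P.l x (P.l y (P.r u w)))]
    [B.e₃ (P.r (P.l (P.om x y) u) w) (P.A (P.om x y) (K.T.obj u) w) (P.A x y (P.om (K.T.obj u) w)),
     P.Ve (P.r (P.l (P.om x y) u) w) (B.e₁₂ x y (K.T.obj u) w), B.e₃i (P.r (P.l (P.om x y) u) w)
     (P.V (P.r (P.A x y (K.T.obj u)) w) (P.A x (P.om y (K.T.obj u)) w)) (P.l x (P.A y (K.T.obj u)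
     w)), P.eV (B.e₃i (P.r (P.l (P.om x y) u) w) (P.r (P.A x y (K.T.obj u)) w) (P.A x (P.om y
     (K.T.obj u)) w)) (P.l x (P.A y (K.T.obj u) w)), P.eV (P.eV (B.e₆i (P.l (P.om x y) u) (P.A x y
     (K.T.obj u)) w) (P.A x (P.om y (K.T.obj u)) w)) (P.l x (P.A y (K.T.obj u) w)), P.eV (P.eV (P.er
     (B.e₁₀ x y u) w) (P.A x (P.om y (K.T.obj u)) w)) (P.l x (P.A y (K.T.obj u) w)), P.eV (P.eV
     (B.e₆ (P.A x y (K.S.obj u)) (P.l x (P.l y u)) w) (P.A x (P.om y (K.T.obj u)) w)) (P.l x (P.A y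
     (K.T.obj u) w)), P.eV (B.e₃ (P.r (P.A x y (K.S.obj u)) w) (P.r (P.l x (P.l y u)) w) (P.A x
     (P.om y (K.T.obj u)) w)) (P.l x (P.A y (K.T.obj u) w)), P.eV (P.Ve (P.r (P.A x y (K.S.obj u))
     w) (B.e₁₁ x (P.l y u) w)) (P.l x (P.A y (K.T.obj u) w)), P.eV (B.e₃i (P.r (P.A x y (K.S.obj u))
     w) (P.A x (P.om y (K.S.obj u)) w) (P.l x (P.r (P.l y u) w))) (P.l x (P.A y (K.T.obj u) w)),
     B.e₃ (P.V (P.r (P.A x y (K.S.obj u)) w) (P.A x (P.om y (K.S.obj u)) w)) (P.l x (P.r (P.l y u)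
     w)) (P.l x (P.A y (K.T.obj u) w)), P.Ve (P.V (P.r (P.A x y (K.S.obj u)) w) (P.A x (P.om y
     (K.S.obj u)) w)) (B.e₇i x (P.r (P.l y u) w) (P.A y (K.T.obj u) w)), P.Ve (P.V (P.r (P.A x y
     (K.S.obj u)) w) (P.A x (P.om y (K.S.obj u)) w)) (P.le x (B.e₁₁ y u w)), P.Ve (P.V (P.r (P.A x y
     (K.S.obj u)) w) (P.A x (P.om y (K.S.obj u)) w)) (B.e₇ x (P.A y (K.S.obj u) w) (P.l y (P.r u
     w))), B.e₃i (P.V (P.r (P.A x y (K.S.obj u)) w) (P.A x (P.om y (K.S.obj u)) w)) (P.l x (P.A y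
     (K.S.obj u) w)) (P.l x (P.l y (P.r u w)))]

/-- Associahedron for five composable 1-cells. -/
def Ax₁₇ : Prop := ∀ (x y z v w : K.C₁) (h : K.s.obj y = K.t.obj x) (h' : K.s.obj z = K.t.obj y)
    (h'' : K.s.obj v = K.t.obj z) (h''' : K.s.obj w = K.t.obj v),
  K.Commutes
    [P.eV (B.e₁₂ (P.om x y) z v w) (P.A x y (P.om z (P.om v w))), B.e₃ (P.V (P.r (P.A (P.om x y) z
     v) w) (P.A (P.om x y) (P.om z v) w)) (P.l (P.om x y) (P.A z v w)) (P.A x y (P.om z (P.om v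
     w))), P.Ve (P.V (P.r (P.A (P.om x y) z v) w) (P.A (P.om x y) (P.om z v) w)) (B.e₁₀ x y (P.A z v
     w)), B.e₃i (P.V (P.r (P.A (P.om x y) z v) w) (P.A (P.om x y) (P.om z v) w)) (P.A x y (P.om
     (P.om z v) w)) (P.l x (P.l y (P.A z v w))), P.eV (B.e₃ (P.r (P.A (P.om x y) z v) w) (P.A (P.om
     x y) (P.om z v) w) (P.A x y (P.om (P.om z v) w))) (P.l x (P.l y (P.A z v w))), P.eV (P.Ve (P.r
     (P.A (P.om x y) z v) w) (B.e₁₂ x y (P.om z v) w)) (P.l x (P.l y (P.A z v w))), P.eV (B.e₃i (P.r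
     (P.A (P.om x y) z v) w) (P.V (P.r (P.A x y (P.om z v)) w) (P.A x (P.om y (P.om z v)) w)) (P.l x
     (P.A y (P.om z v) w))) (P.l x (P.l y (P.A z v w))), P.eV (P.eV (B.e₃i (P.r (P.A (P.om x y) z v)
     w) (P.r (P.A x y (P.om z v)) w) (P.A x (P.om y (P.om z v)) w)) (P.l x (P.A y (P.om z v) w)))
     (P.l x (P.l y (P.A z v w))), P.eV (P.eV (P.eV (B.e₆i (P.A (P.om x y) z v) (P.A x y (P.om z v))
     w) (P.A x (P.om y (P.om z v)) w)) (P.l x (P.A y (P.om z v) w))) (P.l x (P.l y (P.A z v w))),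
     P.eV (P.eV (P.eV (P.er (B.e₁₂ x y z v) w) (P.A x (P.om y (P.om z v)) w)) (P.l x (P.A y (P.om z
     v) w))) (P.l x (P.l y (P.A z v w))), P.eV (P.eV (P.eV (B.e₆ (P.V (P.r (P.A x y z) v) (P.A x
     (P.om y z) v)) (P.l x (P.A y z v)) w) (P.A x (P.om y (P.om z v)) w)) (P.l x (P.A y (P.om z v)
     w))) (P.l x (P.l y (P.A z v w))), P.eV (P.eV (P.eV (P.eV (B.e₆ (P.r (P.A x y z) v) (P.A x (P.om
     y z) v) w) (P.r (P.l x (P.A y z v)) w)) (P.A x (P.om y (P.om z v)) w)) (P.l x (P.A y (P.om z v)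
     w))) (P.l x (P.l y (P.A z v w))), P.eV (P.eV (B.e₃ (P.V (P.r (P.r (P.A x y z) v) w) (P.r (P.A x
     (P.om y z) v) w)) (P.r (P.l x (P.A y z v)) w) (P.A x (P.om y (P.om z v)) w)) (P.l x (P.A y
     (P.om z v) w))) (P.l x (P.l y (P.A z v w))), P.eV (P.eV (P.Ve (P.V (P.r (P.r (P.A x y z) v) w)
     (P.r (P.A x (P.om y z) v) w)) (B.e₁₁ x (P.A y z v) w)) (P.l x (P.A y (P.om z v) w))) (P.l x
     (P.l y (P.A z v w)))]
    [B.e₃ (P.A (P.om (P.om x y) z) v w) (P.A (P.om x y) z (P.om v w)) (P.A x y (P.om z (P.om v w))),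
     P.Ve (P.A (P.om (P.om x y) z) v w) (B.e₁₂ x y z (P.om v w)), B.e₃i (P.A (P.om (P.om x y) z) v
     w) (P.V (P.r (P.A x y z) (P.om v w)) (P.A x (P.om y z) (P.om v w))) (P.l x (P.A y z (P.om v
     w))), P.eV (B.e₃i (P.A (P.om (P.om x y) z) v w) (P.r (P.A x y z) (P.om v w)) (P.A x (P.om y z)
     (P.om v w))) (P.l x (P.A y z (P.om v w))), P.eV (P.eV (B.e₉i (P.A x y z) v w) (P.A x (P.om y z)
     (P.om v w))) (P.l x (P.A y z (P.om v w))), P.eV (B.e₃ (P.r (P.r (P.A x y z) v) w) (P.A (P.om x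
     (P.om y z)) v w) (P.A x (P.om y z) (P.om v w))) (P.l x (P.A y z (P.om v w))), P.eV (P.Ve (P.r
     (P.r (P.A x y z) v) w) (B.e₁₂ x (P.om y z) v w)) (P.l x (P.A y z (P.om v w))), P.eV (B.e₃i (P.r
     (P.r (P.A x y z) v) w) (P.V (P.r (P.A x (P.om y z) v) w) (P.A x (P.om (P.om y z) v) w)) (P.l x
     (P.A (P.om y z) v w))) (P.l x (P.A y z (P.om v w))), B.e₃ (P.V (P.r (P.r (P.A x y z) v) w) (P.V
     (P.r (P.A x (P.om y z) v) w) (P.A x (P.om (P.om y z) v) w))) (P.l x (P.A (P.om y z) v w)) (P.l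
     x (P.A y z (P.om v w))), P.Ve (P.V (P.r (P.r (P.A x y z) v) w) (P.V (P.r (P.A x (P.om y z) v)
     w) (P.A x (P.om (P.om y z) v) w))) (B.e₇i x (P.A (P.om y z) v w) (P.A y z (P.om v w))), P.Ve
     (P.V (P.r (P.r (P.A x y z) v) w) (P.V (P.r (P.A x (P.om y z) v) w) (P.A x (P.om (P.om y z) v)
     w))) (P.le x (B.e₁₂ y z v w)), P.Ve (P.V (P.r (P.r (P.A x y z) v) w) (P.V (P.r (P.A x (P.om y
     z) v) w) (P.A x (P.om (P.om y z) v) w))) (B.e₇ x (P.V (P.r (P.A y z v) w) (P.A y (P.om z v) w))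
     (P.l y (P.A z v w))), P.Ve (P.V (P.r (P.r (P.A x y z) v) w) (P.V (P.r (P.A x (P.om y z) v) w)
     (P.A x (P.om (P.om y z) v) w))) (P.eV (B.e₇ x (P.r (P.A y z v) w) (P.A y (P.om z v) w)) (P.l x
     (P.l y (P.A z v w)))), P.eV (B.e₃i (P.r (P.r (P.A x y z) v) w) (P.r (P.A x (P.om y z) v) w)
     (P.A x (P.om (P.om y z) v) w)) (P.V (P.V (P.l x (P.r (P.A y z v) w)) (P.l x (P.A y (P.om z v)
     w))) (P.l x (P.l y (P.A z v w)))), B.e₃i (P.V (P.V (P.r (P.r (P.A x y z) v) w) (P.r (P.A x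
     (P.om y z) v) w)) (P.A x (P.om (P.om y z) v) w)) (P.V (P.l x (P.r (P.A y z v) w)) (P.l x (P.A y
     (P.om z v) w))) (P.l x (P.l y (P.A z v w))), P.eV (B.e₃i (P.V (P.V (P.r (P.r (P.A x y z) v) w)
     (P.r (P.A x (P.om y z) v) w)) (P.A x (P.om (P.om y z) v) w)) (P.l x (P.r (P.A y z v) w)) (P.l x
     (P.A y (P.om z v) w))) (P.l x (P.l y (P.A z v w))), P.eV (P.eV (B.e₃ (P.V (P.r (P.r (P.A x y z)
     v) w) (P.r (P.A x (P.om y z) v) w)) (P.A x (P.om (P.om y z) v) w) (P.l x (P.r (P.A y z v) w)))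
     (P.l x (P.A y (P.om z v) w))) (P.l x (P.l y (P.A z v w)))]

/-- Left 2-cell identities and identities. -/
def Ax₁₈ : Prop := ∀ (x : K.C₁),
  K.Commutes
    [P.eV (B.e₅ (P.i.obj (K.s.obj x)) x) (P.il.obj x), B.e₁ (P.il.obj x)]
    [B.e₁₃ (P.iv.obj x), B.e₂ (P.il.obj x)]

/-- Right 2-cell identities and identities. -/
def Ax₁₈' : Prop := ∀ (x : K.C₁),
  K.Commutes
    [P.eV (B.e₄ x (P.i.obj (K.t.obj x))) (P.ir.obj x), B.e₁ (P.ir.obj x)]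
    [B.e₁₄ (P.iv.obj x), B.e₂ (P.ir.obj x)]

/-- Left 2-cell identities and vertical composition. -/
def Ax₁₉ : Prop := ∀ (u v : K.C₂) (h : K.S.obj v = K.T.obj u),
  K.Commutes
    [P.eV (B.e₇ (P.i.obj (K.s.obj (K.S.obj u))) u v) (P.il.obj (K.T.obj v)), B.e₃ (P.l (P.i.obj
     (K.s.obj (K.S.obj u))) u) (P.l (P.i.obj (K.s.obj (K.S.obj u))) v) (P.il.obj (K.T.obj v)), P.Ve
     (P.l (P.i.obj (K.s.obj (K.S.obj u))) u) (B.e₁₃ v), B.e₃i (P.l (P.i.obj (K.s.obj (K.S.obj u)))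
     u) (P.il.obj (K.T.obj u)) v, P.eV (B.e₁₃ u) v, B.e₃ (P.il.obj (K.S.obj u)) u v]
    [B.e₁₃ (P.V u v)]

/-- Right 2-cell identities and vertical composition. -/
def Ax₁₉' : Prop := ∀ (u v : K.C₂) (h : K.S.obj v = K.T.obj u),
  K.Commutes
    [P.eV (B.e₆ u v (P.i.obj (K.t.obj (K.S.obj u)))) (P.ir.obj (K.T.obj v)), B.e₃ (P.r u (P.i.obj
     (K.t.obj (K.S.obj u)))) (P.r v (P.i.obj (K.t.obj (K.S.obj u)))) (P.ir.obj (K.T.obj v)), P.Ve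
     (P.r u (P.i.obj (K.t.obj (K.S.obj u)))) (B.e₁₄ v), B.e₃i (P.r u (P.i.obj (K.t.obj (K.S.obj
     u)))) (P.ir.obj (K.T.obj u)) v, P.eV (B.e₁₄ u) v, B.e₃ (P.ir.obj (K.S.obj u)) u v]
    [B.e₁₄ (P.V u v)]

/-- Compatibility of `b₁₈` with a 2-cell in the first place. -/
def Ax₂₀ : Prop := ∀ (u : K.C₂) (y : K.C₁) (h : K.s.obj y = K.t.obj (K.S.obj u)),
  K.Commutes
    [B.e₆i (P.r u (P.i.obj (K.t.obj (K.S.obj u)))) (P.ir.obj (K.T.obj u)) y, P.er (B.e₁₄ u) y, B.e₆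
     (P.ir.obj (K.S.obj u)) u y, P.eV (B.e₁₈ (K.S.obj u) y) (P.r u y)]
    [P.Ve (P.r (P.r u (P.i.obj (K.t.obj (K.S.obj u)))) y) (B.e₁₈ (K.T.obj u) y), B.e₃i (P.r (P.r u
     (P.i.obj (K.t.obj (K.S.obj u)))) y) (P.A (K.T.obj u) (P.i.obj (K.t.obj (K.S.obj u))) y) (P.l
     (K.T.obj u) (P.il.obj y)), P.eV (B.e₉ u (P.i.obj (K.t.obj (K.S.obj u))) y) (P.l (K.T.obj u)
     (P.il.obj y)), B.e₃ (P.A (K.S.obj u) (P.i.obj (K.t.obj (K.S.obj u))) y) (P.r u (P.om (P.i.obj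
     (K.t.obj (K.S.obj u))) y)) (P.l (K.T.obj u) (P.il.obj y)), P.Ve (P.A (K.S.obj u) (P.i.obj
     (K.t.obj (K.S.obj u))) y) (B.e₈ u (P.il.obj y)), B.e₃i (P.A (K.S.obj u) (P.i.obj (K.t.obj
     (K.S.obj u))) y) (P.l (K.S.obj u) (P.il.obj y)) (P.r u y)]

/-- Compatibility of `b₁₈` with a 2-cell in the second place. -/
def Ax₂₀' : Prop := ∀ (x : K.C₁) (u : K.C₂) (h : K.s.obj (K.S.obj u) = K.t.obj x),
  K.Commutes
    [P.Ve (P.l (P.om x (P.i.obj (K.t.obj x))) u) (B.e₁₈ x (K.T.obj u)), B.e₃i (P.l (P.om x (P.i.obj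
     (K.t.obj x))) u) (P.A x (P.i.obj (K.t.obj x)) (K.T.obj u)) (P.l x (P.il.obj (K.T.obj u))), P.eV
     (B.e₁₀ x (P.i.obj (K.t.obj x)) u) (P.l x (P.il.obj (K.T.obj u))), B.e₃ (P.A x (P.i.obj (K.t.obj
     x)) (K.S.obj u)) (P.l x (P.l (P.i.obj (K.t.obj x)) u)) (P.l x (P.il.obj (K.T.obj u))), P.Ve
     (P.A x (P.i.obj (K.t.obj x)) (K.S.obj u)) (B.e₇i x (P.l (P.i.obj (K.t.obj x)) u) (P.il.obj
     (K.T.obj u))), P.Ve (P.A x (P.i.obj (K.t.obj x)) (K.S.obj u)) (P.le x (B.e₁₃ u)), P.Ve (P.A x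
     (P.i.obj (K.t.obj x)) (K.S.obj u)) (B.e₇ x (P.il.obj (K.S.obj u)) u), B.e₃i (P.A x (P.i.obj
     (K.t.obj x)) (K.S.obj u)) (P.l x (P.il.obj (K.S.obj u))) (P.l x u)]
    [B.e₈i (P.ir.obj x) u, P.eV (B.e₁₈ x (K.S.obj u)) (P.l x u)]

/-- Compatibility of `b₁₇` with a 2-cell in the first place. -/
def Ax₂₁ : Prop := ∀ (u : K.C₂) (y : K.C₁) (h : K.s.obj y = K.t.obj (K.S.obj u)),
  K.Commutes
    [B.e₃ (P.r (P.r u y) (P.i.obj (K.t.obj y))) (P.A (K.T.obj u) y (P.i.obj (K.t.obj y))) (P.l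
     (K.T.obj u) (P.ir.obj y)), P.Ve (P.r (P.r u y) (P.i.obj (K.t.obj y))) (B.e₁₇ (K.T.obj u) y),
     B.e₁₄ (P.r u y)]
    [P.eV (B.e₉ u y (P.i.obj (K.t.obj y))) (P.l (K.T.obj u) (P.ir.obj y)), B.e₃ (P.A (K.S.obj u) y
     (P.i.obj (K.t.obj y))) (P.r u (P.om y (P.i.obj (K.t.obj y)))) (P.l (K.T.obj u) (P.ir.obj y)),
     P.Ve (P.A (K.S.obj u) y (P.i.obj (K.t.obj y))) (B.e₈ u (P.ir.obj y)), B.e₃i (P.A (K.S.obj u) y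
     (P.i.obj (K.t.obj y))) (P.l (K.S.obj u) (P.ir.obj y)) (P.r u y), P.eV (B.e₁₇ (K.S.obj u) y)
     (P.r u y)]

/-- Compatibility of `b₁₆` with a 2-cell in the second place. -/
def Ax₂₁' : Prop := ∀ (x : K.C₁) (u : K.C₂) (h : K.s.obj (K.S.obj u) = K.t.obj x),
  K.Commutes
    [P.Ve (P.l (P.om (P.i.obj (K.s.obj x)) x) u) (B.e₁₆ x (K.T.obj u)), B.e₃i (P.l (P.om (P.i.obj
     (K.s.obj x)) x) u) (P.A (P.i.obj (K.s.obj x)) x (K.T.obj u)) (P.il.obj (P.om x (K.T.obj u))),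
     P.eV (B.e₁₀ (P.i.obj (K.s.obj x)) x u) (P.il.obj (P.om x (K.T.obj u))), B.e₃ (P.A (P.i.obj
     (K.s.obj x)) x (K.S.obj u)) (P.l (P.i.obj (K.s.obj x)) (P.l x u)) (P.il.obj (P.om x (K.T.obj
     u))), P.Ve (P.A (P.i.obj (K.s.obj x)) x (K.S.obj u)) (B.e₁₃ (P.l x u)), B.e₃i (P.A (P.i.obj
     (K.s.obj x)) x (K.S.obj u)) (P.il.obj (P.om x (K.S.obj u))) (P.l x u)]
    [B.e₈i (P.il.obj x) u, P.eV (B.e₁₆ x (K.S.obj u)) (P.l x u)]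

/-- Compatibility of `b₁₆` with a 2-cell in the first place. -/
def Ax₂₂ : Prop := ∀ (u : K.C₂) (y : K.C₁) (h : K.s.obj y = K.t.obj (K.S.obj u)),
  K.Commutes
    [B.e₆i (P.l (P.i.obj (K.s.obj (K.S.obj u))) u) (P.il.obj (K.T.obj u)) y, P.er (B.e₁₃ u) y, B.e₆
     (P.il.obj (K.S.obj u)) u y, P.eV (B.e₁₆ (K.S.obj u) y) (P.r u y)]
    [P.Ve (P.r (P.l (P.i.obj (K.s.obj (K.S.obj u))) u) y) (B.e₁₆ (K.T.obj u) y), B.e₃i (P.r (P.l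
     (P.i.obj (K.s.obj (K.S.obj u))) u) y) (P.A (P.i.obj (K.s.obj (K.S.obj u))) (K.T.obj u) y)
     (P.il.obj (P.om (K.T.obj u) y)), P.eV (B.e₁₁ (P.i.obj (K.s.obj (K.S.obj u))) u y) (P.il.obj
     (P.om (K.T.obj u) y)), B.e₃ (P.A (P.i.obj (K.s.obj (K.S.obj u))) (K.S.obj u) y) (P.l (P.i.obj
     (K.s.obj (K.S.obj u))) (P.r u y)) (P.il.obj (P.om (K.T.obj u) y)), P.Ve (P.A (P.i.obj (K.s.obj
     (K.S.obj u))) (K.S.obj u) y) (B.e₁₃ (P.r u y)), B.e₃i (P.A (P.i.obj (K.s.obj (K.S.obj u)))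
     (K.S.obj u) y) (P.il.obj (P.om (K.S.obj u) y)) (P.r u y)]

/-- Compatibility of `b₁₇` with a 2-cell in the second place. -/
def Ax₂₂' : Prop := ∀ (x : K.C₁) (u : K.C₂) (h : K.s.obj (K.S.obj u) = K.t.obj x),
  K.Commutes
    [B.e₃ (P.r (P.l x u) (P.i.obj (K.t.obj (K.S.obj u)))) (P.A x (K.T.obj u) (P.i.obj (K.t.obj
     (K.S.obj u)))) (P.l x (P.ir.obj (K.T.obj u))), P.Ve (P.r (P.l x u) (P.i.obj (K.t.obj (K.S.obj
     u)))) (B.e₁₇ x (K.T.obj u)), B.e₁₄ (P.l x u)]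
    [P.eV (B.e₁₁ x u (P.i.obj (K.t.obj (K.S.obj u)))) (P.l x (P.ir.obj (K.T.obj u))), B.e₃ (P.A x
     (K.S.obj u) (P.i.obj (K.t.obj (K.S.obj u)))) (P.l x (P.r u (P.i.obj (K.t.obj (K.S.obj u)))))
     (P.l x (P.ir.obj (K.T.obj u))), P.Ve (P.A x (K.S.obj u) (P.i.obj (K.t.obj (K.S.obj u)))) (B.e₇i
     x (P.r u (P.i.obj (K.t.obj (K.S.obj u)))) (P.ir.obj (K.T.obj u))), P.Ve (P.A x (K.S.obj u)
     (P.i.obj (K.t.obj (K.S.obj u)))) (P.le x (B.e₁₄ u)), P.Ve (P.A x (K.S.obj u) (P.i.obj (K.t.obj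
     (K.S.obj u)))) (B.e₇ x (P.ir.obj (K.S.obj u)) u), B.e₃i (P.A x (K.S.obj u) (P.i.obj (K.t.obj
     (K.S.obj u)))) (P.l x (P.ir.obj (K.S.obj u))) (P.l x u), P.eV (B.e₁₇ x (K.S.obj u)) (P.l x u)]

/-- Unit coherence for `(1, 1, x)`. -/
def Ax₂₃ : Prop := ∀ (x : K.C₁),
  K.Commutes
    [P.eV (P.er (B.e₁₅ (K.s.obj x)) x) (P.il.obj x), P.eV (B.e₁₈ (P.i.obj (K.s.obj x)) x) (P.il.obj
     x), B.e₃ (P.A (P.i.obj (K.s.obj x)) (P.i.obj (K.s.obj x)) x) (P.l (P.i.obj (K.s.obj x))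
     (P.il.obj x)) (P.il.obj x), P.Ve (P.A (P.i.obj (K.s.obj x)) (P.i.obj (K.s.obj x)) x) (B.e₁₃
     (P.il.obj x)), B.e₃i (P.A (P.i.obj (K.s.obj x)) (P.i.obj (K.s.obj x)) x) (P.il.obj (P.om
     (P.i.obj (K.s.obj x)) x)) (P.il.obj x)]
    [P.eV (B.e₁₆ (P.i.obj (K.s.obj x)) x) (P.il.obj x)]

/-- Unit coherence for `(x, 1, 1)`. -/
def Ax₂₃' : Prop := ∀ (x : K.C₁),
  K.Commutes
    [B.e₁₄ (P.ir.obj x)]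
    [P.eV (B.e₁₈ x (P.i.obj (K.t.obj x))) (P.ir.obj x), P.eV (P.Ve (P.A x (P.i.obj (K.t.obj x))
     (P.i.obj (K.t.obj x))) (P.le x (B.e₁₅ (K.t.obj x)))) (P.ir.obj x), P.eV (B.e₁₇ x (P.i.obj
     (K.t.obj x))) (P.ir.obj x)]

/-- Unit coherence for `(1, x, 1)`. -/
def Ax₂₄ : Prop := ∀ (x : K.C₁),
  K.Commutes
    [B.e₁₄ (P.il.obj x)]
    [P.eV (B.e₁₆ x (P.i.obj (K.t.obj x))) (P.ir.obj x), B.e₃ (P.A (P.i.obj (K.s.obj x)) x (P.i.obj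
     (K.t.obj x))) (P.il.obj (P.om x (P.i.obj (K.t.obj x)))) (P.ir.obj x), P.Ve (P.A (P.i.obj
     (K.s.obj x)) x (P.i.obj (K.t.obj x))) (B.e₁₃i (P.ir.obj x)), B.e₃i (P.A (P.i.obj (K.s.obj x)) x
     (P.i.obj (K.t.obj x))) (P.l (P.i.obj (K.s.obj x)) (P.ir.obj x)) (P.il.obj x), P.eV (B.e₁₇
     (P.i.obj (K.s.obj x)) x) (P.il.obj x)]

/-- Unit coherence for `(1, x, y, z)`. -/
def Ax₂₅ : Prop := ∀ (x y z : K.C₁) (h : K.s.obj y = K.t.obj x) (h' : K.s.obj z = K.t.obj y),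
  K.Commutes
    [B.e₉ (P.il.obj x) y z, P.Ve (P.A (P.om (P.i.obj (K.s.obj x)) x) y z) (B.e₁₆ x (P.om y z)),
     B.e₃i (P.A (P.om (P.i.obj (K.s.obj x)) x) y z) (P.A (P.i.obj (K.s.obj x)) x (P.om y z))
     (P.il.obj (P.om x (P.om y z))), P.eV (B.e₁₂ (P.i.obj (K.s.obj x)) x y z) (P.il.obj (P.om x
     (P.om y z))), B.e₃ (P.V (P.r (P.A (P.i.obj (K.s.obj x)) x y) z) (P.A (P.i.obj (K.s.obj x))
     (P.om x y) z)) (P.l (P.i.obj (K.s.obj x)) (P.A x y z)) (P.il.obj (P.om x (P.om y z))), P.Ve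
     (P.V (P.r (P.A (P.i.obj (K.s.obj x)) x y) z) (P.A (P.i.obj (K.s.obj x)) (P.om x y) z)) (B.e₁₃
     (P.A x y z))]
    [P.eV (P.er (B.e₁₆ x y) z) (P.A x y z), P.eV (B.e₆ (P.A (P.i.obj (K.s.obj x)) x y) (P.il.obj
     (P.om x y)) z) (P.A x y z), P.eV (P.Ve (P.r (P.A (P.i.obj (K.s.obj x)) x y) z) (B.e₁₆ (P.om x
     y) z)) (P.A x y z), P.eV (B.e₃i (P.r (P.A (P.i.obj (K.s.obj x)) x y) z) (P.A (P.i.obj (K.s.obj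
     x)) (P.om x y) z) (P.il.obj (P.om (P.om x y) z))) (P.A x y z), B.e₃ (P.V (P.r (P.A (P.i.obj
     (K.s.obj x)) x y) z) (P.A (P.i.obj (K.s.obj x)) (P.om x y) z)) (P.il.obj (P.om (P.om x y) z))
     (P.A x y z)]

/-- Unit coherence for `(x, y, z, 1)`. -/
def Ax₂₅' : Prop := ∀ (x y z : K.C₁) (h : K.s.obj y = K.t.obj x) (h' : K.s.obj z = K.t.obj y),
  K.Commutes
    [P.eV (B.e₁₂ x y z (P.i.obj (K.t.obj z))) (P.l x (P.l y (P.ir.obj z))), B.e₃ (P.V (P.r (P.A x y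
     z) (P.i.obj (K.t.obj z))) (P.A x (P.om y z) (P.i.obj (K.t.obj z)))) (P.l x (P.A y z (P.i.obj
     (K.t.obj z)))) (P.l x (P.l y (P.ir.obj z))), P.Ve (P.V (P.r (P.A x y z) (P.i.obj (K.t.obj z)))
     (P.A x (P.om y z) (P.i.obj (K.t.obj z)))) (B.e₇i x (P.A y z (P.i.obj (K.t.obj z))) (P.l y
     (P.ir.obj z))), P.Ve (P.V (P.r (P.A x y z) (P.i.obj (K.t.obj z))) (P.A x (P.om y z) (P.i.obj
     (K.t.obj z)))) (P.le x (B.e₁₇ y z)), B.e₃ (P.r (P.A x y z) (P.i.obj (K.t.obj z))) (P.A x (P.om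
     y z) (P.i.obj (K.t.obj z))) (P.l x (P.ir.obj (P.om y z))), P.Ve (P.r (P.A x y z) (P.i.obj
     (K.t.obj z))) (B.e₁₇ x (P.om y z)), B.e₁₄ (P.A x y z)]
    [B.e₃ (P.A (P.om x y) z (P.i.obj (K.t.obj z))) (P.A x y (P.om z (P.i.obj (K.t.obj z)))) (P.l x
     (P.l y (P.ir.obj z))), P.Ve (P.A (P.om x y) z (P.i.obj (K.t.obj z))) (B.e₁₀i x y (P.ir.obj z)),
     B.e₃i (P.A (P.om x y) z (P.i.obj (K.t.obj z))) (P.l (P.om x y) (P.ir.obj z)) (P.A x y z), P.eV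
     (B.e₁₇ (P.om x y) z) (P.A x y z)]

/-- Unit coherence for `(x, 1, y, z)`. -/
def Ax₂₆ : Prop := ∀ (x y z : K.C₁) (h : K.s.obj y = K.t.obj x) (h' : K.s.obj z = K.t.obj y),
  K.Commutes
    [B.e₉ (P.ir.obj x) y z, P.Ve (P.A (P.om x (P.i.obj (K.t.obj x))) y z) (B.e₁₈ x (P.om y z)),
     B.e₃i (P.A (P.om x (P.i.obj (K.t.obj x))) y z) (P.A x (P.i.obj (K.t.obj x)) (P.om y z)) (P.l x
     (P.il.obj (P.om y z))), P.eV (B.e₁₂ x (P.i.obj (K.t.obj x)) y z) (P.l x (P.il.obj (P.om y z)))]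
    [P.eV (P.er (B.e₁₈ x y) z) (P.A x y z), P.eV (B.e₆ (P.A x (P.i.obj (K.t.obj x)) y) (P.l x
     (P.il.obj y)) z) (P.A x y z), B.e₃ (P.r (P.A x (P.i.obj (K.t.obj x)) y) z) (P.r (P.l x
     (P.il.obj y)) z) (P.A x y z), P.Ve (P.r (P.A x (P.i.obj (K.t.obj x)) y) z) (B.e₁₁ x (P.il.obj
     y) z), P.Ve (P.r (P.A x (P.i.obj (K.t.obj x)) y) z) (P.Ve (P.A x (P.om (P.i.obj (K.t.obj x)) y)
     z) (P.le x (B.e₁₆ y z))), P.Ve (P.r (P.A x (P.i.obj (K.t.obj x)) y) z) (P.Ve (P.A x (P.om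
     (P.i.obj (K.t.obj x)) y) z) (B.e₇ x (P.A (P.i.obj (K.t.obj x)) y z) (P.il.obj (P.om y z)))),
     B.e₃i (P.r (P.A x (P.i.obj (K.t.obj x)) y) z) (P.A x (P.om (P.i.obj (K.t.obj x)) y) z) (P.V
     (P.l x (P.A (P.i.obj (K.t.obj x)) y z)) (P.l x (P.il.obj (P.om y z)))), B.e₃i (P.V (P.r (P.A x
     (P.i.obj (K.t.obj x)) y) z) (P.A x (P.om (P.i.obj (K.t.obj x)) y) z)) (P.l x (P.A (P.i.obj
     (K.t.obj x)) y z)) (P.l x (P.il.obj (P.om y z)))]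

/-- Unit coherence for `(x, y, 1, z)`. -/
def Ax₂₆' : Prop := ∀ (x y z : K.C₁) (h : K.s.obj y = K.t.obj x) (h' : K.s.obj z = K.t.obj y),
  K.Commutes
    [P.eV (P.er (B.e₁₇ x y) z) (P.A x y z), P.eV (B.e₁₈ (P.om x y) z) (P.A x y z), B.e₃ (P.A (P.om x
     y) (P.i.obj (K.t.obj y)) z) (P.l (P.om x y) (P.il.obj z)) (P.A x y z), P.Ve (P.A (P.om x y)
     (P.i.obj (K.t.obj y)) z) (B.e₁₀ x y (P.il.obj z)), B.e₃i (P.A (P.om x y) (P.i.obj (K.t.obj y))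
     z) (P.A x y (P.om (P.i.obj (K.t.obj y)) z)) (P.l x (P.l y (P.il.obj z))), P.eV (B.e₁₂ x y
     (P.i.obj (K.t.obj y)) z) (P.l x (P.l y (P.il.obj z)))]
    [P.eV (B.e₆ (P.A x y (P.i.obj (K.t.obj y))) (P.l x (P.ir.obj y)) z) (P.A x y z), B.e₃ (P.r (P.A
     x y (P.i.obj (K.t.obj y))) z) (P.r (P.l x (P.ir.obj y)) z) (P.A x y z), P.Ve (P.r (P.A x y
     (P.i.obj (K.t.obj y))) z) (B.e₁₁ x (P.ir.obj y) z), P.Ve (P.r (P.A x y (P.i.obj (K.t.obj y)))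
     z) (P.Ve (P.A x (P.om y (P.i.obj (K.t.obj y))) z) (P.le x (B.e₁₈ y z))), P.Ve (P.r (P.A x y
     (P.i.obj (K.t.obj y))) z) (P.Ve (P.A x (P.om y (P.i.obj (K.t.obj y))) z) (B.e₇ x (P.A y
     (P.i.obj (K.t.obj y)) z) (P.l y (P.il.obj z)))), B.e₃i (P.r (P.A x y (P.i.obj (K.t.obj y))) z)
     (P.A x (P.om y (P.i.obj (K.t.obj y))) z) (P.V (P.l x (P.A y (P.i.obj (K.t.obj y)) z)) (P.l x
     (P.l y (P.il.obj z)))), B.e₃i (P.V (P.r (P.A x y (P.i.obj (K.t.obj y))) z) (P.A x (P.om y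
     (P.i.obj (K.t.obj y))) z)) (P.l x (P.A y (P.i.obj (K.t.obj y)) z)) (P.l x (P.l y (P.il.obj
     z)))]

end Data₂

namespace Cells

/-- Component of a vertical isomorphism. -/
abbrev VIso.arr {K : Cells.{u}} {X : Type u} [Category.{u} X] {F G : X ⥤ K.C₂} (e : K.VIso F G)
    (x : X) : K.VArr := ⟨F.obj x, G.obj x, e.iso.hom.app x, e.isVert x⟩

end Cells

namespace Data₂

variable {K : Cells.{u}} {P : Data₁ K} (B : Data₂ P)

/-- A two-sided inverse, with respect to vertical composition, of a functor `k` to the category of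
2-cells: a functor with source and target exchanged and vertical isomorphisms from the two
composites to 2-cell identities, satisfying the triangle identities. -/
structure Inverse {X : Type u} [Category.{u} X] (k : X ⥤ K.C₂) where
  inv : X ⥤ K.C₂
  inv_S : inv ⋙ K.S = k ⋙ K.T
  inv_T : inv ⋙ K.T = k ⋙ K.S
  η : K.VIso (P.fV k inv inv_S.symm) (k ⋙ K.S ⋙ P.iv)
  ε : K.VIso (P.fV inv k inv_T) (k ⋙ K.T ⋙ P.iv)
  triangle : ∀ c (h : K.S.obj (inv.obj c) = K.T.obj (k.obj c))
    (h' : K.T.obj (inv.obj c) = K.S.obj (k.obj c)), K.Commutes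
    [P.eV (η.arr c) (k.obj c) ((P.T_mv_obj _).trans h'), B.e₁ (k.obj c)]
    [B.e₃ (k.obj c) (inv.obj c) (k.obj c),
      P.Ve (k.obj c) (ε.arr c) (h.symm.trans (P.S_mv_obj ⟨inv.obj c, k.obj c, h'⟩).symm), B.e₂ (k.obj c)]
  triangle' : ∀ c (h : K.S.obj (inv.obj c) = K.T.obj (k.obj c))
    (h' : K.T.obj (inv.obj c) = K.S.obj (k.obj c)), K.Commutes
    [P.eV (ε.arr c) (inv.obj c) ((P.T_mv_obj _).trans h.symm), B.e₁ (inv.obj c)]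
    [B.e₃ (inv.obj c) (k.obj c) (inv.obj c),
      P.Ve (inv.obj c) (η.arr c) (h'.trans (P.S_mv_obj ⟨k.obj c, inv.obj c, h.symm⟩).symm), B.e₂ (inv.obj c)]

end Data₂

/-- A not-necessarily fibrant bicategory object in the 2-category of categories with given
categories of 0-, 1- and 2-cells, source functors and target functors. -/
structure BicatObj (K : Cells.{u}) where
  data₁ : Data₁ K
  data₂ : Data₂ data₁
  il_inv : Nonempty (data₂.Inverse data₁.il)
  ir_inv : Nonempty (data₂.Inverse data₁.ir)
  a_inv : Nonempty (data₂.Inverse data₁.a)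
  ax₁ : data₂.Ax₁
  ax₂ : data₂.Ax₂
  ax₂' : data₂.Ax₂'
  ax₃ : data₂.Ax₃
  ax₄ : data₂.Ax₄
  ax₅a : data₂.Ax₅a
  ax₅b : data₂.Ax₅b
  ax₅c : data₂.Ax₅c
  ax₅d : data₂.Ax₅d
  ax₆ : data₂.Ax₆
  ax₆' : data₂.Ax₆'
  ax₇ : data₂.Ax₇
  ax₇' : data₂.Ax₇'
  ax₈ : data₂.Ax₈
  ax₈' : data₂.Ax₈'
  ax₉ : data₂.Ax₉
  ax₉' : data₂.Ax₉'
  ax₁₀ : data₂.Ax₁₀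
  ax₁₁ : data₂.Ax₁₁
  ax₁₁' : data₂.Ax₁₁'
  ax₁₂ : data₂.Ax₁₂
  ax₁₃ : data₂.Ax₁₃
  ax₁₃' : data₂.Ax₁₃'
  ax₁₄ : data₂.Ax₁₄
  ax₁₅ : data₂.Ax₁₅
  ax₁₅' : data₂.Ax₁₅'
  ax₁₆ : data₂.Ax₁₆
  ax₁₆' : data₂.Ax₁₆'
  ax₁₇ : data₂.Ax₁₇
  ax₁₈ : data₂.Ax₁₈
  ax₁₈' : data₂.Ax₁₈'
  ax₁₉ : data₂.Ax₁₉
  ax₁₉' : data₂.Ax₁₉'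
  ax₂₀ : data₂.Ax₂₀
  ax₂₀' : data₂.Ax₂₀'
  ax₂₁ : data₂.Ax₂₁
  ax₂₁' : data₂.Ax₂₁'
  ax₂₂ : data₂.Ax₂₂
  ax₂₂' : data₂.Ax₂₂'
  ax₂₃ : data₂.Ax₂₃
  ax₂₃' : data₂.Ax₂₃'
  ax₂₄ : data₂.Ax₂₄
  ax₂₅ : data₂.Ax₂₅
  ax₂₅' : data₂.Ax₂₅'
  ax₂₆ : data₂.Ax₂₆
  ax₂₆' : data₂.Ax₂₆'

namespace TwoCat

variable (X : TwoCat.{u})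

theorem comp_congr {f f' g g' : X.Hom} (hf : f = f') (hg : g = g') (h : X.tgt f = X.src g)
    (h' : X.tgt f' = X.src g') : X.comp f g h = X.comp f' g' h' := by
  subst hf hg
  rfl

theorem vcomp_congr {f f' g g' : X.Hom₂} (hf : f = f') (hg : g = g') (h : X.tgt₂ f = X.src₂ g)
    (h' : X.tgt₂ f' = X.src₂ g') : X.vcomp f g h = X.vcomp f' g' h' := by
  subst hf hg
  rfl

theorem hcomp_congr {f f' g g' : X.Hom₂} (hf : f = f') (hg : g = g')
    (h : X.tgt (X.src₂ f) = X.src (X.src₂ g)) (h' : X.tgt (X.src₂ f') = X.src (X.src₂ g')) :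
    X.hcomp f g h = X.hcomp f' g' h' := by
  subst hf hg
  rfl

theorem one_comp' {x : X.Ob} {f : X.Hom} (hx : X.src f = x) (h : X.tgt (X.one x) = X.src f) :
    X.comp (X.one x) f h = f := by
  subst hx
  exact X.one_comp f _

theorem comp_one' {x : X.Ob} {f : X.Hom} (hx : X.tgt f = x) (h : X.tgt f = X.src (X.one x)) :
    X.comp f (X.one x) h = f := by
  subst hx
  exact X.comp_one f _

theorem one₂_vcomp' {f : X.Hom} {φ : X.Hom₂} (hf : X.src₂ φ = f)
    (h : X.tgt₂ (X.one₂ f) = X.src₂ φ) : X.vcomp (X.one₂ f) φ h = φ := by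
  subst hf
  exact X.one₂_vcomp φ _

theorem vcomp_one₂' {f : X.Hom} {φ : X.Hom₂} (hf : X.tgt₂ φ = f)
    (h : X.tgt₂ φ = X.src₂ (X.one₂ f)) : X.vcomp φ (X.one₂ f) h = φ := by
  subst hf
  exact X.vcomp_one₂ φ _

theorem one_hcomp' {x : X.Ob} {φ : X.Hom₂} (hx : X.src (X.src₂ φ) = x)
    (h : X.tgt (X.src₂ (X.one₂ (X.one x))) = X.src (X.src₂ φ)) :
    X.hcomp (X.one₂ (X.one x)) φ h = φ := by
  subst hx
  exact X.one_hcomp φ _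

theorem hcomp_one' {x : X.Ob} {φ : X.Hom₂} (hx : X.tgt (X.src₂ φ) = x)
    (h : X.tgt (X.src₂ φ) = X.src (X.src₂ (X.one₂ (X.one x)))) :
    X.hcomp φ (X.one₂ (X.one x)) h = φ := by
  subst hx
  exact X.hcomp_one φ _

theorem whisker_right (φ ψ : X.Hom₂) (g : X.Hom) (h : X.tgt₂ φ = X.src₂ ψ) (h₁ h₂ h₃ h₄) :
    X.hcomp (X.vcomp φ ψ h) (X.one₂ g) h₁ =
      X.vcomp (X.hcomp φ (X.one₂ g) h₂) (X.hcomp ψ (X.one₂ g) h₃) h₄ := by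
  rw [X.hcomp_congr rfl (X.one₂_vcomp' (f := g) (φ := X.one₂ g) (by simp) (by simp)).symm h₁
    (by simpa using h₂)]
  exact X.interchange _ _ _ _ _ _ _ _ _ _

theorem whisker_left (φ ψ : X.Hom₂) (g : X.Hom) (h : X.tgt₂ φ = X.src₂ ψ) (h₁ h₂ h₃ h₄) :
    X.hcomp (X.one₂ g) (X.vcomp φ ψ h) h₁ =
      X.vcomp (X.hcomp (X.one₂ g) φ h₂) (X.hcomp (X.one₂ g) ψ h₃) h₄ := by
  rw [X.hcomp_congr (X.one₂_vcomp' (f := g) (φ := X.one₂ g) (by simp) (by simp)).symm rfl h₁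
    (by simpa using h₂)]
  exact X.interchange _ _ _ _ _ _ _ _ _ _

/-- The underlying category of a 2-category. -/
instance category : Category.{u} X.Ob where
  Hom x y := {f : X.Hom // X.src f = x ∧ X.tgt f = y}
  id x := ⟨X.one x, X.src_one x, X.tgt_one x⟩
  comp f g := ⟨X.comp f.1 g.1 (f.2.2.trans g.2.1.symm), (X.src_comp _ _ _).trans f.2.1,
    (X.tgt_comp _ _ _).trans g.2.2⟩
  id_comp f := Subtype.ext (X.one_comp' f.2.1 _)
  comp_id f := Subtype.ext (X.comp_one' f.2.2 _)
  assoc _ g k := Subtype.ext (X.comp_assoc _ _ _ _ (g.2.2.trans k.2.1.symm) _ _)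

variable {X}

theorem eq_conj {x y x' y' : X.Ob} (f : x ⟶ y) (f' : x' ⟶ y') (hx : x = x') (hy : y' = y)
    (h : f.1 = f'.1) : f = eqToHom hx ≫ f' ≫ eqToHom hy := by
  subst hx hy
  simp [Subtype.ext h]

end TwoCat

/-- The functor of underlying categories given by a strict functor. -/
def StrictFunctor.functor {A B : TwoCat.{u}} (F : StrictFunctor A B) : A.Ob ⥤ B.Ob where
  obj := F.ob
  map f := ⟨F.hom f.1, (F.src_hom _).trans (congrArg F.ob f.2.1),
    (F.tgt_hom _).trans (congrArg F.ob f.2.2)⟩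
  map_id x := Subtype.ext (F.map_one x)
  map_comp _ _ := Subtype.ext (F.map_comp _ _ _ _)

namespace CatData₁

variable {X₀ X₁ : TwoCat.{u}} (C : CatData₁ X₀ X₁)

/-- Objects of the category of 2-cells: morphisms of 1-cells whose images under source and target
are identities. -/
@[ext]
structure Obj₂ where
  p : X₀.Ob
  u : X₁.Hom
  q : X₀.Ob
  hs : X₀.one p = C.s.hom u
  ht : C.t.hom u = X₀.one q

/-- Morphisms of the category of 2-cells: 2-morphisms `φ : b ≫ g ⟹ f ≫ b'` of 1-cells whose images
under source and target are identities. -/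
@[ext]
structure Mor₂ where
  φ : X₁.Hom₂
  b : C.Obj₂
  g : X₁.Hom
  f : X₁.Hom
  b' : C.Obj₂
  hbg : X₁.tgt b.u = X₁.src g
  hfb : X₁.tgt f = X₁.src b'.u
  src_eq : X₁.src (X₁.comp b.u g hbg) = X₁.src (X₁.comp f b'.u hfb)
  tgt_eq : X₁.tgt (X₁.comp b.u g hbg) = X₁.tgt (X₁.comp f b'.u hfb)
  s_eq : C.s.hom (X₁.comp b.u g hbg) = C.s.hom (X₁.comp f b'.u hfb)
  t_eq : C.t.hom (X₁.comp b.u g hbg) = C.t.hom (X₁.comp f b'.u hfb)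
  src_φ : X₁.src₂ φ = X₁.comp b.u g hbg
  tgt_φ : X₁.tgt₂ φ = X₁.comp f b'.u hfb
  s_φ : C.s.hom₂ φ = X₀.one₂ (C.s.hom (X₁.comp b.u g hbg))
  t_φ : C.t.hom₂ φ = X₀.one₂ (C.t.hom (X₁.comp b.u g hbg))

namespace Mor₂

variable {C}

/-- The identity of an object of the category of 2-cells. -/
def one (b : C.Obj₂) : C.Mor₂ where
  φ := X₁.one₂ b.u
  b := b
  g := X₁.one (X₁.tgt b.u)
  f := X₁.one (X₁.src b.u)
  b' := b
  hbg := by simp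
  hfb := by simp
  src_eq := by simp
  tgt_eq := by simp
  s_eq := by rw [X₁.comp_one', X₁.one_comp'] <;> simp
  t_eq := by rw [X₁.comp_one', X₁.one_comp'] <;> simp
  src_φ := by rw [X₁.comp_one'] <;> simp
  tgt_φ := by rw [X₁.one_comp'] <;> simp
  s_φ := by rw [X₁.comp_one'] <;> simp
  t_φ := by rw [X₁.comp_one'] <;> simp

theorem src_f (μ : C.Mor₂) : X₁.src μ.f = X₁.src μ.b.u := by
  have := μ.src_eq
  simpa using this.symm

theorem tgt_g (μ : C.Mor₂) : X₁.tgt μ.g = X₁.tgt μ.b'.u := by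
  have := μ.tgt_eq
  simpa using this

theorem s_u (b : C.Obj₂) : C.s.hom b.u = X₀.one (C.s.ob (X₁.src b.u)) := by
  have h := congrArg X₀.src b.hs
  rw [← C.s.src_hom, ← h, ← b.hs]
  simp

theorem t_u (b : C.Obj₂) : C.t.hom b.u = X₀.one (C.t.ob (X₁.src b.u)) := by
  have h := congrArg X₀.src b.ht
  rw [← C.t.src_hom, h, b.ht]
  simp

theorem s_u' (b : C.Obj₂) : C.s.hom b.u = X₀.one (C.s.ob (X₁.tgt b.u)) := by
  have h := congrArg X₀.tgt b.hs
  rw [← C.s.tgt_hom, ← h, ← b.hs]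
  simp

theorem t_u' (b : C.Obj₂) : C.t.hom b.u = X₀.one (C.t.ob (X₁.tgt b.u)) := by
  have h := congrArg X₀.tgt b.ht
  rw [← C.t.tgt_hom, h, b.ht]
  simp

theorem s_f (μ : C.Mor₂) : C.s.hom μ.f = C.s.hom μ.g := by
  have h := μ.s_eq
  rw [C.s.map_comp _ _ _ (by simp [μ.hbg]), C.s.map_comp _ _ _ (by simp [μ.hfb])] at h
  rw [X₀.comp_congr (s_u' μ.b) rfl _ (by simp [μ.hbg]),
    X₀.comp_congr rfl (s_u μ.b') _ (by simp [μ.hfb]), X₀.one_comp', X₀.comp_one'] at h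
  · exact h.symm
  · simp [μ.hfb]
  · simp [μ.hbg]

theorem t_f (μ : C.Mor₂) : C.t.hom μ.f = C.t.hom μ.g := by
  have h := μ.t_eq
  rw [C.t.map_comp _ _ _ (by simp [μ.hbg]), C.t.map_comp _ _ _ (by simp [μ.hfb])] at h
  rw [X₀.comp_congr (t_u' μ.b) rfl _ (by simp [μ.hbg]),
    X₀.comp_congr rfl (t_u μ.b') _ (by simp [μ.hfb]), X₀.one_comp', X₀.comp_one'] at h
  · exact h.symm
  · simp [μ.hfb]
  · simp [μ.hbg]

theorem s_bg (μ : C.Mor₂) : C.s.hom (X₁.comp μ.b.u μ.g μ.hbg) = C.s.hom μ.g := by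
  rw [C.s.map_comp _ _ _ (by simp [μ.hbg]), X₀.comp_congr (s_u' μ.b) rfl _ (by simp [μ.hbg]),
    X₀.one_comp']
  simp [μ.hbg]

theorem t_bg (μ : C.Mor₂) : C.t.hom (X₁.comp μ.b.u μ.g μ.hbg) = C.t.hom μ.g := by
  rw [C.t.map_comp _ _ _ (by simp [μ.hbg]), X₀.comp_congr (t_u' μ.b) rfl _ (by simp [μ.hbg]),
    X₀.one_comp']
  simp [μ.hbg]

/-- Constructor for morphisms of the category of 2-cells. -/
def of (φ : X₁.Hom₂) (b : C.Obj₂) (g f : X₁.Hom) (b' : C.Obj₂) (hbg : X₁.tgt b.u = X₁.src g)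
    (hfb : X₁.tgt f = X₁.src b'.u) (src_φ : X₁.src₂ φ = X₁.comp b.u g hbg)
    (tgt_φ : X₁.tgt₂ φ = X₁.comp f b'.u hfb) (s_φ : C.s.hom₂ φ = X₀.one₂ (C.s.hom g))
    (t_φ : C.t.hom₂ φ = X₀.one₂ (C.t.hom g)) : C.Mor₂ where
  φ := φ
  b := b
  g := g
  f := f
  b' := b'
  hbg := hbg
  hfb := hfb
  src_eq := by
    rw [← src_φ, ← tgt_φ, X₁.src_tgt₂]
  tgt_eq := by
    rw [← src_φ, ← tgt_φ, X₁.tgt_tgt₂]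
  s_eq := by
    have h := congrArg X₀.tgt₂ s_φ
    have h' := congrArg X₀.src₂ s_φ
    rw [← src_φ, ← tgt_φ, ← C.s.src₂_hom₂, ← C.s.tgt₂_hom₂, h, h']
    simp
  t_eq := by
    have h := congrArg X₀.tgt₂ t_φ
    have h' := congrArg X₀.src₂ t_φ
    rw [← src_φ, ← tgt_φ, ← C.t.src₂_hom₂, ← C.t.tgt₂_hom₂, h, h']
    simp
  src_φ := src_φ
  tgt_φ := tgt_φ
  s_φ := by
    rw [s_φ, ← src_φ, ← C.s.src₂_hom₂, s_φ, X₀.src₂_one₂]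
  t_φ := by
    rw [t_φ, ← src_φ, ← C.t.src₂_hom₂, t_φ, X₀.src₂_one₂]

theorem aux₁ (μ ν : C.Mor₂) (h : μ.b' = ν.b) :
    X₁.tgt (X₁.src₂ μ.φ) = X₁.src (X₁.src₂ (X₁.one₂ ν.g)) := by
  rw [μ.src_φ, X₁.tgt_comp, X₁.src₂_one₂, ← ν.hbg, ← h, μ.tgt_g]

theorem aux₂ (μ ν : C.Mor₂) (h : μ.b' = ν.b) :
    X₁.tgt (X₁.src₂ (X₁.one₂ μ.f)) = X₁.src (X₁.src₂ ν.φ) := by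
  rw [ν.src_φ, X₁.src_comp, X₁.src₂_one₂, ← h, μ.hfb]

theorem aux₃ (μ ν : C.Mor₂) (h : μ.b' = ν.b) :
    X₁.tgt₂ (X₁.hcomp μ.φ (X₁.one₂ ν.g) (aux₁ μ ν h)) =
      X₁.src₂ (X₁.hcomp (X₁.one₂ μ.f) ν.φ (aux₂ μ ν h)) := by
  rw [X₁.src₂_hcomp, X₁.tgt₂_hcomp _ _ _ (by simpa using aux₁ μ ν h),
    X₁.comp_congr μ.tgt_φ (X₁.tgt₂_one₂ _) _ (by simp [h, ν.hbg]),
    X₁.comp_congr (X₁.src₂_one₂ _) ν.src_φ _ (by simp [← h, μ.hfb]),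
    X₁.comp_assoc _ _ _ _ (by rw [h, ν.hbg]) _ (by simp [μ.hfb])]
  exact X₁.comp_congr rfl (X₁.comp_congr (by rw [h]) rfl _ _) _ _

theorem hom₂_aux (F : StrictFunctor X₁ X₀) (μ ν : C.Mor₂) (h : μ.b' = ν.b)
    (hf : F.hom μ.f = F.hom μ.g) (hμ : F.hom₂ μ.φ = X₀.one₂ (F.hom μ.g))
    (hν : F.hom₂ ν.φ = X₀.one₂ (F.hom ν.g)) (h' : X₁.tgt μ.g = X₁.src ν.g) :
    F.hom₂ (X₁.vcomp (X₁.hcomp μ.φ (X₁.one₂ ν.g) (aux₁ μ ν h))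
      (X₁.hcomp (X₁.one₂ μ.f) ν.φ (aux₂ μ ν h)) (aux₃ μ ν h)) =
    X₀.one₂ (F.hom (X₁.comp μ.g ν.g h')) := by
  have h₀ : X₀.tgt (F.hom μ.g) = X₀.src (F.hom ν.g) := by simp [h']
  have e₁ : F.hom₂ (X₁.hcomp μ.φ (X₁.one₂ ν.g) (aux₁ μ ν h)) =
      X₀.one₂ (X₀.comp (F.hom μ.g) (F.hom ν.g) h₀) := by
    rw [F.map_hcomp _ _ _ (by simpa using congrArg F.ob (aux₁ μ ν h)),
      X₀.hcomp_congr hμ (F.map_one₂ _) _ (by simp [h']), X₀.one₂_comp _ _ _ (by simp [h'])]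
  have e₂ : F.hom₂ (X₁.hcomp (X₁.one₂ μ.f) ν.φ (aux₂ μ ν h)) =
      X₀.one₂ (X₀.comp (F.hom μ.g) (F.hom ν.g) h₀) := by
    rw [F.map_hcomp _ _ _ (by simpa using congrArg F.ob (aux₂ μ ν h)),
      X₀.hcomp_congr ((F.map_one₂ _).trans (congrArg X₀.one₂ hf)) hν _ (by simp [h']),
      X₀.one₂_comp _ _ _ (by simp [h'])]
  rw [F.map_vcomp _ _ _ (by simpa using congrArg F.hom (aux₃ μ ν h)),
    X₀.vcomp_congr e₁ e₂ _ (by simp), X₀.one₂_vcomp' (by simp), F.map_comp]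

/-- Composition of morphisms of the category of 2-cells, by pasting. -/
def comp (μ ν : C.Mor₂) (h : μ.b' = ν.b) : C.Mor₂ :=
  .of (X₁.vcomp (X₁.hcomp μ.φ (X₁.one₂ ν.g) (aux₁ μ ν h))
      (X₁.hcomp (X₁.one₂ μ.f) ν.φ (aux₂ μ ν h)) (aux₃ μ ν h))
    μ.b (X₁.comp μ.g ν.g (by rw [μ.tgt_g, h, ν.hbg]))
    (X₁.comp μ.f ν.f (by rw [ν.src_f, ← h, μ.hfb])) ν.b' (by simp [μ.hbg]) (by simp [ν.hfb])
    (by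
      rw [X₁.src₂_vcomp, X₁.src₂_hcomp,
        X₁.comp_congr μ.src_φ (X₁.src₂_one₂ _) _ (by simp [μ.tgt_g, h, ν.hbg])]
      exact X₁.comp_assoc _ _ _ _ _ _ _)
    (by
      rw [X₁.tgt₂_vcomp, X₁.tgt₂_hcomp _ _ _ (by simpa using aux₂ μ ν h),
        X₁.comp_congr (X₁.tgt₂_one₂ _) ν.tgt_φ _ (by simp [ν.src_f, ← h, μ.hfb])]
      exact (X₁.comp_assoc _ _ _ _ _ _ _).symm)
    (hom₂_aux C.s μ ν h μ.s_f (μ.s_φ.trans (congrArg _ μ.s_bg))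
      (ν.s_φ.trans (congrArg _ ν.s_bg)) _)
    (hom₂_aux C.t μ ν h μ.t_f (μ.t_φ.trans (congrArg _ μ.t_bg))
      (ν.t_φ.trans (congrArg _ ν.t_bg)) _)

theorem one_comp (μ : C.Mor₂) : comp (one μ.b) μ rfl = μ := by
  apply Mor₂.ext
  · refine (X₁.vcomp_congr (X₁.one₂_comp _ _ μ.hbg _).symm (X₁.one_hcomp' ?_ _) _ ?_).trans
      (X₁.one₂_vcomp' μ.src_φ _)
    · simp [μ.src_φ]
    · simp [μ.src_φ]
  · rfl
  · exact X₁.one_comp' μ.hbg.symm _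
  · exact X₁.one_comp' μ.src_f _
  · rfl

theorem comp_one (μ : C.Mor₂) : comp μ (one μ.b') rfl = μ := by
  apply Mor₂.ext
  · refine (X₁.vcomp_congr (X₁.hcomp_one' ?_ _) (X₁.one₂_comp _ _ μ.hfb _).symm _ ?_).trans
      (X₁.vcomp_one₂' μ.tgt_φ _)
    · simp [μ.src_φ, μ.tgt_g]
    · simp [μ.tgt_φ]
  · rfl
  · exact X₁.comp_one' μ.tgt_g _
  · exact X₁.comp_one' μ.hfb _
  · rfl

theorem comp_assoc (μ ν κ : C.Mor₂) (h : μ.b' = ν.b) (h' : ν.b' = κ.b) :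
    comp (comp μ ν h) κ h' = comp μ (comp ν κ h') h := by
  have e₁ := aux₁ μ ν h
  have e₂ := aux₂ μ ν h
  have e₃ := aux₃ μ ν h
  have e₁' := aux₁ ν κ h'
  have e₂' := aux₂ ν κ h'
  have e₃' := aux₃ ν κ h'
  have hg : X₁.tgt μ.g = X₁.src ν.g := by rw [μ.tgt_g, h, ν.hbg]
  have hg' : X₁.tgt ν.g = X₁.src κ.g := by rw [ν.tgt_g, h', κ.hbg]
  have hf : X₁.tgt μ.f = X₁.src ν.f := by rw [ν.src_f, ← h, μ.hfb]
  have hf' : X₁.tgt ν.f = X₁.src κ.f := by rw [κ.src_f, ← h', ν.hfb]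
  have k₁ : X₁.tgt (X₁.src₂ (X₁.hcomp μ.φ (X₁.one₂ ν.g) e₁)) = X₁.src (X₁.src₂ (X₁.one₂ κ.g)) := by
    simpa using hg'
  have k₂ : X₁.tgt (X₁.src₂ (X₁.hcomp (X₁.one₂ μ.f) ν.φ e₂)) =
      X₁.src (X₁.src₂ (X₁.one₂ κ.g)) := by
    simpa using e₁'
  have k₃ : X₁.tgt (X₁.src₂ (X₁.one₂ μ.f)) =
      X₁.src (X₁.src₂ (X₁.hcomp (X₁.one₂ ν.f) κ.φ e₂')) := by
    simpa using hf
  have k₄ : X₁.tgt (X₁.src₂ (X₁.one₂ μ.f)) =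
      X₁.src (X₁.src₂ (X₁.hcomp ν.φ (X₁.one₂ κ.g) e₁')) := by
    simpa using e₂
  apply Mor₂.ext
  · have q₁ : X₁.tgt₂ (X₁.hcomp (X₁.hcomp μ.φ (X₁.one₂ ν.g) e₁) (X₁.one₂ κ.g) k₁) =
        X₁.src₂ (X₁.hcomp (X₁.hcomp (X₁.one₂ μ.f) ν.φ e₂) (X₁.one₂ κ.g) k₂) := by
      refine (X₁.tgt₂_hcomp _ _ _ (by simpa [hg] using hg')).trans
        ((X₁.comp_congr e₃ (by simp) _ ?_).trans (X₁.src₂_hcomp _ _ _).symm)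
      simpa using k₂
    have q₂ : X₁.tgt₂ (X₁.hcomp (X₁.one₂ μ.f) (X₁.hcomp ν.φ (X₁.one₂ κ.g) e₁') k₄) =
        X₁.src₂ (X₁.hcomp (X₁.one₂ μ.f) (X₁.hcomp (X₁.one₂ ν.f) κ.φ e₂') k₃) := by
      refine (X₁.tgt₂_hcomp _ _ _ (by rw [e₃']; simpa using hf)).trans
        ((X₁.comp_congr (by simp) e₃' _ ?_).trans (X₁.src₂_hcomp _ _ _).symm)
      simpa using k₃
    have k₅ : X₁.tgt (X₁.src₂ (X₁.vcomp _ _ e₃)) = X₁.src (X₁.src₂ (X₁.one₂ κ.g)) := by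
      simpa using k₁
    have k₆ : X₁.tgt (X₁.src₂ (X₁.one₂ μ.f)) = X₁.src (X₁.src₂ (X₁.vcomp _ _ e₃')) := by
      simpa using k₄
    have a₁ := X₁.whisker_right _ _ κ.g e₃ k₅ k₁ k₂ q₁
    have a₂ := X₁.whisker_left _ _ μ.f e₃' k₆ k₄ k₃ q₂
    have b₁ : X₁.hcomp (X₁.hcomp μ.φ (X₁.one₂ ν.g) e₁) (X₁.one₂ κ.g) k₁ =
        X₁.hcomp μ.φ (X₁.one₂ (X₁.comp ν.g κ.g hg')) (by simpa using e₁) := by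
      rw [X₁.hcomp_congr rfl (X₁.one₂_comp ν.g κ.g hg' (by simpa using hg')) _
        (by simpa using e₁)]
      exact X₁.hcomp_assoc _ _ _ _ _ _ _
    have b₂ : X₁.hcomp (X₁.hcomp (X₁.one₂ μ.f) ν.φ e₂) (X₁.one₂ κ.g) k₂ =
        X₁.hcomp (X₁.one₂ μ.f) (X₁.hcomp ν.φ (X₁.one₂ κ.g) e₁') k₄ :=
      X₁.hcomp_assoc _ _ _ _ _ _ _
    have b₃ : X₁.hcomp (X₁.one₂ (X₁.comp μ.f ν.f hf)) κ.φ (by simpa using e₂') =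
        X₁.hcomp (X₁.one₂ μ.f) (X₁.hcomp (X₁.one₂ ν.f) κ.φ e₂') k₃ := by
      rw [X₁.hcomp_congr (X₁.one₂_comp μ.f ν.f hf (by simpa using hf)) rfl _
        (by simpa using e₂')]
      exact X₁.hcomp_assoc _ _ _ _ _ _ _
    have c₁ := aux₃ (comp μ ν h) κ h'
    have c₂ := aux₃ μ (comp ν κ h') h
    have q₃ := q₂
    rw [← b₂, ← b₃] at q₃
    have q₄ := q₁
    rw [b₁, b₂] at q₄
    calc (comp (comp μ ν h) κ h').φ = _ := X₁.vcomp_congr a₁ rfl c₁ (by rw [← a₁]; exact c₁)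
      _ = _ := X₁.vcomp_assoc _ _ _ _ q₃ _ (by rw [X₁.src₂_vcomp, q₁])
      _ = X₁.vcomp _ (X₁.vcomp _ _ q₂) (by rw [X₁.src₂_vcomp, q₄]) :=
        X₁.vcomp_congr b₁ (X₁.vcomp_congr b₂ b₃ _ _) _ _
      _ = (comp μ (comp ν κ h') h).φ := X₁.vcomp_congr rfl a₂.symm _ c₂
  · rfl
  · exact X₁.comp_assoc _ _ _ _ hg' _ _
  · exact X₁.comp_assoc _ _ _ _ hf' _ _
  · rfl

end Mor₂

instance : Category.{u} C.Obj₂ where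
  Hom b b' := {μ : C.Mor₂ // μ.b = b ∧ μ.b' = b'}
  id b := ⟨.one b, rfl, rfl⟩
  comp μ ν := ⟨μ.1.comp ν.1 (μ.2.2.trans ν.2.1.symm), μ.2.1, ν.2.2⟩
  id_comp μ := Subtype.ext (by
    obtain ⟨μ, rfl, rfl⟩ := μ
    exact μ.one_comp)
  comp_id μ := Subtype.ext (by
    obtain ⟨μ, rfl, rfl⟩ := μ
    exact μ.comp_one)
  assoc μ ν κ := Subtype.ext (μ.1.comp_assoc ν.1 κ.1 (μ.2.2.trans ν.2.1.symm)
    (ν.2.2.trans κ.2.1.symm))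

/-- The source functor from 2-cells to 1-cells. -/
def S : C.Obj₂ ⥤ X₁.Ob where
  obj b := X₁.src b.u
  map μ := ⟨μ.1.f, μ.1.src_f.trans (congrArg (fun b => X₁.src b.u) μ.2.1),
    μ.1.hfb.trans (congrArg (fun b => X₁.src b.u) μ.2.2)⟩
  map_id _ := rfl
  map_comp _ _ := rfl

/-- The target functor from 2-cells to 1-cells. -/
def T : C.Obj₂ ⥤ X₁.Ob where
  obj b := X₁.tgt b.u
  map μ := ⟨μ.1.g, μ.1.hbg.symm.trans (congrArg (fun b => X₁.tgt b.u) μ.2.1),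
    μ.1.tgt_g.trans (congrArg (fun b => X₁.tgt b.u) μ.2.2)⟩
  map_id _ := rfl
  map_comp _ _ := rfl

theorem s_tgt (b : C.Obj₂) : C.s.ob (X₁.tgt b.u) = C.s.ob (X₁.src b.u) := by
  rw [← C.s.tgt_hom, ← C.s.src_hom, ← b.hs, X₀.tgt_one, X₀.src_one]

theorem t_tgt (b : C.Obj₂) : C.t.ob (X₁.tgt b.u) = C.t.ob (X₁.src b.u) := by
  rw [← C.t.tgt_hom, ← C.t.src_hom, b.ht, X₀.tgt_one, X₀.src_one]

/-- The categories of 0-, 1- and 2-cells built from the 2-categories `X₀` and `X₁`. -/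
def cells : Cells.{u} where
  C₀ := X₀.Ob
  C₁ := X₁.Ob
  C₂ := C.Obj₂
  s := C.s.functor
  t := C.t.functor
  S := C.S
  T := C.T
  T_s := CategoryTheory.Functor.ext C.s_tgt
    fun _ _ μ => TwoCat.eq_conj _ _ _ _ μ.1.s_f.symm
  T_t := CategoryTheory.Functor.ext C.t_tgt
    fun _ _ μ => TwoCat.eq_conj _ _ _ _ μ.1.t_f.symm

end CatData₁

/-- The structure of the bicategory object `B` is read off from the structure of the category object
`C`.  The 1-cell identity and horizontal composition are restrictions, the 2-cell identity and
vertical composition come from the identities and composition of morphisms and 2-morphisms, the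
whiskers from the horizontal composition functor, and the 2-cell identities and associator 2-cell
from the left identity, right identity and associator transformations.  The 2-data `b₁` to `b₈` are
identities, `b₉`, `b₁₀`, `b₁₁`, `b₁₃` and `b₁₄` are inverse naturality 2-morphisms of the associator
and identity transformations, and `b₁₂`, `b₁₅` to `b₁₈` are the five modifications. -/
structure ReadsOff {X₀ X₁ : TwoCat.{u}} (C : CatObj X₀ X₁) (B : BicatObj C.data₁.cells) :
    Prop where
  i : B.data₁.i = C.data₁.i.functor
  m_obj : ∀ p h, B.data₁.m.obj p = C.data₁.m.ob ⟨(p.fst, p.snd), h⟩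
  m_map : ∀ p q (f : p ⟶ q) h,
    (B.data₁.m.map f).1 = C.data₁.m.hom ⟨(f.1.1.1, f.1.2.1), h⟩
  iv_obj : ∀ x : X₁.Ob, (B.data₁.iv.obj x).u = X₁.one x
  iv_map : ∀ (x y : X₁.Ob) (f : x ⟶ y), (B.data₁.iv.map f).1.φ = X₁.one₂ f.1
  mv_obj : ∀ p h, (B.data₁.mv.obj p).u = X₁.comp p.fst.u p.snd.u h
  mv_map : ∀ p q (f : p ⟶ q) h₁ h₂ h₃, (B.data₁.mv.map f).1.φ =
    X₁.vcomp (X₁.hcomp (X₁.one₂ p.fst.u) f.1.2.1.φ h₁)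
      (X₁.hcomp f.1.1.1.φ (X₁.one₂ q.snd.u) h₂) h₃
  wr_obj : ∀ p h, (B.data₁.wr.obj p).u = C.data₁.m.hom ⟨(p.fst.u, X₁.one p.snd), h⟩
  wr_map : ∀ p q (f : p ⟶ q) h,
    (B.data₁.wr.map f).1.φ = C.data₁.m.hom₂ ⟨(f.1.1.1.φ, X₁.one₂ f.1.2.1), h⟩
  wl_obj : ∀ p h, (B.data₁.wl.obj p).u = C.data₁.m.hom ⟨(X₁.one p.fst, p.snd.u), h⟩
  wl_map : ∀ p q (f : p ⟶ q) h,
    (B.data₁.wl.map f).1.φ = C.data₁.m.hom₂ ⟨(X₁.one₂ f.1.1.1, f.1.2.1.φ), h⟩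
  il_obj : ∀ x : X₁.Ob, (B.data₁.il.obj x).u = C.data₂.lam.app x
  il_map : ∀ (x y : X₁.Ob) (f : x ⟶ y), (B.data₁.il.map f).1.φ = C.data₂.lam.nat f.1
  ir_obj : ∀ x : X₁.Ob, (B.data₁.ir.obj x).u = C.data₂.rho.app x
  ir_map : ∀ (x y : X₁.Ob) (f : x ⟶ y), (B.data₁.ir.map f).1.φ = C.data₂.rho.nat f.1
  a_obj : ∀ p h h',
    (B.data₁.a.obj p).u = C.data₂.alp.app ⟨(⟨(p.fst.fst, p.fst.snd), h⟩, p.snd), h'⟩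
  a_map : ∀ p q (f : p ⟶ q) h h', (B.data₁.a.map f).1.φ =
    C.data₂.alp.nat ⟨(⟨(f.1.1.1.1.1, f.1.1.1.2.1), h⟩, f.1.2.1), h'⟩
  b₁ : ∀ p, IsEqHom (B.data₂.b₁.iso.hom.app p)
  b₂ : ∀ p, IsEqHom (B.data₂.b₂.iso.hom.app p)
  b₃ : ∀ p, IsEqHom (B.data₂.b₃.iso.hom.app p)
  b₄ : ∀ p, IsEqHom (B.data₂.b₄.iso.hom.app p)
  b₅ : ∀ p, IsEqHom (B.data₂.b₅.iso.hom.app p)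
  b₆ : ∀ p, IsEqHom (B.data₂.b₆.iso.hom.app p)
  b₇ : ∀ p, IsEqHom (B.data₂.b₇.iso.hom.app p)
  b₈ : ∀ p, IsEqHom (B.data₂.b₈.iso.hom.app p)
  b₉ : ∀ p h h', (B.data₂.b₉.iso.inv.app p).1.φ =
    C.data₂.alp.nat ⟨(⟨(p.fst.fst.u, X₁.one p.fst.snd), h⟩, X₁.one p.snd), h'⟩
  b₁₀ : ∀ p h h', (B.data₂.b₁₀.iso.inv.app p).1.φ =
    C.data₂.alp.nat ⟨(⟨(X₁.one p.fst.fst, X₁.one p.fst.snd), h⟩, p.snd.u), h'⟩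
  b₁₁ : ∀ p h h', (B.data₂.b₁₁.iso.inv.app p).1.φ =
    C.data₂.alp.nat ⟨(⟨(X₁.one p.fst.fst, p.fst.snd.u), h⟩, X₁.one p.snd), h'⟩
  b₁₂ : ∀ p h h' h'', (B.data₂.b₁₂.iso.hom.app p).1.φ =
    C.data₃.c₅.app ⟨(⟨(⟨(p.fst.fst.fst, p.fst.fst.snd), h⟩, p.fst.snd), h'⟩, p.snd), h''⟩
  b₁₃ : ∀ b : C.data₁.Obj₂, (B.data₂.b₁₃.iso.inv.app b).1.φ = C.data₂.lam.nat b.u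
  b₁₄ : ∀ b : C.data₁.Obj₂, (B.data₂.b₁₄.iso.inv.app b).1.φ = C.data₂.rho.nat b.u
  b₁₅ : ∀ x : X₀.Ob, (B.data₂.b₁₅.iso.hom.app x).1.φ = C.data₃.c₁.app x
  b₁₆ : ∀ p h, (B.data₂.b₁₆.iso.hom.app p).1.φ = C.data₃.c₂.app ⟨(p.fst, p.snd), h⟩
  b₁₇ : ∀ p h, (B.data₂.b₁₇.iso.hom.app p).1.φ = C.data₃.c₃.app ⟨(p.fst, p.snd), h⟩
  b₁₈ : ∀ p h, (B.data₂.b₁₈.iso.hom.app p).1.φ = C.data₃.c₄.app ⟨(p.fst, p.snd), h⟩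

/-! A morphism of the category of 2-cells is a 2-morphism `φ : u·g ⇒ f·u'` of `C₁`, that is, a
square, and every composition of such squares is a pasting. Hence each equation required of `B` is
an equation between two pasting composites in the strict 2-category `C₁`. The theorem amounts to a
dictionary telling which law of `C` gives which datum and which axiom of `B`.

The 2-data are of three kinds. The data `b₁` to `b₈` compare composites that the strict laws of `C₁`
and the strict functoriality of `M` make equal; even interchange is strict, both sides of `b₈` being
`u*v`. So they come from equalities of functors (`Obj₂.functor_ext`, `src₁_eq` to `src₈_eq`). The
data `b₉`, `b₁₀`, `b₁₁`, `b₁₃`, `b₁₄` are inverse naturality 2-morphisms of `α`, `λ`, `ρ`. They are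
natural in the square `φ` because the naturality of a weak transformation at `φ`, with the
naturality 2-morphisms at `u·g` and `f·u'` split by the composition law, says just that
(`Transf.IsWeak.square`). The remaining data are components of modifications. Once both sides of
such a datum are recognised as functors read off from a transformation (`Represents`), naturality is
the modification law (`vIsoOfModif`).

The axioms follow the same division. Those involving only `b₁` to `b₈` have identities for all their
steps. `bicat_ax₉` to `bicat_ax₁₄`, `bicat_ax₁₈` and `bicat_ax₁₉` express the value of a weak
transformation on identities and on composites; the ones about interchange compare two
factorisations of one triple of morphisms (`Ai_comp_common₂`). `bicat_ax₁₅`, `bicat_ax₁₆` and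
`bicat_ax₂₀` to `bicat_ax₂₂`, with their primed companions, are the naturality of a modification at
a tuple with one entry a 2-cell and identities elsewhere (`c₂_natInv_common` to `c₅_natInv_common`).
`bicat_ax₁₇` and `bicat_ax₂₃` to `bicat_ax₂₆`, again with their primed companions, are the coherence
axioms of `C`, after naturality 2-morphisms have been moved to the other side as inverses.
Invertibility of the unit and associator 2-cells is carried over by `inverseOf`.

To avoid bracketings and composability proofs, a pasting is written as a list of rows: entries of a
row are composed horizontally, rows vertically. `Val` evaluates such a list, `Le` refines or
simplifies it, and `Common` expresses that two lists have the same composite. A chain of vertical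
arrows in `B` is evaluated to a list of rows by `Seq`, where identity steps leave no row.
`Seq.commutes` then turns each axiom of `B` into a statement `Common` in `C₁`. -/

namespace TwoCat

variable {X : TwoCat.{u}}

/-! ### Horizontal composites of lists of 2-morphisms. -/

namespace Row

theorem ne_nil {r : List X.Hom₂} {φ : X.Hom₂} (h : X.Row r φ) : r ≠ [] := by
  cases h <;> simp

theorem single_iff {φ ψ : X.Hom₂} : X.Row [φ] ψ ↔ ψ = φ := by
  constructor
  · intro h
    cases h with
    | single => rfl
    | cons _ _ _ _ h => exact absurd rfl h.ne_nil
  · rintro rfl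
    exact .single _

theorem cons_iff {φ χ : X.Hom₂} {r : List X.Hom₂} (hr : r ≠ []) :
    X.Row (φ :: r) χ ↔ ∃ ψ h, X.Row r ψ ∧ χ = X.hcomp φ ψ h := by
  constructor
  · intro h
    cases h with
    | single => exact absurd rfl hr
    | cons _ _ ψ h h' => exact ⟨ψ, h, h', rfl⟩
  · rintro ⟨ψ, h, h', rfl⟩
    exact .cons _ _ _ _ h'

/-- Composition depends on its composability proof only through a proposition, so a row has at most
one composite. -/
theorem unique {r : List X.Hom₂} {φ ψ : X.Hom₂} (h : X.Row r φ) (h' : X.Row r ψ) : φ = ψ := by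
  induction h generalizing ψ with
  | single => exact (single_iff.1 h').symm
  | cons _ _ _ _ h ih =>
    obtain ⟨_, _, k, rfl⟩ := (cons_iff h.ne_nil).1 h'
    cases ih k
    rfl

/-- Rows are nested to the right; strict associativity is used here once and afterwards hidden in
concatenation of lists. -/
theorem append {r r' : List X.Hom₂} {φ ψ : X.Hom₂} (h : X.Row r φ) (h' : X.Row r' ψ)
    (e : X.tgt (X.src₂ φ) = X.src (X.src₂ ψ)) : X.Row (r ++ r') (X.hcomp φ ψ e) := by
  induction h with
  | single => exact .cons _ _ _ _ h'
  | cons φ r φ' k _ ih =>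
    rw [X.hcomp_assoc φ φ' ψ k (by simpa using e) e (by simpa using k)]
    exact .cons _ _ _ _ (ih _)

theorem subst_head {q r : List X.Hom₂} {ψ χ : X.Hom₂} (h : X.Row (ψ :: r) χ) (hq : X.Row q ψ) :
    X.Row (q ++ r) χ := by
  -- There are no empty rows, so a replaced entry standing last has to be treated apart.
  by_cases hr : r = []
  · subst hr
    rw [single_iff.1 h]
    simpa using hq
  · obtain ⟨_, _, h', rfl⟩ := (cons_iff hr).1 h
    exact hq.append h' _

/-- An entry can be refined in place, since a list records no bracketing. Its main use is to split
the identity of a composite morphism into the identities of the factors. -/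
theorem subst {p q r : List X.Hom₂} {ψ χ : X.Hom₂} (h : X.Row (p ++ ψ :: r) χ) (hq : X.Row q ψ) :
    X.Row (p ++ (q ++ r)) χ := by
  induction p generalizing χ with
  | nil => exact h.subst_head hq
  | cons a p ih =>
    obtain ⟨_, _, h', rfl⟩ := (cons_iff (by simp)).1 h
    exact .cons _ _ _ _ (ih h')

/-- A row of identities composes to an identity. -/
theorem eq_one₂ {r : List X.Hom₂} {φ : X.Hom₂} (h : X.Row r φ)
    (hr : ∀ ψ ∈ r, ∃ f, ψ = X.one₂ f) : ∃ f, φ = X.one₂ f := by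
  induction h with
  | single φ => exact hr _ (by simp)
  | cons φ r ψ k _ ih =>
    obtain ⟨f, rfl⟩ := hr φ (by simp)
    obtain ⟨g, rfl⟩ := ih fun ψ h => hr ψ (by simp [h])
    exact ⟨_, (X.one₂_comp f g (by simpa using k) k).symm⟩

end Row

/-! ### Vertical composites of lists of rows. -/

/-- The vertical composite of a list of rows; the empty list composes to any identity. -/
inductive Val (X : TwoCat.{u}) : List (List X.Hom₂) → X.Hom₂ → Prop
  | nil (f : X.Hom) : Val X [] (X.one₂ f)
  | cons (r : List X.Hom₂) (φ : X.Hom₂) (L : List (List X.Hom₂)) (ψ : X.Hom₂)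
      (h : X.tgt₂ φ = X.src₂ ψ) : X.Row r φ → Val X L ψ → Val X (r :: L) (X.vcomp φ ψ h)

namespace Val

theorem nil_iff {χ : X.Hom₂} : X.Val [] χ ↔ ∃ f, χ = X.one₂ f := by
  constructor
  · intro h
    cases h
    exact ⟨_, rfl⟩
  · rintro ⟨f, rfl⟩
    exact .nil f

theorem cons_iff {r : List X.Hom₂} {L : List (List X.Hom₂)} {χ : X.Hom₂} :
    X.Val (r :: L) χ ↔ ∃ φ ψ h, X.Row r φ ∧ X.Val L ψ ∧ χ = X.vcomp φ ψ h := by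
  constructor
  · intro h
    cases h with
    | cons _ φ _ ψ h h₁ h₂ => exact ⟨φ, ψ, h, h₁, h₂, rfl⟩
  · rintro ⟨φ, ψ, h, h₁, h₂, rfl⟩
    exact .cons _ _ _ _ _ h₁ h₂

theorem of_row {r : List X.Hom₂} {φ : X.Hom₂} (h : X.Row r φ) : X.Val [r] φ := by
  rw [← X.vcomp_one₂ φ (by simp)]
  exact .cons _ _ _ _ _ h (.nil _)

theorem of_atom (φ : X.Hom₂) : X.Val [[φ]] φ := .of_row (.single φ)

theorem row_iff {r : List X.Hom₂} {φ : X.Hom₂} : X.Val [r] φ ↔ X.Row r φ := by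
  refine ⟨fun h => ?_, of_row⟩
  obtain ⟨φ, ψ, k, h₁, h₂, rfl⟩ := cons_iff.1 h
  obtain ⟨f, rfl⟩ := nil_iff.1 h₂
  rwa [X.vcomp_one₂' (by simpa using k)]

theorem atom_iff {φ ψ : X.Hom₂} : X.Val [[φ]] ψ ↔ ψ = φ := row_iff.trans Row.single_iff

theorem of_paste {L : List (List X.Hom₂)} {φ : X.Hom₂} (h : X.Paste L φ) : X.Val L φ := by
  induction h with
  | single _ _ h => exact of_row h
  | cons _ _ _ _ _ h _ ih => exact .cons _ _ _ _ _ h ih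

/-- The condition on sources is needed for the empty list only, which composes to every identity. In
a nonempty list the first row already fixes the source. -/
theorem unique {L : List (List X.Hom₂)} {φ ψ : X.Hom₂} (h : X.Val L φ) (h' : X.Val L ψ)
    (e : X.src₂ φ = X.src₂ ψ) : φ = ψ := by
  induction h generalizing ψ with
  | nil f =>
    obtain ⟨g, rfl⟩ := nil_iff.1 h'
    rw [show f = g by simpa using e]
  | cons r φ L χ k h₁ _ ih =>
    obtain ⟨φ', χ', k', h₁', h₂', rfl⟩ := cons_iff.1 h'
    cases h₁.unique h₁'
    cases ih h₂' (k.symm.trans k')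
    rfl

theorem unique_of_ne_nil {L : List (List X.Hom₂)} {φ ψ : X.Hom₂} (h : X.Val L φ)
    (h' : X.Val L ψ) (hL : L ≠ []) : φ = ψ := by
  cases L with
  | nil => exact absurd rfl hL
  | cons r L =>
    refine h.unique h' ?_
    obtain ⟨φ, χ, k, h₁, -, rfl⟩ := cons_iff.1 h
    obtain ⟨φ', χ', k', h₁', -, rfl⟩ := cons_iff.1 h'
    rw [src₂_vcomp, src₂_vcomp, h₁.unique h₁']

theorem append {L L' : List (List X.Hom₂)} {φ ψ : X.Hom₂} (h : X.Val L φ) (h' : X.Val L' ψ)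
    (e : X.tgt₂ φ = X.src₂ ψ) : X.Val (L ++ L') (X.vcomp φ ψ e) := by
  induction h with
  | nil f =>
    rw [X.one₂_vcomp' (by simpa using e.symm)]
    exact h'
  | cons r φ L φ' k h₁ _ ih =>
    rw [X.vcomp_assoc φ φ' ψ k (by simpa using e) e (by simpa using k)]
    exact .cons _ _ _ _ _ h₁ (ih _)

theorem of_append {L L' : List (List X.Hom₂)} {χ : X.Hom₂} (h : X.Val (L ++ L') χ) :
    ∃ φ ψ e, X.Val L φ ∧ X.Val L' ψ ∧ χ = X.vcomp φ ψ e := by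
  induction L generalizing χ with
  -- An empty initial part is given the identity on the source of the whole as its composite.
  | nil => exact ⟨X.one₂ (X.src₂ χ), χ, by simp, .nil _, h, (X.one₂_vcomp _ _).symm⟩
  | cons r L ih =>
    obtain ⟨φ, ψ, k, h₁, h₂, rfl⟩ := cons_iff.1 h
    obtain ⟨φ', ψ', k', h₁', h₂', rfl⟩ := ih h₂
    refine ⟨_, ψ', ?_, .cons _ _ _ _ (by simpa using k) h₁ h₁', h₂', ?_⟩
    · simpa using k'
    · exact (X.vcomp_assoc _ _ _ _ _ _ _).symm

/-- Whiskering by an identity distributes over vertical composition, by interchange. The row `p` is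
any way of writing the whiskering identity as a path. -/
theorem whisker_right {L : List (List X.Hom₂)} {φ : X.Hom₂} (h : X.Val L φ) {p : List X.Hom₂}
    {f : X.Hom} (hp : X.Row p (X.one₂ f)) (e : X.tgt (X.src₂ φ) = X.src (X.src₂ (X.one₂ f))) :
    X.Val (L.map (· ++ p)) (X.hcomp φ (X.one₂ f) e) := by
  induction h with
  | nil g =>
    rw [← X.one₂_comp g f (by simpa using e)]
    exact .nil _
  | cons r φ L ψ k h₁ _ ih =>
    have e₁ : X.tgt (X.src₂ φ) = X.src (X.src₂ (X.one₂ f)) := by simpa using e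
    have e₂ : X.tgt (X.src₂ ψ) = X.src (X.src₂ (X.one₂ f)) := by simpa [← k] using e
    have e₃ : X.tgt₂ (X.hcomp φ (X.one₂ f) e₁) = X.src₂ (X.hcomp ψ (X.one₂ f) e₂) := by
      rw [X.src₂_hcomp, X.tgt₂_hcomp _ _ _ (by simpa using e₁)]
      exact X.comp_congr k (by simp) _ _
    rw [TwoCat.whisker_right X φ ψ f k e e₁ e₂ e₃]
    exact .cons _ _ _ _ _ (h₁.append hp _) (ih _)

theorem whisker_left {L : List (List X.Hom₂)} {φ : X.Hom₂} (h : X.Val L φ) {p : List X.Hom₂}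
    {f : X.Hom} (hp : X.Row p (X.one₂ f)) (e : X.tgt (X.src₂ (X.one₂ f)) = X.src (X.src₂ φ)) :
    X.Val (L.map (p ++ ·)) (X.hcomp (X.one₂ f) φ e) := by
  induction h with
  | nil g =>
    rw [← X.one₂_comp f g (by simpa using e)]
    exact .nil _
  | cons r φ L ψ k h₁ _ ih =>
    have e₁ : X.tgt (X.src₂ (X.one₂ f)) = X.src (X.src₂ φ) := by simpa using e
    have e₂ : X.tgt (X.src₂ (X.one₂ f)) = X.src (X.src₂ ψ) := by simpa [← k] using e
    have e₃ : X.tgt₂ (X.hcomp (X.one₂ f) φ e₁) = X.src₂ (X.hcomp (X.one₂ f) ψ e₂) := by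
      rw [X.src₂_hcomp, X.tgt₂_hcomp _ _ _ (by simpa using e₁)]
      exact X.comp_congr (by simp) k _ _
    rw [TwoCat.whisker_left X φ ψ f k e e₁ e₂ e₃]
    exact .cons _ _ _ _ _ (hp.append h₁ _) (ih _)

theorem row_right {L : List (List X.Hom₂)} {φ χ : X.Hom₂} {f : X.Hom} (h : X.Val L φ)
    (hχ : X.Row [φ, X.one₂ f] χ) : X.Val (L.map (· ++ [X.one₂ f])) χ := by
  obtain ⟨_, k, h', rfl⟩ := (Row.cons_iff (by simp)).1 hχ
  cases Row.single_iff.1 h'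
  exact h.whisker_right (.single _) _

theorem row_left {L : List (List X.Hom₂)} {φ χ : X.Hom₂} {f : X.Hom} (h : X.Val L φ)
    (hχ : X.Row [X.one₂ f, φ] χ) : X.Val (L.map ([X.one₂ f] ++ ·)) χ := by
  obtain ⟨_, k, h', rfl⟩ := (Row.cons_iff (by simp)).1 hχ
  cases Row.single_iff.1 h'
  exact h.whisker_left (.single _) _

end Val

/-! ### Refinement and simplification of pastings. -/

/-- Every composite of the first list of rows is a composite of the second. -/
def Le (X : TwoCat.{u}) (L L' : List (List X.Hom₂)) : Prop := ∀ χ, X.Val L χ → X.Val L' χ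

namespace Le

theorem refl (L : List (List X.Hom₂)) : X.Le L L := fun _ h => h

theorem skip {r : List X.Hom₂} {L L' : List (List X.Hom₂)} (h : X.Le L L') :
    X.Le (r :: L) (r :: L') := by
  intro χ k
  obtain ⟨φ, ψ, e, h₁, h₂, rfl⟩ := Val.cons_iff.1 k
  exact .cons _ _ _ _ _ h₁ (h _ h₂)

/-- Identities compose to an identity, which is a unit. Only this direction holds in general: a
deleted row need not be composable with an arbitrary composite of the rows that remain. -/
theorem drop {r : List X.Hom₂} {L L' : List (List X.Hom₂)} (hr : ∀ ψ ∈ r, ∃ f, ψ = X.one₂ f)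
    (h : X.Le L L') : X.Le (r :: L) L' := by
  intro χ k
  obtain ⟨φ, ψ, e, h₁, h₂, rfl⟩ := Val.cons_iff.1 k
  obtain ⟨f, rfl⟩ := h₁.eq_one₂ hr
  rw [X.one₂_vcomp' (by simpa using e.symm)]
  exact h _ h₂

theorem drop₁ {f : X.Hom} {L L' : List (List X.Hom₂)} (h : X.Le L L') :
    X.Le ([X.one₂ f] :: L) L' := h.drop (by simp)

theorem drop₂ {f g : X.Hom} {L L' : List (List X.Hom₂)} (h : X.Le L L') :
    X.Le ([X.one₂ f, X.one₂ g] :: L) L' := h.drop (by simp)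

/-- Since `r` has at most one composite, the hypothesis on `M` concerns a single 2-morphism. This is
how a composite 2-morphism is replaced by the rows that define it. -/
theorem expand {r : List X.Hom₂} {L L' M : List (List X.Hom₂)}
    (hr : ∀ ρ, X.Row r ρ → X.Val M ρ) (h : X.Le L L') : X.Le (r :: L) (M ++ L') := by
  intro χ k
  obtain ⟨φ, ψ, e, h₁, h₂, rfl⟩ := Val.cons_iff.1 k
  exact (hr _ h₁).append (h _ h₂) _

end Le

/-! ### Equality of pastings, and cancellation of invertible rows. -/

/-- Two lists of rows have a common composite. -/
def Common (X : TwoCat.{u}) (L L' : List (List X.Hom₂)) : Prop := ∃ ψ, X.Val L ψ ∧ X.Val L' ψ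

/-- Two 2-morphisms are mutually inverse. -/
def InvPair (X : TwoCat.{u}) (φ ψ : X.Hom₂) : Prop :=
  ∃ (h : X.tgt₂ φ = X.src₂ ψ) (h' : X.tgt₂ ψ = X.src₂ φ),
    X.vcomp φ ψ h = X.one₂ (X.src₂ φ) ∧ X.vcomp ψ φ h' = X.one₂ (X.tgt₂ φ)

namespace InvPair

theorem symm {φ ψ : X.Hom₂} (h : X.InvPair φ ψ) : X.InvPair ψ φ := by
  obtain ⟨h, h', e, e'⟩ := h
  exact ⟨h', h, by rw [e', h], by rw [e, h']⟩

theorem one₂ (f : X.Hom) : X.InvPair (X.one₂ f) (X.one₂ f) :=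
  ⟨by simp, by simp, by rw [X.one₂_vcomp'] <;> simp, by rw [X.one₂_vcomp'] <;> simp⟩

theorem hcomp {φ φ' ψ ψ' : X.Hom₂} (h : X.InvPair φ φ') (k : X.InvPair ψ ψ')
    (e : X.tgt (X.src₂ φ) = X.src (X.src₂ ψ)) (e' : X.tgt (X.src₂ φ') = X.src (X.src₂ ψ')) :
    X.InvPair (X.hcomp φ ψ e) (X.hcomp φ' ψ' e') := by
  -- One of the two inverse equations suffices; the other is the same statement for the exchanged
  -- pairs.
  have aux : ∀ {φ φ' ψ ψ' : X.Hom₂} (_ : X.InvPair φ φ') (_ : X.InvPair ψ ψ')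
      (e : X.tgt (X.src₂ φ) = X.src (X.src₂ ψ)) (e' : X.tgt (X.src₂ φ') = X.src (X.src₂ ψ')),
      ∃ h, X.vcomp (X.hcomp φ ψ e) (X.hcomp φ' ψ' e') h = X.one₂ (X.src₂ (X.hcomp φ ψ e)) := by
    intro φ φ' ψ ψ' h k e e'
    obtain ⟨h₁, h₂, h₃, h₄⟩ := h
    obtain ⟨k₁, k₂, k₃, k₄⟩ := k
    refine ⟨?_, ?_⟩
    · rw [X.src₂_hcomp, X.tgt₂_hcomp _ _ _ (by simpa using e)]
      exact X.comp_congr h₁ k₁ _ _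
    · rw [← X.interchange φ φ' ψ ψ' h₁ k₁ (by simpa using e),
        X.hcomp_congr h₃ k₃ _ (by simpa using e), X.src₂_hcomp, X.one₂_comp]
  obtain ⟨h₁, h₂⟩ := aux h k e e'
  obtain ⟨h₃, h₄⟩ := aux h.symm k.symm e' e
  exact ⟨h₁, h₃, h₂, by rw [h₄, h₁]⟩

theorem vcomp {φ φ' ψ ψ' : X.Hom₂} (h : X.InvPair φ φ') (k : X.InvPair ψ ψ')
    (e : X.tgt₂ φ = X.src₂ ψ) (e' : X.tgt₂ ψ' = X.src₂ φ') :
    X.InvPair (X.vcomp φ ψ e) (X.vcomp ψ' φ' e') := by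
  -- As before, one equation is proved and the exchanged pairs give the other. Vertical composition
  -- reverses the order of the inverses.
  have aux : ∀ {φ φ' ψ ψ' : X.Hom₂} (_ : X.InvPair φ φ') (_ : X.InvPair ψ ψ')
      (e : X.tgt₂ φ = X.src₂ ψ) (e' : X.tgt₂ ψ' = X.src₂ φ'),
      ∃ h, X.vcomp (X.vcomp φ ψ e) (X.vcomp ψ' φ' e') h = X.one₂ (X.src₂ (X.vcomp φ ψ e)) := by
    intro φ φ' ψ ψ' h k e e'
    obtain ⟨h₁, h₂, h₃, h₄⟩ := h
    obtain ⟨k₁, k₂, k₃, k₄⟩ := k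
    refine ⟨by simpa using k₁, ?_⟩
    rw [X.vcomp_assoc φ ψ _ e (by simpa using k₁) _ (by simpa using e),
      X.vcomp_congr rfl (X.vcomp_assoc ψ ψ' φ' k₁ e' (by simpa using e') _).symm _
        (by simpa using e),
      X.vcomp_congr rfl (X.vcomp_congr k₃ rfl _ (by simp [← h₁, e])) _ (by simpa using e),
      X.vcomp_congr rfl (X.one₂_vcomp' (by simp [← h₁, e]) _) _ h₁, h₃, X.src₂_vcomp]
  obtain ⟨h₁, h₂⟩ := aux h k e e'
  obtain ⟨h₃, h₄⟩ := aux k.symm h.symm e' e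
  exact ⟨h₁, h₃, h₂, by rw [h₄, h₁]⟩

/-- A row is inverted entry by entry in the same order, because horizontal composition of inverses
does not reverse. -/
theorem of_row {r r' : List X.Hom₂} {φ : X.Hom₂} (h : X.Row r φ)
    (hr : List.Forall₂ X.InvPair r r') : ∃ φ', X.Row r' φ' ∧ X.InvPair φ φ' := by
  induction h generalizing r' with
  | single φ =>
    cases hr with
    | cons h h' =>
      cases h'
      exact ⟨_, .single _, h⟩
  | cons φ L ψ k _ ih =>
    cases hr with
    | cons h h' =>
      obtain ⟨ψ', k', h''⟩ := ih h'
      rename_i χ _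
      -- Inverse 2-morphisms lie between the same objects as the original ones, so the inverted row
      -- is composable.
      have e : X.tgt (X.src₂ χ) = X.src (X.src₂ ψ') := by
        rw [← h.choose, ← h''.choose, X.tgt_tgt₂, X.src_tgt₂, k]
      exact ⟨_, .cons _ _ _ e k', h.hcomp h'' _ _⟩

end InvPair

namespace Common

theorem of_commutes {L L' : List (List X.Hom₂)} (h : X.Commutes L L') : X.Common L L' := by
  obtain ⟨φ, h, h'⟩ := h
  exact ⟨φ, .of_paste h, .of_paste h'⟩

theorem symm {L L' : List (List X.Hom₂)} (h : X.Common L L') : X.Common L' L := by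
  obtain ⟨φ, h, h'⟩ := h
  exact ⟨φ, h', h⟩

theorem mono {L L' M M' : List (List X.Hom₂)} (h : X.Common L L') (k : X.Le L M)
    (k' : X.Le L' M') : X.Common M M' := by
  obtain ⟨φ, h, h'⟩ := h
  exact ⟨φ, k _ h, k' _ h'⟩

/-- Both sides are composed below with the inverse of the row `r`, which cancels on the right. This
puts the inverse of a naturality 2-morphism on the other side of an equation. -/
theorem move_right {L L' : List (List X.Hom₂)} {r r' : List X.Hom₂}
    (h : X.Common L (L' ++ [r])) (hr : List.Forall₂ X.InvPair r r') :
    X.Common (L ++ [r']) L' := by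
  obtain ⟨ψ, h, h'⟩ := h
  obtain ⟨φ, ρ, e, h₁, h₂, rfl⟩ := h'.of_append
  obtain ⟨ρ', k, hi⟩ := InvPair.of_row (Val.row_iff.1 h₂) hr
  obtain ⟨i₁, i₂, i₃, i₄⟩ := hi
  have e' : X.vcomp (X.vcomp φ ρ e) ρ' (by simpa using i₁) = φ := by
    rw [X.vcomp_assoc φ ρ ρ' e i₁ _ (by simpa using e), X.vcomp_congr rfl i₃ _ (by simpa using e),
      X.vcomp_one₂' e]
  refine ⟨φ, ?_, h₁⟩
  rw [← e']
  exact h.append (.of_row k) _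

/-- The same cancellation for a first row, composing above. -/
theorem move_left {L L' : List (List X.Hom₂)} {r r' : List X.Hom₂}
    (h : X.Common L (r :: L')) (hr : List.Forall₂ X.InvPair r r') :
    X.Common (r' :: L) L' := by
  obtain ⟨ψ, h, h'⟩ := h
  obtain ⟨ρ, φ, e, h₁, h₂, rfl⟩ := Val.cons_iff.1 h'
  obtain ⟨ρ', k, hi⟩ := InvPair.of_row h₁ hr
  obtain ⟨i₁, i₂, i₃, i₄⟩ := hi
  have e' : X.vcomp ρ' (X.vcomp ρ φ e) (by simpa using i₂) = φ := by
    rw [← X.vcomp_assoc ρ' ρ φ i₂ e (by simpa using e), X.vcomp_congr i₄ rfl _ (by simpa using e),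
      X.one₂_vcomp' e.symm]
  refine ⟨φ, ?_, h₂⟩
  rw [← e']
  exact .cons _ _ _ _ _ k h

/-- The interchange law for a pair of rows. -/
theorem exchange {φ ψ : X.Hom₂} (h : X.tgt (X.src₂ φ) = X.src (X.src₂ ψ)) :
    X.Common [[X.one₂ (X.src₂ φ), ψ], [φ, X.one₂ (X.tgt₂ ψ)]]
      [[φ, X.one₂ (X.src₂ ψ)], [X.one₂ (X.tgt₂ φ), ψ]] := by
  -- Both pastings evaluate to the plain horizontal composite: each factor is padded by an identity,
  -- before or after, and interchange separates the rows.
  refine ⟨X.hcomp φ ψ h, ?_, ?_⟩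
  · have e : X.hcomp φ ψ h = X.hcomp (X.vcomp (X.one₂ (X.src₂ φ)) φ (by simp))
      (X.vcomp ψ (X.one₂ (X.tgt₂ ψ)) (by simp)) (by simpa using h) :=
        X.hcomp_congr (X.one₂_vcomp _ _).symm (X.vcomp_one₂ _ _).symm _ _
    have e₁ : X.tgt₂ (X.hcomp (X.one₂ (X.src₂ φ)) ψ (by simpa using h)) =
        X.src₂ (X.hcomp φ (X.one₂ (X.tgt₂ ψ)) (by simpa using h)) := by
      rw [X.src₂_hcomp, X.tgt₂_hcomp _ _ _ (by simpa using h)]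
      exact X.comp_congr (by simp) (by simp) _ _
    rw [e, X.interchange _ _ _ _ _ _ _ (by simpa using h) (by simpa using h) e₁]
    exact .cons _ _ _ _ _ (.cons _ _ _ _ (.single _)) (.of_row (.cons _ _ _ _ (.single _)))
  · have e : X.hcomp φ ψ h = X.hcomp (X.vcomp φ (X.one₂ (X.tgt₂ φ)) (by simp))
      (X.vcomp (X.one₂ (X.src₂ ψ)) ψ (by simp)) (by simpa using h) :=
        X.hcomp_congr (X.vcomp_one₂ _ _).symm (X.one₂_vcomp _ _).symm _ _
    have e₁ : X.tgt₂ (X.hcomp φ (X.one₂ (X.src₂ ψ)) (by simpa using h)) =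
        X.src₂ (X.hcomp (X.one₂ (X.tgt₂ φ)) ψ (by simpa using h)) := by
      rw [X.src₂_hcomp, X.tgt₂_hcomp _ _ _ (by simpa using h)]
      exact X.comp_congr (by simp) (by simp) _ _
    rw [e, X.interchange _ _ _ _ _ _ _ (by simpa using h) (by simpa using h) e₁]
    exact .cons _ _ _ _ _ (.cons _ _ _ _ (.single _)) (.of_row (.cons _ _ _ _ (.single _)))

end Common

end TwoCat

/-! ### Naturality 2-morphisms of weak transformations and modifications, and their inverses. -/

theorem TwoCat.InvPair.map {A B : TwoCat.{u}} (F : StrictFunctor A B) {φ ψ : A.Hom₂}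
    (h : A.InvPair φ ψ) : B.InvPair (F.hom₂ φ) (F.hom₂ ψ) := by
  obtain ⟨h, h', e, e'⟩ := h
  refine ⟨by simp [h], by simp [h'], ?_, ?_⟩
  · rw [← F.map_vcomp _ _ h, e]
    simp
  · rw [← F.map_vcomp _ _ h', e']
    simp

theorem TwoCat.InvPair.pb {A B D : TwoCat.{u}} {F : StrictFunctor A D} {G : StrictFunctor B D}
    {φ ψ : (TwoCat.pb F G).Hom₂} (h : A.InvPair φ.1.1 ψ.1.1) (k : B.InvPair φ.1.2 ψ.1.2) :
    (TwoCat.pb F G).InvPair φ ψ := by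
  obtain ⟨h, h', e, e'⟩ := h
  obtain ⟨k, k', i, i'⟩ := k
  exact ⟨Subtype.ext (Prod.ext h k), Subtype.ext (Prod.ext h' k'), Subtype.ext (Prod.ext e i),
    Subtype.ext (Prod.ext e' i')⟩

namespace Transf

variable {A B D : TwoCat.{u}}

/-- The naturality 2-morphisms of a transformation are inverse to the candidate inverses. -/
def HasInv (α : Transf A B) : Prop := ∀ f, B.InvPair (α.nat f) (α.natInv f)

theorem IsWeak.hasInv {α : Transf A B} (h : α.IsWeak) : α.HasInv := fun f =>
  ⟨by simp, by simp, h.nat_natInv _ _, h.natInv_nat _ _⟩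

theorem HasInv.id (F : StrictFunctor A B) : (Transf.id F).HasInv := fun _ => .one₂ _

theorem HasInv.pre (F : StrictFunctor D A) {α : Transf A B} (h : α.HasInv) :
    (Transf.pre F α).HasInv := fun _ => h _

theorem HasInv.post {α : Transf A B} (h : α.HasInv) (F : StrictFunctor B D) :
    (α.post F).HasInv := fun f => (h f).map F

theorem HasInv.pair {E : TwoCat.{u}} {F : StrictFunctor B E} {G : StrictFunctor D E}
    {α : Transf A B} {β : Transf A D} (h : α.HasInv) (k : β.HasInv)
    (e : α.post F = β.post G) : (Transf.pair α β e).HasInv := fun f => .pb (h f) (k f)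

theorem HasInv.comp {α β : Transf A B} (h : α.HasInv) (k : β.HasInv) (e : α.cod = β.dom) :
    (α.comp β e).HasInv := fun f =>
  TwoCat.InvPair.vcomp ((TwoCat.InvPair.one₂ _).hcomp (k f) _ _)
    ((h f).hcomp (TwoCat.InvPair.one₂ _) _ _) _ _

theorem comp_natInv_val (α β : Transf A B) (e : α.cod = β.dom) (f : A.Hom) :
    B.Val [[α.natInv f, B.one₂ (β.app (A.tgt f))], [B.one₂ (α.app (A.src f)), β.natInv f]]
      ((α.comp β e).natInv f) :=
  .cons _ _ _ _ _ (.cons _ _ _ _ (.single _)) (.of_row (.cons _ _ _ _ (.single _)))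

theorem comp_nat_val (α β : Transf A B) (e : α.cod = β.dom) (f : A.Hom) :
    B.Val [[B.one₂ (α.app (A.src f)), β.nat f], [α.nat f, B.one₂ (β.app (A.tgt f))]]
      ((α.comp β e).nat f) :=
  .cons _ _ _ _ _ (.cons _ _ _ _ (.single _)) (.of_row (.cons _ _ _ _ (.single _)))

namespace IsWeak

variable {α : Transf A B}

/-- The inverse of an identity is that identity. It makes the naturality steps at identity morphisms
disappear from the axioms of `B`. -/
theorem natInv_one (h : α.IsWeak) (x : A.Ob) : α.natInv (A.one x) = B.one₂ (α.app x) := by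
  obtain ⟨h₁, h₂, h₃, -⟩ := h.hasInv (A.one x)
  have e := h.nat_one x
  rw [B.vcomp_congr e rfl _ (by rw [← h₁, e]), B.one₂_vcomp' (by rw [← h₁, e]; simp)] at h₃
  rw [h₃, e]
  simp

theorem nat_comp_val (h : α.IsWeak) (f g : A.Hom) (e : A.tgt f = A.src g) :
    B.Val [[α.nat f, B.one₂ (α.cod.hom g)], [B.one₂ (α.dom.hom f), α.nat g]]
      (α.nat (A.comp f g e)) := by
  have e₁ : B.tgt (B.src₂ (α.nat f)) = B.src (B.src₂ (B.one₂ (α.cod.hom g))) := by simp [e]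
  have e₂ : B.tgt (B.src₂ (B.one₂ (α.dom.hom f))) = B.src (B.src₂ (α.nat g)) := by simp [e]
  rw [h.nat_comp f g e e₁ e₂]
  · exact .cons _ _ _ _ _ (.cons _ _ _ _ (.single _)) (.of_row (.cons _ _ _ _ (.single _)))
  · rw [B.src₂_hcomp, B.tgt₂_hcomp _ _ _ (by simp [e])]
    simp only [src₂_nat', tgt₂_nat', TwoCat.src₂_one₂, TwoCat.tgt₂_one₂]
    rw [B.comp_assoc _ _ _ _ (by simp [e]) _ (by simp [e])]
    simp only [e]

/-- Inverting the composition law reverses the order of the two rows. -/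
theorem natInv_comp_val (h : α.IsWeak) (f g : A.Hom) (e : A.tgt f = A.src g) :
    B.Val [[B.one₂ (α.dom.hom f), α.natInv g], [α.natInv f, B.one₂ (α.cod.hom g)]]
      (α.natInv (A.comp f g e)) := by
  -- The composition law followed by the inverse at the composite is an identity, hence equal to the
  -- empty pasting. Moving the two rows of the law to the other side leaves only that inverse.
  have k : B.Common [] ([[α.nat f, B.one₂ (α.cod.hom g)]] ++
      [[B.one₂ (α.dom.hom f), α.nat g]] ++ [[α.natInv (A.comp f g e)]]) := by
    obtain ⟨h₁, -, h₃, -⟩ := h.hasInv (A.comp f g e)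
    refine ⟨_, .nil (B.src₂ (α.nat (A.comp f g e))), ?_⟩
    rw [← h₃]
    exact (h.nat_comp_val f g e).append (.of_atom _) _
  have k₁ := TwoCat.Common.move_left k (.cons (h.hasInv f) (.cons (.one₂ _) .nil))
  have k₂ := TwoCat.Common.move_left k₁ (.cons (.one₂ _) (.cons (h.hasInv g) .nil))
  obtain ⟨ψ, h₁, h₂⟩ := k₂
  rwa [TwoCat.Val.atom_iff.1 h₂] at h₁

theorem natural_common (h : α.IsWeak) (φ : A.Hom₂) :
    B.Common [[B.one₂ (α.app (A.src (A.src₂ φ))), α.cod.hom₂ φ], [α.nat (A.tgt₂ φ)]]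
      [[α.nat (A.src₂ φ)], [α.dom.hom₂ φ, B.one₂ (α.app (A.tgt (A.src₂ φ)))]] := by
  have e₁ : B.tgt (B.src₂ (B.one₂ (α.app (A.src (A.src₂ φ))))) =
    B.src (B.src₂ (α.cod.hom₂ φ)) := by simp
  have e₂ : B.tgt (B.src₂ (α.dom.hom₂ φ)) =
    B.src (B.src₂ (B.one₂ (α.app (A.tgt (A.src₂ φ))))) := by simp
  have e₃ : B.tgt₂ (B.hcomp (B.one₂ (α.app (A.src (A.src₂ φ)))) (α.cod.hom₂ φ) e₁) =
      B.src₂ (α.nat (A.tgt₂ φ)) := by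
    rw [B.tgt₂_hcomp _ _ _ (by simp)]
    simp
  have e₄ : B.tgt₂ (α.nat (A.src₂ φ)) =
      B.src₂ (B.hcomp (α.dom.hom₂ φ) (B.one₂ (α.app (A.tgt (A.src₂ φ)))) e₂) := by
    simp
  refine ⟨B.vcomp _ _ e₃, ?_, ?_⟩
  · exact .cons _ _ _ _ _ (.cons _ _ _ _ (.single _)) (.of_atom _)
  · rw [h.natural φ e₁ e₃ e₂ e₄]
    exact .cons _ _ _ _ _ (.single _) (.of_row (.cons _ _ _ _ (.single _)))

/-- Naturality for a 2-morphism `U ≫ G ⟹ F ≫ U'`, solved for the inverses at `U` and `U'`. -/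
theorem square (h : α.IsWeak) {Ψ : A.Hom₂} {U G F U' : A.Hom} {e : A.tgt U = A.src G}
    {e' : A.tgt F = A.src U'} (hs : A.src₂ Ψ = A.comp U G e) (ht : A.tgt₂ Ψ = A.comp F U' e') :
    B.Common
      [[B.one₂ (α.dom.hom U), α.nat G], [α.dom.hom₂ Ψ, B.one₂ (α.app (A.tgt G))],
        [B.one₂ (α.dom.hom F), α.natInv U']]
      [[α.natInv U, B.one₂ (α.cod.hom G)], [B.one₂ (α.app (A.src U)), α.cod.hom₂ Ψ],
        [α.nat F, B.one₂ (α.cod.hom U')]] := by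
  have k := h.natural_common Ψ
  simp only [hs, ht, A.src_comp, A.tgt_comp] at k
  -- The naturality 2-morphisms at `U·G` and `F·U'` are split by the composition law. The factor at
  -- `U` is then the first row of one side and the factor at `U'` the last row of the other, so both
  -- can be moved across.
  have k₁ : B.Common
      [[B.one₂ (α.app (A.src U)), α.cod.hom₂ Ψ], [α.nat F, B.one₂ (α.cod.hom U')],
        [B.one₂ (α.dom.hom F), α.nat U']]
      [[α.nat U, B.one₂ (α.cod.hom G)], [B.one₂ (α.dom.hom U), α.nat G],
        [α.dom.hom₂ Ψ, B.one₂ (α.app (A.tgt G))]] := by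
    refine k.mono (.skip (.expand (M := [_, _]) (fun ρ hρ => ?_) (.refl _)))
      (.expand (M := [_, _]) (fun ρ hρ => ?_) (.refl _))
    · rw [TwoCat.Row.single_iff.1 hρ]
      exact h.nat_comp_val _ _ _
    · rw [TwoCat.Row.single_iff.1 hρ]
      exact h.nat_comp_val _ _ _
  have k₂ := k₁.move_left (.cons (h.hasInv U) (.cons (.one₂ _) .nil))
  exact TwoCat.Common.move_right (L := [_, _]) (L' := [_, _, _]) k₂.symm
    (.cons (.one₂ _) (.cons (h.hasInv U') .nil))

end IsWeak

end Transf

namespace Modif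

variable {A B : TwoCat.{u}} {α β : Transf A B} {hd : α.dom = β.dom} {hc : α.cod = β.cod}

theorem natural_common (Γ : Modif α β hd hc) (f : A.Hom) :
    B.Common [[α.nat f], [B.one₂ (α.dom.hom f), Γ.app (A.tgt f)]]
      [[Γ.app (A.src f), B.one₂ (α.cod.hom f)], [β.nat f]] := by
  have e₁ : B.tgt (B.src₂ (B.one₂ (α.dom.hom f))) = B.src (B.src₂ (Γ.app (A.tgt f))) := by simp
  have e₂ : B.tgt (B.src₂ (Γ.app (A.src f))) = B.src (B.src₂ (B.one₂ (α.cod.hom f))) := by simp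
  have e₃ : B.tgt₂ (α.nat f) = B.src₂ (B.hcomp (B.one₂ (α.dom.hom f)) (Γ.app (A.tgt f)) e₁) := by
    simp
  have e₄ : B.tgt₂ (B.hcomp (Γ.app (A.src f)) (B.one₂ (α.cod.hom f)) e₂) = B.src₂ (β.nat f) := by
    rw [B.tgt₂_hcomp _ _ _ (by simp [hc])]
    simp [hc]
  refine ⟨B.vcomp _ _ e₃, ?_, ?_⟩
  · exact .cons _ _ _ _ _ (.single _) (.of_row (.cons _ _ _ _ (.single _)))
  · rw [Γ.natural f e₁ e₃ e₂ e₄]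
    exact .cons _ _ _ _ _ (.cons _ _ _ _ (.single _)) (.of_atom _)

/-- Naturality of a modification, solved for the inverse naturality 2-morphisms. -/
theorem natInv_common (Γ : Modif α β hd hc) (hα : α.HasInv) (hβ : β.HasInv) (f : A.Hom) :
    B.Common [[α.natInv f], [Γ.app (A.src f), B.one₂ (α.cod.hom f)]]
      [[B.one₂ (α.dom.hom f), Γ.app (A.tgt f)], [β.natInv f]] := by
  have k := TwoCat.Common.move_right (L' := [_]) (Γ.natural_common f) (.cons (hβ f) .nil)
  exact k.symm.move_left (.cons (hα f) .nil)

end Modif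

/-! ### Extensionality in the category of 2-cells. -/

namespace CatData₁

variable {X₀ X₁ : TwoCat.{u}} {C : CatData₁ X₀ X₁}

theorem m₁_one (x y : X₁.Ob) (h : C.t.hom (X₁.one x) = C.s.hom (X₁.one y))
    (h' : C.t.ob x = C.s.ob y) :
    C.m.hom ⟨(X₁.one x, X₁.one y), h⟩ = X₁.one (C.m.ob ⟨(x, y), h'⟩) :=
  C.m.map_one ⟨(x, y), h'⟩

theorem m₂_one₂ (f g : X₁.Hom) (h : C.t.hom₂ (X₁.one₂ f) = C.s.hom₂ (X₁.one₂ g))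
    (h' : C.t.hom f = C.s.hom g) :
    C.m.hom₂ ⟨(X₁.one₂ f, X₁.one₂ g), h⟩ = X₁.one₂ (C.m.hom ⟨(f, g), h'⟩) :=
  C.m.map_one₂ ⟨(f, g), h'⟩

theorem t_ob_of_hom {x y : X₁.Ob} (h : C.t.hom (X₁.one x) = C.s.hom (X₁.one y)) :
    C.t.ob x = C.s.ob y := by
  simpa using congrArg X₀.src h

theorem t_hom_of_hom₂ {f g : X₁.Hom} (h : C.t.hom₂ (X₁.one₂ f) = C.s.hom₂ (X₁.one₂ g)) :
    C.t.hom f = C.s.hom g := by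
  simpa using congrArg X₀.src₂ h

theorem m₁_one' (x y : X₁.Ob) (h : C.t.hom (X₁.one x) = C.s.hom (X₁.one y)) :
    C.m.hom ⟨(X₁.one x, X₁.one y), h⟩ = X₁.one (C.m.ob ⟨(x, y), t_ob_of_hom h⟩) :=
  C.m₁_one _ _ _ _

theorem m₂_one₂' (f g : X₁.Hom) (h : C.t.hom₂ (X₁.one₂ f) = C.s.hom₂ (X₁.one₂ g)) :
    C.m.hom₂ ⟨(X₁.one₂ f, X₁.one₂ g), h⟩ = X₁.one₂ (C.m.hom ⟨(f, g), t_hom_of_hom₂ h⟩) :=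
  C.m₂_one₂ _ _ _ _

namespace Obj₂

/-- The entries `p` and `q` are the objects of the identities `s u` and `t u`, so they are
determined by `u`. -/
theorem ext_u {b b' : C.Obj₂} (h : b.u = b'.u) : b = b' := by
  apply Obj₂.ext _ h
  · have := congrArg X₀.tgt (b.ht.symm.trans ((congrArg C.t.hom h).trans b'.ht))
    simpa using this
  · have := congrArg X₀.tgt (b.hs.trans ((congrArg C.s.hom h).trans b'.hs.symm))
    simpa using this

/-- Constructor for 2-cells. -/
def of (u : X₁.Hom) (hs : C.s.hom u = X₀.one (C.s.ob (X₁.src u)))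
    (ht : C.t.hom u = X₀.one (C.t.ob (X₁.src u))) : C.Obj₂ where
  p := C.s.ob (X₁.src u)
  u := u
  q := C.t.ob (X₁.src u)
  hs := hs.symm
  ht := ht

end Obj₂

namespace Mor₂

theorem s_φ' (μ : C.Mor₂) : C.s.hom₂ μ.φ = X₀.one₂ (C.s.hom μ.g) :=
  μ.s_φ.trans (congrArg _ μ.s_bg)

theorem t_φ' (μ : C.Mor₂) : C.t.hom₂ μ.φ = X₀.one₂ (C.t.hom μ.g) :=
  μ.t_φ.trans (congrArg _ μ.t_bg)

/-- Constructor for morphisms of 2-cells with given source and target. -/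
def homOf (b b' : C.Obj₂) (φ : X₁.Hom₂) (g f : X₁.Hom) (hbg : X₁.tgt b.u = X₁.src g)
    (hfb : X₁.tgt f = X₁.src b'.u) (src_φ : X₁.src₂ φ = X₁.comp b.u g hbg)
    (tgt_φ : X₁.tgt₂ φ = X₁.comp f b'.u hfb) (s_φ : C.s.hom₂ φ = X₀.one₂ (C.s.hom g))
    (t_φ : C.t.hom₂ φ = X₀.one₂ (C.t.hom g)) : b ⟶ b' :=
  ⟨.of φ b g f b' hbg hfb src_φ tgt_φ s_φ t_φ, rfl, rfl⟩

theorem hom_ext {b b' : C.Obj₂} {μ ν : b ⟶ b'} (hφ : μ.1.φ = ν.1.φ) (hf : μ.1.f = ν.1.f)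
    (hg : μ.1.g = ν.1.g) : μ = ν :=
  Subtype.ext (Mor₂.ext hφ (μ.2.1.trans ν.2.1.symm) hg hf (μ.2.2.trans ν.2.2.symm))

/-- This is the passage from composition in the category of 2-cells to lists of rows: all later
computations with composites of squares start from these two rows. -/
theorem comp_val {b b' b'' : C.Obj₂} (μ : b ⟶ b') (ν : b' ⟶ b'') :
    X₁.Val [[μ.1.φ, X₁.one₂ ν.1.g], [X₁.one₂ μ.1.f, ν.1.φ]] (μ ≫ ν).1.φ :=
  .cons _ _ _ _ _ (.cons _ _ _ _ (.single _)) (.of_row (.cons _ _ _ _ (.single _)))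

/-- Equality of composites in the category of 2-cells. -/
theorem comp_ext {b b₁ b₂ b' : C.Obj₂} {μ : b ⟶ b₁} {ν : b₁ ⟶ b'} {μ' : b ⟶ b₂} {ν' : b₂ ⟶ b'}
    (hφ : X₁.Common [[μ.1.φ, X₁.one₂ ν.1.g], [X₁.one₂ μ.1.f, ν.1.φ]]
      [[μ'.1.φ, X₁.one₂ ν'.1.g], [X₁.one₂ μ'.1.f, ν'.1.φ]])
    (hf : (μ ≫ ν).1.f = (μ' ≫ ν').1.f) (hg : (μ ≫ ν).1.g = (μ' ≫ ν').1.g) :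
    μ ≫ ν = μ' ≫ ν' := by
  refine hom_ext ?_ hf hg
  obtain ⟨ψ, h, h'⟩ := hφ
  exact ((comp_val μ ν).unique_of_ne_nil h (by simp)).trans
    ((comp_val μ' ν').unique_of_ne_nil h' (by simp)).symm

end Mor₂

end CatData₁

/-! ### Pastings under strict functors and in fibre products. -/

namespace TwoCat

namespace Le

variable {X : TwoCat.{u}}

/-- Nonemptiness of `M` guarantees that its composite inside the given pasting is the one shared
with `M'`; an empty list could stand for a different identity. -/
theorem replace {L L' M M' : List (List X.Hom₂)} (hM : X.Common M M') (hM' : M ≠ [])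
    (h : X.Le L L') : X.Le (M ++ L) (M' ++ L') := by
  intro χ k
  obtain ⟨φ, ψ, e, h₁, h₂, rfl⟩ := Val.of_append k
  obtain ⟨φ', k₁, k₂⟩ := hM
  cases h₁.unique_of_ne_nil k₁ hM'
  exact k₂.append (h _ h₂) _

theorem subst {p q r : List X.Hom₂} {ψ : X.Hom₂} {L L' : List (List X.Hom₂)} (hq : X.Row q ψ)
    (h : X.Le L L') : X.Le ((p ++ ψ :: r) :: L) ((p ++ (q ++ r)) :: L') :=
  expand (M := [_]) (fun _ k => .of_row (k.subst hq)) h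

end Le

theorem Row.pair (X : TwoCat.{u}) (f g : X.Hom) (h : X.tgt f = X.src g) :
    X.Row [X.one₂ f, X.one₂ g] (X.one₂ (X.comp f g h)) := by
  have k : X.Row [X.one₂ f, X.one₂ g] (X.hcomp (X.one₂ f) (X.one₂ g) (by simpa using h)) :=
    .cons _ _ _ _ (.single _)
  rwa [← X.one₂_comp _ _ h] at k

theorem Row.map {A B : TwoCat.{u}} (F : StrictFunctor A B) {r : List A.Hom₂} {φ : A.Hom₂}
    (h : A.Row r φ) : B.Row (r.map F.hom₂) (F.hom₂ φ) := by
  induction h with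
  | single φ => exact .single _
  | cons φ r ψ h _ ih =>
    rw [F.map_hcomp _ _ _ (by simp [h])]
    exact .cons _ _ _ _ ih

theorem Val.map {A B : TwoCat.{u}} (F : StrictFunctor A B) {L : List (List A.Hom₂)} {φ : A.Hom₂}
    (h : A.Val L φ) : B.Val (L.map (·.map F.hom₂)) (F.hom₂ φ) := by
  induction h with
  | nil f =>
    rw [F.map_one₂]
    exact .nil _
  | cons r φ L ψ h hr _ ih =>
    rw [F.map_vcomp _ _ _ (by simp [h])]
    exact .cons _ _ _ _ _ (hr.map F) ih

theorem Row.ofPb {A B D : TwoCat.{u}} {F : StrictFunctor A D} {G : StrictFunctor B D}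
    {r : List (TwoCat.pb F G).Hom₂} {φ : A.Hom₂} {ψ : B.Hom₂} (h : A.Row (r.map (·.1.1)) φ)
    (h' : B.Row (r.map (·.1.2)) ψ) : ∃ e, (TwoCat.pb F G).Row r ⟨(φ, ψ), e⟩ := by
  induction r generalizing φ ψ with
  | nil => exact absurd rfl h.ne_nil
  | cons a r ih =>
    cases r with
    | nil =>
      cases Row.single_iff.1 h
      cases Row.single_iff.1 h'
      exact ⟨a.2, .single _⟩
    | cons b r =>
      obtain ⟨φ', k, l, rfl⟩ := (Row.cons_iff (by simp)).1 h
      obtain ⟨ψ', k', l', rfl⟩ := (Row.cons_iff (by simp)).1 h'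
      obtain ⟨e, m⟩ := ih l l'
      exact ⟨_, .cons a _ _ (Subtype.ext (Prod.ext k k')) m⟩

/-- A pasting of pairs is evaluated in each coordinate, provided both coordinates are cut into rows
of the same shape. Agreement over the base then follows from agreement of the entries. For the empty
list it could fail, the two coordinates being unrelated identities. -/
theorem Val.ofPb {A B D : TwoCat.{u}} {F : StrictFunctor A D} {G : StrictFunctor B D}
    {L : List (List (TwoCat.pb F G).Hom₂)} {φ : A.Hom₂} {ψ : B.Hom₂}
    (h : A.Val (L.map (·.map (·.1.1))) φ) (h' : B.Val (L.map (·.map (·.1.2))) ψ) (hL : L ≠ []) :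
    ∃ e, (TwoCat.pb F G).Val L ⟨(φ, ψ), e⟩ := by
  induction L generalizing φ ψ with
  | nil => exact absurd rfl hL
  | cons r L ih =>
    cases L with
    | nil =>
      obtain ⟨e, m⟩ := Row.ofPb (Val.row_iff.1 h) (Val.row_iff.1 h')
      exact ⟨e, .of_row m⟩
    | cons r' L =>
      obtain ⟨φ', φ'', k, l, n, rfl⟩ := Val.cons_iff.1 h
      obtain ⟨ψ', ψ'', k', l', n', rfl⟩ := Val.cons_iff.1 h'
      obtain ⟨e, m⟩ := Row.ofPb l l'
      obtain ⟨e', m'⟩ := ih n n' (by simp)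
      exact ⟨_, .cons r _ _ _ (Subtype.ext (Prod.ext k k')) m m'⟩

variable {X : TwoCat.{u}} {D : Type u} [Category.{u} D]

theorem eqToHom_val {x y : X.Ob} (h : x = y) : (eqToHom h).1 = X.one x := by
  subst h
  rfl

/-- The morphisms `eqToHom` are identities of the 2-category, so the commuting squares that define
morphisms in `Pb` are plain equalities of underlying morphisms. This is what identifies `Pb` with a
strict fibre product. -/
theorem val_eq_of_square {x y x' y' : X.Ob} {f : x ⟶ y} {g : x' ⟶ y'} {hx : x = x'} {hy : y = y'}
    (h : f ≫ eqToHom hy = eqToHom hx ≫ g) : f.1 = g.1 := by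
  subst hx hy
  simpa using congrArg Subtype.val h

/-- Sources and targets belong to the underlying morphism itself, so equality of functors can be
tested on underlying morphisms without transport along object equalities. -/
theorem functor_ext {F G : D ⥤ X.Ob} (h : ∀ x, F.obj x = G.obj x)
    (h' : ∀ {x y} (f : x ⟶ y), (F.map f).1 = (G.map f).1) : F = G :=
  CategoryTheory.Functor.ext h fun _ _ f => eq_conj _ _ _ _ (h' f)

theorem map_val_eq {F G : D ⥤ X.Ob} (h : F = G) {x y : D} (f : x ⟶ y) :
    (F.map f).1 = (G.map f).1 := by
  rw [h]

end TwoCat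

/-! ### Composable tuples of 1-cells as objects of the iterated fibre products. -/

instance TwoCat.categoryPb {A B D : TwoCat.{u}} (F : StrictFunctor A D) (G : StrictFunctor B D) :
    Category.{u} (TwoCat.pb F G).Ob := TwoCat.category _

namespace CatData₁

variable {X₀ X₁ : TwoCat.{u}} (C : CatData₁ X₀ X₁)

/-- The functor from composable pairs of 1-cells to the underlying category of the pullback. -/
def pairs : C.cells.D11 ⥤ C.X₂.Ob where
  obj p := ⟨(p.fst, p.snd), p.w⟩
  map f := ⟨⟨(f.1.1.1, f.1.2.1), TwoCat.val_eq_of_square f.2⟩,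
    Subtype.ext (Prod.ext f.1.1.2.1 f.1.2.2.1), Subtype.ext (Prod.ext f.1.1.2.2 f.1.2.2.2)⟩
  map_id _ := rfl
  map_comp _ _ := rfl

instance : Category.{u} C.X₃.Ob := TwoCat.category _

instance : Category.{u} C.X₄.Ob := TwoCat.category _

/-- The functor from composable triples of 1-cells to the underlying category of the pullback. -/
def triples : C.cells.D111 ⥤ C.X₃.Ob where
  obj p := ⟨(C.pairs.obj p.fst, p.snd), p.w⟩
  map f := ⟨⟨((C.pairs.map f.1.1).1, f.1.2.1), TwoCat.val_eq_of_square f.2⟩,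
    Subtype.ext (Prod.ext (C.pairs.map f.1.1).2.1 f.1.2.2.1),
    Subtype.ext (Prod.ext (C.pairs.map f.1.1).2.2 f.1.2.2.2)⟩
  map_id _ := rfl
  map_comp _ _ := rfl

/-- The functor from composable quadruples of 1-cells to the underlying category of the
pullback. -/
def quads : C.cells.D1111 ⥤ C.X₄.Ob where
  obj p := ⟨(C.triples.obj p.fst, p.snd), p.w⟩
  map f := ⟨⟨((C.triples.map f.1.1).1, f.1.2.1), TwoCat.val_eq_of_square f.2⟩,
    Subtype.ext (Prod.ext (C.triples.map f.1.1).2.1 f.1.2.2.1),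
    Subtype.ext (Prod.ext (C.triples.map f.1.1).2.2 f.1.2.2.2)⟩
  map_id _ := rfl
  map_comp _ _ := rfl

/-! ### Identity 2-cells, and 2-cells given by transformations. -/

variable {C}

/-- The identity 2-cell of a 1-cell. -/
def Obj₂.id (C : CatData₁ X₀ X₁) (x : X₁.Ob) : C.Obj₂ := .of (X₁.one x) (by simp) (by simp)

/-- The action of the identity 2-cells on morphisms. -/
def Mor₂.idMap (C : CatData₁ X₀ X₁) {x y : X₁.Ob} (f : x ⟶ y) : Obj₂.id C x ⟶ Obj₂.id C y :=
  Mor₂.homOf _ _ (X₁.one₂ f.1) f.1 f.1 ((X₁.tgt_one x).trans f.2.1.symm)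
    (f.2.2.trans (X₁.src_one y).symm) ((X₁.src₂_one₂ _).trans (X₁.one_comp' f.2.1 _).symm)
    ((X₁.tgt₂_one₂ _).trans (X₁.comp_one' f.2.2 _).symm) (by simp) (by simp)

/-- The functor of 2-cell identities. -/
def iv (C : CatData₁ X₀ X₁) : X₁.Ob ⥤ C.Obj₂ where
  obj x := .id C x
  map f := Mor₂.idMap C f
  map_id x := Mor₂.hom_ext rfl (congrArg X₁.one (X₁.src_one x).symm :)
    (congrArg X₁.one (X₁.tgt_one x).symm :)
  map_comp {x y z} f g := Mor₂.hom_ext (by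
      have h : X₁.tgt f.1 = X₁.src g.1 := f.2.2.trans g.2.1.symm
      have k := Mor₂.comp_val (Mor₂.idMap C f) (Mor₂.idMap C g)
      -- Both rows of the composite of two identity squares consist of identities on `f` and `g`;
      -- one is dropped and the other composes to the identity of the composite.
      refine TwoCat.Val.unique_of_ne_nil (L := [[X₁.one₂ f.1, X₁.one₂ g.1]])
        (.of_row (?_ : X₁.Row _ (X₁.one₂ (X₁.comp f.1 g.1 h))))
        (TwoCat.Le.skip (.drop₂ (.refl _)) _ k) (by simp)
      exact .pair _ _ _ _)
    rfl rfl

/-- The 2-cell given by a component of a weak transformation whose images under source and target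
are identities. -/
def Obj₂.app {A : TwoCat.{u}} (τ : Transf A X₁)
    (hs : τ.post C.s = .id (τ.dom.comp C.s)) (ht : τ.post C.t = .id (τ.dom.comp C.t))
    (x : A.Ob) : C.Obj₂ := .of (τ.app x)
  ((congrFun (congrArg Transf.app hs) x).trans (by simp))
  ((congrFun (congrArg Transf.app ht) x).trans (by simp))

/-- The morphism of 2-cells given by a naturality 2-morphism. -/
def Mor₂.nat {A : TwoCat.{u}} (τ : Transf A X₁)
    (hs : τ.post C.s = .id (τ.dom.comp C.s)) (ht : τ.post C.t = .id (τ.dom.comp C.t))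
    {x y : A.Ob} (f : x ⟶ y) : Obj₂.app τ hs ht x ⟶ Obj₂.app τ hs ht y :=
  Mor₂.homOf _ _ (τ.nat f.1) (τ.cod.hom f.1) (τ.dom.hom f.1)
    (by
      refine (τ.tgt_app _).trans ?_
      rw [τ.cod.src_hom, f.2.1])
    (by
      refine Eq.trans ?_ (τ.src_app _).symm
      rw [τ.dom.tgt_hom, f.2.2])
    ((τ.src₂_nat' _).trans (X₁.comp_congr (congrArg τ.app f.2.1) rfl _ _))
    ((τ.tgt₂_nat' _).trans (X₁.comp_congr rfl (congrArg τ.app f.2.2) _ _))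
    ((congrFun (congrArg Transf.nat hs) f.1).trans (congrArg X₀.one₂
      (congrFun (congrArg (fun τ => τ.cod.hom) hs) f.1).symm))
    ((congrFun (congrArg Transf.nat ht) f.1).trans (congrArg X₀.one₂
      (congrFun (congrArg (fun τ => τ.cod.hom) ht) f.1).symm))

/-- The functor to 2-cells given by a weak transformation whose images under source and target are
identities. -/
def ofTransf {A : TwoCat.{u}} (τ : Transf A X₁) (hτ : τ.IsWeak)
    (hs : τ.post C.s = .id (τ.dom.comp C.s)) (ht : τ.post C.t = .id (τ.dom.comp C.t)) :
    A.Ob ⥤ C.Obj₂ where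
  obj x := .app τ hs ht x
  map f := Mor₂.nat τ hs ht f
  map_id x := Mor₂.hom_ext (hτ.nat_one x)
    ((τ.dom.map_one x).trans (congrArg X₁.one (τ.src_app x).symm))
    ((τ.cod.map_one x).trans (congrArg X₁.one (τ.tgt_app x).symm))
  map_comp {x y z} f g := Mor₂.hom_ext
    ((hτ.nat_comp_val f.1 g.1 (f.2.2.trans g.2.1.symm)).unique_of_ne_nil
      (Mor₂.comp_val (Mor₂.nat τ hs ht f) (Mor₂.nat τ hs ht g)) (by simp))
    (τ.dom.map_comp _ _ _ _) (τ.cod.map_comp _ _ _ _)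

/-! ### Vertical composition of 2-cells. -/

/-- The vertical composite of 2-cells. -/
def Obj₂.comp (b b' : C.Obj₂) (h : X₁.tgt b.u = X₁.src b'.u) : C.Obj₂ :=
  .of (X₁.comp b.u b'.u h)
    (by
      rw [C.s.map_comp _ _ _ (by simp [h]), X₀.comp_congr (Mor₂.s_u' b) (Mor₂.s_u b') _
        (by simp [h]), X₀.one_comp' (by simp [h]), X₁.src_comp, ← h, C.s_tgt])
    (by
      rw [C.t.map_comp _ _ _ (by simp [h]), X₀.comp_congr (Mor₂.t_u' b) (Mor₂.t_u b') _
        (by simp [h]), X₀.one_comp' (by simp [h]), X₁.src_comp, ← h, C.t_tgt])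

namespace Mor₂

theorem src_φ' {b b' : C.Obj₂} (μ : b ⟶ b') (h : X₁.tgt b.u = X₁.src μ.1.g) :
    X₁.src₂ μ.1.φ = X₁.comp b.u μ.1.g h := by
  obtain ⟨μ, rfl, rfl⟩ := μ
  exact μ.src_φ

theorem tgt_φ' {b b' : C.Obj₂} (μ : b ⟶ b') (h : X₁.tgt μ.1.f = X₁.src b'.u) :
    X₁.tgt₂ μ.1.φ = X₁.comp μ.1.f b'.u h := by
  obtain ⟨μ, rfl, rfl⟩ := μ
  exact μ.tgt_φ

theorem hbg' {b b' : C.Obj₂} (μ : b ⟶ b') : X₁.tgt b.u = X₁.src μ.1.g := by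
  obtain ⟨μ, rfl, rfl⟩ := μ
  exact μ.hbg

theorem hfb' {b b' : C.Obj₂} (μ : b ⟶ b') : X₁.tgt μ.1.f = X₁.src b'.u := by
  obtain ⟨μ, rfl, rfl⟩ := μ
  exact μ.hfb

theorem src_f' {b b' : C.Obj₂} (μ : b ⟶ b') : X₁.src μ.1.f = X₁.src b.u := (C.S.map μ).2.1

theorem tgt_g' {b b' : C.Obj₂} (μ : b ⟶ b') : X₁.tgt μ.1.g = X₁.tgt b'.u := (C.T.map μ).2.2

section comp

variable {b₁ b₁' b₂ b₂' : C.Obj₂} (μ : b₁ ⟶ b₁') (ν : b₂ ⟶ b₂')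

theorem vcomp_aux₁ (h : X₁.tgt b₁.u = X₁.src b₂.u) :
    X₁.tgt (X₁.src₂ (X₁.one₂ b₁.u)) = X₁.src (X₁.src₂ ν.1.φ) := by
  simp [src_φ' ν (hbg' ν), h]

theorem vcomp_aux₂ (h : X₁.tgt b₁'.u = X₁.src b₂'.u) :
    X₁.tgt (X₁.src₂ μ.1.φ) = X₁.src (X₁.src₂ (X₁.one₂ b₂'.u)) := by
  simp [src_φ' μ (hbg' μ), tgt_g', h]

theorem vcomp_aux₃ (h : X₁.tgt b₁.u = X₁.src b₂.u)
    (h' : X₁.tgt b₁'.u = X₁.src b₂'.u) (e : μ.1.g = ν.1.f) :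
    X₁.tgt₂ (X₁.hcomp (X₁.one₂ b₁.u) ν.1.φ (vcomp_aux₁ ν h)) =
      X₁.src₂ (X₁.hcomp μ.1.φ (X₁.one₂ b₂'.u) (vcomp_aux₂ μ h')) := by
  have e₁ : X₁.tgt b₁.u = X₁.src ν.1.f := (hbg' μ).trans (congrArg X₁.src e)
  have e₂ : X₁.tgt μ.1.g = X₁.src b₂'.u := (congrArg X₁.tgt e).trans (hfb' ν)
  rw [X₁.tgt₂_hcomp _ _ _ (by simpa [src_φ' ν (hbg' ν), tgt_φ' ν (hfb' ν)] using e₁),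
    X₁.src₂_hcomp, X₁.comp_congr (X₁.tgt₂_one₂ _) (tgt_φ' ν (hfb' ν)) _ (by simpa using e₁),
    X₁.comp_congr (src_φ' μ (hbg' μ)) (X₁.src₂_one₂ _) _ (by simpa using e₂)]
  rw [← X₁.comp_assoc _ _ _ e₁ (hfb' ν) (by simpa using hfb' ν) (by simpa using e₁)]
  exact X₁.comp_congr (X₁.comp_congr rfl e.symm _ _) rfl _ _

/-- The vertical composite of morphisms of 2-cells. -/
def compMap (h : X₁.tgt b₁.u = X₁.src b₂.u) (h' : X₁.tgt b₁'.u = X₁.src b₂'.u)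
    (e : μ.1.g = ν.1.f) : b₁.comp b₂ h ⟶ b₁'.comp b₂' h' := by
  have e₁ : X₁.tgt b₁.u = X₁.src ν.1.f := (hbg' μ).trans (congrArg X₁.src e)
  have e₂ : X₁.tgt μ.1.g = X₁.src b₂'.u := (congrArg X₁.tgt e).trans (hfb' ν)
  -- One computation serves both `s` and `t`. Such a functor sends the outer 2-cells and the
  -- 2-morphisms of the squares to identities, so each of the two rows is sent to the same identity.
  have aux : ∀ (F : StrictFunctor X₁ X₀), F.hom b₁.u = X₀.one (F.ob (X₁.src b₁.u)) →
      F.hom b₂'.u = X₀.one (F.ob (X₁.src b₂'.u)) → F.hom ν.1.f = F.hom ν.1.g →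
      F.hom₂ μ.1.φ = X₀.one₂ (F.hom μ.1.g) → F.hom₂ ν.1.φ = X₀.one₂ (F.hom ν.1.g) →
      F.hom₂ (X₁.vcomp (X₁.hcomp (X₁.one₂ b₁.u) ν.1.φ (vcomp_aux₁ ν h))
        (X₁.hcomp μ.1.φ (X₁.one₂ b₂'.u) (vcomp_aux₂ μ h')) (vcomp_aux₃ μ ν h h' e)) =
      X₀.one₂ (F.hom ν.1.g) := by
    intro F h₁ h₂ h₃ h₄ h₅
    have k₁ : F.ob (X₁.src b₁.u) = F.ob (X₁.src ν.1.f) := by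
      simpa [e₁] using (congrArg X₀.tgt h₁).symm
    have k₂ : X₀.tgt (F.hom ν.1.f) = F.ob (X₁.src b₂'.u) := by
      rw [F.tgt_hom, hfb' ν]
    rw [F.map_vcomp _ _ _ (by simpa using congrArg F.hom (vcomp_aux₃ μ ν h h' e)),
      X₀.vcomp_congr (f' := X₀.one₂ (F.hom ν.1.g)) (g' := X₀.one₂ (F.hom ν.1.g)) _ _ _ (by simp),
      X₀.one₂_vcomp' (by simp)]
    · rw [F.map_hcomp _ _ _ (by simpa using congrArg F.ob (vcomp_aux₁ ν h)),
        X₀.hcomp_congr ((F.map_one₂ _).trans (congrArg X₀.one₂ h₁))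
          (h₅.trans (congrArg X₀.one₂ h₃.symm)) _
          (by simp [k₁]), X₀.one_hcomp' (by simp [k₁]), h₃]
    · rw [F.map_hcomp _ _ _ (by simpa using congrArg F.ob (vcomp_aux₂ μ h')),
        X₀.hcomp_congr (h₄.trans (congrArg (fun g => X₀.one₂ (F.hom g)) e))
          ((F.map_one₂ _).trans (congrArg X₀.one₂ h₂)) _
          (by simpa using k₂), X₀.hcomp_one' (by simpa using k₂), h₃]
  refine Mor₂.homOf _ _ (X₁.vcomp (X₁.hcomp (X₁.one₂ b₁.u) ν.1.φ (vcomp_aux₁ ν h))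
    (X₁.hcomp μ.1.φ (X₁.one₂ b₂'.u) (vcomp_aux₂ μ h')) (vcomp_aux₃ μ ν h h' e))
    ν.1.g μ.1.f ((X₁.tgt_comp _ _ _).trans (hbg' ν))
    ((hfb' μ).trans (X₁.src_comp _ _ _).symm) ?_ ?_
    (aux C.s (s_u _) (s_u _) ν.1.s_f μ.1.s_φ' ν.1.s_φ')
    (aux C.t (t_u _) (t_u _) ν.1.t_f μ.1.t_φ' ν.1.t_φ')
  · rw [X₁.src₂_vcomp, X₁.src₂_hcomp,
      X₁.comp_congr (X₁.src₂_one₂ _) (src_φ' ν (hbg' ν)) _ (by simpa using h)]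
    exact (X₁.comp_assoc _ _ _ _ _ _ _).symm
  · rw [X₁.tgt₂_vcomp, X₁.tgt₂_hcomp _ _ _ (by simpa [tgt_φ' μ (hfb' μ)] using h'),
      X₁.comp_congr (tgt_φ' μ (hfb' μ)) (X₁.tgt₂_one₂ _) _ (by simpa using h')]
    exact X₁.comp_assoc _ _ _ _ _ _ _

theorem compMap_val (h : X₁.tgt b₁.u = X₁.src b₂.u) (h' : X₁.tgt b₁'.u = X₁.src b₂'.u)
    (e : μ.1.g = ν.1.f) : X₁.Val [[X₁.one₂ b₁.u, ν.1.φ], [μ.1.φ, X₁.one₂ b₂'.u]]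
      (compMap μ ν h h' e).1.φ :=
  .cons _ _ _ _ _ (.cons _ _ _ _ (.single _)) (.of_row (.cons _ _ _ _ (.single _)))

/-- Expanded completely, each side has four rows, with the same first and last rows. The middle two
rows carry `μ.φ` and `ν'.φ` side by side, in opposite orders, and interchange exchanges them. -/
theorem compMap_comp {b₁'' b₂'' : C.Obj₂} (μ' : b₁' ⟶ b₁'') (ν' : b₂' ⟶ b₂'') (h h' h'' e e' e'') :
    compMap (μ ≫ μ') (ν ≫ ν') h h'' e'' = compMap μ ν h h' e ≫ compMap μ' ν' h' h'' e' := by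
  refine hom_ext ?_ rfl rfl
  have k := compMap_val (μ ≫ μ') (ν ≫ ν') h h'' e''
  have k' := comp_val (compMap μ ν h h' e) (compMap μ' ν' h' h'' e')
  have e₁ : X₁.tgt b₁.u = X₁.src ν.1.f := (hbg' μ).trans (congrArg X₁.src e)
  have e₁' : X₁.tgt b₁'.u = X₁.src ν'.1.f := (hbg' μ').trans (congrArg X₁.src e')
  have l : X₁.Common [[X₁.one₂ b₁.u, X₁.one₂ ν.1.f, ν'.1.φ],
      [μ.1.φ, X₁.one₂ μ'.1.g, X₁.one₂ b₂''.u]]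
      [[μ.1.φ, X₁.one₂ b₂'.u, X₁.one₂ ν'.1.g], [X₁.one₂ μ.1.f, X₁.one₂ b₁'.u, ν'.1.φ]] := by
    have l := TwoCat.Common.exchange (φ := μ.1.φ) (ψ := ν'.1.φ)
      (by simp [src_φ' μ (hbg' μ), src_φ' ν' (hbg' ν'), tgt_g', h'])
    rw [src_φ' μ (hbg' μ), tgt_φ' μ (hfb' μ), src_φ' ν' (hbg' ν'), tgt_φ' ν' (hfb' ν')] at l
    -- The identities on the sources and targets of `μ.φ` and `ν'.φ` are split into paths. On the
    -- first side the paths are those wanted only after `e` and `e'` identify the shared edges.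
    refine l.mono (.subst (p := []) (r := [_]) (q := [_, _]) ?_
      (.subst (p := [_]) (r := []) (q := [_, _]) ?_ (.refl _)))
      (.subst (p := [_]) (r := []) (q := [_, _]) ?_
        (.subst (p := []) (r := [_]) (q := [_, _]) ?_ (.refl _)))
    · simp only [e]
      exact .pair _ _ _ _
    · simp only [e']
      exact .pair _ _ _ _
    · exact .pair _ _ _ _
    · exact .pair _ _ _ _
  have m := (TwoCat.Le.expand (fun ρ hρ => (comp_val ν ν').row_left hρ)
    (.expand (fun ρ hρ => (comp_val μ μ').row_right hρ) (.refl _))) _ k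
  have m' := (TwoCat.Le.expand (fun ρ hρ => (compMap_val μ ν h h' e).row_right hρ)
    (.expand (fun ρ hρ => (compMap_val μ' ν' h' h'' e').row_left hρ) (.refl _))) _ k'
  refine TwoCat.Val.unique_of_ne_nil (TwoCat.Le.skip (.replace l (by simp) (.refl _)) _ m) m'
      (by simp)

end comp

end Mor₂

/-- Vertical composition of 2-cells. -/
def mv (C : CatData₁ X₀ X₁) : C.cells.DV ⥤ C.Obj₂ where
  obj p := Obj₂.comp p.fst p.snd p.w
  map {p q} f := Mor₂.compMap f.1.1 f.1.2 p.w q.w (TwoCat.val_eq_of_square f.2)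
  map_id p := Mor₂.hom_ext
    (TwoCat.Val.unique_of_ne_nil (TwoCat.Le.skip (.drop₂ (.refl _)) _
      (Mor₂.compMap_val (𝟙 p.fst) (𝟙 p.snd) p.w p.w (TwoCat.val_eq_of_square (𝟙 p :).2)))
      (.of_row (.pair _ _ _ p.w)) (by simp))
    (congrArg X₁.one (X₁.src_comp _ _ _).symm) (congrArg X₁.one (X₁.tgt_comp _ _ _).symm)
  map_comp f g := Mor₂.compMap_comp f.1.1 f.1.2 g.1.1 g.1.2 _ _ _ _ _ _

/-! ### Whiskers. -/

/-- The right whisker of a 2-cell. -/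
def Obj₂.whiskerRight (b : C.Obj₂) (y : X₁.Ob) (h : C.t.ob (X₁.src b.u) = C.s.ob y) : C.Obj₂ :=
  .of (C.m.hom ⟨(b.u, X₁.one y), by simp [Mor₂.t_u b, h]⟩)
    ((C.s_m_hom _).trans ((Mor₂.s_u b).trans (by simp)))
    ((C.t_m_hom _).trans (by simp))

/-- The left whisker of a 2-cell. -/
def Obj₂.whiskerLeft (x : X₁.Ob) (b : C.Obj₂) (h : C.t.ob x = C.s.ob (X₁.src b.u)) : C.Obj₂ :=
  .of (C.m.hom ⟨(X₁.one x, b.u), by simp [Mor₂.s_u b, h]⟩)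
    ((C.s_m_hom _).trans (by simp))
    ((C.t_m_hom _).trans ((Mor₂.t_u b).trans (by simp)))

/-- The right whisker of a morphism of 2-cells. -/
def Mor₂.whiskerRight {b b' : C.Obj₂} (μ : b ⟶ b') {y y' : X₁.Ob} (f : y ⟶ y')
    (h : C.t.ob (X₁.src b.u) = C.s.ob y) (h' : C.t.ob (X₁.src b'.u) = C.s.ob y')
    (e : C.t.hom μ.1.f = C.s.hom f.1) : b.whiskerRight y h ⟶ b'.whiskerRight y' h' :=
  -- Since `t` sends the 2-morphism of a square and its two 2-cells to identities, it takes the same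
  -- value on both remaining edges. Composability at `f` therefore gives composability at `g`.
  have e' : C.t.hom μ.1.g = C.s.hom f.1 := μ.1.t_f.symm.trans e
  Mor₂.homOf _ _ (C.m.hom₂ ⟨(μ.1.φ, X₁.one₂ f.1), by simp [t_φ', e']⟩)
    (C.m.hom ⟨(μ.1.g, f.1), e'⟩) (C.m.hom ⟨(μ.1.f, f.1), e⟩)
    (by
      refine (C.m.tgt_hom _).trans (Eq.trans ?_ (C.m.src_hom _).symm)
      exact congrArg C.m.ob (Subtype.ext (Prod.ext (hbg' μ) ((X₁.tgt_one _).trans f.2.1.symm))))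
    (by
      refine (C.m.tgt_hom _).trans (Eq.trans ?_ (C.m.src_hom _).symm)
      exact congrArg C.m.ob (Subtype.ext (Prod.ext (hfb' μ) (f.2.2.trans (X₁.src_one _).symm))))
    (by
      refine (C.m.src₂_hom₂ _).trans (Eq.trans ?_ (C.m.map_comp _ _ ?_ _))
      · exact congrArg C.m.hom (Subtype.ext (Prod.ext (src_φ' μ (hbg' μ))
          ((X₁.src₂_one₂ _).trans (X₁.one_comp' f.2.1 _).symm)))
      · exact Subtype.ext (Prod.ext (hbg' μ) ((X₁.tgt_one _).trans f.2.1.symm)))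
    (by
      refine (C.m.tgt₂_hom₂ _).trans (Eq.trans ?_ (C.m.map_comp _ _ ?_ _))
      · exact congrArg C.m.hom (Subtype.ext (Prod.ext (tgt_φ' μ (hfb' μ))
          ((X₁.tgt₂_one₂ _).trans (X₁.comp_one' f.2.2 _).symm)))
      · exact Subtype.ext (Prod.ext (hfb' μ) (f.2.2.trans (X₁.src_one _).symm)))
    ((C.s_m_hom₂ _).trans (μ.1.s_φ'.trans (by simp)))
    ((C.t_m_hom₂ _).trans (by simp))

/-- The left whisker of a morphism of 2-cells. -/
def Mor₂.whiskerLeft {x x' : X₁.Ob} (f : x ⟶ x') {b b' : C.Obj₂} (μ : b ⟶ b')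
    (h : C.t.ob x = C.s.ob (X₁.src b.u)) (h' : C.t.ob x' = C.s.ob (X₁.src b'.u))
    (e : C.t.hom f.1 = C.s.hom μ.1.f) : Obj₂.whiskerLeft x b h ⟶ Obj₂.whiskerLeft x' b' h' :=
  have e' : C.t.hom f.1 = C.s.hom μ.1.g := e.trans μ.1.s_f
  Mor₂.homOf _ _ (C.m.hom₂ ⟨(X₁.one₂ f.1, μ.1.φ), by simp [s_φ', e']⟩)
    (C.m.hom ⟨(f.1, μ.1.g), e'⟩) (C.m.hom ⟨(f.1, μ.1.f), e⟩)
    (by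
      refine (C.m.tgt_hom _).trans (Eq.trans ?_ (C.m.src_hom _).symm)
      exact congrArg C.m.ob (Subtype.ext (Prod.ext ((X₁.tgt_one _).trans f.2.1.symm) (hbg' μ))))
    (by
      refine (C.m.tgt_hom _).trans (Eq.trans ?_ (C.m.src_hom _).symm)
      exact congrArg C.m.ob (Subtype.ext (Prod.ext (f.2.2.trans (X₁.src_one _).symm) (hfb' μ))))
    (by
      refine (C.m.src₂_hom₂ _).trans (Eq.trans ?_ (C.m.map_comp _ _ ?_ _))
      · exact congrArg C.m.hom (Subtype.ext (Prod.ext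
          ((X₁.src₂_one₂ _).trans (X₁.one_comp' f.2.1 _).symm) (src_φ' μ (hbg' μ))))
      · exact Subtype.ext (Prod.ext ((X₁.tgt_one _).trans f.2.1.symm) (hbg' μ)))
    (by
      refine (C.m.tgt₂_hom₂ _).trans (Eq.trans ?_ (C.m.map_comp _ _ ?_ _))
      · exact congrArg C.m.hom (Subtype.ext (Prod.ext
          ((X₁.tgt₂_one₂ _).trans (X₁.comp_one' f.2.2 _).symm) (tgt_φ' μ (hfb' μ))))
      · exact Subtype.ext (Prod.ext (f.2.2.trans (X₁.src_one _).symm) (hfb' μ)))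
    ((C.s_m_hom₂ _).trans (by simp))
    ((C.t_m_hom₂ _).trans (μ.1.t_φ'.trans (by simp)))

theorem Obj₂.src_whiskerRight (b : C.Obj₂) (y : X₁.Ob) (h) :
    X₁.src (b.whiskerRight y h).u = C.m.ob ⟨(X₁.src b.u, y), h⟩ :=
  (C.m.src_hom _).trans (congrArg C.m.ob (Subtype.ext (Prod.ext rfl (X₁.src_one y))))

theorem Obj₂.tgt_whiskerRight (b : C.Obj₂) (y : X₁.Ob) (h) :
    X₁.tgt (b.whiskerRight y h).u = C.m.ob ⟨(X₁.tgt b.u, y), (C.t_tgt b).trans h⟩ :=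
  (C.m.tgt_hom _).trans (congrArg C.m.ob (Subtype.ext (Prod.ext rfl (X₁.tgt_one y))))

theorem Obj₂.src_whiskerLeft (x : X₁.Ob) (b : C.Obj₂) (h) :
    X₁.src (Obj₂.whiskerLeft x b h).u = C.m.ob ⟨(x, X₁.src b.u), h⟩ :=
  (C.m.src_hom _).trans (congrArg C.m.ob (Subtype.ext (Prod.ext (X₁.src_one x) rfl)))

theorem Obj₂.tgt_whiskerLeft (x : X₁.Ob) (b : C.Obj₂) (h) :
    X₁.tgt (Obj₂.whiskerLeft x b h).u = C.m.ob ⟨(x, X₁.tgt b.u), h.trans (C.s_tgt b).symm⟩ :=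
  (C.m.tgt_hom _).trans (congrArg C.m.ob (Subtype.ext (Prod.ext (X₁.tgt_one x) rfl)))

theorem Mor₂.whiskerRight_id (b : C.Obj₂) (y : X₁.Ob) (h : C.t.ob (X₁.src b.u) = C.s.ob y) (e) :
    Mor₂.whiskerRight (𝟙 b) (𝟙 y) h h e = 𝟙 _ :=
  Mor₂.hom_ext (C.m₂_one₂' _ _ _)
    ((C.m₁_one' _ _ _).trans (congrArg X₁.one (b.src_whiskerRight y h).symm))
    ((C.m₁_one' _ _ _).trans (congrArg X₁.one (b.tgt_whiskerRight y h).symm))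

theorem Mor₂.whiskerLeft_id (x : X₁.Ob) (b : C.Obj₂) (h : C.t.ob x = C.s.ob (X₁.src b.u)) (e) :
    Mor₂.whiskerLeft (𝟙 x) (𝟙 b) h h e = 𝟙 _ :=
  Mor₂.hom_ext (C.m₂_one₂' _ _ _)
    ((C.m₁_one' _ _ _).trans (congrArg X₁.one (Obj₂.src_whiskerLeft x b h).symm))
    ((C.m₁_one' _ _ _).trans (congrArg X₁.one (Obj₂.tgt_whiskerLeft x b h).symm))

/-- The repeated row gives an identity the same shape as a composite of two squares, so that the two
can be paired in the fibre product. -/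
theorem one₂_comp_val {f g : X₁.Hom} (h : X₁.tgt f = X₁.src g) :
    X₁.Val [[X₁.one₂ f, X₁.one₂ g], [X₁.one₂ f, X₁.one₂ g]] (X₁.one₂ (X₁.comp f g h)) := by
  rw [← X₁.one₂_vcomp' (X₁.src₂_one₂ (X₁.comp f g h)) (by simp)]
  exact .cons _ _ _ _ _ (.pair _ _ _ _) (.of_row (.pair _ _ _ _))

theorem Mor₂.whiskerRight_comp {b b' b'' : C.Obj₂} (μ : b ⟶ b') (ν : b' ⟶ b'') {y y' y'' : X₁.Ob}
    (f : y ⟶ y') (g : y' ⟶ y'') (h h' h'' e e' e'') :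
    Mor₂.whiskerRight (μ ≫ ν) (f ≫ g) h h'' e'' =
      Mor₂.whiskerRight μ f h h' e ≫ Mor₂.whiskerRight ν g h' h'' e' := by
  have k : X₁.tgt f.1 = X₁.src g.1 := f.2.2.trans g.2.1.symm
  refine Mor₂.hom_ext ?_
    (C.m.map_comp ⟨(μ.1.f, f.1), e⟩ ⟨(ν.1.f, g.1), e'⟩ (Subtype.ext (Prod.ext
      ((hfb' μ).trans (src_f' ν).symm) k)) _)
    (C.m.map_comp ⟨(μ.1.g, f.1), μ.1.t_f.symm.trans e⟩ ⟨(ν.1.g, g.1), ν.1.t_f.symm.trans e'⟩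
      (Subtype.ext (Prod.ext ((tgt_g' μ).trans (hbg' ν)) k)) _)
  -- The pasting is made of pairs, the first coordinate composing two squares and the second an
  -- identity. Applying `M` to it, entry by entry, gives the pasting of the whiskered squares.
  obtain ⟨_, l⟩ := TwoCat.Val.ofPb (F := C.t) (G := C.s)
    (L := [[⟨(μ.1.φ, X₁.one₂ f.1), by simp [t_φ', μ.1.t_f.symm.trans e]⟩,
      ⟨(X₁.one₂ ν.1.g, X₁.one₂ g.1), by simp [ν.1.t_f.symm.trans e']⟩],
      [⟨(X₁.one₂ μ.1.f, X₁.one₂ f.1), by simp [e]⟩,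
        ⟨(ν.1.φ, X₁.one₂ g.1), by simp [t_φ', ν.1.t_f.symm.trans e']⟩]])
    (comp_val μ ν) (one₂_comp_val k) (by simp)
  refine (l.map C.m).unique_of_ne_nil ?_ (by simp)
  have m := Mor₂.comp_val (Mor₂.whiskerRight μ f h h' e) (Mor₂.whiskerRight ν g h' h'' e')
  simp only [List.map_cons, List.map_nil, m₂_one₂']
  exact m

theorem Mor₂.whiskerLeft_comp {x x' x'' : X₁.Ob} (f : x ⟶ x') (g : x' ⟶ x'') {b b' b'' : C.Obj₂}
    (μ : b ⟶ b') (ν : b' ⟶ b'') (h h' h'' e e' e'') :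
    Mor₂.whiskerLeft (f ≫ g) (μ ≫ ν) h h'' e'' =
      Mor₂.whiskerLeft f μ h h' e ≫ Mor₂.whiskerLeft g ν h' h'' e' := by
  have k : X₁.tgt f.1 = X₁.src g.1 := f.2.2.trans g.2.1.symm
  refine Mor₂.hom_ext ?_
    (C.m.map_comp ⟨(f.1, μ.1.f), e⟩ ⟨(g.1, ν.1.f), e'⟩ (Subtype.ext (Prod.ext k
      ((hfb' μ).trans (src_f' ν).symm))) _)
    (C.m.map_comp ⟨(f.1, μ.1.g), e.trans μ.1.s_f⟩ ⟨(g.1, ν.1.g), e'.trans ν.1.s_f⟩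
      (Subtype.ext (Prod.ext k ((tgt_g' μ).trans (hbg' ν)))) _)
  -- The same pasting of pairs with the two coordinates exchanged.
  obtain ⟨_, l⟩ := TwoCat.Val.ofPb (F := C.t) (G := C.s)
    (L := [[⟨(X₁.one₂ f.1, μ.1.φ), by simp [s_φ', e.trans μ.1.s_f]⟩,
      ⟨(X₁.one₂ g.1, X₁.one₂ ν.1.g), by simp [e'.trans ν.1.s_f]⟩],
      [⟨(X₁.one₂ f.1, X₁.one₂ μ.1.f), by simp [e]⟩,
        ⟨(X₁.one₂ g.1, ν.1.φ), by simp [s_φ', e'.trans ν.1.s_f]⟩]])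
    (one₂_comp_val k) (comp_val μ ν) (by simp)
  refine (l.map C.m).unique_of_ne_nil ?_ (by simp)
  have m := Mor₂.comp_val (Mor₂.whiskerLeft f μ h h' e) (Mor₂.whiskerLeft g ν h' h'' e')
  simp only [List.map_cons, List.map_nil, m₂_one₂']
  exact m

/-- Right whiskers. -/
def wr (C : CatData₁ X₀ X₁) : C.cells.D21 ⥤ C.Obj₂ where
  obj p := Obj₂.whiskerRight p.fst p.snd p.w
  map {p q} f := Mor₂.whiskerRight f.1.1 f.1.2 p.w q.w (TwoCat.val_eq_of_square f.2)
  map_id _ := Mor₂.whiskerRight_id _ _ _ _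
  map_comp _ _ := Mor₂.whiskerRight_comp _ _ _ _ _ _ _ _ _ _

/-- Left whiskers. -/
def wl (C : CatData₁ X₀ X₁) : C.cells.D12 ⥤ C.Obj₂ where
  obj p := Obj₂.whiskerLeft p.fst p.snd p.w
  map {p q} f := Mor₂.whiskerLeft f.1.1 f.1.2 p.w q.w (TwoCat.val_eq_of_square f.2)
  map_id _ := Mor₂.whiskerLeft_id _ _ _ _
  map_comp _ _ := Mor₂.whiskerLeft_comp _ _ _ _ _ _ _ _ _ _

end CatData₁

/-! ### The 1-data of the bicategory object. -/

/-- The domain of the image transformation forces which identity transformation it is. This puts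
conditions stated with different functors into the uniform form required by `ofTransf`. -/
theorem Transf.post_eq_id {A B D : TwoCat.{u}} {τ : Transf A B} {F : StrictFunctor B D}
    {G : StrictFunctor A D} (h : τ.post F = .id G) : τ.post F = .id (τ.dom.comp F) :=
  h.trans (congrArg Transf.id (congrArg Transf.dom h).symm)

namespace CatObj

variable {X₀ X₁ : TwoCat.{u}} (C : CatObj X₀ X₁)

/-- The 1-data of the bicategory object of a category object. -/
def bicatData₁ : Data₁ C.data₁.cells where
  i := C.data₁.i.functor
  m := C.data₁.pairs ⋙ C.data₁.m.functor
  iv := C.data₁.iv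
  mv := C.data₁.mv
  wr := C.data₁.wr
  wl := C.data₁.wl
  il := CatData₁.ofTransf C.data₂.lam C.data₂.lam_isWeak
    (Transf.post_eq_id C.data₂.lam_s) (Transf.post_eq_id C.data₂.lam_t)
  ir := CatData₁.ofTransf C.data₂.rho C.data₂.rho_isWeak
    (Transf.post_eq_id C.data₂.rho_s) (Transf.post_eq_id C.data₂.rho_t)
  a := C.data₁.triples ⋙
    CatData₁.ofTransf C.data₂.alp C.data₂.alp_isWeak
    (Transf.post_eq_id C.data₂.alp_s) (Transf.post_eq_id C.data₂.alp_t)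
  i_s := TwoCat.functor_ext C.data₁.s_i_ob (fun f => C.data₁.s_i_hom f.1)
  i_t := TwoCat.functor_ext C.data₁.t_i_ob (fun f => C.data₁.t_i_hom f.1)
  m_s := TwoCat.functor_ext (fun p => C.data₁.s_m_ob (C.data₁.pairs.obj p))
    (fun f => C.data₁.s_m_hom (C.data₁.pairs.map f).1)
  m_t := TwoCat.functor_ext (fun p => C.data₁.t_m_ob (C.data₁.pairs.obj p))
    (fun f => C.data₁.t_m_hom (C.data₁.pairs.map f).1)
  iv_S := TwoCat.functor_ext (X₁.src_one) (fun _ => rfl)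
  iv_T := TwoCat.functor_ext (X₁.tgt_one) (fun _ => rfl)
  mv_S := TwoCat.functor_ext (fun _ => X₁.src_comp _ _ _) (fun _ => rfl)
  mv_T := TwoCat.functor_ext (fun _ => X₁.tgt_comp _ _ _) (fun _ => rfl)
  wr_S := TwoCat.functor_ext (fun p => CatData₁.Obj₂.src_whiskerRight _ _ p.w) (fun _ => rfl)
  wr_T := TwoCat.functor_ext (fun p => CatData₁.Obj₂.tgt_whiskerRight _ _ p.w) (fun _ => rfl)
  wl_S := TwoCat.functor_ext (fun p => CatData₁.Obj₂.src_whiskerLeft _ _ p.w) (fun _ => rfl)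
  wl_T := TwoCat.functor_ext (fun p => CatData₁.Obj₂.tgt_whiskerLeft _ _ p.w) (fun _ => rfl)
  il_S := TwoCat.functor_ext
    (fun x => (C.data₂.lam.src_app x).trans (congrArg (fun F => F.ob x) C.data₂.lam_dom))
    (fun f => congrArg (fun F => F.hom f.1) C.data₂.lam_dom)
  il_T := TwoCat.functor_ext
    (fun x => (C.data₂.lam.tgt_app x).trans (congrArg (fun F => F.ob x) C.data₂.lam_cod))
    (fun f => congrArg (fun F => F.hom f.1) C.data₂.lam_cod)
  ir_S := TwoCat.functor_ext
    (fun x => (C.data₂.rho.src_app x).trans (congrArg (fun F => F.ob x) C.data₂.rho_dom))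
    (fun f => congrArg (fun F => F.hom f.1) C.data₂.rho_dom)
  ir_T := TwoCat.functor_ext
    (fun x => (C.data₂.rho.tgt_app x).trans (congrArg (fun F => F.ob x) C.data₂.rho_cod))
    (fun f => congrArg (fun F => F.hom f.1) C.data₂.rho_cod)
  a_S := TwoCat.functor_ext
    (fun p => (C.data₂.alp.src_app (C.data₁.triples.obj p)).trans
      (congrArg (fun F => F.ob (C.data₁.triples.obj p)) C.data₂.alp_dom))
    (fun f => congrArg (fun F => F.hom (C.data₁.triples.map f).1) C.data₂.alp_dom)
  a_T := TwoCat.functor_ext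
    (fun p => (C.data₂.alp.tgt_app (C.data₁.triples.obj p)).trans
      (congrArg (fun F => F.ob (C.data₁.triples.obj p)) C.data₂.alp_cod))
    (fun f => congrArg (fun F => F.hom (C.data₁.triples.map f).1) C.data₂.alp_cod)

end CatObj

/-! ### Cancellation of unit entries and unit rows. -/

namespace TwoCat

variable {X : TwoCat.{u}}

theorem Row.one_left {x : X.Ob} {φ χ : X.Hom₂} (h : X.Row [X.o x, φ] χ) : χ = φ := by
  obtain ⟨_, k, l, rfl⟩ := (Row.cons_iff (by simp)).1 h
  cases Row.single_iff.1 l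
  exact X.one_hcomp' (by simpa using k.symm) _

theorem Row.one_right {x : X.Ob} {φ χ : X.Hom₂} (h : X.Row [φ, X.o x] χ) : χ = φ := by
  obtain ⟨_, k, l, rfl⟩ := (Row.cons_iff (by simp)).1 h
  cases Row.single_iff.1 l
  exact X.hcomp_one' (by simpa using k) _

theorem Row.left_one {x : X.Ob} {φ : X.Hom₂} (h : X.src (X.src₂ φ) = x) : X.Row [X.o x, φ] φ := by
  have k : X.Row [X.o x, φ] (X.hcomp (X.o x) φ (by simp [h])) := .cons _ _ _ _ (.single _)
  rwa [k.one_left] at k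

theorem Row.right_one {x : X.Ob} {φ : X.Hom₂} (h : X.tgt (X.src₂ φ) = x) : X.Row [φ, X.o x] φ := by
  have k : X.Row [φ, X.o x] (X.hcomp φ (X.o x) (by simp [h])) := .cons _ _ _ _ (.single _)
  rwa [k.one_right] at k

theorem Val.append_one {L : List (List X.Hom₂)} {r : List X.Hom₂} {φ : X.Hom₂} (h : X.Val L φ)
    (hr : X.Row r (X.one₂ (X.tgt₂ φ))) : X.Val (L ++ [r]) φ := by
  have k := h.append (.of_row hr) (by simp)
  rwa [X.vcomp_one₂' rfl] at k

theorem Val.one_cons {L : List (List X.Hom₂)} {r : List X.Hom₂} {φ : X.Hom₂} (h : X.Val L φ)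
    (hr : X.Row r (X.one₂ (X.src₂ φ))) : X.Val (r :: L) φ := by
  have k := Val.cons r _ L φ (by simp) hr h
  rwa [X.one₂_vcomp' rfl] at k

end TwoCat

/-! ### Strictness of vertical composition, whiskers and interchange. -/

namespace CatData₁

variable {X₀ X₁ : TwoCat.{u}} {C : CatData₁ X₀ X₁} {D : Type u} [Category.{u} D]

/-- A square consists of its 2-morphism and its edges, and its remaining edges are seen by `S` and
`T`. Equalities of functors into 2-cells thus reduce to underlying cells, which is what makes `b₁`
to `b₈` identities. -/
theorem Obj₂.functor_ext {F G : D ⥤ C.Obj₂} (h : ∀ x, (F.obj x).u = (G.obj x).u)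
    (hS : F ⋙ C.S = G ⋙ C.S) (hT : F ⋙ C.T = G ⋙ C.T)
    (h' : ∀ {x y} (f : x ⟶ y), (F.map f).1.φ = (G.map f).1.φ) : F = G := by
  -- With the endpoints generalised, the object equalities can be substituted and the transports
  -- vanish.
  have hom_eq : ∀ {b₁ b₂ b₁' b₂' : C.Obj₂} (μ : b₁ ⟶ b₂) (μ' : b₁' ⟶ b₂') (e : b₁ = b₁')
      (e' : b₂' = b₂), μ.1.φ = μ'.1.φ → μ.1.f = μ'.1.f → μ.1.g = μ'.1.g →
      μ = eqToHom e ≫ μ' ≫ eqToHom e' := by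
    intro b₁ b₂ b₁' b₂' μ μ' e e' h₁ h₂ h₃
    subst e e'
    simpa using Mor₂.hom_ext h₁ h₂ h₃
  exact CategoryTheory.Functor.ext (fun x => Obj₂.ext_u (h x)) fun x y f => hom_eq _ _ _ _ (h' f)
    (TwoCat.map_val_eq hS f) (TwoCat.map_val_eq hT f)

/-- The vertical isomorphism of an equality of functors. -/
def vIsoOfEq {F G : D ⥤ C.Obj₂} (h : F = G) : C.cells.VIso F G where
  iso := eqToIso h
  isVert x := by
    subst h
    exact ⟨IsEqHom.map _ (.id _), IsEqHom.map _ (.id _)⟩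

theorem vIsoOfEq_isEqHom {F G : D ⥤ C.Obj₂} (h : F = G) (x : D) :
    IsEqHom ((vIsoOfEq h).iso.hom.app x) := by
  subst h
  exact .id _

namespace Mor₂

variable {b₁ b₁' b₂ b₂' b₃ b₃' : C.Obj₂} (μ : b₁ ⟶ b₁') (ν : b₂ ⟶ b₂') (κ : b₃ ⟶ b₃')

/-- Of the two rows of the vertical composite, one is `φ` beside the identity of an identity
morphism, and the other is the identity on the target of `φ`. -/
theorem idMap_compMap {x y : X₁.Ob} (f : x ⟶ y) (h h' e) :
    (compMap (idMap C f) μ h h' e).1.φ = μ.1.φ := by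
  refine (compMap_val (idMap C f) μ h h' e).unique_of_ne_nil (TwoCat.Val.append_one (L := [_])
    (.of_row (TwoCat.Row.left_one ?_)) ?_) (by simp)
  · rw [src_φ' μ (hbg' μ), X₁.src_comp]
    exact h.symm.trans (X₁.tgt_one x)
  · obtain ⟨f, rfl, rfl⟩ := f
    obtain rfl : f = μ.1.f := e
    rw [tgt_φ' μ (hfb' μ)]
    exact .pair _ _ _ _

theorem compMap_idMap {x y : X₁.Ob} (f : x ⟶ y) (h h' e) :
    (compMap μ (idMap C f) h h' e).1.φ = μ.1.φ := by
  refine (compMap_val μ (idMap C f) h h' e).unique_of_ne_nil (TwoCat.Val.one_cons (L := [_])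
    (.of_row (TwoCat.Row.right_one ?_)) ?_) (by simp)
  · rw [src_φ' μ (hbg' μ), X₁.tgt_comp, tgt_g']
    exact h'.trans (X₁.src_one y)
  · obtain ⟨f, rfl, rfl⟩ := f
    obtain rfl : μ.1.g = f := e
    rw [src_φ' μ (hbg' μ)]
    exact .pair _ _ _ _

/-- Both bracketings expand to the same three rows, in which `κ`, `ν` and `μ` act in this order. -/
theorem compMap_assoc (h h' e k k' l m m' n p p' q) :
    (compMap (compMap μ ν h h' e) κ k k' l).1.φ = (compMap μ (compMap ν κ m m' n) p p' q).1.φ := by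
  have v := compMap_val (compMap μ ν h h' e) κ k k' l
  have v' := compMap_val μ (compMap ν κ m m' n) p p' q
  have w : X₁.Val ([[X₁.one₂ b₁.u, X₁.one₂ b₂.u, κ.1.φ]] ++
      ([[X₁.one₂ b₁.u, ν.1.φ], [μ.1.φ, X₁.one₂ b₂'.u]].map (· ++ [X₁.one₂ b₃'.u])))
      (compMap (compMap μ ν h h' e) κ k k' l).1.φ :=
    TwoCat.Le.subst (p := []) (r := [_]) (.pair _ _ _ _)
      (.expand (fun ρ hρ => (compMap_val μ ν h h' e).row_right hρ) (.refl _)) _ v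
  refine w.unique_of_ne_nil (TwoCat.Le.expand (fun ρ hρ => (compMap_val ν κ m m' n).row_left hρ)
    (.subst (p := [_]) (r := []) (.pair _ _ _ _) (.refl _)) _ v') (by simp)

/-- The whiskering identity of `f` is written as the two rows `[1, f]`, `[f, 1]`, the shape of the
vertical composite. Strict functoriality of `M` applied to the pasting of pairs then distributes the
whisker. -/
theorem whiskerRight_compMap {y y' : X₁.Ob} (f : y ⟶ y') (h h' e k k' l m m' n m₁ m₁' n₁ p p') :
    (whiskerRight (compMap μ ν h h' e) f k k' l).1.φ =
      (compMap (whiskerRight μ f m m' n) (whiskerRight ν f m₁ m₁' n₁) p p'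
        (congrArg C.m.hom (Subtype.ext (Prod.ext e rfl)))).1.φ := by
  have v := compMap_val (whiskerRight μ f m m' n) (whiskerRight ν f m₁ m₁' n₁) p p'
    (congrArg C.m.hom (Subtype.ext (Prod.ext e rfl)))
  have e₀ : C.t.hom μ.1.g = C.s.hom f.1 := μ.1.t_f.symm.trans n
  obtain ⟨_, w⟩ := TwoCat.Val.ofPb (F := C.t) (G := C.s)
    (L := [[⟨(X₁.one₂ b₁.u, X₁.o y), by simp [t_u, m]⟩,
      ⟨(ν.1.φ, X₁.one₂ f.1), by simp [t_φ', ν.1.t_f.symm.trans n₁]⟩],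
      [⟨(μ.1.φ, X₁.one₂ f.1), by simp [t_φ', e₀]⟩,
        ⟨(X₁.one₂ b₂'.u, X₁.o y'), by simp [t_u, m₁']⟩]])
    (compMap_val μ ν h h' e) (TwoCat.Val.append_one (L := [_]) (φ := X₁.one₂ f.1)
      (.of_row (.left_one (by simpa using f.2.1))) (by
        simpa using TwoCat.Row.right_one (by simpa using f.2.2))) (by simp)
  refine (w.map C.m).unique_of_ne_nil ?_ (by simp)
  simp only [List.map_cons, List.map_nil, m₂_one₂']
  exact v

theorem whiskerLeft_compMap {x x' : X₁.Ob} (f : x ⟶ x') (h h' e k k' l m m' n m₁ m₁' n₁ p p') :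
    (whiskerLeft f (compMap μ ν h h' e) k k' l).1.φ =
      (compMap (whiskerLeft f μ m m' n) (whiskerLeft f ν m₁ m₁' n₁) p p'
        (congrArg C.m.hom (Subtype.ext (Prod.ext rfl e)))).1.φ := by
  have v := compMap_val (whiskerLeft f μ m m' n) (whiskerLeft f ν m₁ m₁' n₁) p p'
    (congrArg C.m.hom (Subtype.ext (Prod.ext rfl e)))
  obtain ⟨_, w⟩ := TwoCat.Val.ofPb (F := C.t) (G := C.s)
    (L := [[⟨(X₁.o x, X₁.one₂ b₁.u), by simp [s_u, m]⟩,
      ⟨(X₁.one₂ f.1, ν.1.φ), by simp [s_φ', n₁.trans ν.1.s_f]⟩],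
      [⟨(X₁.one₂ f.1, μ.1.φ), by simp [s_φ', n.trans μ.1.s_f]⟩,
        ⟨(X₁.o x', X₁.one₂ b₂'.u), by simp [s_u, m₁']⟩]])
    (TwoCat.Val.append_one (L := [_]) (φ := X₁.one₂ f.1)
      (.of_row (.left_one (by simpa using f.2.1))) (by
        simpa using TwoCat.Row.right_one (by simpa using f.2.2)))
    (compMap_val μ ν h h' e) (by simp)
  refine (w.map C.m).unique_of_ne_nil ?_ (by simp)
  simp only [List.map_cons, List.map_nil, m₂_one₂']
  exact v

/-- Both sides evaluate to `M` applied to the pair of 2-morphisms of `μ` and `ν`. This is why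
interchange needs no correcting 2-morphism on squares. -/
theorem whisker_exchange (h h' e k k' l m m' p p' q r r' s t t') :
    (compMap (whiskerRight μ (C.S.map ν) h h' e) (whiskerLeft (C.T.map μ) ν k k' l) m m' rfl).1.φ =
      (compMap (whiskerLeft (C.S.map μ) ν p p' q)
        (whiskerRight μ (C.T.map ν) r r' s) t t' rfl).1.φ := by
  have v := compMap_val (whiskerRight μ (C.S.map ν) h h' e) (whiskerLeft (C.T.map μ) ν k k' l)
    m m' rfl
  have v' := compMap_val (whiskerLeft (C.S.map μ) ν p p' q) (whiskerRight μ (C.T.map ν) r r' s)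
    t t' rfl
  have h₁ : C.t.ob (X₁.src b₁.u) = C.s.ob (X₁.src b₂.u) := h
  have h₂ : C.t.hom μ.1.g = C.s.hom ν.1.g := l.trans ν.1.s_f
  have h₃ : C.t.ob (X₁.src b₁'.u) = C.s.ob (X₁.src b₂'.u) := h'
  -- A square is unchanged when its 2-morphism is preceded by the identity path of its source, or
  -- followed by that of its target. Using one padding in each coordinate aligns the rows of the two
  -- whiskers.
  have left : ∀ {b b' : C.Obj₂} (μ : b ⟶ b'), X₁.Val [[X₁.one₂ b.u, X₁.one₂ μ.1.g],
      [μ.1.φ, X₁.o (X₁.tgt b'.u)]] μ.1.φ := fun μ => TwoCat.Val.one_cons (L := [_])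
    (.of_row (.right_one (by simp [src_φ' μ (hbg' μ), tgt_g'])))
    (by simpa only [src_φ' μ (hbg' μ)] using .pair _ _ _ _)
  have right : ∀ {b b' : C.Obj₂} (μ : b ⟶ b'), X₁.Val [[X₁.o (X₁.src b.u), μ.1.φ],
      [X₁.one₂ μ.1.f, X₁.one₂ b'.u]] μ.1.φ := fun μ => TwoCat.Val.append_one (L := [_])
    (.of_row (.left_one (by simp [src_φ' μ (hbg' μ)])))
    (by simpa only [tgt_φ' μ (hfb' μ)] using .pair _ _ _ _)
  obtain ⟨_, i⟩ := TwoCat.Val.ofPb (F := C.t) (G := C.s)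
    (L := [[⟨(X₁.one₂ b₁.u, X₁.o (X₁.src b₂.u)), by simp [t_u, h₁]⟩,
      ⟨(X₁.one₂ μ.1.g, ν.1.φ), by simp [s_φ', h₂]⟩],
      [⟨(μ.1.φ, X₁.one₂ ν.1.f), by simp [t_φ', ν.1.s_f, h₂]⟩,
        ⟨(X₁.o (X₁.tgt b₁'.u), X₁.one₂ b₂'.u), by simp [s_u, t_tgt, h₃]⟩]])
    (left μ) (right ν) (by simp)
  obtain ⟨_, j⟩ := TwoCat.Val.ofPb (F := C.t) (G := C.s)
    (L := [[⟨(X₁.o (X₁.src b₁.u), X₁.one₂ b₂.u), by simp [s_u, h₁]⟩,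
      ⟨(μ.1.φ, X₁.one₂ ν.1.g), by simp [t_φ', h₂]⟩],
      [⟨(X₁.one₂ μ.1.f, ν.1.φ), by simp [s_φ', μ.1.t_f, h₂]⟩,
        ⟨(X₁.one₂ b₁'.u, X₁.o (X₁.tgt b₂'.u)), by simp [t_u, s_tgt, h₃]⟩]])
    (right μ) (left ν) (by simp)
  have i' := i.map C.m
  have j' := j.map C.m
  simp only [List.map_cons, List.map_nil, m₂_one₂'] at i' j'
  exact (v.unique_of_ne_nil i' (by simp)).trans (v'.unique_of_ne_nil j' (by simp)).symm

end Mor₂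

namespace Obj₂

theorem whiskerRight_id (x y : X₁.Ob) (h : C.t.ob x = C.s.ob y) :
    ((Obj₂.id C x).whiskerRight y ((congrArg C.t.ob (X₁.src_one x)).trans h)).u =
      (Obj₂.id C (C.m.ob ⟨(x, y), h⟩)).u := C.m₁_one' _ _ _

theorem whiskerLeft_id (x y : X₁.Ob) (h : C.t.ob x = C.s.ob y) :
    (whiskerLeft x (Obj₂.id C y) (h.trans (congrArg C.s.ob (X₁.src_one y)).symm)).u =
      (Obj₂.id C (C.m.ob ⟨(x, y), h⟩)).u := C.m₁_one' _ _ _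

theorem whiskerRight_comp (b b' : C.Obj₂) (y : X₁.Ob) (h : X₁.tgt b.u = X₁.src b'.u)
    (k : C.t.ob (X₁.src b.u) = C.s.ob y) (l) :
    ((b.comp b' h).whiskerRight y ((congrArg C.t.ob (X₁.src_comp _ _ _)).trans k)).u =
      ((b.whiskerRight y k).comp (b'.whiskerRight y ((congrArg C.t.ob h).symm.trans
        ((C.t_tgt b).trans k))) l).u := by
  refine Eq.trans ?_ (C.m.map_comp ⟨(b.u, X₁.one y), by simp [Mor₂.t_u, k]⟩
    ⟨(b'.u, X₁.one y), by simp [Mor₂.t_u, ← h, C.t_tgt, k]⟩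
      (Subtype.ext (Prod.ext h (by simp))) l)
  exact congrArg C.m.hom (Subtype.ext (Prod.ext rfl (X₁.one_comp' (by simp) _).symm))

theorem whiskerLeft_comp (x : X₁.Ob) (b b' : C.Obj₂) (h : X₁.tgt b.u = X₁.src b'.u)
    (k : C.t.ob x = C.s.ob (X₁.src b.u)) (l) :
    (whiskerLeft x (b.comp b' h) (k.trans (congrArg C.s.ob (X₁.src_comp _ _ _)).symm)).u =
      ((whiskerLeft x b k).comp (whiskerLeft x b' (k.trans ((C.s_tgt b).symm.trans
        (congrArg C.s.ob h)))) l).u := by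
  refine Eq.trans ?_ (C.m.map_comp ⟨(X₁.one x, b.u), by simp [Mor₂.s_u, k]⟩
    ⟨(X₁.one x, b'.u), by simp [Mor₂.s_u, ← h, C.s_tgt, k]⟩
      (Subtype.ext (Prod.ext (by simp) h)) l)
  exact congrArg C.m.hom (Subtype.ext (Prod.ext (X₁.one_comp' (by simp) _).symm rfl))

/-- Both composites are `M` of the pair of underlying morphisms, each factor having been padded by
an identity on one side or the other. -/
theorem whisker_exchange (b b' : C.Obj₂) (h : C.t.ob (X₁.src b.u) = C.s.ob (X₁.src b'.u)) (l r) :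
    ((b.whiskerRight (X₁.src b'.u) h).comp
      (whiskerLeft (X₁.tgt b.u) b' ((C.t_tgt b).trans h)) l).u =
      ((whiskerLeft (X₁.src b.u) b' h).comp
        (b.whiskerRight (X₁.tgt b'.u) (h.trans (C.s_tgt b').symm)) r).u := by
  refine (C.m.map_comp _ _ (Subtype.ext (Prod.ext (X₁.src_one _).symm (X₁.tgt_one _))) l).symm.trans
    (Eq.trans ?_ (C.m.map_comp _ _ (Subtype.ext (Prod.ext (X₁.tgt_one _) (X₁.src_one _).symm)) r))
  exact congrArg C.m.hom (Subtype.ext (Prod.ext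
    ((X₁.comp_one' rfl _).trans (X₁.one_comp' rfl _).symm)
    ((X₁.one_comp' rfl _).trans (X₁.comp_one' rfl _).symm)))

end Obj₂

end CatData₁

/-! ### Agreement of sources and targets of the two sides of each 2-datum. -/

namespace Data₁

variable {K : Cells.{u}} (P : Data₁ K)

theorem src₁_S : P.src₁ ⋙ K.S = 𝟭 _ ⋙ K.S := by simp [src₁]
theorem src₁_T : P.src₁ ⋙ K.T = 𝟭 _ ⋙ K.T := by simp [src₁]
theorem src₂_S : P.src₂ ⋙ K.S = 𝟭 _ ⋙ K.S := by simp [src₂]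
theorem src₂_T : P.src₂ ⋙ K.T = 𝟭 _ ⋙ K.T := by simp [src₂]
theorem src₃_S : P.src₃ ⋙ K.S = P.tgt₃ ⋙ K.S := by simp [src₃, tgt₃]
theorem src₃_T : P.src₃ ⋙ K.T = P.tgt₃ ⋙ K.T := by simp [src₃, tgt₃]
theorem src₄_S : P.src₄ ⋙ K.S = P.tgt₄ ⋙ K.S := by simp [src₄, tgt₄]
theorem src₄_T : P.src₄ ⋙ K.T = P.tgt₄ ⋙ K.T := by simp [src₄, tgt₄]
theorem src₅_S : P.src₅ ⋙ K.S = P.tgt₅ ⋙ K.S := by simp [src₅, tgt₅]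
theorem src₅_T : P.src₅ ⋙ K.T = P.tgt₅ ⋙ K.T := by simp [src₅, tgt₅]
theorem src₆_S : P.src₆ ⋙ K.S = P.tgt₆ ⋙ K.S := by simp [src₆, tgt₆]
theorem src₆_T : P.src₆ ⋙ K.T = P.tgt₆ ⋙ K.T := by simp [src₆, tgt₆]
theorem src₇_S : P.src₇ ⋙ K.S = P.tgt₇ ⋙ K.S := by simp [src₇, tgt₇]
theorem src₇_T : P.src₇ ⋙ K.T = P.tgt₇ ⋙ K.T := by simp [src₇, tgt₇]
theorem src₈_S : P.src₈ ⋙ K.S = P.tgt₈ ⋙ K.S := by simp [src₈, tgt₈]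
theorem src₈_T : P.src₈ ⋙ K.T = P.tgt₈ ⋙ K.T := by simp [src₈, tgt₈]
theorem src₉_S : P.src₉ ⋙ K.S = P.tgt₉ ⋙ K.S := by simp [src₉, tgt₉]
theorem src₉_T : P.src₉ ⋙ K.T = P.tgt₉ ⋙ K.T := by simp [src₉, tgt₉]
theorem src₁₀_S : P.src₁₀ ⋙ K.S = P.tgt₁₀ ⋙ K.S := by simp [src₁₀, tgt₁₀]
theorem src₁₀_T : P.src₁₀ ⋙ K.T = P.tgt₁₀ ⋙ K.T := by simp [src₁₀, tgt₁₀]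
theorem src₁₁_S : P.src₁₁ ⋙ K.S = P.tgt₁₁ ⋙ K.S := by simp [src₁₁, tgt₁₁]
theorem src₁₁_T : P.src₁₁ ⋙ K.T = P.tgt₁₁ ⋙ K.T := by simp [src₁₁, tgt₁₁]
theorem src₁₂_S : P.src₁₂ ⋙ K.S = P.tgt₁₂ ⋙ K.S := by simp [src₁₂, tgt₁₂]
theorem src₁₂_T : P.src₁₂ ⋙ K.T = P.tgt₁₂ ⋙ K.T := by simp [src₁₂, tgt₁₂]
theorem src₁₃_S : P.src₁₃ ⋙ K.S = P.tgt₁₃ ⋙ K.S := by simp [src₁₃, tgt₁₃]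
theorem src₁₃_T : P.src₁₃ ⋙ K.T = P.tgt₁₃ ⋙ K.T := by simp [src₁₃, tgt₁₃]
theorem src₁₄_S : P.src₁₄ ⋙ K.S = P.tgt₁₄ ⋙ K.S := by simp [src₁₄, tgt₁₄]
theorem src₁₄_T : P.src₁₄ ⋙ K.T = P.tgt₁₄ ⋙ K.T := by simp [src₁₄, tgt₁₄]
theorem src₁₅_S : P.src₁₅ ⋙ K.S = P.tgt₁₅ ⋙ K.S := by simp [src₁₅, tgt₁₅]
theorem src₁₅_T : P.src₁₅ ⋙ K.T = P.tgt₁₅ ⋙ K.T := by simp [src₁₅, tgt₁₅]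
theorem src₁₆_S : P.src₁₆ ⋙ K.S = P.tgt₁₆ ⋙ K.S := by simp [src₁₆, tgt₁₆]
theorem src₁₆_T : P.src₁₆ ⋙ K.T = P.tgt₁₆ ⋙ K.T := by simp [src₁₆, tgt₁₆]
theorem src₁₇_S : P.src₁₇ ⋙ K.S = P.tgt₁₇ ⋙ K.S := by simp [src₁₇, tgt₁₇]
theorem src₁₇_T : P.src₁₇ ⋙ K.T = P.tgt₁₇ ⋙ K.T := by simp [src₁₇, tgt₁₇]
theorem src₁₈_S : P.src₁₈ ⋙ K.S = P.tgt₁₈ ⋙ K.S := by simp [src₁₈, tgt₁₈]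
theorem src₁₈_T : P.src₁₈ ⋙ K.T = P.tgt₁₈ ⋙ K.T := by simp [src₁₈, tgt₁₈]

end Data₁

/-! ### Equality of the two sides of the first eight 2-data. -/

namespace CatObj

variable {X₀ X₁ : TwoCat.{u}} (C : CatObj X₀ X₁)

open CatData₁

/-- On objects this is a unit law of `C₁`, and on morphisms the corresponding law for squares. The
next seven equalities likewise pair a strict law of `C₁` or of `M` with its version for squares. -/
theorem src₁_eq : C.bicatData₁.src₁ = 𝟭 _ :=
  Obj₂.functor_ext (fun _ => X₁.one_comp' rfl _) C.bicatData₁.src₁_S C.bicatData₁.src₁_T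
    fun _ => Mor₂.idMap_compMap _ _ _ _ rfl

theorem src₂_eq : C.bicatData₁.src₂ = 𝟭 _ :=
  Obj₂.functor_ext (fun _ => X₁.comp_one' rfl _) C.bicatData₁.src₂_S C.bicatData₁.src₂_T
    fun _ => Mor₂.compMap_idMap _ _ _ _ rfl

theorem src₃_eq : C.bicatData₁.src₃ = C.bicatData₁.tgt₃ :=
  Obj₂.functor_ext (fun _ => X₁.comp_assoc _ _ _ _ _ _ _) C.bicatData₁.src₃_S C.bicatData₁.src₃_T
    fun f => Mor₂.compMap_assoc _ _ _ _ _ (TwoCat.val_eq_of_square f.1.1.2) _ _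
      (TwoCat.val_eq_of_square f.2) _ _ (TwoCat.val_eq_of_square f.2) _ _
      (TwoCat.val_eq_of_square f.1.1.2)

theorem src₄_eq : C.bicatData₁.src₄ = C.bicatData₁.tgt₄ :=
  Obj₂.functor_ext (fun p => Obj₂.whiskerRight_id _ _ p.w) C.bicatData₁.src₄_S
    C.bicatData₁.src₄_T fun _ => C.data₁.m₂_one₂' _ _ _

theorem src₅_eq : C.bicatData₁.src₅ = C.bicatData₁.tgt₅ :=
  Obj₂.functor_ext (fun p => Obj₂.whiskerLeft_id _ _ p.w) C.bicatData₁.src₅_S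
    C.bicatData₁.src₅_T fun _ => C.data₁.m₂_one₂' _ _ _

theorem src₆_eq : C.bicatData₁.src₆ = C.bicatData₁.tgt₆ :=
  Obj₂.functor_ext (fun p => Obj₂.whiskerRight_comp _ _ _ _ p.w _) C.bicatData₁.src₆_S
    C.bicatData₁.src₆_T fun f => Mor₂.whiskerRight_compMap _ _ _ _ _
      (TwoCat.val_eq_of_square f.1.1.2) _ _ _ _ _ _ _ _ _ _ _

theorem src₇_eq : C.bicatData₁.src₇ = C.bicatData₁.tgt₇ :=
  Obj₂.functor_ext (fun p => Obj₂.whiskerLeft_comp _ _ _ _ p.w _) C.bicatData₁.src₇_S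
    C.bicatData₁.src₇_T fun f => Mor₂.whiskerLeft_compMap _ _ _ _ _
      (TwoCat.val_eq_of_square f.1.2.2) _ _ _ _ _ _ _ _ _ _ _

theorem src₈_eq : C.bicatData₁.src₈ = C.bicatData₁.tgt₈ :=
  Obj₂.functor_ext (fun p => Obj₂.whisker_exchange _ _ p.w _ _) C.bicatData₁.src₈_S
    C.bicatData₁.src₈_T
    fun _ => Mor₂.whisker_exchange _ _ _ _ _ _ _ _ _ _ _ _ _ _ _ _ _ _

end CatObj

/-! ### Vertical isomorphisms from invertible 2-morphisms. -/

namespace TwoCat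

theorem InvPair.eq_one₂ {X : TwoCat.{u}} {f : X.Hom} {ψ : X.Hom₂} (h : X.InvPair (X.one₂ f) ψ) :
    ψ = X.one₂ f := by
  obtain ⟨h₁, -, h₃, -⟩ := h
  rw [X.one₂_vcomp' (by simpa using h₁.symm)] at h₃
  simpa using h₃

end TwoCat

theorem Transf.comp_nat_val' {A B : TwoCat.{u}} (α β : Transf A B) (e : α.cod = β.dom) {x y : A.Ob}
    (f : x ⟶ y) : B.Val [[B.one₂ (α.app x), β.nat f.1], [α.nat f.1, B.one₂ (β.app y)]]
      ((α.comp β e).nat f.1) := by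
  obtain ⟨f, rfl, rfl⟩ := f
  exact comp_nat_val α β e f

namespace CatData₁

variable {X₀ X₁ : TwoCat.{u}} {C : CatData₁ X₀ X₁} {D : Type u} [Category.{u} D]

/-- The vertical morphism of 2-cells given by a 2-morphism. -/
def Mor₂.vert {b b' : C.Obj₂} (γ : X₁.Hom₂) (h : X₁.src₂ γ = b.u) (h' : X₁.tgt₂ γ = b'.u)
    (hs : ∃ y, C.s.hom₂ γ = X₀.one₂ y) (ht : ∃ y, C.t.hom₂ γ = X₀.one₂ y) : b ⟶ b' :=
  Mor₂.homOf b b' γ (X₁.one (X₁.tgt b.u)) (X₁.one (X₁.src b.u)) (by simp)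
    (by rw [X₁.tgt_one, ← h, ← h', X₁.src_tgt₂]) (by rw [X₁.comp_one' rfl, h])
    (by
      rw [X₁.one_comp', h']
      rw [← h, ← h', X₁.src_tgt₂])
    (by
      -- Comparing sources, the identity to which `s` sends `γ` must be the identity of `s u`,
      -- itself an identity morphism.
      obtain ⟨y, hy⟩ := hs
      have k := congrArg X₀.src₂ hy
      rw [C.s.src₂_hom₂, h, s_u', X₀.src₂_one₂] at k
      rw [hy, ← k]
      simp)
    (by
      obtain ⟨y, hy⟩ := ht
      have k := congrArg X₀.src₂ hy
      rw [C.t.src₂_hom₂, h, t_u', X₀.src₂_one₂] at k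
      rw [hy, ← k]
      simp)

theorem Mor₂.vert_isVert {b b' : C.cells.C₂} (f : b ⟶ b') (hf : ∃ x, f.1.f = X₁.one x)
    (hg : ∃ x, f.1.g = X₁.one x) : C.cells.IsVert f := by
  have aux : ∀ {x y : X₁.Ob} (f : x ⟶ y), (∃ x, f.1 = X₁.one x) → IsEqHom f := by
    rintro x y ⟨f, rfl, rfl⟩ ⟨z, rfl⟩
    refine ⟨by simp, Subtype.ext ?_⟩
    rw [TwoCat.eqToHom_val]
    simp
  exact ⟨aux (C.S.map f) hf, aux (C.T.map f) hg⟩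

/-- Squares with identity edges compose like their 2-morphisms: the unit entries drop out of both
rows, so an inverse 2-morphism gives an inverse square. -/
theorem Mor₂.vert_comp {b b' : C.Obj₂} {γ γ' : X₁.Hom₂} (h h' hs ht k k' ks kt)
    (e : X₁.tgt₂ γ = X₁.src₂ γ') (e' : X₁.vcomp γ γ' e = X₁.one₂ b.u) :
    (vert (b := b) (b' := b') γ h h' hs ht : b ⟶ b') ≫ (vert (b' := b) γ' k k' ks kt : b' ⟶ b) =
      𝟙 b := by
  have v := comp_val (vert (b := b) (b' := b') γ h h' hs ht) (vert (b' := b) γ' k k' ks kt)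
  have w : X₁.Val [[γ], [γ']] (X₁.one₂ b.u) := by
    rw [← e']
    exact .cons _ _ _ _ _ (.single _) (.of_atom _)
  refine hom_ext ((TwoCat.Le.expand (M := [_]) (fun ρ hρ => ?_)
    (TwoCat.Le.expand (M := [_]) (fun ρ hρ => ?_) (.refl _))) _ v |>.unique_of_ne_nil w (by simp))
    ?_ ?_
  · rw [TwoCat.Row.one_right hρ]
    exact .of_atom _
  · rw [TwoCat.Row.one_left hρ]
    exact .of_atom _
  · refine X₁.comp_one' ?_ _
    simp [vert, homOf, of, ← k, ← e, ← h]
  · exact X₁.comp_one' (by simp [vert, homOf, of, ← h, ← h']) _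

/-- A vertical isomorphism between functors given by invertible 2-morphisms. -/
def vIso {F G : D ⥤ C.Obj₂} (γ γ' : D → X₁.Hom₂) (hγ : ∀ x, X₁.InvPair (γ x) (γ' x))
    (h : ∀ x, X₁.src₂ (γ x) = (F.obj x).u) (h' : ∀ x, X₁.tgt₂ (γ x) = (G.obj x).u)
    (hs : ∀ x, ∃ y, C.s.hom₂ (γ x) = X₀.one₂ y) (ht : ∀ x, ∃ y, C.t.hom₂ (γ x) = X₀.one₂ y)
    (hS : F ⋙ C.S = G ⋙ C.S) (hT : F ⋙ C.T = G ⋙ C.T)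
    -- Naturality is accepted for expanded forms `c`, `c'` of the two 2-morphisms, as the squares at
    -- hand are themselves vertical composites. They must be nonempty in order to have a unique
    -- composite.
    (nat : ∀ {x y} (f : x ⟶ y), ∃ c c', c ≠ [] ∧ c' ≠ [] ∧ X₁.Val c (F.map f).1.φ ∧
      X₁.Val c' (G.map f).1.φ ∧ X₁.Common (c ++ [[X₁.one₂ (F.map f).1.f, γ y]])
        ([γ x, X₁.one₂ (G.map f).1.g] :: c')) : C.cells.VIso F G where
  iso := NatIso.ofComponents (fun x =>
    { hom := Mor₂.vert (γ x) (h x) (h' x) (hs x) (ht x)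
      inv := Mor₂.vert (γ' x) ((hγ x).choose.symm.trans (h' x))
        ((hγ x).choose_spec.choose.trans (h x))
        (by
          obtain ⟨y, hy⟩ := hs x
          have k := (hγ x).map C.s
          rw [hy] at k
          exact ⟨y, k.eq_one₂⟩)
        (by
          obtain ⟨y, hy⟩ := ht x
          have k := (hγ x).map C.t
          rw [hy] at k
          exact ⟨y, k.eq_one₂⟩)
      hom_inv_id := Mor₂.vert_comp _ _ _ _ _ _ _ _ _ ((hγ x).choose_spec.choose_spec.1.trans
        (congrArg X₁.one₂ (h x)))
      inv_hom_id := Mor₂.vert_comp _ _ _ _ _ _ _ _ _ ((hγ x).choose_spec.choose_spec.2.trans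
        (congrArg X₁.one₂ (h' x))) }) (by
    intro x y f
    obtain ⟨c, c', hc, hc', k, k', l⟩ := nat f
    -- The vertical component contributes an identity edge to the second row of the composite, and
    -- this unit entry is restored here.
    have m : X₁.Le c' [[X₁.o (X₁.src (F.obj x).u), (G.map f).1.φ]] := by
      have m := TwoCat.Le.replace (L := [])
        ⟨_, k', .of_row (.left_one (x := X₁.src (F.obj x).u) ?_)⟩
        hc' (.refl _)
      · simpa using m
      · rw [Mor₂.src_φ' _ (Mor₂.hbg' _), X₁.src_comp, ← h, ← h', X₁.src_tgt₂]
    refine Mor₂.comp_ext (l.mono (.replace ⟨_, k, .of_row (.right_one ?_)⟩ hc (.refl _)) (.skip m))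
      ?_ ?_
    · rw [Mor₂.src_φ' _ (Mor₂.hbg' _), X₁.tgt_comp, Mor₂.tgt_g']
    · exact (X₁.comp_one' (Mor₂.hfb' (F.map f)) _).trans ((TwoCat.map_val_eq hS f).trans
        (X₁.one_comp' ((Mor₂.src_f' _).trans (by rw [← h, ← h', X₁.src_tgt₂])) _).symm)
    · exact (X₁.comp_one' (Mor₂.tgt_g' (F.map f)) _).trans ((TwoCat.map_val_eq hT f).trans
        (X₁.one_comp' ((Mor₂.hbg' _).symm.trans (by rw [← h, ← h', X₁.tgt_tgt₂])) _).symm))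
  isVert x := Mor₂.vert_isVert _ ⟨_, rfl⟩ ⟨_, rfl⟩

theorem natInv_hom₂ {A : TwoCat.{u}} {τ : Transf A X₁} {F : StrictFunctor X₁ X₀}
    {G : StrictFunctor A X₀} (h : τ.post F = .id G) (f : A.Hom) :
    ∃ y, F.hom₂ (τ.natInv f) = X₀.one₂ y :=
  ⟨_, congrFun (congrArg Transf.natInv h) f⟩

end CatData₁

/-! ### Naturality squares of the associator and the units. -/

namespace CatData₂

variable {X₀ X₁ : TwoCat.{u}} {C : CatData₁ X₀ X₁} (D : CatData₂ C)

open CatData₁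

/-- The naturality square of a weak transformation for the triple `(φ₁, φ₂, φ₃)` in the fibre
product, where all boundary conditions are checked in each coordinate. -/
theorem alp_square {φ₁ φ₂ φ₃ : X₁.Hom₂} {u₁ g₁ f₁ v₁ u₂ g₂ f₂ v₂ u₃ g₃ f₃ v₃ : X₁.Hom}
    {d₁ e₁ d₂ e₂ d₃ e₃} (h₁ : X₁.src₂ φ₁ = X₁.comp u₁ g₁ d₁) (k₁ : X₁.tgt₂ φ₁ = X₁.comp f₁ v₁ e₁)
    (h₂ : X₁.src₂ φ₂ = X₁.comp u₂ g₂ d₂) (k₂ : X₁.tgt₂ φ₂ = X₁.comp f₂ v₂ e₂)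
    (h₃ : X₁.src₂ φ₃ = X₁.comp u₃ g₃ d₃) (k₃ : X₁.tgt₂ φ₃ = X₁.comp f₃ v₃ e₃)
    (p : C.t.hom₂ φ₁ = C.s.hom₂ φ₂) (q : C.t.hom₂ φ₂ = C.s.hom₂ φ₃)
    (pu : C.t.hom u₁ = C.s.hom u₂) (qu : C.t.hom u₂ = C.s.hom u₃)
    (pg : C.t.hom g₁ = C.s.hom g₂) (qg : C.t.hom g₂ = C.s.hom g₃)
    (pf : C.t.hom f₁ = C.s.hom f₂) (qf : C.t.hom f₂ = C.s.hom f₃)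
    (pv : C.t.hom v₁ = C.s.hom v₂) (qv : C.t.hom v₂ = C.s.hom v₃) (pt qt ps qs) :
    X₁.Common
      [[X₁.one₂ (C.m₁ (C.m₁ u₁ u₂) u₃), D.An g₁ g₂ g₃],
        [C.m₂ (C.m₂ φ₁ φ₂) φ₃, X₁.one₂ (D.A (X₁.tgt g₁) (X₁.tgt g₂) (X₁.tgt g₃) pt qt)],
        [X₁.one₂ (C.m₁ (C.m₁ f₁ f₂) f₃), D.Ai v₁ v₂ v₃]]
      [[D.Ai u₁ u₂ u₃, X₁.one₂ (C.m₁ g₁ (C.m₁ g₂ g₃))],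
        [X₁.one₂ (D.A (X₁.src u₁) (X₁.src u₂) (X₁.src u₃) ps qs), C.m₂ φ₁ (C.m₂ φ₂ φ₃)],
        [D.An f₁ f₂ f₃, X₁.one₂ (C.m₁ v₁ (C.m₁ v₂ v₃))]] := by
  have k := D.alp_isWeak.square (Ψ := ⟨(⟨(φ₁, φ₂), p⟩, φ₃), q⟩)
    (U := ⟨(⟨(u₁, u₂), pu⟩, u₃), qu⟩) (G := ⟨(⟨(g₁, g₂), pg⟩, g₃), qg⟩)
    (F := ⟨(⟨(f₁, f₂), pf⟩, f₃), qf⟩) (U' := ⟨(⟨(v₁, v₂), pv⟩, v₃), qv⟩)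
    (e := Subtype.ext (Prod.ext (Subtype.ext (Prod.ext d₁ d₂)) d₃))
    (e' := Subtype.ext (Prod.ext (Subtype.ext (Prod.ext e₁ e₂)) e₃))
    (Subtype.ext (Prod.ext (Subtype.ext (Prod.ext h₁ h₂)) h₃))
    (Subtype.ext (Prod.ext (Subtype.ext (Prod.ext k₁ k₂)) k₃))
  rw [D.alp_dom, D.alp_cod] at k
  exact k

theorem lam_square {φ : X₁.Hom₂} {u g f v : X₁.Hom} {d e} (h : X₁.src₂ φ = X₁.comp u g d)
    (k : X₁.tgt₂ φ = X₁.comp f v e) :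
    X₁.Common
      [[X₁.one₂ (C.m₁ (C.i.hom (C.s.hom u)) u), D.lam.nat g],
        [C.m₂ (C.i.hom₂ (C.s.hom₂ φ)) φ, X₁.one₂ (D.lam.app (X₁.tgt g))],
        [X₁.one₂ (C.m₁ (C.i.hom (C.s.hom f)) f), D.lam.natInv v]]
      [[D.lam.natInv u, X₁.one₂ g], [X₁.one₂ (D.lam.app (X₁.src u)), φ],
        [D.lam.nat f, X₁.one₂ v]] := by
  have k := D.lam_isWeak.square h k
  rw [D.lam_dom, D.lam_cod] at k
  exact k

theorem rho_square {φ : X₁.Hom₂} {u g f v : X₁.Hom} {d e} (h : X₁.src₂ φ = X₁.comp u g d)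
    (k : X₁.tgt₂ φ = X₁.comp f v e) :
    X₁.Common
      [[X₁.one₂ (C.m₁ u (C.i.hom (C.t.hom u))), D.rho.nat g],
        [C.m₂ φ (C.i.hom₂ (C.t.hom₂ φ)), X₁.one₂ (D.rho.app (X₁.tgt g))],
        [X₁.one₂ (C.m₁ f (C.i.hom (C.t.hom f))), D.rho.natInv v]]
      [[D.rho.natInv u, X₁.one₂ g], [X₁.one₂ (D.rho.app (X₁.src u)), φ],
        [D.rho.nat f, X₁.one₂ v]] := by
  have k := D.rho_isWeak.square h k
  rw [D.rho_dom, D.rho_cod] at k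
  exact k

section components

variable {b₁ b₁' b₂ b₂' b₃ b₃' : C.Obj₂}

theorem t_hom_u_eq {b b' : C.Obj₂} (h : C.t.ob (X₁.src b.u) = C.s.ob (X₁.src b'.u)) :
    C.t.hom b.u = C.s.hom b'.u := by
  rw [Mor₂.t_u, Mor₂.s_u, h]

theorem t_hom_g_eq {μ ν : C.Mor₂} (h : C.t.hom μ.f = C.s.hom ν.f) : C.t.hom μ.g = C.s.hom ν.g :=
  μ.t_f.symm.trans (h.trans ν.s_f)

theorem t_hom₂_φ_eq {μ ν : C.Mor₂} (h : C.t.hom μ.f = C.s.hom ν.f) :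
    C.t.hom₂ μ.φ = C.s.hom₂ ν.φ := by
  rw [μ.t_φ', ν.s_φ', t_hom_g_eq h]

theorem t_eq_s_m₁ {f g k : X₁.Hom} (h : C.t.hom f = C.s.hom g) (h' : C.t.hom g = C.s.hom k) :
    C.t.hom f = C.s.hom (C.m₁ g k h') :=
  h.trans (C.s_m_hom ⟨(g, k), h'⟩).symm

/-- The objects and the morphism `k` are kept as free names for the boundary. Where two of the
entries are identities, the whisker in `B` has `1_{xy}` in place of `1_x * 1_y`, and `hk` accounts
for the difference. -/
theorem src₂_natInv_alp {x y z : X₁.Ob} (h₁ : X₁.tgt b₁.u = x) (h₂ : X₁.tgt b₂.u = y)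
    (h₃ : X₁.tgt b₃.u = z) (p : C.t.ob (X₁.src b₁.u) = C.s.ob (X₁.src b₂.u))
    (q : C.t.ob (X₁.src b₂.u) = C.s.ob (X₁.src b₃.u)) {k : X₁.Hom}
    (hk : C.m₁ b₁.u b₂.u (t_hom_u_eq p) = k) {p' q' l r} : X₁.src₂
      (D.Ai b₁.u b₂.u b₃.u (t_hom_u_eq p) (t_hom_u_eq q)) =
      X₁.comp (C.m₁ k b₃.u l) (D.A x y z p' q') r := by
  subst h₁ h₂ h₃ hk
  exact (D.alp.src₂_natInv' _).trans (X₁.comp_congr (congrArg (fun F =>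
    F.hom ⟨(⟨(b₁.u, b₂.u), t_hom_u_eq p⟩, b₃.u), t_hom_u_eq q⟩) D.alp_dom) rfl _ _)

theorem tgt₂_natInv_alp {x y z : X₁.Ob} (h₁ : X₁.src b₁.u = x) (h₂ : X₁.src b₂.u = y)
    (h₃ : X₁.src b₃.u = z) (p : C.t.ob (X₁.src b₁.u) = C.s.ob (X₁.src b₂.u))
    (q : C.t.ob (X₁.src b₂.u) = C.s.ob (X₁.src b₃.u)) {k : X₁.Hom}
    (hk : C.m₁ b₂.u b₃.u (t_hom_u_eq q) = k) {p' q' l r} : X₁.tgt₂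
      (D.Ai b₁.u b₂.u b₃.u (t_hom_u_eq p) (t_hom_u_eq q)) =
      X₁.comp (D.A x y z p' q') (C.m₁ b₁.u k l) r := by
  subst h₁ h₂ h₃ hk
  exact (D.alp.tgt₂_natInv' _).trans (X₁.comp_congr rfl (congrArg (fun F =>
    F.hom ⟨(⟨(b₁.u, b₂.u), t_hom_u_eq p⟩, b₃.u), t_hom_u_eq q⟩) D.alp_cod) _ _)

/-- The form of `alp_square` applied to three morphisms of 2-cells, some of them identity squares.
The extra names again absorb identifications such as that of `1_f * 1_g` with the identity of `f *
g`. -/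
theorem alp_square_mor (μ₁ : b₁ ⟶ b₁') (μ₂ : b₂ ⟶ b₂') (μ₃ : b₃ ⟶ b₃')
    (p : C.t.ob (X₁.src b₁.u) = C.s.ob (X₁.src b₂.u))
    (q : C.t.ob (X₁.src b₂.u) = C.s.ob (X₁.src b₃.u))
    (p' : C.t.ob (X₁.src b₁'.u) = C.s.ob (X₁.src b₂'.u))
    (q' : C.t.ob (X₁.src b₂'.u) = C.s.ob (X₁.src b₃'.u))
    (e : C.t.hom μ₁.1.f = C.s.hom μ₂.1.f) (e' : C.t.hom μ₂.1.f = C.s.hom μ₃.1.f)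
    {x y z x' y' z' : X₁.Ob} (h₁ : X₁.src b₁.u = x) (h₂ : X₁.src b₂.u = y)
    (h₃ : X₁.src b₃.u = z) (h₁' : X₁.tgt b₁'.u = x') (h₂' : X₁.tgt b₂'.u = y')
    (h₃' : X₁.tgt b₃'.u = z') {k k' : X₁.Hom} (hk : C.m₁ b₁.u b₂.u (t_hom_u_eq p) = k)
    (hk' : C.m₁ b₂'.u b₃'.u (t_hom_u_eq q') = k') {χ χ' : X₁.Hom₂}
    (hχ : C.m₂ μ₁.1.φ μ₂.1.φ (t_hom₂_φ_eq e) = χ) (hχ' : C.m₂ μ₂.1.φ μ₃.1.φ (t_hom₂_φ_eq e') = χ')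
    {r r' s s' l l' m m'} :
    X₁.Common
      [[X₁.one₂ (C.m₁ k b₃.u l), D.An μ₁.1.g μ₂.1.g μ₃.1.g (t_hom_g_eq e) (t_hom_g_eq e')],
        [C.m₂ χ μ₃.1.φ m, X₁.one₂ (D.A x' y' z' r' s')],
        [X₁.one₂ (C.m₁ (C.m₁ μ₁.1.f μ₂.1.f e) μ₃.1.f ((C.t_m_hom _).trans e')),
          D.Ai b₁'.u b₂'.u b₃'.u (t_hom_u_eq p') (t_hom_u_eq q')]]
      [[D.Ai b₁.u b₂.u b₃.u (t_hom_u_eq p) (t_hom_u_eq q),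
          X₁.one₂ (C.m₁ μ₁.1.g (C.m₁ μ₂.1.g μ₃.1.g (t_hom_g_eq e'))
            (t_eq_s_m₁ (t_hom_g_eq e) _))],
        [X₁.one₂ (D.A x y z r s), C.m₂ μ₁.1.φ χ' m'],
        [D.An μ₁.1.f μ₂.1.f μ₃.1.f e e', X₁.one₂ (C.m₁ b₁'.u k' l')]] := by
  subst h₁ h₂ h₃ hk hk' hχ hχ'
  rw [← Mor₂.tgt_g' μ₁] at h₁'
  rw [← Mor₂.tgt_g' μ₂] at h₂'
  rw [← Mor₂.tgt_g' μ₃] at h₃'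
  subst h₁' h₂' h₃'
  exact D.alp_square (Mor₂.src_φ' μ₁ (Mor₂.hbg' _)) (Mor₂.tgt_φ' μ₁ (Mor₂.hfb' _))
    (Mor₂.src_φ' μ₂ (Mor₂.hbg' _)) (Mor₂.tgt_φ' μ₂ (Mor₂.hfb' _))
    (Mor₂.src_φ' μ₃ (Mor₂.hbg' _)) (Mor₂.tgt_φ' μ₃ (Mor₂.hfb' _))
    (t_hom₂_φ_eq e) (t_hom₂_φ_eq e') (t_hom_u_eq p) (t_hom_u_eq q) (t_hom_g_eq e) (t_hom_g_eq e')
    e e' (t_hom_u_eq p') (t_hom_u_eq q') _ _ _ _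

theorem src₂_natInv_lam {b : C.Obj₂} (r) : X₁.src₂ (D.lam.natInv b.u) =
    X₁.comp (C.m₁ (X₁.one (C.i.ob (C.s.ob (X₁.src b.u)))) b.u (by simp [Mor₂.s_u]))
      (D.lam.app (X₁.tgt b.u)) r := by
  refine (D.lam.src₂_natInv' _).trans (X₁.comp_congr ?_ rfl _ _)
  rw [D.lam_dom]
  refine congrArg C.m.hom (Subtype.ext (Prod.ext ?_ rfl))
  exact (congrArg C.i.hom (Mor₂.s_u b)).trans (by simp)

theorem tgt₂_natInv_lam {b : C.Obj₂} (r) : X₁.tgt₂ (D.lam.natInv b.u) =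
    X₁.comp (D.lam.app (X₁.src b.u)) b.u r :=
  (D.lam.tgt₂_natInv' _).trans (X₁.comp_congr rfl (congrArg (fun F => F.hom b.u) D.lam_cod) _ _)

theorem lam_square_mor {b b' : C.Obj₂} (μ : b ⟶ b') :
    X₁.Common
      [[X₁.one₂ (C.m₁ (X₁.one (C.i.ob (C.s.ob (X₁.src b.u)))) b.u (by simp [Mor₂.s_u])),
          D.lam.nat μ.1.g],
        [C.m₂ (X₁.one₂ (C.i.hom (C.s.hom μ.1.f))) μ.1.φ (by simp [μ.1.s_f, μ.1.s_φ']),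
          X₁.one₂ (D.lam.app (X₁.tgt b'.u))],
        [X₁.one₂ (C.m₁ (C.i.hom (C.s.hom μ.1.f)) μ.1.f), D.lam.natInv b'.u]]
      [[D.lam.natInv b.u, X₁.one₂ μ.1.g], [X₁.one₂ (D.lam.app (X₁.src b.u)), μ.1.φ],
        [D.lam.nat μ.1.f, X₁.one₂ b'.u]] := by
  have k := D.lam_square (Mor₂.src_φ' μ (Mor₂.hbg' _)) (Mor₂.tgt_φ' μ (Mor₂.hfb' _))
  simp only [Mor₂.s_u, μ.1.s_φ', ← μ.1.s_f, C.i.map_one₂, C.i.map_one, Mor₂.tgt_g'] at k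
  exact k

theorem src₂_natInv_rho {b : C.Obj₂} (r) : X₁.src₂ (D.rho.natInv b.u) =
    X₁.comp (C.m₁ b.u (X₁.one (C.i.ob (C.t.ob (X₁.src b.u)))) (by simp [Mor₂.t_u]))
      (D.rho.app (X₁.tgt b.u)) r := by
  refine (D.rho.src₂_natInv' _).trans (X₁.comp_congr ?_ rfl _ _)
  rw [D.rho_dom]
  refine congrArg C.m.hom (Subtype.ext (Prod.ext rfl ?_))
  exact (congrArg C.i.hom (Mor₂.t_u b)).trans (by simp)

theorem tgt₂_natInv_rho {b : C.Obj₂} (r) : X₁.tgt₂ (D.rho.natInv b.u) =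
    X₁.comp (D.rho.app (X₁.src b.u)) b.u r :=
  (D.rho.tgt₂_natInv' _).trans (X₁.comp_congr rfl (congrArg (fun F => F.hom b.u) D.rho_cod) _ _)

theorem rho_square_mor {b b' : C.Obj₂} (μ : b ⟶ b') :
    X₁.Common
      [[X₁.one₂ (C.m₁ b.u (X₁.one (C.i.ob (C.t.ob (X₁.src b.u)))) (by simp [Mor₂.t_u])),
          D.rho.nat μ.1.g],
        [C.m₂ μ.1.φ (X₁.one₂ (C.i.hom (C.t.hom μ.1.f))) (by simp [μ.1.t_f, μ.1.t_φ']),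
          X₁.one₂ (D.rho.app (X₁.tgt b'.u))],
        [X₁.one₂ (C.m₁ μ.1.f (C.i.hom (C.t.hom μ.1.f))), D.rho.natInv b'.u]]
      [[D.rho.natInv b.u, X₁.one₂ μ.1.g], [X₁.one₂ (D.rho.app (X₁.src b.u)), μ.1.φ],
        [D.rho.nat μ.1.f, X₁.one₂ b'.u]] := by
  have k := D.rho_square (Mor₂.src_φ' μ (Mor₂.hbg' _)) (Mor₂.tgt_φ' μ (Mor₂.hfb' _))
  simp only [Mor₂.t_u, μ.1.t_φ', ← μ.1.t_f, C.i.map_one₂, C.i.map_one, Mor₂.tgt_g'] at k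
  exact k

end components

end CatData₂

/-! ### The 2-data of the bicategory object. -/

namespace CatObj

variable {X₀ X₁ : TwoCat.{u}} (C : CatObj X₀ X₁) {D : Type u} [Category.{u} D]

open CatData₁

theorem fV_val {F G : D ⥤ C.data₁.cells.C₂} (h) {x y : D} (f : x ⟶ y) :
    X₁.Val [[X₁.one₂ (F.obj x).u, (G.map f).1.φ], [(F.map f).1.φ, X₁.one₂ (G.obj y).u]]
      ((C.bicatData₁.fV F G h).map f).1.φ :=
  Mor₂.compMap_val (F.map f) (G.map f) _ _ (TwoCat.map_val_eq h f)

theorem one_w {y z : X₁.Ob} (h : C.data₁.t.ob y = C.data₁.s.ob z) :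
    C.data₁.t.ob (X₁.src (X₁.one y)) = C.data₁.s.ob (X₁.src (X₁.one z)) := by
  simp [h]

theorem u_one_w {b : C.data₁.Obj₂} {y : X₁.Ob} (h : C.data₁.t.ob (X₁.src b.u) = C.data₁.s.ob y) :
    C.data₁.t.ob (X₁.src b.u) = C.data₁.s.ob (X₁.src (X₁.one y)) := by
  simp [h]

theorem one_u_w {b : C.data₁.Obj₂} {x : X₁.Ob} (h : C.data₁.t.ob x = C.data₁.s.ob (X₁.src b.u)) :
    C.data₁.t.ob (X₁.src (X₁.one x)) = C.data₁.s.ob (X₁.src b.u) := by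
  simp [h]

/-- The 2-datum `b₉` of the bicategory object of a category object. -/
def b₉ : C.data₁.cells.VIso C.bicatData₁.src₉ C.bicatData₁.tgt₉ :=
  vIso
    -- The datum runs from the side containing the whisker of `u` by `y` and then by `z`, which is
    -- the target of the naturality 2-morphism. Its component is therefore the inverse.
    (fun p => C.data₂.Ai p.fst.fst.u (X₁.one p.fst.snd) (X₁.one p.snd)
      (CatData₂.t_hom_u_eq (b := p.fst.fst) (b' := .id _ p.fst.snd) (C.u_one_w p.fst.w))
      (CatData₂.t_hom_u_eq (b := .id _ p.fst.snd) (b' := .id _ p.snd) (C.one_w p.w)))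
    (fun p => C.data₂.alp.nat _)
    (fun p => (C.data₂.alp_isWeak.hasInv _).symm)
    (fun p => C.data₂.src₂_natInv_alp (b₂ := .id _ p.fst.snd) (b₃ := .id _ p.snd) rfl
      (X₁.tgt_one _) (X₁.tgt_one _) (C.u_one_w p.fst.w) (C.one_w p.w) rfl)
    (fun p => C.data₂.tgt₂_natInv_alp (b₂ := .id _ p.fst.snd) (b₃ := .id _ p.snd) rfl
      (X₁.src_one _) (X₁.src_one _) (C.u_one_w p.fst.w) (C.one_w p.w) (C.data₁.m₁_one' _ _ _))
    (fun p => natInv_hom₂ C.data₂.alp_s _) (fun p => natInv_hom₂ C.data₂.alp_t _)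
    C.bicatData₁.src₉_S C.bicatData₁.src₉_T (fun {p q} f =>
      ⟨_, _, by simp, by simp, C.fV_val _ _, C.fV_val _ _,
        C.data₂.alp_square_mor f.1.1.1.1 (Mor₂.idMap _ f.1.1.1.2) (Mor₂.idMap _ f.1.2)
        (C.u_one_w p.fst.w) (C.one_w p.w) (C.u_one_w q.fst.w) (C.one_w q.w)
        (TwoCat.val_eq_of_square f.1.1.2) (TwoCat.val_eq_of_square f.2)
        rfl (X₁.src_one _) (X₁.src_one _) rfl (X₁.tgt_one _) (X₁.tgt_one _) rfl
        -- On the target side the whisker is by the single 1-cell `yz`, so the identities at `y` and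
        -- `z` are merged, for objects and for morphisms.
        (C.data₁.m₁_one' _ _ _) rfl (C.data₁.m₂_one₂' _ _ _)⟩)

/-- The 2-datum `b₁₀` of the bicategory object of a category object. -/
def b₁₀ : C.data₁.cells.VIso C.bicatData₁.src₁₀ C.bicatData₁.tgt₁₀ :=
  vIso
    (fun p => C.data₂.Ai (X₁.one p.fst.fst) (X₁.one p.fst.snd) p.snd.u
      (CatData₂.t_hom_u_eq (b := .id _ p.fst.fst) (b' := .id _ p.fst.snd) (C.one_w p.fst.w))
      (CatData₂.t_hom_u_eq (b := .id _ p.fst.snd) (b' := p.snd) (C.one_u_w p.w)))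
    (fun p => C.data₂.alp.nat _)
    (fun p => (C.data₂.alp_isWeak.hasInv _).symm)
    (fun p => C.data₂.src₂_natInv_alp (b₁ := .id _ p.fst.fst) (b₂ := .id _ p.fst.snd)
      (X₁.tgt_one _) (X₁.tgt_one _) rfl (C.one_w p.fst.w) (C.one_u_w p.w) (C.data₁.m₁_one' _ _ _))
    (fun p => C.data₂.tgt₂_natInv_alp (b₁ := .id _ p.fst.fst) (b₂ := .id _ p.fst.snd)
      (X₁.src_one _) (X₁.src_one _) rfl (C.one_w p.fst.w) (C.one_u_w p.w) rfl)
    (fun p => natInv_hom₂ C.data₂.alp_s _) (fun p => natInv_hom₂ C.data₂.alp_t _)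
    C.bicatData₁.src₁₀_S C.bicatData₁.src₁₀_T (fun {p q} f =>
      ⟨_, _, by simp, by simp, C.fV_val _ _, C.fV_val _ _,
        C.data₂.alp_square_mor (Mor₂.idMap _ f.1.1.1.1) (Mor₂.idMap _ f.1.1.1.2) f.1.2
        (C.one_w p.fst.w) (C.one_u_w p.w) (C.one_w q.fst.w) (C.one_u_w q.w)
        (TwoCat.val_eq_of_square f.1.1.2) (TwoCat.val_eq_of_square f.2)
        (X₁.src_one _) (X₁.src_one _) rfl (X₁.tgt_one _) (X₁.tgt_one _) rfl
        (C.data₁.m₁_one' _ _ _) rfl (C.data₁.m₂_one₂' _ _ _) rfl⟩)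

/-- The 2-datum `b₁₁` of the bicategory object of a category object. -/
def b₁₁ : C.data₁.cells.VIso C.bicatData₁.src₁₁ C.bicatData₁.tgt₁₁ :=
  vIso
    (fun p => C.data₂.Ai (X₁.one p.fst.fst) p.fst.snd.u (X₁.one p.snd)
      (CatData₂.t_hom_u_eq (b := .id _ p.fst.fst) (b' := p.fst.snd) (C.one_u_w p.fst.w))
      (CatData₂.t_hom_u_eq (b := p.fst.snd) (b' := .id _ p.snd) (C.u_one_w p.w)))
    (fun p => C.data₂.alp.nat _)
    (fun p => (C.data₂.alp_isWeak.hasInv _).symm)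
    (fun p => C.data₂.src₂_natInv_alp (b₁ := .id _ p.fst.fst) (b₃ := .id _ p.snd)
      (X₁.tgt_one _) rfl (X₁.tgt_one _) (C.one_u_w p.fst.w) (C.u_one_w p.w) rfl)
    (fun p => C.data₂.tgt₂_natInv_alp (b₁ := .id _ p.fst.fst) (b₃ := .id _ p.snd)
      (X₁.src_one _) rfl (X₁.src_one _) (C.one_u_w p.fst.w) (C.u_one_w p.w) rfl)
    (fun p => natInv_hom₂ C.data₂.alp_s _) (fun p => natInv_hom₂ C.data₂.alp_t _)
    C.bicatData₁.src₁₁_S C.bicatData₁.src₁₁_T (fun {p q} f =>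
      ⟨_, _, by simp, by simp, C.fV_val _ _, C.fV_val _ _,
        C.data₂.alp_square_mor (Mor₂.idMap _ f.1.1.1.1) f.1.1.1.2 (Mor₂.idMap _ f.1.2)
        (C.one_u_w p.fst.w) (C.u_one_w p.w) (C.one_u_w q.fst.w) (C.u_one_w q.w)
        (TwoCat.val_eq_of_square f.1.1.2) (TwoCat.val_eq_of_square f.2)
        (X₁.src_one _) rfl (X₁.src_one _) (X₁.tgt_one _) rfl (X₁.tgt_one _) rfl rfl rfl rfl⟩)

/-- The 2-datum `b₁₃` of the bicategory object of a category object. -/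
def b₁₃ : C.data₁.cells.VIso C.bicatData₁.src₁₃ C.bicatData₁.tgt₁₃ :=
  vIso (fun b => C.data₂.lam.natInv b.u) (fun b => C.data₂.lam.nat b.u)
    (fun b => (C.data₂.lam_isWeak.hasInv _).symm)
    (fun b => C.data₂.src₂_natInv_lam (b := b) _) (fun b => C.data₂.tgt₂_natInv_lam (b := b) _)
    (fun p => natInv_hom₂ C.data₂.lam_s _) (fun p => natInv_hom₂ C.data₂.lam_t _)
    C.bicatData₁.src₁₃_S C.bicatData₁.src₁₃_T (fun f =>
      ⟨_, _, by simp, by simp, C.fV_val _ _, C.fV_val _ _, C.data₂.lam_square_mor f⟩)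

/-- The 2-datum `b₁₄` of the bicategory object of a category object. -/
def b₁₄ : C.data₁.cells.VIso C.bicatData₁.src₁₄ C.bicatData₁.tgt₁₄ :=
  vIso (fun b => C.data₂.rho.natInv b.u) (fun b => C.data₂.rho.nat b.u)
    (fun b => (C.data₂.rho_isWeak.hasInv _).symm)
    (fun b => C.data₂.src₂_natInv_rho (b := b) _) (fun b => C.data₂.tgt₂_natInv_rho (b := b) _)
    (fun p => natInv_hom₂ C.data₂.rho_s _) (fun p => natInv_hom₂ C.data₂.rho_t _)
    C.bicatData₁.src₁₄_S C.bicatData₁.src₁₄_T (fun f =>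
      ⟨_, _, by simp, by simp, C.fV_val _ _, C.fV_val _ _, C.data₂.rho_square_mor f⟩)

variable {C} in
/-- A functor to 2-cells given by the components and naturality 2-morphisms of a transformation. -/
structure Represents {A : TwoCat.{u}} (F : D ⥤ C.data₁.cells.C₂) (J : D ⥤ A.Ob)
    (α : Transf A X₁) : Prop where
  u : ∀ x, (F.obj x).u = α.app (J.obj x)
  φ : ∀ {x y} (f : x ⟶ y), (F.map f).1.φ = α.nat (J.map f).1
  f : ∀ {x y} (f : x ⟶ y), (F.map f).1.f = α.dom.hom (J.map f).1
  g : ∀ {x y} (f : x ⟶ y), (F.map f).1.g = α.cod.hom (J.map f).1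

variable {C} in
-- Vertical composition of squares and composition of transformations are defined by the same two
-- rows, so they agree by uniqueness of composites.
theorem Represents.comp {A : TwoCat.{u}} {F G : D ⥤ C.data₁.cells.C₂} {J : D ⥤ A.Ob}
    {α β : Transf A X₁} (hF : Represents F J α) (hG : Represents G J β) (h) (e) :
    Represents (C.bicatData₁.fV F G h) J (α.comp β e) where
  u _ := X₁.comp_congr (hF.u _) (hG.u _) _ _
  φ f := by
    have k := C.fV_val h f
    rw [hF.u, hG.u, hF.φ, hG.φ] at k
    exact k.unique_of_ne_nil (α.comp_nat_val' β e _) (by simp)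
  f _ := hF.f _
  g _ := hG.g _

/-- The vertical isomorphism given by a modification. -/
noncomputable def vIsoOfModif {A : TwoCat.{u}} {α β : Transf A X₁} {hd hc} {Γ : Modif α β hd hc}
    (good : C.data₁.IsGood Γ) {J : D ⥤ A.Ob} {F G : D ⥤ C.data₁.cells.C₂} (hF : Represents F J α)
    (hG : Represents G J β) (hS : F ⋙ C.data₁.cells.S = G ⋙ C.data₁.cells.S)
    (hT : F ⋙ C.data₁.cells.T = G ⋙ C.data₁.cells.T) : C.data₁.cells.VIso F G :=
  -- The inverse components are chosen, because invertibility of a modification is an existence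
  -- statement. Their naturality follows from that of the modification itself.
  vIso (fun x => Γ.app (J.obj x)) (fun x => (good.inv (J.obj x)).choose)
    (fun x => (good.inv (J.obj x)).choose_spec)
    (fun x => (Γ.src₂_app _).trans (hF.u x).symm) (fun x => (Γ.tgt₂_app _).trans (hG.u x).symm)
    (fun x => ⟨_, good.s _⟩) (fun x => ⟨_, good.t _⟩) hS hT (fun {x y} f => by
      have k := Γ.natural_common (J.map f).1
      rw [(J.map f).2.1, (J.map f).2.2, hc, ← hF.φ, ← hG.φ, ← hF.f, ← hG.g] at k
      exact ⟨[[_]], [[_]], by simp, by simp, .of_atom _, .of_atom _, k⟩)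

/-- The 2-datum `b₁₂` of the bicategory object of a category object. -/
noncomputable def b₁₂ : C.data₁.cells.VIso C.bicatData₁.src₁₂ C.bicatData₁.tgt₁₂ :=
  -- The individual factors, being whiskers and associators, coincide with the transformations by
  -- definition. Only vertical composition needs `Represents.comp`.
  have h : Represents C.bicatData₁.src₁₂ C.data₁.quads C.data₂.src₅ :=
    .comp ⟨fun _ => rfl, fun _ => rfl, fun _ => rfl, fun _ => rfl⟩
      ⟨fun _ => rfl, fun _ => rfl, fun _ => rfl, fun _ => rfl⟩ _ _
  have h' : Represents C.bicatData₁.tgt₁₂ C.data₁.quads C.data₂.tgt₅ :=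
    .comp (.comp ⟨fun _ => rfl, fun _ => rfl, fun _ => rfl, fun _ => rfl⟩
      ⟨fun _ => rfl, fun _ => rfl, fun _ => rfl, fun _ => rfl⟩ _ _)
      ⟨fun _ => rfl, fun _ => rfl, fun _ => rfl, fun _ => rfl⟩ _ _
  C.vIsoOfModif C.data₃.c₅_isGood h h' C.bicatData₁.src₁₂_S C.bicatData₁.src₁₂_T

/-- The 2-datum `b₁₅` of the bicategory object of a category object. -/
noncomputable def b₁₅ : C.data₁.cells.VIso C.bicatData₁.src₁₅ C.bicatData₁.tgt₁₅ :=
  have h : Represents C.bicatData₁.src₁₅ (𝟭 X₀.Ob) (C.data₂.lunit C.data₁.i) :=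
    ⟨fun _ => rfl, fun _ => rfl, fun _ => rfl, fun _ => rfl⟩
  have h' : Represents C.bicatData₁.tgt₁₅ (𝟭 X₀.Ob) (C.data₂.runit C.data₁.i) :=
    ⟨fun _ => rfl, fun _ => rfl, fun _ => rfl, fun _ => rfl⟩
  C.vIsoOfModif C.data₃.c₁_isGood h h' C.bicatData₁.src₁₅_S C.bicatData₁.src₁₅_T

/-- The 2-datum `b₁₆` of the bicategory object of a category object. -/
noncomputable def b₁₆ : C.data₁.cells.VIso C.bicatData₁.src₁₆ C.bicatData₁.tgt₁₆ :=
  have h : Represents C.bicatData₁.src₁₆ C.data₁.pairs C.data₂.src₂ :=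
    ⟨fun _ => rfl, fun _ => rfl, fun _ => rfl, fun _ => rfl⟩
  have h' : Represents C.bicatData₁.tgt₁₆ C.data₁.pairs C.data₂.tgt₂ :=
    .comp ⟨fun _ => rfl, fun _ => rfl, fun _ => rfl, fun _ => rfl⟩
      ⟨fun _ => rfl, fun _ => rfl, fun _ => rfl, fun _ => rfl⟩ _ _
  C.vIsoOfModif C.data₃.c₂_isGood h h' C.bicatData₁.src₁₆_S C.bicatData₁.src₁₆_T

/-- The 2-datum `b₁₇` of the bicategory object of a category object. -/
noncomputable def b₁₇ : C.data₁.cells.VIso C.bicatData₁.src₁₇ C.bicatData₁.tgt₁₇ :=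
  have h : Represents C.bicatData₁.src₁₇ C.data₁.pairs C.data₂.src₃ :=
    .comp ⟨fun _ => rfl, fun _ => rfl, fun _ => rfl, fun _ => rfl⟩
      ⟨fun _ => rfl, fun _ => rfl, fun _ => rfl, fun _ => rfl⟩ _ _
  have h' : Represents C.bicatData₁.tgt₁₇ C.data₁.pairs (C.data₂.runit C.data₁.m) :=
    ⟨fun _ => rfl, fun _ => rfl, fun _ => rfl, fun _ => rfl⟩
  C.vIsoOfModif C.data₃.c₃_isGood h h' C.bicatData₁.src₁₇_S C.bicatData₁.src₁₇_T

/-- The 2-datum `b₁₈` of the bicategory object of a category object. -/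
noncomputable def b₁₈ : C.data₁.cells.VIso C.bicatData₁.src₁₈ C.bicatData₁.tgt₁₈ :=
  have h : Represents C.bicatData₁.src₁₈ C.data₁.pairs C.data₂.src₄ :=
    ⟨fun _ => rfl, fun _ => rfl, fun _ => rfl, fun _ => rfl⟩
  have h' : Represents C.bicatData₁.tgt₁₈ C.data₁.pairs C.data₂.tgt₄ :=
    .comp ⟨fun _ => rfl, fun _ => rfl, fun _ => rfl, fun _ => rfl⟩
      ⟨fun _ => rfl, fun _ => rfl, fun _ => rfl, fun _ => rfl⟩ _ _
  C.vIsoOfModif C.data₃.c₄_isGood h h' C.bicatData₁.src₁₈_S C.bicatData₁.src₁₈_T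

/-- The 2-data of the bicategory object of a category object. -/
noncomputable def bicatData₂ : Data₂ C.bicatData₁ where
  b₁ := vIsoOfEq C.src₁_eq
  b₂ := vIsoOfEq C.src₂_eq
  b₃ := vIsoOfEq C.src₃_eq
  b₄ := vIsoOfEq C.src₄_eq
  b₅ := vIsoOfEq C.src₅_eq
  b₆ := vIsoOfEq C.src₆_eq
  b₇ := vIsoOfEq C.src₇_eq
  b₈ := vIsoOfEq C.src₈_eq
  b₉ := C.b₉
  b₁₀ := C.b₁₀
  b₁₁ := C.b₁₁
  b₁₂ := C.b₁₂
  b₁₃ := C.b₁₃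
  b₁₄ := C.b₁₄
  b₁₅ := C.b₁₅
  b₁₆ := C.b₁₆
  b₁₇ := C.b₁₇
  b₁₈ := C.b₁₈

end CatObj

/-! ### Evaluation of chains of vertical arrows as pastings. -/

namespace TwoCat.Val

variable {X : TwoCat.{u}}

theorem unique_of_src₂ {L : List (List X.Hom₂)} {φ ψ : X.Hom₂} (h : X.Val L φ) (h' : X.Val L ψ)
    (e : X.src₂ φ = X.src₂ ψ) : φ = ψ := by
  cases L with
  | nil =>
    obtain ⟨f, rfl⟩ := nil_iff.1 h
    obtain ⟨g, rfl⟩ := nil_iff.1 h'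
    exact congrArg X.one₂ (by simpa using e)
  | cons r L => exact h.unique_of_ne_nil h' (by simp)

end TwoCat.Val

namespace CatObj

variable {X₀ X₁ : TwoCat.{u}} {C : CatObj X₀ X₁}

open CatData₁

theorem exists_one {x y : X₁.Ob} {f : x ⟶ y} (h : IsEqHom f) : f.1 = X₁.one x := by
  obtain ⟨rfl, rfl⟩ := h
  rfl

/-- Vertical squares have identity edges, which drop out of the rows. Their composition is thus
vertical composition of 2-morphisms. -/
theorem comp_φ_val {a b c : C.data₁.Obj₂} {μ : a ⟶ b} {ν : b ⟶ c} (h : C.data₁.cells.IsVert μ)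
    (h' : C.data₁.cells.IsVert ν) : X₁.Val [[μ.1.φ], [ν.1.φ]] (μ ≫ ν).1.φ := by
  have k := Mor₂.comp_val μ ν
  rw [show μ.1.f = _ from exists_one h.1, show ν.1.g = _ from exists_one h'.2] at k
  refine (TwoCat.Le.expand (M := [_]) (fun ρ hρ => ?_)
    (TwoCat.Le.expand (M := [_]) (fun ρ hρ => ?_) (.refl _))) _ k
  · rw [TwoCat.Row.one_right hρ]
    exact .of_atom _
  · rw [TwoCat.Row.one_left hρ]
    exact .of_atom _

theorem φ_of_isEqHom {a b : C.data₁.Obj₂} {μ : a ⟶ b} (h : IsEqHom μ) : ∃ f, μ.1.φ = X₁.one₂ f := by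
  obtain ⟨rfl, rfl⟩ := h
  exact ⟨_, rfl⟩

/-- A vertical arrow is an identity. -/
class IsId (e : C.data₁.cells.VArr) : Prop where
  out : IsEqHom e.hom

/-- The 2-morphism underlying a vertical arrow is the composite of a row. -/
class HasRow (e : C.data₁.cells.VArr) (r : outParam (List X₁.Hom₂)) : Prop where
  out : X₁.Row r (Mor₂.φ e.hom.1)

/-- A 2-cell is the composite of a path. -/
class HasPath (v : C.data₁.cells.C₂) (r : outParam (List X₁.Hom₂)) : Prop where
  out : X₁.Row r (X₁.one₂ (Obj₂.u v))

/-- A list of composable vertical arrows, of which those which are not identities are composites of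
the given rows. -/
inductive Seq : List C.data₁.cells.VArr → C.data₁.cells.C₂ → C.data₁.cells.C₂ →
    List (List X₁.Hom₂) → Prop
  | nil {a b} (h : a = b) : Seq [] a b []
  | id {e L a b c} (he : IsId e) (h : a = e.src) (hL : Seq L e.tgt b c) : Seq (e :: L) a b c
  | row {e L a b c r} (he : HasRow e r) (h : a = e.src) (hL : Seq L e.tgt b c) :
      Seq (e :: L) a b (r :: c)

/-- The composite of the chain is evaluated by its non-identity steps alone, since an identity step
contributes a row that can be dropped. -/
theorem Seq.chain {L a b c} (h : Seq (C := C) L a b c) (hL : L ≠ []) :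
    ∃ f : a ⟶ b, C.data₁.cells.Chain L (Arrow.mk f) ∧ C.data₁.cells.IsVert f ∧
      X₁.Val c (Mor₂.φ f.1) := by
  -- The part common to both constructors: the first step is kept as a row with its own 2-morphism.
  -- Afterwards that row is dropped for an identity, or refined into the given row otherwise.
  have aux : ∀ {e : C.data₁.cells.VArr} {L b c} (hL : Seq (C := C) L e.tgt b c)
      (ih : L ≠ [] → ∃ f : e.tgt ⟶ b, C.data₁.cells.Chain L (Arrow.mk f) ∧
        C.data₁.cells.IsVert f ∧ X₁.Val c (Mor₂.φ f.1)),
      ∃ f : e.src ⟶ b, C.data₁.cells.Chain (e :: L) (Arrow.mk f) ∧ C.data₁.cells.IsVert f ∧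
        X₁.Val ([Mor₂.φ e.hom.1] :: c) (Mor₂.φ f.1) := by
    intro e L b c hL ih
    cases L with
    | nil =>
      cases hL with
      | nil h =>
        subst h
        exact ⟨e.hom, .single e, e.isVert, .of_atom _⟩
    | cons e' L =>
      obtain ⟨f, h₁, h₂, h₃⟩ := ih (by simp)
      refine ⟨e.hom ≫ f, ?_, ⟨?_, ?_⟩, ?_⟩
      · simpa using Cells.Chain.cons e (e' :: L) (Arrow.mk f) rfl h₁
      · obtain ⟨x, hx⟩ := e.isVert.1
        obtain ⟨y, hy⟩ := h₂.1
        exact ⟨x.trans y, by rw [Functor.map_comp, hx, hy, eqToHom_trans]⟩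
      · obtain ⟨x, hx⟩ := e.isVert.2
        obtain ⟨y, hy⟩ := h₂.2
        exact ⟨x.trans y, by rw [Functor.map_comp, hx, hy, eqToHom_trans]⟩
      · have k := comp_φ_val e.isVert h₂
        obtain ⟨ρ, σ, w, h₄, h₅, h₆⟩ := TwoCat.Val.cons_iff.1 k
        cases TwoCat.Val.atom_iff.1 h₅
        exact h₆ ▸ .cons _ _ _ _ _ h₄ h₃
  induction h with
  | nil h => exact absurd rfl hL
  | @id e L a b c he h hs ih =>
    subst h
    obtain ⟨f, h₁, h₂, h₃⟩ := aux hs ih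
    obtain ⟨x, hx⟩ := φ_of_isEqHom he.out
    refine ⟨f, h₁, h₂, ?_⟩
    rw [show Mor₂.φ e.hom.1 = _ from hx] at h₃
    exact TwoCat.Le.drop₁ (.refl _) _ h₃
  | @row e L a b c r he h hs ih =>
    subst h
    obtain ⟨f, h₁, h₂, h₃⟩ := aux hs ih
    refine ⟨f, h₁, h₂, TwoCat.Le.expand (M := [_]) (fun ρ hρ => ?_) (.refl _) _ h₃⟩
    rw [TwoCat.Row.single_iff.1 hρ]
    exact .of_row he.out

/-- Two vertical squares between the same 2-cells have the same identity edges, and their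
2-morphisms have the same source. So only the 2-morphisms have to be compared, by a statement in
`C₁`. -/
theorem Seq.commutes {L L' a b c c'} (h : Seq (C := C) L a b c) (h' : Seq L' a b c') (hL : L ≠ [])
    (hL' : L' ≠ []) (k : X₁.Common c c') : C.data₁.cells.Commutes L L' := by
  obtain ⟨f, h₁, h₂, h₃⟩ := h.chain hL
  obtain ⟨f', h₁', h₂', h₃'⟩ := h'.chain hL'
  obtain ⟨φ, k, k'⟩ := k
  have hg : (f.1.g : X₁.Hom) = X₁.one _ := exists_one h₂.2
  have hg' : (f'.1.g : X₁.Hom) = X₁.one _ := exists_one h₂'.2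
  have hf : (f.1.f : X₁.Hom) = X₁.one _ := exists_one h₂.1
  have hf' : (f'.1.f : X₁.Hom) = X₁.one _ := exists_one h₂'.1
  have e : X₁.src₂ (Mor₂.φ f.1) = X₁.src₂ (Mor₂.φ f'.1) :=
    (Mor₂.src_φ' f (Mor₂.hbg' f)).trans ((X₁.comp_congr rfl (hg.trans hg'.symm) _ _).trans
      (Mor₂.src_φ' f' (Mor₂.hbg' f')).symm)
  have e' : Mor₂.φ f.1 = Mor₂.φ f'.1 := by
    -- If no row is left on one side, the composite is an identity determined only through its
    -- source, and `e` supplies the missing comparison.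
    cases c with
    | nil =>
      obtain ⟨x, rfl⟩ := TwoCat.Val.nil_iff.1 k
      obtain ⟨y, hy⟩ := TwoCat.Val.nil_iff.1 h₃
      cases c' with
      | nil => exact h₃.unique_of_src₂ h₃' e
      | cons =>
        have := h₃'.unique_of_ne_nil k' (by simp)
        rw [this, hy] at e ⊢
        exact congrArg X₁.one₂ (by simpa using e)
    | cons =>
      cases h₃.unique_of_ne_nil k (by simp)
      exact k'.unique_of_src₂ h₃' e
  obtain rfl : f = f' := Mor₂.hom_ext e' (hf.trans hf'.symm) (hg.trans hg'.symm)
  exact ⟨_, h₁, h₁'⟩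

/-! ### Rows of the individual steps. -/

section instances

open TwoCat

variable {e : C.data₁.cells.VArr} {r p : List X₁.Hom₂} {φ : X₁.Hom₂}

instance isId_e₁ (u) : IsId (C.bicatData₂.e₁ u) := ⟨vIsoOfEq_isEqHom _ _⟩
instance isId_e₂ (u) : IsId (C.bicatData₂.e₂ u) := ⟨vIsoOfEq_isEqHom _ _⟩
instance isId_e₂i (u) : IsId (C.bicatData₂.e₂i u) :=
  ⟨IsEqHom.inv (C.bicatData₂.b₂.iso.app u) (vIsoOfEq_isEqHom C.src₂_eq _)⟩
instance isId_e₃ (u v w h h') : IsId (C.bicatData₂.e₃ u v w h h') := ⟨vIsoOfEq_isEqHom _ _⟩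
instance isId_e₃i (u v w h h') : IsId (C.bicatData₂.e₃i u v w h h') :=
  ⟨IsEqHom.inv (C.bicatData₂.b₃.iso.app _) (vIsoOfEq_isEqHom C.src₃_eq _)⟩
instance isId_e₄ (x y h) : IsId (C.bicatData₂.e₄ x y h) := ⟨vIsoOfEq_isEqHom _ _⟩
instance isId_e₅ (x y h) : IsId (C.bicatData₂.e₅ x y h) := ⟨vIsoOfEq_isEqHom _ _⟩
instance isId_e₆ (u v w h h') : IsId (C.bicatData₂.e₆ u v w h h') := ⟨vIsoOfEq_isEqHom _ _⟩
instance isId_e₆i (u v w h h') : IsId (C.bicatData₂.e₆i u v w h h') :=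
  ⟨IsEqHom.inv (C.bicatData₂.b₆.iso.app _) (vIsoOfEq_isEqHom C.src₆_eq _)⟩
instance isId_e₇ (u v w h h') : IsId (C.bicatData₂.e₇ u v w h h') := ⟨vIsoOfEq_isEqHom _ _⟩
instance isId_e₇i (u v w h h') : IsId (C.bicatData₂.e₇i u v w h h') :=
  ⟨IsEqHom.inv (C.bicatData₂.b₇.iso.app _) (vIsoOfEq_isEqHom C.src₇_eq _)⟩
instance isId_e₈ (u v h) : IsId (C.bicatData₂.e₈ u v h) := ⟨vIsoOfEq_isEqHom _ _⟩
instance isId_e₈i (u v h) : IsId (C.bicatData₂.e₈i u v h) :=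
  ⟨IsEqHom.inv (C.bicatData₂.b₈.iso.app _) (vIsoOfEq_isEqHom C.src₈_eq _)⟩
instance isId_eV [he : IsId e] (v h) : IsId (no_index (C.bicatData₁.eV e v h)) :=
    ⟨.map C.bicatData₁.mv (.pair he.out (.id _))⟩
instance isId_Ve [he : IsId e] (v h) : IsId (no_index (C.bicatData₁.Ve v e h)) :=
    ⟨.map C.bicatData₁.mv (.pair (.id _) he.out)⟩
instance isId_er [he : IsId e] (y h) : IsId (no_index (C.bicatData₁.er e y h)) :=
    ⟨.map C.bicatData₁.wr (.pair he.out (.id _))⟩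
instance isId_le [he : IsId e] (x h) : IsId (no_index (C.bicatData₁.le x e h)) :=
    ⟨.map C.bicatData₁.wl (.pair (.id _) he.out)⟩

/-- A fallback of low priority, so that a vertical composite is first split into its factors. -/
instance (priority := low) hasPath (v : C.data₁.cells.C₂) : HasPath v [X₁.one₂ (Obj₂.u v)] :=
    ⟨.single _⟩
instance hasPath_V (v w : C.data₁.cells.C₂) (h) [hv : HasPath v r] [hw : HasPath w p] :
    HasPath (C.bicatData₁.V v w h) (r ++ p) := ⟨by
  have h' : X₁.tgt (Obj₂.u v) = X₁.src (Obj₂.u w) := h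
  have k := hv.out.append hw.out (by simpa using h')
  rwa [← X₁.one₂_comp _ _ h'] at k⟩

/-- Composing with an identity square below makes the first row of `compMap` a row of identities;
the surviving row is that of `μ` followed by the path of `v`. -/
theorem hasRow_eV_aux {a b v : C.data₁.Obj₂} {μ : a ⟶ b} (k : X₁.Row r μ.1.φ)
    (k' : X₁.Row p (X₁.one₂ v.u)) (h h' e) :
    X₁.Row (r ++ p) (Mor₂.compMap μ (𝟙 v) h h' e).1.φ := by
  have l := TwoCat.Le.drop₂ (.refl _) _ (Mor₂.compMap_val μ (𝟙 v) h h' e)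
  obtain ⟨ψ, e, h₁, h₂⟩ := (Row.cons_iff (by simp)).1 (Val.row_iff.1 l)
  cases Row.single_iff.1 h₁
  exact h₂ ▸ k.append k' _

theorem hasRow_Ve_aux {a b v : C.data₁.Obj₂} {μ : a ⟶ b} (k : X₁.Row r μ.1.φ)
    (k' : X₁.Row p (X₁.one₂ v.u)) (h h' e) :
    X₁.Row (p ++ r) (Mor₂.compMap (𝟙 v) μ h h' e).1.φ := by
  have l := Mor₂.compMap_val (𝟙 v) μ h h' e
  rw [← List.append_nil [[_, _], _]] at l
  have l := (TwoCat.Le.skip (.drop₂ (.refl _))) _ l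
  obtain ⟨ψ, e, h₁, h₂⟩ := (Row.cons_iff (by simp)).1 (Val.row_iff.1 l)
  cases Row.single_iff.1 h₁
  exact h₂ ▸ k'.append k _

instance hasRow_eV [he : HasRow e r] (v : C.data₁.cells.C₂) (h) [hv : HasPath v p] :
    HasRow (no_index (C.bicatData₁.eV e v h)) (r ++ p) :=
  ⟨hasRow_eV_aux he.out hv.out _ _
    (TwoCat.val_eq_of_square (e.isVert.2.square h (e.isVert.2.choose.symm.trans h)))⟩

instance hasRow_Ve [he : HasRow e r] (v : C.data₁.cells.C₂) (h) [hv : HasPath v p] :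
    HasRow (no_index (C.bicatData₁.Ve v e h)) (p ++ r) :=
  ⟨hasRow_Ve_aux he.out hv.out _ _
    (TwoCat.val_eq_of_square (e.isVert.1.square' h (h.trans e.isVert.1.choose)))⟩

theorem t_φ_of_isVert {a b : C.data₁.Obj₂} {μ : a ⟶ b} (h : C.data₁.cells.IsVert μ) :
    C.data₁.t.hom₂ μ.1.φ = X₀.one₂ (X₀.one (C.data₁.t.ob (X₁.src a.u))) := by
  rw [Mor₂.t_φ', ← Mor₂.t_f, show μ.1.f = X₁.one (X₁.src a.u) from exists_one h.1,
      C.data₁.t.map_one]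

theorem s_φ_of_isVert {a b : C.data₁.Obj₂} {μ : a ⟶ b} (h : C.data₁.cells.IsVert μ) :
    C.data₁.s.hom₂ μ.1.φ = X₀.one₂ (X₀.one (C.data₁.s.ob (X₁.src a.u))) := by
  rw [Mor₂.s_φ', ← Mor₂.s_f, show μ.1.f = X₁.one (X₁.src a.u) from exists_one h.1,
      C.data₁.s.map_one]

theorem t_of_hasRow (he : HasRow e [φ]) {y : X₁.Ob}
    (h : C.data₁.cells.t.obj (C.data₁.cells.S.obj e.src) = C.data₁.cells.s.obj y) :
    C.data₁.t.hom₂ φ = C.data₁.s.hom₂ (X₁.o y) := by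
  rw [← Row.single_iff.1 he.out, C.data₁.s.map_one₂, C.data₁.s.map_one]
  exact (t_φ_of_isVert e.isVert).trans (congrArg (fun x => X₀.one₂ (X₀.one x)) h)

theorem s_of_hasRow (he : HasRow e [φ]) {x : X₁.Ob}
    (h : C.data₁.cells.t.obj x = C.data₁.cells.s.obj (C.data₁.cells.S.obj e.src)) :
    C.data₁.t.hom₂ (X₁.o x) = C.data₁.s.hom₂ φ := by
  rw [← Row.single_iff.1 he.out, C.data₁.t.map_one₂, C.data₁.t.map_one]
  exact (congrArg (fun x => X₀.one₂ (X₀.one x)) h).trans (s_φ_of_isVert e.isVert).symm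

/-- A whisker applies `M` to one 2-morphism, so only steps with a single entry are covered. Those
are the only non-identity steps whiskered horizontally in the axioms. -/
instance hasRow_er [he : HasRow e [φ]] (y h) : HasRow (no_index (C.bicatData₁.er e y h))
    [C.data₁.m₂ φ (X₁.o y) (t_of_hasRow he h)] := ⟨by
  cases Row.single_iff.1 he.out
  exact .single _⟩

instance hasRow_le [he : HasRow e [φ]] (x h) : HasRow (no_index (C.bicatData₁.le x e h))
    [C.data₁.m₂ (X₁.o x) φ (s_of_hasRow he h)] := ⟨by
  cases Row.single_iff.1 he.out
  exact .single _⟩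

instance hasRow_e₉ (u : C.data₁.cells.C₂) (y z : C.data₁.cells.C₁) (h h') : HasRow
    (C.bicatData₂.e₉ u y z h h')
    [C.data₂.Ai (Obj₂.u u) (X₁.one y) (X₁.one z)
      (CatData₂.t_hom_u_eq (b := u) (b' := .id _ y) (C.u_one_w h.symm))
      (CatData₂.t_hom_u_eq (b := .id _ y) (b' := .id _ z) (C.one_w h'.symm))] := ⟨.single _⟩

instance hasRow_e₉i (u : C.data₁.cells.C₂) (y z : C.data₁.cells.C₁) (h h') : HasRow
    (C.bicatData₂.e₉i u y z h h')
    [C.data₂.An (Obj₂.u u) (X₁.one y) (X₁.one z)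
      (CatData₂.t_hom_u_eq (b := u) (b' := .id _ y) (C.u_one_w h.symm))
      (CatData₂.t_hom_u_eq (b := .id _ y) (b' := .id _ z) (C.one_w h'.symm))] := ⟨.single _⟩

instance hasRow_e₁₀ (x y : C.data₁.cells.C₁) (u : C.data₁.cells.C₂) (h h') :
    HasRow (C.bicatData₂.e₁₀ x y u h h') [C.data₂.Ai (X₁.one x) (X₁.one y) (Obj₂.u u)
      (CatData₂.t_hom_u_eq (b := .id _ x) (b' := .id _ y) (C.one_w h.symm))
      (CatData₂.t_hom_u_eq (b := .id _ y) (b' := u) (C.one_u_w h'.symm))] := ⟨.single _⟩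

instance hasRow_e₁₀i (x y : C.data₁.cells.C₁) (u : C.data₁.cells.C₂) (h h') :
    HasRow (C.bicatData₂.e₁₀i x y u h h') [C.data₂.An (X₁.one x) (X₁.one y) (Obj₂.u u)
      (CatData₂.t_hom_u_eq (b := .id _ x) (b' := .id _ y) (C.one_w h.symm))
      (CatData₂.t_hom_u_eq (b := .id _ y) (b' := u) (C.one_u_w h'.symm))] := ⟨.single _⟩

instance hasRow_e₁₁ (x : C.data₁.cells.C₁) (u : C.data₁.cells.C₂) (z : C.data₁.cells.C₁) (h h') :
    HasRow (C.bicatData₂.e₁₁ x u z h h') [C.data₂.Ai (X₁.one x) (Obj₂.u u) (X₁.one z)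
      (CatData₂.t_hom_u_eq (b := .id _ x) (b' := u) (C.one_u_w h.symm))
      (CatData₂.t_hom_u_eq (b := u) (b' := .id _ z) (C.u_one_w h'.symm))] := ⟨.single _⟩

instance hasRow_e₁₂ (x y z w : C.data₁.cells.C₁) (h h' h'') : HasRow
    (C.bicatData₂.e₁₂ x y z w h h' h'')
    [C.data₃.b₅ x y z w h.symm h'.symm h''.symm] := ⟨.single _⟩

instance hasRow_e₁₃ (u : C.data₁.cells.C₂) : HasRow (C.bicatData₂.e₁₃ u)
    [C.data₂.lam.natInv (Obj₂.u u)] :=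
  ⟨.single _⟩

instance hasRow_e₁₃i (u : C.data₁.cells.C₂) : HasRow (C.bicatData₂.e₁₃i u)
    [C.data₂.lam.nat (Obj₂.u u)] :=
  ⟨.single _⟩

instance hasRow_e₁₄ (u : C.data₁.cells.C₂) : HasRow (C.bicatData₂.e₁₄ u)
    [C.data₂.rho.natInv (Obj₂.u u)] :=
  ⟨.single _⟩

instance hasRow_e₁₅ (p : C.data₁.cells.C₀) : HasRow (C.bicatData₂.e₁₅ p) [C.data₃.c₁.app p] :=
    ⟨.single _⟩

instance hasRow_e₁₆ (x y : C.data₁.cells.C₁) (h) : HasRow (C.bicatData₂.e₁₆ x y h)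
    [C.data₃.b₂ x y h.symm] := ⟨.single _⟩

instance hasRow_e₁₇ (x y : C.data₁.cells.C₁) (h) : HasRow (C.bicatData₂.e₁₇ x y h)
    [C.data₃.b₃ x y h.symm] := ⟨.single _⟩

instance hasRow_e₁₈ (x y : C.data₁.cells.C₁) (h) : HasRow (C.bicatData₂.e₁₈ x y h)
    [C.data₃.b₄ x y h.symm] := ⟨.single _⟩

end instances

/-- The default arguments run through both chains step by step: end of chain, identity step, or step
with a row found by instance search. The rows so computed appear in `k`, which is the mathematical
content left to prove. -/
theorem commutes_of {L L' a b c c'}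
    (h : Seq (C := C) L a b c := by
      repeat' first
        | exact Seq.nil (by first | rfl | simp [*])
        | refine Seq.id inferInstance (by first | rfl | simp [*]) ?_
        | apply Seq.row inferInstance (by first | rfl | simp [*]))
    (h' : Seq (C := C) L' a b c' := by
      repeat' first
        | exact Seq.nil (by first | rfl | simp [*])
        | refine Seq.id inferInstance (by first | rfl | simp [*]) ?_
        | apply Seq.row inferInstance (by first | rfl | simp [*]))
    (hL : L ≠ [] := by simp) (hL' : L' ≠ [] := by simp) (k : X₁.Common c c') :
    C.data₁.cells.Commutes L L' :=
  h.commutes h' hL hL' k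

/-- The morphism only serves to exhibit some identity as a composite of the empty pasting; any
choice works. -/
theorem common_nil (f : X₁.Hom) : X₁.Common [] [] := ⟨_, .nil f, .nil f⟩

end CatObj

/-! ### Axioms all of whose steps are identities. -/

namespace CatObj

variable {X₀ X₁ : TwoCat.{u}} (C : CatObj X₀ X₁)

theorem bicat_ax₁ : C.bicatData₂.Ax₁ := fun x => commutes_of (k := common_nil (X₁.one x))

theorem bicat_ax₂ : C.bicatData₂.Ax₂ := fun u v h => commutes_of
    (k := common_nil (CatData₁.Obj₂.u u))

theorem bicat_ax₂' : C.bicatData₂.Ax₂' := fun u v h => commutes_of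
    (k := common_nil (CatData₁.Obj₂.u u))

theorem bicat_ax₃ : C.bicatData₂.Ax₃ := fun u v h => commutes_of
    (k := common_nil (CatData₁.Obj₂.u u))

theorem bicat_ax₄ : C.bicatData₂.Ax₄ := fun u v w c h h' h'' => commutes_of
    (k := common_nil (CatData₁.Obj₂.u u))

theorem bicat_ax₅a : C.bicatData₂.Ax₅a := fun u y h => commutes_of
    (k := common_nil (CatData₁.Obj₂.u u))

theorem bicat_ax₅b : C.bicatData₂.Ax₅b := fun u y h => commutes_of
    (k := common_nil (CatData₁.Obj₂.u u))

theorem bicat_ax₅c : C.bicatData₂.Ax₅c := fun x u h => commutes_of (k := common_nil (X₁.one x))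

theorem bicat_ax₅d : C.bicatData₂.Ax₅d := fun x u h => commutes_of (k := common_nil (X₁.one x))

theorem bicat_ax₆ : C.bicatData₂.Ax₆ := fun x v h => commutes_of (k := common_nil (X₁.one x))

theorem bicat_ax₆' : C.bicatData₂.Ax₆' := fun u y h => commutes_of
    (k := common_nil (CatData₁.Obj₂.u u))

theorem bicat_ax₇ : C.bicatData₂.Ax₇ := fun u v w y h h' h'' => commutes_of
    (k := common_nil (CatData₁.Obj₂.u u))

theorem bicat_ax₇' : C.bicatData₂.Ax₇' := fun x u v w h h' h'' => commutes_of
    (k := common_nil (X₁.one x))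

theorem bicat_ax₈ : C.bicatData₂.Ax₈ := fun u w v h h' => commutes_of
    (k := common_nil (CatData₁.Obj₂.u u))

theorem bicat_ax₈' : C.bicatData₂.Ax₈' := fun u v w h h' => commutes_of
    (k := common_nil (CatData₁.Obj₂.u u))

end CatObj

/-! ### Axioms from the values of weak transformations on identities and composites. -/

namespace Transf.IsWeak

variable {A B : TwoCat.{u}} {α : Transf A B}

theorem natInv_one_common (h : α.IsWeak) {f : A.Hom} {x : A.Ob} (e : f = A.one x) :
    B.Common [] [[α.natInv f]] := by
  subst e
  rw [h.natInv_one]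
  exact ⟨_, .nil _, .of_atom _⟩

/-- The images of `f` and `g` and the composite are free names, so that the law can be matched with
rows in which products of identities have already been simplified. -/
theorem natInv_comp_common (h : α.IsWeak) {f g k f₀ g₀} (hf : α.dom.hom f = f₀)
    (hg : α.cod.hom g = g₀) (e : A.tgt f = A.src g) (hk : A.comp f g e = k) :
    B.Common [[B.one₂ f₀, α.natInv g], [α.natInv f, B.one₂ g₀]] [[α.natInv k]] := by
  subst hf hg hk
  exact ⟨_, h.natInv_comp_val f g e, .of_atom _⟩

/-- Two factorisations of one morphism give two expansions of the same inverse naturality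
2-morphism. -/
theorem natInv_comp_common₂ (h : α.IsWeak) {f g f' g' f₀ g₀ f₀' g₀'} (hf : α.dom.hom f = f₀)
    (hg : α.cod.hom g = g₀) (hf' : α.dom.hom f' = f₀') (hg' : α.cod.hom g' = g₀')
    (e : A.tgt f = A.src g) (e' : A.tgt f' = A.src g')
    (hk : A.comp f g e = A.comp f' g' e') :
    B.Common [[B.one₂ f₀, α.natInv g], [α.natInv f, B.one₂ g₀]]
      [[B.one₂ f₀', α.natInv g'], [α.natInv f', B.one₂ g₀']] := by
  subst hf hg hf' hg'
  refine ⟨_, h.natInv_comp_val f g e, ?_⟩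
  rw [hk]
  exact h.natInv_comp_val f' g' e'

end Transf.IsWeak

namespace CatObj

variable {X₀ X₁ : TwoCat.{u}} (C : CatObj X₀ X₁)

theorem m₁_congr {f g f' g' : X₁.Hom} {h : C.data₁.t.hom f = C.data₁.s.hom g} (hf : f = f')
    (hg : g = g') :
    C.data₁.m₁ f g h = C.data₁.m₁ f' g' (by rw [← hf, ← hg, h]) := by
  subst hf hg
  rfl

theorem alp_dom_hom {f g k f₀ : X₁.Hom} {h : C.data₁.t.hom f = C.data₁.s.hom g}
    {h' : C.data₁.t.hom g = C.data₁.s.hom k}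
    (e : C.data₁.m₁ (C.data₁.m₁ f g h) k (by simpa using h') = f₀) :
    C.data₂.alp.dom.hom ⟨(⟨(f, g), h⟩, k), h'⟩ = f₀ :=
  (congrArg (fun F => StrictFunctor.hom F _) C.data₂.alp_dom).trans e

theorem alp_cod_hom {f g k f₀ : X₁.Hom} {h : C.data₁.t.hom f = C.data₁.s.hom g}
    {h' : C.data₁.t.hom g = C.data₁.s.hom k}
    (e : C.data₁.m₁ f (C.data₁.m₁ g k h') (by simpa using h) = f₀) :
    C.data₂.alp.cod.hom ⟨(⟨(f, g), h⟩, k), h'⟩ = f₀ :=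
  (congrArg (fun F => StrictFunctor.hom F _) C.data₂.alp_cod).trans e

/-- The composition law of the associator for a composite of triples, whose three coordinates are
composed separately. -/
theorem Ai_comp_common {f₁ f₂ f₃ g₁ g₂ g₃ k₁ k₂ k₃ f₀ g₀ : X₁.Hom}
    (hf : C.data₁.t.hom f₁ = C.data₁.s.hom f₂) (hf' : C.data₁.t.hom f₂ = C.data₁.s.hom f₃)
    (hg : C.data₁.t.hom g₁ = C.data₁.s.hom g₂) (hg' : C.data₁.t.hom g₂ = C.data₁.s.hom g₃)
    (hk : C.data₁.t.hom k₁ = C.data₁.s.hom k₂) (hk' : C.data₁.t.hom k₂ = C.data₁.s.hom k₃)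
    (kf : C.data₁.m₁ (C.data₁.m₁ f₁ f₂ hf) f₃ (by simpa using hf') = f₀)
    (kg : C.data₁.m₁ g₁ (C.data₁.m₁ g₂ g₃ hg') (by simpa using hg) = g₀)
    {e₁ : X₁.tgt f₁ = X₁.src g₁} {e₂ : X₁.tgt f₂ = X₁.src g₂} {e₃ : X₁.tgt f₃ = X₁.src g₃}
    (h₁ : X₁.comp f₁ g₁ e₁ = k₁) (h₂ : X₁.comp f₂ g₂ e₂ = k₂) (h₃ : X₁.comp f₃ g₃ e₃ = k₃) :
    X₁.Common
      [[X₁.one₂ f₀, C.data₂.Ai g₁ g₂ g₃ hg hg'], [C.data₂.Ai f₁ f₂ f₃ hf hf', X₁.one₂ g₀]]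
      [[C.data₂.Ai k₁ k₂ k₃ hk hk']] := by
  subst h₁ h₂ h₃
  exact C.data₂.alp_isWeak.natInv_comp_common (C.alp_dom_hom kf) (C.alp_cod_hom kg)
    (Subtype.ext (Prod.ext (Subtype.ext (Prod.ext e₁ e₂)) e₃)) rfl

/-- The common triple `(k₁, k₂, k₃)` has two factorisations. Those used below put two 2-cells one
after the other in either order, with identities filling the other places. -/
theorem Ai_comp_common₂ {f₁ f₂ f₃ g₁ g₂ g₃ f₁' f₂' f₃' g₁' g₂' g₃' k₁ k₂ k₃ f₀ g₀ f₀' g₀' : X₁.Hom}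
    (hf : C.data₁.t.hom f₁ = C.data₁.s.hom f₂) (hf' : C.data₁.t.hom f₂ = C.data₁.s.hom f₃)
    (hg : C.data₁.t.hom g₁ = C.data₁.s.hom g₂) (hg' : C.data₁.t.hom g₂ = C.data₁.s.hom g₃)
    (kf : C.data₁.t.hom f₁' = C.data₁.s.hom f₂') (kf' : C.data₁.t.hom f₂' = C.data₁.s.hom f₃')
    (kg : C.data₁.t.hom g₁' = C.data₁.s.hom g₂') (kg' : C.data₁.t.hom g₂' = C.data₁.s.hom g₃')
    (lf : C.data₁.m₁ (C.data₁.m₁ f₁ f₂ hf) f₃ (by simpa using hf') = f₀)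
    (lg : C.data₁.m₁ g₁ (C.data₁.m₁ g₂ g₃ hg') (by simpa using hg) = g₀)
    (lf' : C.data₁.m₁ (C.data₁.m₁ f₁' f₂' kf) f₃' (by simpa using kf') = f₀')
    (lg' : C.data₁.m₁ g₁' (C.data₁.m₁ g₂' g₃' kg') (by simpa using kg) = g₀')
    {e₁ : X₁.tgt f₁ = X₁.src g₁} {e₂ : X₁.tgt f₂ = X₁.src g₂} {e₃ : X₁.tgt f₃ = X₁.src g₃}
    {e₁' : X₁.tgt f₁' = X₁.src g₁'} {e₂' : X₁.tgt f₂' = X₁.src g₂'}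
    {e₃' : X₁.tgt f₃' = X₁.src g₃'}
    (h₁ : X₁.comp f₁ g₁ e₁ = k₁) (h₂ : X₁.comp f₂ g₂ e₂ = k₂) (h₃ : X₁.comp f₃ g₃ e₃ = k₃)
    (h₁' : X₁.comp f₁' g₁' e₁' = k₁) (h₂' : X₁.comp f₂' g₂' e₂' = k₂)
    (h₃' : X₁.comp f₃' g₃' e₃' = k₃) :
    X₁.Common
      [[X₁.one₂ f₀, C.data₂.Ai g₁ g₂ g₃ hg hg'], [C.data₂.Ai f₁ f₂ f₃ hf hf', X₁.one₂ g₀]]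
      [[X₁.one₂ f₀', C.data₂.Ai g₁' g₂' g₃' kg kg'],
        [C.data₂.Ai f₁' f₂' f₃' kf kf', X₁.one₂ g₀']] := by
  subst h₁ h₂ h₃
  exact C.data₂.alp_isWeak.natInv_comp_common₂ (C.alp_dom_hom lf) (C.alp_cod_hom lg)
    (C.alp_dom_hom lf') (C.alp_cod_hom lg')
    (Subtype.ext (Prod.ext (Subtype.ext (Prod.ext e₁ e₂)) e₃))
    (Subtype.ext (Prod.ext (Subtype.ext (Prod.ext e₁' e₂')) e₃'))
    (Subtype.ext (Prod.ext (Subtype.ext (Prod.ext h₁'.symm h₂'.symm)) h₃'.symm))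

theorem comp_one_one (x : X₁.Ob) : X₁.comp (X₁.one x) (X₁.one x) (by simp) = X₁.one x :=
  X₁.comp_one' (X₁.tgt_one x) _

theorem u_one (u : C.data₁.Obj₂) {x : X₁.Ob} (h : x = X₁.tgt u.u) :
    X₁.comp u.u (X₁.one x) (by simp [h]) = u.u := X₁.comp_one' h.symm _

theorem one_u (u : C.data₁.Obj₂) {x : X₁.Ob} (h : x = X₁.src u.u) :
    X₁.comp (X₁.one x) u.u (by simp [h]) = u.u := X₁.one_comp' h.symm _

/-- In this axiom and the next two, only the associator step at a triple of identities is not an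
identity step, and its naturality 2-morphism there is an identity. -/
theorem bicat_ax₉ : C.bicatData₂.Ax₉ := fun x y z h h' => commutes_of (k :=
  C.data₂.alp_isWeak.natInv_one_common (x := ⟨(⟨(x, y), h.symm⟩, z), h'.symm⟩) rfl)

theorem bicat_ax₉' : C.bicatData₂.Ax₉' := fun x y z h h' => commutes_of (k :=
  C.data₂.alp_isWeak.natInv_one_common (x := ⟨(⟨(x, y), h.symm⟩, z), h'.symm⟩) rfl)

theorem bicat_ax₁₀ : C.bicatData₂.Ax₁₀ := fun x y z h h' => commutes_of (k :=
  C.data₂.alp_isWeak.natInv_one_common (x := ⟨(⟨(x, y), h.symm⟩, z), h'.symm⟩) rfl)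

/-- The triple `(u·v, 1, 1)` is the composite of `(u, 1, 1)` and `(v, 1, 1)`. As `b₉` is an inverse
naturality 2-morphism, the factor for `v` acts first. The next two axioms move the composite to the
other places. -/
theorem bicat_ax₁₁ : C.bicatData₂.Ax₁₁ := fun u v y z h h' h'' => commutes_of (k := by
  exact C.Ai_comp_common _ _ _ _ _ _ rfl (C.m₁_congr rfl (C.data₁.m₁_one' _ _ _))
    (e₁ := h.symm) rfl (comp_one_one y) (comp_one_one z))

theorem bicat_ax₁₁' : C.bicatData₂.Ax₁₁' := fun x y u v h h' h'' => commutes_of (k := by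
  exact C.Ai_comp_common _ _ _ _ _ _ (C.m₁_congr (C.data₁.m₁_one' _ _ _) rfl) rfl
    (e₃ := h''.symm) (comp_one_one x) (comp_one_one y) rfl)

theorem bicat_ax₁₂ : C.bicatData₂.Ax₁₂ := fun x u v z h h' h'' => commutes_of (k := by
  exact C.Ai_comp_common _ _ _ _ _ _ rfl rfl (e₂ := h''.symm) (comp_one_one x) rfl
    (comp_one_one z))

/-- The triple `(u, v, 1)` is `(1, v, 1)` followed by `(u, 1, 1)`, and also the reverse composite.
The next two axioms treat the triples `(1, u, v)` and `(u, 1, v)` in the same way. -/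
theorem bicat_ax₁₃ : C.bicatData₂.Ax₁₃ := fun u v z h h' => commutes_of (k := by
  exact C.Ai_comp_common₂ _ _ _ _ _ _ _ _ rfl (C.m₁_congr rfl (C.data₁.m₁_one' _ _ _)) rfl rfl
    (C.one_u u rfl) (C.u_one v rfl) (comp_one_one z) (C.u_one u rfl) (C.one_u v rfl)
    (comp_one_one z))

theorem bicat_ax₁₃' : C.bicatData₂.Ax₁₃' := fun x u v h h' => commutes_of (k := by
  exact C.Ai_comp_common₂ _ _ _ _ _ _ _ _ (C.m₁_congr (C.data₁.m₁_one' _ _ _) rfl) rfl rfl rfl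
    (comp_one_one x) (C.one_u u rfl) (C.u_one v rfl) (comp_one_one x) (C.u_one u rfl)
    (C.one_u v rfl))

theorem bicat_ax₁₄ : C.bicatData₂.Ax₁₄ := fun u y v h h' => commutes_of (k := by
  exact C.Ai_comp_common₂ _ _ _ _ _ _ _ _ (C.m₁_congr (C.data₁.m₁_one' _ _ _) rfl)
    (C.m₁_congr rfl (C.data₁.m₁_one' _ _ _)) rfl rfl
    (C.one_u u rfl) (comp_one_one y) (C.u_one v rfl) (C.u_one u rfl) (comp_one_one y)
    (C.one_u v rfl))

theorem bicat_ax₁₈ : C.bicatData₂.Ax₁₈ := fun x => commutes_of (k :=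
  C.data₂.lam_isWeak.natInv_one_common rfl)

theorem bicat_ax₁₈' : C.bicatData₂.Ax₁₈' := fun x => commutes_of (k :=
  C.data₂.rho_isWeak.natInv_one_common rfl)

theorem lam_dom_hom (u : C.data₁.Obj₂) : C.data₂.lam.dom.hom u.u =
    C.data₁.m₁ (X₁.one (C.data₁.i.ob (C.data₁.s.ob (X₁.src u.u)))) u.u
      (by simp [CatData₁.Mor₂.s_u]) :=
  (congrArg (fun F => StrictFunctor.hom F _) C.data₂.lam_dom).trans
    (C.m₁_congr ((congrArg C.data₁.i.hom (CatData₁.Mor₂.s_u u)).trans (C.data₁.i.map_one _)) rfl)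

theorem rho_dom_hom (u : C.data₁.Obj₂) : C.data₂.rho.dom.hom u.u =
    C.data₁.m₁ u.u (X₁.one (C.data₁.i.ob (C.data₁.t.ob (X₁.src u.u))))
      (by simp [CatData₁.Mor₂.t_u]) :=
  (congrArg (fun F => StrictFunctor.hom F _) C.data₂.rho_dom).trans
    (C.m₁_congr rfl ((congrArg C.data₁.i.hom (CatData₁.Mor₂.t_u u)).trans (C.data₁.i.map_one _)))

theorem lam_cod_hom (f : X₁.Hom) : C.data₂.lam.cod.hom f = f :=
  congrArg (fun F => StrictFunctor.hom F _) C.data₂.lam_cod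

theorem rho_cod_hom (f : X₁.Hom) : C.data₂.rho.cod.hom f = f :=
  congrArg (fun F => StrictFunctor.hom F _) C.data₂.rho_cod

/-- The composition law of the left unit transformation, its distribution over the whiskers being
strict. -/
theorem bicat_ax₁₉ : C.bicatData₂.Ax₁₉ := fun u v h => commutes_of (k := by
  exact C.data₂.lam_isWeak.natInv_comp_common (C.lam_dom_hom u) (C.lam_cod_hom v.u)
    h.symm rfl)

theorem bicat_ax₁₉' : C.bicatData₂.Ax₁₉' := fun u v h => commutes_of (k := by
  exact C.data₂.rho_isWeak.natInv_comp_common (C.rho_dom_hom u) (C.rho_cod_hom v.u)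
    h.symm rfl)

end CatObj

/-! ### Axioms from the coherence axioms of the category object. -/

namespace CatObj

variable {X₀ X₁ : TwoCat.{u}} (C : CatObj X₀ X₁)

/-- With rebracketing and distribution of whiskers removed, the remaining rows are literally those
of `ax₅`. The inverse naturality 2-morphisms there are the data `b₁₀` and `b₁₁`, and the uninverted
one is the inverse of `b₉`. -/
theorem bicat_ax₁₇ : C.bicatData₂.Ax₁₇ := fun x y z v w h h' h'' h''' => commutes_of (k := by
  exact .of_commutes (C.ax₅ x y z v w h.symm h'.symm h''.symm h'''.symm))

/-- In `ax₁` the naturality 2-morphism of `λ` is the last row of one side, whereas `b₁₃` is its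
inverse on the other side. -/
theorem bicat_ax₂₃ : C.bicatData₂.Ax₂₃ := fun x => commutes_of (k := by
  exact TwoCat.Common.move_right (L := [_, _]) (L' := [_]) (.of_commutes (C.ax₁ x))
    (.cons (.one₂ _) (.cons (C.data₂.lam_isWeak.hasInv _) .nil)))

theorem bicat_ax₂₃' : C.bicatData₂.Ax₂₃' := fun x => commutes_of (k := by
  -- The coherence axiom equates a composite with an identity. After the row of `ρ` has been moved
  -- over, the identity row stands before its inverse and is dropped.
  have k := TwoCat.Common.move_right (L' := [_, _, _])
    (TwoCat.Common.of_commutes (C.ax₁' x)).symm (.cons (C.data₂.rho_isWeak.hasInv _) .nil)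
  exact k.mono (.drop₂ (.refl _)) (.refl _))

theorem bicat_ax₂₄ : C.bicatData₂.Ax₂₄ := fun x => commutes_of (k := by
  -- The naturality row of `λ` stays where it is, in agreement with the use of the inverse of `b₁₃`;
  -- only the final row of `ρ` changes side.
  have k := TwoCat.Common.move_right (L' := [_, _, _])
    (TwoCat.Common.of_commutes (C.ax₂ x)).symm (.cons (C.data₂.rho_isWeak.hasInv _) .nil)
  exact k.mono (.drop₂ (.refl _)) (.refl _))

/-- Two rows of `ax₃` change side: the associator naturality 2-morphism in front, and that of `λ` at
the end. -/
theorem bicat_ax₂₅ : C.bicatData₂.Ax₂₅ := fun x y z h h' => commutes_of (k := by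
  have k := TwoCat.Common.move_left
    (TwoCat.Common.of_commutes (C.ax₃ x y z h.symm h'.symm)).symm
    (.cons (C.data₂.alp_isWeak.hasInv _) .nil)
  exact TwoCat.Common.move_right (L := [_, _, _]) (L' := [_, _]) k
    (.cons (.one₂ _) (.cons (.one₂ _) (.cons (C.data₂.lam_isWeak.hasInv _) .nil))))

theorem bicat_ax₂₅' : C.bicatData₂.Ax₂₅' := fun x y z h h' => commutes_of (k := by
  exact TwoCat.Common.move_right (L := [_, _, _]) (L' := [_, _])
    (TwoCat.Common.of_commutes (C.ax₃' x y z h.symm h'.symm))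
    (.cons (C.data₂.rho_isWeak.hasInv _) .nil))

/-- Only the leading associator row of `ax₄` changes side; its other naturality 2-morphism is
already inverted, as `b₁₁` requires. -/
theorem bicat_ax₂₆ : C.bicatData₂.Ax₂₆ := fun x y z h h' => commutes_of (k := by
  exact TwoCat.Common.move_left
    (TwoCat.Common.of_commutes (C.ax₄ x y z h.symm h'.symm)).symm
    (.cons (C.data₂.alp_isWeak.hasInv _) .nil))

theorem bicat_ax₂₆' : C.bicatData₂.Ax₂₆' := fun x y z h h' => commutes_of (k := by
  exact (TwoCat.Common.move_left
    (TwoCat.Common.of_commutes (C.ax₄' x y z h.symm h'.symm)).symm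
    (.cons (.one₂ _) (.cons (C.data₂.alp_isWeak.hasInv _) .nil))).symm)

end CatObj

/-! ### Naturality of the structural modifications, with inverse naturality 2-morphisms. -/

namespace Modif

variable {A B : TwoCat.{u}} {α β : Transf A B} {hd : α.dom = β.dom} {hc : α.cod = β.cod}

/-- The lists `M` and `N` expand the inverse naturality 2-morphisms of composite transformations,
and the other names allow the boundary to be given in simplified form. -/
theorem natInv_common' (Γ : Modif α β hd hc) (hα : α.HasInv) (hβ : β.HasInv) {f : A.Hom}
    {p q F G} (hp : A.src f = p) (hq : A.tgt f = q) (hF : α.dom.hom f = F)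
    (hG : α.cod.hom f = G) {M N : List (List B.Hom₂)} (hM : B.Val M (α.natInv f))
    (hN : B.Val N (β.natInv f)) :
    B.Common (M ++ [[Γ.app p, B.one₂ G]]) ([[B.one₂ F, Γ.app q]] ++ N) := by
  subst hp hq hF hG
  refine (Γ.natInv_common hα hβ f).mono (.expand (fun ρ k => ?_) (.refl _)) (.skip ?_)
  · rwa [TwoCat.Row.single_iff.1 k]
  · intro ρ k
    rwa [TwoCat.Val.atom_iff.1 k]

end Modif

theorem Transf.comp_natInv_val' {A B : TwoCat.{u}} {α β γ : Transf A B} {e : α.cod = β.dom}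
    (h : γ = α.comp β e) {f : A.Hom} {p q} (hp : A.src f = p) (hq : A.tgt f = q) :
    B.Val [[α.natInv f, B.one₂ (β.app q)], [B.one₂ (α.app p), β.natInv f]] (γ.natInv f) := by
  subst h hp hq
  exact comp_natInv_val α β e f

namespace CatObj

variable {X₀ X₁ : TwoCat.{u}} (C : CatObj X₀ X₁)

@[simp] theorem s_lam_natInv (f) : C.data₁.s.hom₂ (C.data₂.lam.natInv f) =
    X₀.one₂ (C.data₁.s.hom f) := congrFun (congrArg Transf.natInv C.data₂.lam_s) f

@[simp] theorem t_lam_natInv (f) : C.data₁.t.hom₂ (C.data₂.lam.natInv f) =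
    X₀.one₂ (C.data₁.t.hom f) := congrFun (congrArg Transf.natInv C.data₂.lam_t) f

@[simp] theorem s_rho_natInv (f) : C.data₁.s.hom₂ (C.data₂.rho.natInv f) =
    X₀.one₂ (C.data₁.s.hom f) := congrFun (congrArg Transf.natInv C.data₂.rho_s) f

@[simp] theorem t_rho_natInv (f) : C.data₁.t.hom₂ (C.data₂.rho.natInv f) =
    X₀.one₂ (C.data₁.t.hom f) := congrFun (congrArg Transf.natInv C.data₂.rho_t) f

@[simp] theorem s_alp_natInv (f) : C.data₁.s.hom₂ (C.data₂.alp.natInv f) =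
    X₀.one₂ (C.data₁.s.hom f.1.1.1.1) := congrFun (congrArg Transf.natInv C.data₂.alp_s) f

@[simp] theorem t_alp_natInv (f) : C.data₁.t.hom₂ (C.data₂.alp.natInv f) =
    X₀.one₂ (C.data₁.t.hom f.1.2) := congrFun (congrArg Transf.natInv C.data₂.alp_t) f

/-- The sources and targets of the modifications are built from weak transformations by strict
functors, pairing and composition, all of which preserve invertibility of the naturality
2-morphisms. -/
theorem src₂_hasInv : C.data₂.src₂.HasInv :=
  .post (.pair (.pre _ C.data₂.lam_isWeak.hasInv) (.id _) _) _

theorem tgt₂_hasInv : C.data₂.tgt₂.HasInv :=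
  .comp (.pre _ C.data₂.alp_isWeak.hasInv) (.pre _ C.data₂.lam_isWeak.hasInv) _

theorem src₃_hasInv : C.data₂.src₃.HasInv :=
  .comp (.pre _ C.data₂.alp_isWeak.hasInv)
    (.post (.pair (.id _) (.pre _ C.data₂.rho_isWeak.hasInv) _) _) _

theorem src₄_hasInv : C.data₂.src₄.HasInv :=
  .post (.pair (.pre _ C.data₂.rho_isWeak.hasInv) (.id _) _) _

theorem tgt₄_hasInv : C.data₂.tgt₄.HasInv :=
  .comp (.pre _ C.data₂.alp_isWeak.hasInv)
    (.post (.pair (.id _) (.pre _ C.data₂.lam_isWeak.hasInv) _) _) _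

theorem src₅_hasInv : C.data₂.src₅.HasInv :=
  .comp (.pre _ C.data₂.alp_isWeak.hasInv) (.pre _ C.data₂.alp_isWeak.hasInv) _

theorem pre₅_hasInv : C.data₂.pre₅.HasInv :=
  .comp (.post (.pair (.pre _ C.data₂.alp_isWeak.hasInv) (.id _) _) _)
    (.pre _ C.data₂.alp_isWeak.hasInv) _

theorem tgt₅_hasInv : C.data₂.tgt₅.HasInv :=
  .comp C.pre₅_hasInv (.post (.pair (.id _) (.pre _ C.data₂.alp_isWeak.hasInv) _) _) _

/-- Stated for a general pair `f`, so that it gives one axiom for `(u, 1)` and another for `(1, u)`.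
The name `e` stands for the unit morphism in front, an identity in both cases. -/
theorem c₂_natInv_common (f : C.data₁.X₂.Hom) {p q} (hp : C.data₁.X₂.src f = p)
    (hq : C.data₁.X₂.tgt f = q) {e F G} (he : C.data₁.i.hom (C.data₁.s.hom f.1.1) = e)
    (h : C.data₁.t.hom e = C.data₁.s.hom f.1.1)
    (hF : C.data₁.m₁ (C.data₁.m₁ e f.1.1 h) f.1.2 (by simpa using f.2) = F)
    (hG : C.data₁.m.hom f = G) :
    X₁.Common
      [[C.data₁.m₂ (C.data₂.lam.natInv f.1.1) (X₁.one₂ f.1.2) (by simp [f.2])],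
        [C.data₃.c₂.app p, X₁.one₂ G]]
      [[X₁.one₂ F, C.data₃.c₂.app q],
        [C.data₂.Ai e f.1.1 f.1.2 h f.2, X₁.one₂ (C.data₂.lam.app (C.data₁.m.ob q))],
        [X₁.one₂ (C.data₂.A (C.data₁.i.ob (C.data₁.s.ob p.1.1)) p.1.1 p.1.2 (by simp) p.2),
          C.data₂.lam.natInv G]] := by
  subst he hF hG
  have k := Transf.comp_natInv_val' (γ := C.data₂.tgt₂) rfl hp hq
  exact C.data₃.c₂.natInv_common' (M := [[_]]) (N := [[_, _], [_, _]]) C.src₂_hasInv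
    C.tgt₂_hasInv hp hq
    ((congrArg (StrictFunctor.hom · f) C.data₂.dom₂).trans (C.alp_dom_hom rfl))
    ((congrArg (StrictFunctor.hom · f) C.data₂.cod₂).trans (C.lam_cod_hom _)) (.of_atom _)
    k

theorem c₃_natInv_common (f : C.data₁.X₂.Hom) {p q} (hp : C.data₁.X₂.src f = p)
    (hq : C.data₁.X₂.tgt f = q) {e F G} (he : C.data₁.i.hom (C.data₁.t.hom f.1.2) = e)
    (h : C.data₁.t.hom f.1.2 = C.data₁.s.hom e)
    (hF : C.data₁.m₁ (C.data₁.m.hom f) e (by simpa using h) = F)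
    (hG : C.data₁.m.hom f = G) :
    X₁.Common
      [[C.data₂.Ai f.1.1 f.1.2 e f.2 h,
          X₁.one₂ (C.data₁.m₁ (X₁.one q.1.1) (C.data₂.rho.app q.1.2) (by simp [q.2]))],
        [X₁.one₂ (C.data₂.A p.1.1 p.1.2 (C.data₁.i.ob (C.data₁.t.ob p.1.2)) p.2 (by simp)),
          C.data₁.m₂ (X₁.one₂ f.1.1) (C.data₂.rho.natInv f.1.2) (by simp [f.2])],
        [C.data₃.c₃.app p, X₁.one₂ G]]
      [[X₁.one₂ F, C.data₃.c₃.app q], [C.data₂.rho.natInv G]] := by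
  subst he hF hG
  have k := Transf.comp_natInv_val' (γ := C.data₂.src₃) rfl hp hq
  exact C.data₃.c₃.natInv_common' (M := [[_, _], [_, _]]) (N := [[_]]) C.src₃_hasInv
    (.pre _ C.data₂.rho_isWeak.hasInv) hp hq (C.alp_dom_hom rfl)
    ((congrArg (StrictFunctor.hom · f) C.data₂.cod₃).trans (C.rho_cod_hom _))
    k (.of_atom _)

theorem c₄_natInv_common (f : C.data₁.X₂.Hom) {p q} (hp : C.data₁.X₂.src f = p)
    (hq : C.data₁.X₂.tgt f = q) {e F G} (he : C.data₁.i.hom (C.data₁.t.hom f.1.1) = e)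
    (h : C.data₁.t.hom f.1.1 = C.data₁.s.hom e) (h' : C.data₁.t.hom e = C.data₁.s.hom f.1.2)
    (hF : C.data₁.m₁ (C.data₁.m₁ f.1.1 e h) f.1.2 (by simpa using h') = F)
    (hG : C.data₁.m.hom f = G) :
    X₁.Common
      [[C.data₁.m₂ (C.data₂.rho.natInv f.1.1) (X₁.one₂ f.1.2) (by simp [f.2])],
        [C.data₃.c₄.app p, X₁.one₂ G]]
      [[X₁.one₂ F, C.data₃.c₄.app q],
        [C.data₂.Ai f.1.1 e f.1.2 h h',
          X₁.one₂ (C.data₁.m₁ (X₁.one q.1.1) (C.data₂.lam.app q.1.2) (by simp [q.2]))],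
        [X₁.one₂ (C.data₂.A p.1.1 (C.data₁.i.ob (C.data₁.t.ob p.1.1)) p.1.2 (by simp)
          (by simp [p.2])),
          C.data₁.m₂ (X₁.one₂ f.1.1) (C.data₂.lam.natInv f.1.2) (by simp [f.2])]] := by
  subst he hF hG
  have k := Transf.comp_natInv_val' (γ := C.data₂.tgt₄) rfl hp hq
  exact C.data₃.c₄.natInv_common' (M := [[_]]) (N := [[_, _], [_, _]]) C.src₄_hasInv
    C.tgt₄_hasInv hp hq
    ((congrArg (StrictFunctor.hom · f) C.data₂.dom₄).trans (C.alp_dom_hom rfl))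
    (by simp [CatData₂.src₄]) (.of_atom _)
    k

/-- Stated for a general quadruple: placing `u` in one of the four places and identities in the
others gives four axioms of `B`. The names `fg`, `gh`, `hk` and `F`, `G` allow products of
identities to be simplified. -/
theorem c₅_natInv_common {f g h k : X₁.Hom} (h₁ : C.data₁.t.hom f = C.data₁.s.hom g)
    (h₂ : C.data₁.t.hom g = C.data₁.s.hom h) (h₃ : C.data₁.t.hom h = C.data₁.s.hom k)
    {x y z w x' y' z' w' : X₁.Ob} (hxy : C.data₁.t.ob x = C.data₁.s.ob y)
    (hyz : C.data₁.t.ob y = C.data₁.s.ob z) (hzw : C.data₁.t.ob z = C.data₁.s.ob w)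
    (hxy' : C.data₁.t.ob x' = C.data₁.s.ob y') (hyz' : C.data₁.t.ob y' = C.data₁.s.ob z')
    (hzw' : C.data₁.t.ob z' = C.data₁.s.ob w')
    (hx : X₁.src f = x) (hy : X₁.src g = y) (hz : X₁.src h = z) (hw : X₁.src k = w)
    (hx' : X₁.tgt f = x') (hy' : X₁.tgt g = y') (hz' : X₁.tgt h = z') (hw' : X₁.tgt k = w')
    {fg gh hk F G : X₁.Hom} (hfg : C.data₁.m₁ f g h₁ = fg) (hgh : C.data₁.m₁ g h h₂ = gh)
    (hhk : C.data₁.m₁ h k h₃ = hk)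
    (hF : C.data₁.m₁ (C.data₁.m₁ fg h (by simpa [← hfg] using h₂)) k (by simpa using h₃) = F)
    (hG : C.data₁.m₁ f (C.data₁.m₁ g hk (by simpa [← hhk] using h₂)) (by simpa using h₁) = G) :
    X₁.Common
      [[C.data₂.Ai fg h k (by simpa [← hfg] using h₂) h₃, X₁.one₂
        (C.data₂.A x' y' (C.data₁.m₀ z' w' hzw') hxy' (by simp [*]))],
        [X₁.one₂ (C.data₂.A (C.data₁.m₀ x y hxy) z w (by simp [*]) hzw), C.data₂.Ai f g hk h₁
          (by simpa [← hhk] using h₂)],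
        [C.data₃.b₅ x y z w hxy hyz hzw, X₁.one₂ G]]
      [[X₁.one₂ F, C.data₃.b₅ x' y' z' w' hxy' hyz' hzw'],
        [C.data₁.m₂ (C.data₂.Ai f g h h₁ h₂) (X₁.one₂ k) (by simp [*]),
          X₁.one₂ (C.data₂.A x' (C.data₁.m₀ y' z' hyz') w' (by simp [*]) (by simp [*])),
          X₁.one₂ (C.data₁.m₁ (X₁.one x') (C.data₂.A y' z' w' hyz' hzw') (by simp [*]))],
        [X₁.one₂ (C.data₁.m₁ (C.data₂.A x y z hxy hyz) (X₁.one w) (by simp [*])),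
          C.data₂.Ai f gh k (by simpa [← hgh] using h₁) (by simpa [← hgh] using h₃),
          X₁.one₂ (C.data₁.m₁ (X₁.one x') (C.data₂.A y' z' w' hyz' hzw') (by simp [*]))],
        [X₁.one₂ (C.data₁.m₁ (C.data₂.A x y z hxy hyz) (X₁.one w) (by simp [*])),
          X₁.one₂ (C.data₂.A x (C.data₁.m₀ y z hyz) w (by simp [*]) (by simp [*])),
          C.data₁.m₂ (X₁.one₂ f) (C.data₂.Ai g h k h₂ h₃) (by simp [*])]] := by
  subst hfg hgh hhk hF hG
  have hp : C.data₁.X₄.src ⟨(⟨(⟨(f, g), h₁⟩, h), h₂⟩, k), h₃⟩ =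
      ⟨(⟨(⟨(x, y), hxy⟩, z), hyz⟩, w), hzw⟩ :=
    Subtype.ext (Prod.ext (Subtype.ext (Prod.ext (Subtype.ext (Prod.ext hx hy)) hz)) hw)
  have hq : C.data₁.X₄.tgt ⟨(⟨(⟨(f, g), h₁⟩, h), h₂⟩, k), h₃⟩ =
      ⟨(⟨(⟨(x', y'), hxy'⟩, z'), hyz'⟩, w'), hzw'⟩ :=
    Subtype.ext (Prod.ext (Subtype.ext (Prod.ext (Subtype.ext (Prod.ext hx' hy')) hz')) hw')
  have k₁ := Transf.comp_natInv_val' (γ := C.data₂.src₅) rfl hp hq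
  have k₂ := Transf.comp_natInv_val' (γ := C.data₂.pre₅) rfl hp hq
  have k₃ := Transf.comp_natInv_val' (γ := C.data₂.tgt₅) rfl hp hq
  refine (C.data₃.c₅.natInv_common' C.src₅_hasInv C.tgt₅_hasInv hp hq (C.alp_dom_hom rfl)
    (C.alp_cod_hom rfl) k₁ k₃).mono (.refl _) (.skip ?_)
  -- The target of the modification is a nested composite: its first two factors are expanded inside
  -- the first row, and the identity of their composite is split in the last row.
  refine .expand (M := [_, _]) (fun ρ r => k₂.row_right r) ?_
  exact .subst (p := []) (q := [_, _]) (.pair X₁ _ _ _) (.refl _)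

end CatObj

/-! ### Axioms from naturality of the structural modifications. -/

theorem TwoCat.Le.drop_atom {X : TwoCat.{u}} {φ : X.Hom₂} {L L' : List (List X.Hom₂)}
    (hφ : ∃ f, φ = X.one₂ f) (h : X.Le L L') : X.Le ([φ] :: L) L' := h.drop (by simp [hφ])

theorem TwoCat.Le.drop_pair {X : TwoCat.{u}} {φ ψ : X.Hom₂} {L L' : List (List X.Hom₂)}
    (hφ : ∃ f, φ = X.one₂ f) (hψ : ∃ f, ψ = X.one₂ f) (h : X.Le L L') :
    X.Le ([φ, ψ] :: L) L' := h.drop (by simp [hφ, hψ])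

theorem TwoCat.Le.drop_triple {X : TwoCat.{u}} {φ ψ χ : X.Hom₂} {L L' : List (List X.Hom₂)}
    (hφ : ∃ f, φ = X.one₂ f) (hψ : ∃ f, ψ = X.one₂ f) (hχ : ∃ f, χ = X.one₂ f) (h : X.Le L L') :
    X.Le ([φ, ψ, χ] :: L) L' := h.drop (by simp [hφ, hψ, hχ])

namespace CatObj

variable {X₀ X₁ : TwoCat.{u}} (C : CatObj X₀ X₁)

theorem i_s_hom (u : C.data₁.Obj₂) : C.data₁.i.hom (C.data₁.s.hom u.u) =
    X₁.one (C.data₁.i.ob (C.data₁.s.ob (X₁.src u.u))) :=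
  (congrArg C.data₁.i.hom (CatData₁.Mor₂.s_u u)).trans (C.data₁.i.map_one _)

theorem i_t_hom (u : C.data₁.Obj₂) : C.data₁.i.hom (C.data₁.t.hom u.u) =
    X₁.one (C.data₁.i.ob (C.data₁.t.ob (X₁.src u.u))) :=
  (congrArg C.data₁.i.hom (CatData₁.Mor₂.t_u u)).trans (C.data₁.i.map_one _)

theorem i_s_hom_one (x : X₁.Ob) : C.data₁.i.hom (C.data₁.s.hom (X₁.one x)) =
    X₁.one (C.data₁.i.ob (C.data₁.s.ob x)) := by simp

theorem i_t_hom_one (x : X₁.Ob) : C.data₁.i.hom (C.data₁.t.hom (X₁.one x)) =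
    X₁.one (C.data₁.i.ob (C.data₁.t.ob x)) := by simp

theorem m₂_eq_one₂ {φ ψ : X₁.Hom₂} (h : C.data₁.t.hom₂ φ = C.data₁.s.hom₂ ψ)
    (hφ : ∃ f, φ = X₁.one₂ f) (hψ : ∃ f, ψ = X₁.one₂ f) : ∃ f, C.data₁.m₂ φ ψ h = X₁.one₂ f := by
  obtain ⟨f, rfl⟩ := hφ
  obtain ⟨g, rfl⟩ := hψ
  exact ⟨_, C.data₁.m₂_one₂' f g h⟩

theorem t_u_eq (u : C.data₁.Obj₂) {y : X₁.Ob}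
    (h : C.data₁.s.ob y = C.data₁.t.ob (X₁.src u.u)) :
    C.data₁.t.hom u.u = C.data₁.s.hom (X₁.one y) := by
  rw [CatData₁.Mor₂.t_u, C.data₁.s.map_one, h]

theorem s_u_eq (u : C.data₁.Obj₂) {x : X₁.Ob}
    (h : C.data₁.s.ob (X₁.src u.u) = C.data₁.t.ob x) :
    C.data₁.t.hom (X₁.one x) = C.data₁.s.hom u.u := by
  rw [CatData₁.Mor₂.s_u, C.data₁.t.map_one, h]

theorem t_tgt_u (u : C.data₁.Obj₂) : C.data₁.t.ob (X₁.tgt u.u) = C.data₁.t.ob (X₁.src u.u) :=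
  by simpa using congrArg X₀.src ((CatData₁.Mor₂.t_u' u).symm.trans (CatData₁.Mor₂.t_u u))

theorem s_tgt_u (u : C.data₁.Obj₂) : C.data₁.s.ob (X₁.tgt u.u) = C.data₁.s.ob (X₁.src u.u) :=
  by simpa using congrArg X₀.src ((CatData₁.Mor₂.s_u' u).symm.trans (CatData₁.Mor₂.s_u u))

variable {C} in
theorem src_pair {f g : X₁.Hom} {x y : X₁.Ob} {h : C.data₁.t.hom f = C.data₁.s.hom g}
    {h' : C.data₁.t.ob x = C.data₁.s.ob y} (hf : X₁.src f = x) (hg : X₁.src g = y) :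
    C.data₁.X₂.src ⟨(f, g), h⟩ = ⟨(x, y), h'⟩ := Subtype.ext (Prod.ext hf hg)

variable {C} in
theorem tgt_pair {f g : X₁.Hom} {x y : X₁.Ob} {h : C.data₁.t.hom f = C.data₁.s.hom g}
    {h' : C.data₁.t.ob x = C.data₁.s.ob y} (hf : X₁.tgt f = x) (hg : X₁.tgt g = y) :
    C.data₁.X₂.tgt ⟨(f, g), h⟩ = ⟨(x, y), h'⟩ := Subtype.ext (Prod.ext hf hg)

theorem t_one_eq {x y : X₁.Ob} (h : C.data₁.t.ob x = C.data₁.s.ob y) :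
    C.data₁.t.hom (X₁.one x) = C.data₁.s.hom (X₁.one y) := by simp [h]

/-- Naturality of `c₄` at `(u, 1_y)`. The row with the naturality 2-morphism of `λ` at `1_y` is an
identity and is dropped. -/
theorem bicat_ax₂₀ : C.bicatData₂.Ax₂₀ := fun u y h => commutes_of (k := by
  have k := C.c₄_natInv_common ⟨(u.u, X₁.one y), C.t_u_eq u h⟩
    (src_pair (h' := h.symm) rfl (X₁.src_one y))
    (tgt_pair (h' := (C.t_tgt_u u).trans h.symm) rfl (X₁.tgt_one y))
    (C.i_t_hom u) (C.t_u_eq u (C.data₁.s_i_ob _))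
    (C.t_one_eq ((C.data₁.t_i_ob _).trans h.symm)) rfl rfl
  exact k.mono (.refl _) (.skip (.skip (.drop_pair ⟨_, rfl⟩
    (C.m₂_eq_one₂ _ ⟨_, rfl⟩ ⟨_, C.data₂.lam_isWeak.natInv_one _⟩) (.refl _)))))

/-- Naturality of `c₄` at `(1_x, u)`, where it is the row of `ρ` at `1_x` that disappears. -/
theorem bicat_ax₂₀' : C.bicatData₂.Ax₂₀' := fun x u h => commutes_of (k := by
  have k := C.c₄_natInv_common ⟨(X₁.one x, u.u), C.s_u_eq u h⟩
    (src_pair (h' := h.symm) (X₁.src_one x) rfl)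
    (tgt_pair (h' := h.symm.trans (C.s_tgt_u u).symm) (X₁.tgt_one x) rfl)
    (C.i_t_hom_one x) (C.t_one_eq (C.data₁.s_i_ob _).symm)
    (C.s_u_eq u (h.trans (C.data₁.t_i_ob _).symm))
    (C.m₁_congr (C.data₁.m₁_one' _ _ _) rfl) rfl
  exact k.symm.mono (.refl _) (.drop_atom
    (C.m₂_eq_one₂ _ ⟨_, C.data₂.rho_isWeak.natInv_one _⟩ ⟨_, rfl⟩) (.refl _)))

/-- Naturality of `c₃` at `(u, 1_y)`, without its row of `ρ` at `1_y`. -/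
theorem bicat_ax₂₁ : C.bicatData₂.Ax₂₁ := fun u y h => commutes_of (k := by
  have k := C.c₃_natInv_common ⟨(u.u, X₁.one y), C.t_u_eq u h⟩
    (src_pair (h' := h.symm) rfl (X₁.src_one y))
    (tgt_pair (h' := (C.t_tgt_u u).trans h.symm) rfl (X₁.tgt_one y))
    (C.i_t_hom_one y) (C.t_one_eq (C.data₁.s_i_ob _).symm) rfl rfl
  exact k.symm.mono (.refl _) (.skip (.drop_pair ⟨_, rfl⟩
    (C.m₂_eq_one₂ _ ⟨_, rfl⟩ ⟨_, C.data₂.rho_isWeak.natInv_one _⟩) (.refl _))))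

/-- Naturality of `c₂` at `(1_x, u)`, without its row of `λ` at `1_x`. -/
theorem bicat_ax₂₁' : C.bicatData₂.Ax₂₁' := fun x u h => commutes_of (k := by
  have k := C.c₂_natInv_common ⟨(X₁.one x, u.u), C.s_u_eq u h⟩
    (src_pair (h' := h.symm) (X₁.src_one x) rfl)
    (tgt_pair (h' := h.symm.trans (C.s_tgt_u u).symm) (X₁.tgt_one x) rfl)
    (C.i_s_hom_one x) (C.t_one_eq (C.data₁.t_i_ob _))
    (C.m₁_congr (C.data₁.m₁_one' _ _ _) rfl) rfl
  exact k.symm.mono (.refl _) (.drop_atom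
    (C.m₂_eq_one₂ _ ⟨_, C.data₂.lam_isWeak.natInv_one _⟩ ⟨_, rfl⟩) (.refl _)))

/-- Naturality of `c₂` at `(u, 1_y)`. Here every row involves `u` or a component of `c₂`, so none is
dropped; the same holds for `c₃` at `(1_x, u)` in the companion axiom. -/
theorem bicat_ax₂₂ : C.bicatData₂.Ax₂₂ := fun u y h => commutes_of (k := by
  exact C.c₂_natInv_common ⟨(u.u, X₁.one y), C.t_u_eq u h⟩
    (src_pair (h' := h.symm) rfl (X₁.src_one y))
    (tgt_pair (h' := (C.t_tgt_u u).trans h.symm) rfl (X₁.tgt_one y))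
    (C.i_s_hom u) (C.s_u_eq u (C.data₁.t_i_ob _).symm) rfl rfl)

theorem bicat_ax₂₂' : C.bicatData₂.Ax₂₂' := fun x u h => commutes_of (k := by
  exact (C.c₃_natInv_common ⟨(X₁.one x, u.u), C.s_u_eq u h⟩
    (src_pair (h' := h.symm) (X₁.src_one x) rfl)
    (tgt_pair (h' := h.symm.trans (C.s_tgt_u u).symm) (X₁.tgt_one x) rfl)
    (C.i_t_hom u) (C.t_u_eq u (C.data₁.s_i_ob _)) rfl rfl).symm)

/-- Naturality of `c₅` at `(u, 1, 1, 1)`. The last associator involves only the three identities, so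
its row is dropped. -/
theorem bicat_ax₁₅ : C.bicatData₂.Ax₁₅ := fun u y z w h h' h'' => commutes_of (k := by
  have k := C.c₅_natInv_common (C.t_u_eq u h) (C.t_one_eq h'.symm) (C.t_one_eq h''.symm)
    h.symm h'.symm h''.symm ((C.t_tgt_u u).trans h.symm) h'.symm h''.symm rfl (X₁.src_one y)
    (X₁.src_one z) (X₁.src_one w) rfl (X₁.tgt_one y) (X₁.tgt_one z) (X₁.tgt_one w) rfl
    (C.data₁.m₁_one' _ _ _) (C.data₁.m₁_one' _ _ _) rfl (C.m₁_congr rfl (C.data₁.m₁_one' _ _ _))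
  exact k.mono (.refl _) (.skip (.skip (.skip (.drop_triple ⟨_, rfl⟩ ⟨_, rfl⟩
    (C.m₂_eq_one₂ _ ⟨_, rfl⟩ ⟨_, C.data₂.alp_isWeak.natInv_one
      ⟨(⟨(y, z), h'.symm⟩, w), h''.symm⟩⟩) (.refl _))))))

/-- Naturality of `c₅` at `(1, 1, 1, u)`, where the dropped row is that of the associator on the
first three places. -/
theorem bicat_ax₁₅' : C.bicatData₂.Ax₁₅' := fun x y z u h h' h'' => commutes_of (k := by
  have k := C.c₅_natInv_common (C.t_one_eq h.symm) (C.t_one_eq h'.symm) (C.s_u_eq u h'')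
    h.symm h'.symm h''.symm h.symm h'.symm (h''.symm.trans (C.s_tgt_u u).symm) (X₁.src_one x)
    (X₁.src_one y) (X₁.src_one z) rfl (X₁.tgt_one x) (X₁.tgt_one y) (X₁.tgt_one z) rfl
    (C.data₁.m₁_one' _ _ _) (C.data₁.m₁_one' _ _ _) rfl (C.m₁_congr (C.data₁.m₁_one' _ _ _) rfl)
    rfl
  exact k.mono (.refl _) (.skip (.drop_triple (C.m₂_eq_one₂ _ ⟨_, C.data₂.alp_isWeak.natInv_one
      ⟨(⟨(x, y), h.symm⟩, z), h'.symm⟩⟩ ⟨_, rfl⟩) ⟨_, rfl⟩ ⟨_, rfl⟩ (.refl _))))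

/-- With `u` in one of the two middle places, every associator in the naturality of `c₅` involves
`u`, so all rows survive here and in the companion axiom. -/
theorem bicat_ax₁₆ : C.bicatData₂.Ax₁₆ := fun x u z w h h' h'' => commutes_of (k := by
  exact C.c₅_natInv_common (C.s_u_eq u h) (C.t_u_eq u h') (C.t_one_eq h''.symm)
    h.symm h'.symm h''.symm (h.symm.trans (C.s_tgt_u u).symm) ((C.t_tgt_u u).trans h'.symm)
    h''.symm (X₁.src_one x) rfl (X₁.src_one z) (X₁.src_one w) (X₁.tgt_one x) rfl (X₁.tgt_one z)
    (X₁.tgt_one w) rfl rfl (C.data₁.m₁_one' _ _ _) rfl rfl)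

theorem bicat_ax₁₆' : C.bicatData₂.Ax₁₆' := fun x y u w h h' h'' => commutes_of (k := by
  exact C.c₅_natInv_common (C.t_one_eq h.symm) (C.s_u_eq u h') (C.t_u_eq u h'')
    h.symm h'.symm h''.symm h.symm (h'.symm.trans (C.s_tgt_u u).symm)
    ((C.t_tgt_u u).trans h''.symm) (X₁.src_one x) (X₁.src_one y) rfl (X₁.src_one w)
    (X₁.tgt_one x) (X₁.tgt_one y) rfl (X₁.tgt_one w) (C.data₁.m₁_one' _ _ _) rfl rfl rfl rfl)

end CatObj

/-! ### Invertibility of the unit and associator 2-cells. -/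

theorem Data₁.V_congr {K : Cells.{u}} (P : Data₁ K) {v v' w w' : K.C₂} (hv : v = v') (hw : w = w')
    (h h') : P.V v w h = P.V v' w' h' := by
  subst hv hw
  rfl

namespace CatObj

variable {X₀ X₁ : TwoCat.{u}} (C : CatObj X₀ X₁) {A : TwoCat.{u}} {D : Type u} [Category.{u} D]

open CatData₁

section

variable {C} {k k' : D ⥤ C.data₁.cells.C₂} {J : D ⥤ A.Ob} {α β : Transf A X₁}

theorem Represents.S_eq {F : StrictFunctor A X₁} (hk : Represents k J α) (h : α.dom = F) :
    k ⋙ C.data₁.cells.S = J ⋙ F.functor := by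
  subst h
  exact TwoCat.functor_ext (fun x => (congrArg X₁.src (hk.u x)).trans (α.src_app _)) hk.f

theorem Represents.T_eq {F : StrictFunctor A X₁} (hk : Represents k J α) (h : α.cod = F) :
    k ⋙ C.data₁.cells.T = J ⋙ F.functor := by
  subst h
  exact TwoCat.functor_ext (fun x => (congrArg X₁.tgt (hk.u x)).trans (α.tgt_app _)) hk.g

theorem Represents.iv (J : D ⥤ A.Ob) (F : StrictFunctor A X₁) :
    Represents ((J ⋙ F.functor) ⋙ C.bicatData₁.iv) J (.id F) :=
  ⟨fun _ => rfl, fun _ => rfl, fun _ => rfl, fun _ => rfl⟩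

theorem Represents.ofTransf (J : D ⥤ A.Ob) (α : Transf A X₁) (hα hs ht) :
    Represents (J ⋙ CatData₁.ofTransf (C := C.data₁) α hα hs ht) J α :=
  ⟨fun _ => rfl, fun _ => rfl, fun _ => rfl, fun _ => rfl⟩

/-- A functor to 2-cells given by an invertible transformation is invertible. -/
noncomputable def inverseOf (hk : Represents k J α) (i : C.data₁.Inverse α) :
    C.bicatData₂.Inverse k :=
  have hi := Represents.ofTransf J i.inv i.isWeak (Transf.post_eq_id i.s_inv)
    (Transf.post_eq_id i.t_inv)
  have inv_S := (hi.S_eq i.dom_eq).trans (hk.T_eq rfl).symm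
  have inv_T := (hi.T_eq i.cod_eq).trans (hk.S_eq rfl).symm
  -- The target of `η` is built from `S` of `k`, which is the domain of `α` only by a proved
  -- equality of functors; the evident representation is transported along it.
  have hS : Represents (k ⋙ C.data₁.cells.S ⋙ C.bicatData₁.iv) J (.id α.dom) :=
    (congrArg (fun F => Represents (F ⋙ C.bicatData₁.iv) J (.id α.dom)) (hk.S_eq rfl)).mpr
      (.iv J α.dom)
  have hT : Represents (k ⋙ C.data₁.cells.T ⋙ C.bicatData₁.iv) J (.id α.cod) :=
    (congrArg (fun F => Represents (F ⋙ C.bicatData₁.iv) J (.id α.cod)) (hk.T_eq rfl)).mpr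
      (.iv J α.cod)
  have η := Represents.comp hk hi inv_S.symm i.dom_eq.symm
  have ε := Represents.comp hi hk inv_T i.cod_eq
  { inv := J ⋙ CatData₁.ofTransf i.inv i.isWeak (Transf.post_eq_id i.s_inv)
      (Transf.post_eq_id i.t_inv)
    inv_S := inv_S
    inv_T := inv_T
    η := C.vIsoOfModif i.η_isGood η hS ((η.S_eq rfl).trans (hS.S_eq rfl).symm)
      ((η.T_eq i.cod_eq).trans (hS.T_eq rfl).symm)
    ε := C.vIsoOfModif i.ε_isGood ε hT ((ε.S_eq i.dom_eq).trans (hT.S_eq rfl).symm)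
      ((ε.T_eq rfl).trans (hT.T_eq rfl).symm)
    triangle := fun c h h' => by
      have : HasRow ((C.vIsoOfModif i.η_isGood η hS ((η.S_eq rfl).trans (hS.S_eq rfl).symm)
        ((η.T_eq i.cod_eq).trans (hS.T_eq rfl).symm)).arr c) [i.η.app (J.obj c)] := ⟨.single _⟩
      have : HasRow ((C.vIsoOfModif i.ε_isGood ε hT ((ε.S_eq i.dom_eq).trans (hT.S_eq rfl).symm)
        ((ε.T_eq rfl).trans (hT.T_eq rfl).symm)).arr c) [i.ε.app (J.obj c)] := ⟨.single _⟩
      -- The steps `e₁`, `e₂`, `e₃` are identities. One row remains on each side, and these are the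
      -- two sides of the triangle identity of `α`.
      refine Seq.commutes (C := C) (.row inferInstance rfl (.id inferInstance rfl (.nil rfl)))
        (.id inferInstance rfl (.row inferInstance rfl (.id inferInstance rfl (.nil rfl))))
        (by simp) (by simp) ?_
      rw [show Obj₂.u (k.obj c) = _ from hk.u c]
      have e := (congrArg X₁.tgt (i.η.src₂_app (J.obj c))).trans (Transf.tgt_app _ _)
      have e' := (congrArg X₁.src (i.ε.src₂_app (J.obj c))).trans (Transf.src_app _ _)
      refine ⟨_, .of_row (.cons _ _ _ (by simpa [i.cod_eq] using e) (.single _)), .of_row ?_⟩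
      rw [i.triangle _ _ (by simpa [i.dom_eq] using e'.symm)]
      exact .cons _ _ _ _ (.single _)
    triangle' := fun c h h' => by
      have : HasRow ((C.vIsoOfModif i.η_isGood η hS ((η.S_eq rfl).trans (hS.S_eq rfl).symm)
        ((η.T_eq i.cod_eq).trans (hS.T_eq rfl).symm)).arr c) [i.η.app (J.obj c)] := ⟨.single _⟩
      have : HasRow ((C.vIsoOfModif i.ε_isGood ε hT ((ε.S_eq i.dom_eq).trans (hT.S_eq rfl).symm)
        ((ε.T_eq rfl).trans (hT.T_eq rfl).symm)).arr c) [i.ε.app (J.obj c)] := ⟨.single _⟩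
      -- The identity 2-cells reached by `ε` and `η` are formed at `T k` and `S k`, while the unit
      -- laws expect them at the source and target of the inverse. The equalities `h` and `h'`
      -- connect the two.
      refine Seq.commutes (C := C) (.row inferInstance rfl (.id inferInstance
          (C.bicatData₁.V_congr (congrArg C.bicatData₁.iv.obj h.symm) rfl _ _) (.nil rfl)))
        (.id inferInstance rfl (.row inferInstance rfl (.id inferInstance
          (C.bicatData₁.V_congr rfl (congrArg C.bicatData₁.iv.obj h'.symm) _ _) (.nil rfl))))
        (by simp) (by simp) ?_
      have e := (congrArg X₁.tgt (i.ε.src₂_app (J.obj c))).trans (Transf.tgt_app _ _)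
      have e' := (congrArg X₁.src (i.η.src₂_app (J.obj c))).trans (Transf.src_app _ _)
      have l : α.cod.ob (J.obj c) = X₁.src (X₁.src₂ (X₁.one₂ (i.inv.app (J.obj c)))) := by simp
        [i.dom_eq]
      refine ⟨_, .of_row (.cons _ _ _ (e.trans l) (.single _)), .of_row ?_⟩
      refine (congrArg (TwoCat.Row X₁ _) (i.triangle' (J.obj c) _
        (by simpa [i.cod_eq] using e'.symm))).mpr ?_
      exact .cons _ _ _ _ (.single _) }

end

/-! ### The bicategory object. -/

/-- The bicategory object of a category object. -/
noncomputable def bicatObj : BicatObj C.data₁.cells where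
  data₁ := C.bicatData₁
  data₂ := C.bicatData₂
  il_inv := C.data₂.lam_inverse.map (inverseOf (J := 𝟭 _)
    ⟨fun _ => rfl, fun _ => rfl, fun _ => rfl, fun _ => rfl⟩)
  ir_inv := C.data₂.rho_inverse.map (inverseOf (J := 𝟭 _)
    ⟨fun _ => rfl, fun _ => rfl, fun _ => rfl, fun _ => rfl⟩)
  a_inv := C.data₂.alp_inverse.map (inverseOf (J := C.data₁.triples)
    ⟨fun _ => rfl, fun _ => rfl, fun _ => rfl, fun _ => rfl⟩)
  ax₁ := C.bicat_ax₁
  ax₂ := C.bicat_ax₂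
  ax₂' := C.bicat_ax₂'
  ax₃ := C.bicat_ax₃
  ax₄ := C.bicat_ax₄
  ax₅a := C.bicat_ax₅a
  ax₅b := C.bicat_ax₅b
  ax₅c := C.bicat_ax₅c
  ax₅d := C.bicat_ax₅d
  ax₆ := C.bicat_ax₆
  ax₆' := C.bicat_ax₆'
  ax₇ := C.bicat_ax₇
  ax₇' := C.bicat_ax₇'
  ax₈ := C.bicat_ax₈
  ax₈' := C.bicat_ax₈'
  ax₉ := C.bicat_ax₉
  ax₉' := C.bicat_ax₉'
  ax₁₀ := C.bicat_ax₁₀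
  ax₁₁ := C.bicat_ax₁₁
  ax₁₁' := C.bicat_ax₁₁'
  ax₁₂ := C.bicat_ax₁₂
  ax₁₃ := C.bicat_ax₁₃
  ax₁₃' := C.bicat_ax₁₃'
  ax₁₄ := C.bicat_ax₁₄
  ax₁₅ := C.bicat_ax₁₅
  ax₁₅' := C.bicat_ax₁₅'
  ax₁₆ := C.bicat_ax₁₆
  ax₁₆' := C.bicat_ax₁₆'
  ax₁₇ := C.bicat_ax₁₇
  ax₁₈ := C.bicat_ax₁₈
  ax₁₈' := C.bicat_ax₁₈'
  ax₁₉ := C.bicat_ax₁₉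
  ax₁₉' := C.bicat_ax₁₉'
  ax₂₀ := C.bicat_ax₂₀
  ax₂₀' := C.bicat_ax₂₀'
  ax₂₁ := C.bicat_ax₂₁
  ax₂₁' := C.bicat_ax₂₁'
  ax₂₂ := C.bicat_ax₂₂
  ax₂₂' := C.bicat_ax₂₂'
  ax₂₃ := C.bicat_ax₂₃
  ax₂₃' := C.bicat_ax₂₃'
  ax₂₄ := C.bicat_ax₂₄
  ax₂₅ := C.bicat_ax₂₅
  ax₂₅' := C.bicat_ax₂₅'
  ax₂₆ := C.bicat_ax₂₆
  ax₂₆' := C.bicat_ax₂₆'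

end CatObj

/-- Every datum of `bicatObj` was defined by the prescribed formula, so the comparison holds by
definition. Only the first eight 2-data require an argument, coming as they do from equalities of
functors. -/
theorem mainTheorem1 {X₀ X₁ : TwoCat.{u}} (C : CatObj X₀ X₁) :
    ∃ B : BicatObj C.data₁.cells, ReadsOff C B :=
  ⟨C.bicatObj,
    { i := rfl
      m_obj := fun _ _ => rfl
      m_map := fun _ _ _ _ => rfl
      iv_obj := fun _ => rfl
      iv_map := fun _ _ _ => rfl
      mv_obj := fun _ _ => rfl
      mv_map := fun _ _ _ _ _ _ => rfl
      wr_obj := fun _ _ => rfl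
      wr_map := fun _ _ _ _ => rfl
      wl_obj := fun _ _ => rfl
      wl_map := fun _ _ _ _ => rfl
      il_obj := fun _ => rfl
      il_map := fun _ _ _ => rfl
      ir_obj := fun _ => rfl
      ir_map := fun _ _ _ => rfl
      a_obj := fun _ _ _ => rfl
      a_map := fun _ _ _ _ _ => rfl
      b₁ := CatData₁.vIsoOfEq_isEqHom _
      b₂ := CatData₁.vIsoOfEq_isEqHom _
      b₃ := CatData₁.vIsoOfEq_isEqHom _
      b₄ := CatData₁.vIsoOfEq_isEqHom _
      b₅ := CatData₁.vIsoOfEq_isEqHom _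
      b₆ := CatData₁.vIsoOfEq_isEqHom _
      b₇ := CatData₁.vIsoOfEq_isEqHom _
      b₈ := CatData₁.vIsoOfEq_isEqHom _
      b₉ := fun _ _ _ => rfl
      b₁₀ := fun _ _ _ => rfl
      b₁₁ := fun _ _ _ => rfl
      b₁₂ := fun _ _ _ _ => rfl
      b₁₃ := fun _ => rfl
      b₁₄ := fun _ => rfl
      b₁₅ := fun _ => rfl
      b₁₆ := fun _ _ => rfl
      b₁₇ := fun _ _ => rfl
      b₁₈ := fun _ _ => rfl }⟩
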